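/- \textbf{Littlewood--Paley square function estimates for the partial harmonic oscillator.} Let $d\ge 1$ and $H_{\mathrm{par}}=-\partial_\rho^2-\Delta_x+|x|^2$ on $\mathbb R\times\mathbb R^d$. Let $\Phi_\mu$ ($\mu\in\mathbb N^d$) be the $L^2$-normalized Hermite functions on $\mathbb R^d$, let $P_kg(x)=\int_{\mathbb R^d}\sum_{|\mu|=k}\Phi_\mu(x)\Phi_\mu(x')g(x')\,dx'$, and let $\mathcal F_\rho$ be the unitary Fourier transform in $\rho$. For a symbol $\sigma$ on $\mathbb R\times\mathbb N$ and $f\in C_c^\infty(\mathbb R^{d+1})$ put $$T_\sigma f(\rho,x)=\sum_{k=0}^\infty\frac1{\sqrt{2\pi}}\int_{\mathbb R}e^{i\tau\rho}\sigma(\tau,k)\,P_k(\mathcal F_\rho f)(\tau,x)\,d\tau .$$ Let $1<p<\infty$ and let $m\in C_c^\infty(\mathbb R;[0,1])$ have support in a compact interval $[a,b]\subset(0,\infty)$. Then the operators $\Delta_j=T_{m(2^{-j}\sqrt{\tau^2+2k+d})}$ ($j\ge 0$) and $H_{\mathrm{par}}^{-\alpha/2}=T_{(\tau^2+2k+d)^{-\alpha/2}}$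 ($\alpha\ge0$) extend from $C_c^\infty(\mathbb R^{d+1})$ to bounded operators on $L^p(\mathbb R^{d+1})$, denoted in the same way. For $f\in L^p$ let $\|f\|_{W^{\alpha,p}_{H_{\mathrm{par}}}}=\|g\|_{L^p}$ if $f=H_{\mathrm{par}}^{-\alpha/2}g$ with $g\in L^p$, and $\|f\|_{W^{\alpha,p}_{H_{\mathrm{par}}}}=\infty$ if there is no such $g$. There are constants $C$, depending only on $d,p,m$ (and on $\alpha$ in the second estimate), such that for all $f\in L^p(\mathbb R^{d+1})$ and all $\alpha\ge 0$ $$\Big\|\Big(\sum_{j=0}^\infty|\Delta_jf|^2\Big)^{1/2}\Big\|_{L^p}\le C\|f\|_{L^p},\qquad \Big\|\Big(\sum_{j=0}^\infty|2^{j\alpha}\Delta_jf|^2\Big)^{1/2}\Big\|_{L^p}\le C\|f\|_{W^{\alpha,p}_{H_{\mathrm{par}}}} .$$ If, moreover, the dilates of $m$ cover the spectrum $[\sqrt d,\infty)$ of $\sqrt{H_{\mathrm{par}}}$, that is, for every $r\ge\sqrt d$ there is $j\ge0$ with $m(2^{-j}r)\ne0$ (for instance if $\sum_{j\ge0}m(2^{-j}r)=1$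 for all $r\ge\sqrt d$), then the reverse inequalities hold as well, so that $$\|f\|_{L^p}\simeq\Big\|\Big(\sum_{j=0}^\infty|\Delta_jf|^2\Big)^{1/2}\Big\|_{L^p},\qquad \|f\|_{W^{\alpha,p}_{H_{\mathrm{par}}}}\simeq\Big\|\Big(\sum_{j=0}^\infty|2^{j\alpha}\Delta_jf|^2\Big)^{1/2}\Big\|_{L^p};$$ in particular $f\in L^p$ belongs to $W^{\alpha,p}_{H_{\mathrm{par}}}$ if and only if the last square function is in $L^p$. -/

import Mathlib

open MeasureTheory
open scoped ENNReal NNReal ContDiff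

noncomputable section

namespace PartialHarmonic

/-- The space `ℝ × ℝ^d`, with points `z = (ρ, x)`, carrying Lebesgue measure. -/
abbrev Space (d : ℕ) : Type := ℝ × EuclideanSpace ℝ (Fin d)

/-- The complex Lebesgue space `L^p(ℝ^{d+1})`. -/
abbrev LpSpace (d : ℕ) (p : ℝ≥0∞) : Type :=
  Lp ℂ p (volume : Measure (Space d))

/-! ### Hermite functions and spectral projections -/

/-- The normalized one-dimensional Hermite function
`h_k(x) = (2^k k! √π)^{-1/2} (-1)^k (d^k/dx^k e^{-x²}) e^{x²/2}`. -/
def hermiteFun (k : ℕ) (x : ℝ) : ℝ :=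
  (Real.sqrt (2 ^ k * (k.factorial : ℝ) * Real.sqrt Real.pi))⁻¹ * (-1) ^ k *
    iteratedDeriv k (fun y : ℝ => Real.exp (-y ^ 2)) x * Real.exp (x ^ 2 / 2)

/-- The `d`-dimensional Hermite function `Φ_μ(x) = ∏_i h_{μ_i}(x_i)`. -/
def hermitePhi {d : ℕ} (μ : Fin d → ℕ) (x : EuclideanSpace ℝ (Fin d)) : ℝ :=
  ∏ i, hermiteFun (μ i) (x i)

/-- The kernel `Φ_k(x, x') = ∑_{|μ| = k} Φ_μ(x) Φ_μ(x')`. -/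
def hermiteKernel {d : ℕ} (k : ℕ) (x x' : EuclideanSpace ℝ (Fin d)) : ℝ :=
  ∑ μ ∈ Finset.piAntidiag (Finset.univ : Finset (Fin d)) k, hermitePhi μ x * hermitePhi μ x'

/-- The projection `P_k` to the eigenspace of `-Δ_x + |x|²` with eigenvalue `2k + d`. -/
def hermiteProj {d : ℕ} (k : ℕ) (g : EuclideanSpace ℝ (Fin d) → ℂ)
    (x : EuclideanSpace ℝ (Fin d)) : ℂ :=
  ∫ x', (hermiteKernel k x x' : ℂ) * g x'

/-- The unitary Fourier transform in the variable `ρ`. -/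
def fourierRho {d : ℕ} (f : Space d → ℂ) (τ : ℝ) (x : EuclideanSpace ℝ (Fin d)) : ℂ :=
  ((Real.sqrt (2 * Real.pi))⁻¹ : ℂ) *
    ∫ ρ : ℝ, Complex.exp (-(Complex.I * τ * ρ)) * f (ρ, x)

/-! ### Multiplier operators -/

/-- The multiplier operator with symbol `σ(τ, k)`, given on test functions by
`T_σ f(ρ, x) = ∑_k (2π)^{-1/2} ∫ e^{iτρ} σ(τ, k) P_k(F_ρ f)(τ, x) dτ`. -/
def multiplierOp {d : ℕ} (σ : ℝ → ℕ → ℂ) (f : Space d → ℂ) (z : Space d) : ℂ :=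
  ∑' k : ℕ, ((Real.sqrt (2 * Real.pi))⁻¹ : ℂ) *
    ∫ τ : ℝ, Complex.exp (Complex.I * τ * z.1) * σ τ k * hermiteProj k (fourierRho f τ) z.2

/-- The bounded operator `A` on `L^p` agrees with `T_σ` on `C_c^∞(ℝ^{d+1})`. As `C_c^∞` is
dense in `L^p` for `1 ≤ p < ∞`, there is at most one such `A` for these `p`. -/
def IsMultiplierExtension {d : ℕ} {p : ℝ≥0∞} [Fact (1 ≤ p)] (σ : ℝ → ℕ → ℂ)
    (A : LpSpace d p →L[ℂ] LpSpace d p) : Prop :=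
  ∀ (u : Space d → ℂ), ContDiff ℝ ∞ u → HasCompactSupport u →
    ∀ hu : MemLp u p volume, A (hu.toLp u) =ᵐ[volume] multiplierOp σ u

open Classical in
/-- The bounded extension of `T_σ` from `C_c^∞` to `L^p` (zero if there is none). -/
def multiplierExt (d : ℕ) (p : ℝ≥0∞) [Fact (1 ≤ p)] (σ : ℝ → ℕ → ℂ) :
    LpSpace d p →L[ℂ] LpSpace d p :=
  if h : ∃ A : LpSpace d p →L[ℂ] LpSpace d p, IsMultiplierExtension σ A then h.choose else 0

/-- The spectral value `τ² + 2k + d` of `H_par = -∂_ρ² - Δ_x + |x|²`. -/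
def spectralValue (d : ℕ) (τ : ℝ) (k : ℕ) : ℝ := τ ^ 2 + 2 * k + d

/-- The symbol `m(2^{-j} √(τ² + 2k + d))`. -/
def dyadicSymbol (d : ℕ) (m : ℝ → ℝ) (j : ℕ) (τ : ℝ) (k : ℕ) : ℂ :=
  (m ((2 : ℝ)⁻¹ ^ j * Real.sqrt (spectralValue d τ k)) : ℂ)

/-- The symbol `(τ² + 2k + d)^{-α/2}` of `H_par^{-α/2}`. -/
def potentialSymbol (d : ℕ) (α : ℝ) (τ : ℝ) (k : ℕ) : ℂ :=
  (spectralValue d τ k ^ (-α / 2) : ℝ)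

/-- The dyadic piece `Δ_j` on `L^p`. -/
def dyadicPiece (d : ℕ) (p : ℝ≥0∞) [Fact (1 ≤ p)] (m : ℝ → ℝ) (j : ℕ) :
    LpSpace d p →L[ℂ] LpSpace d p :=
  multiplierExt d p (dyadicSymbol d m j)

/-- The potential operator `H_par^{-α/2}` on `L^p`. -/
def potential (d : ℕ) (p : ℝ≥0∞) [Fact (1 ≤ p)] (α : ℝ) : LpSpace d p →L[ℂ] LpSpace d p :=
  multiplierExt d p (potentialSymbol d α)

/-! ### The Sobolev norm and the square function -/

/-- The norm of `W^{α,p} = H_par^{-α/2}(L^p)`: it is `‖g‖_p` if `f = H_par^{-α/2} g`, and `∞`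
if `f` is not in `W^{α,p}`. -/
def sobolevNorm (d : ℕ) (p : ℝ≥0∞) [Fact (1 ≤ p)] (α : ℝ) (f : LpSpace d p) : ℝ≥0∞ :=
  ⨅ (g : LpSpace d p) (_ : potential d p α g = f), eLpNorm g p volume

/-- The square function `(∑_{j ≥ 0} |2^{jα} Δ_j f|²)^{1/2}`, with values in `[0, ∞]`. -/
def squareFun (d : ℕ) (p : ℝ≥0∞) [Fact (1 ≤ p)] (m : ℝ → ℝ) (α : ℝ) (f : LpSpace d p)
    (z : Space d) : ℝ≥0∞ :=
  (∑' j : ℕ, ((2 : ℝ≥0∞) ^ ((j : ℝ) * α) * ‖dyadicPiece d p m j f z‖ₑ) ^ 2) ^ (1 / 2 : ℝ)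

/-- Every point of the spectrum `[√d, ∞)` of `√H_par` is seen by some dyadic dilate of `m`
(for instance if `∑_{j ≥ 0} m(2^{-j} r) = 1` for `r ≥ √d`). -/
def CoversSpectrum (d : ℕ) (m : ℝ → ℝ) : Prop :=
  ∀ r : ℝ, Real.sqrt d ≤ r → ∃ j : ℕ, m ((2 : ℝ)⁻¹ ^ j * r) ≠ 0

end PartialHarmonic

end

open MeasureTheory
open scoped ENNReal NNReal ContDiff

noncomputable section

namespace PartialHarmonic

/-! ### Mehler's formula -/

/-! The proof runs Calderón–Zygmund theory on the kernels of smooth functions of `H_par`, and every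
kernel is built from the heat kernel at complex time. No spectral theorem enters, and the
orthogonality of the Hermite functions is never used. Mehler's formula (`hasSum_mehlerKernel`)
writes `e^{-ζ H_par}` as an explicit Gaussian `heatC ζ`. The semigroup law is then a Gaussian
integral (`integral_heatC_mul`). Its action on test functions is multiplication by `e^{-ζ s}` on the
joint spectrum (`integral_heatC_mul_eq`), and letting `t → 0` gives the inversion formula
`integral_kap`.

A test symbol `φ` is a Fourier superposition `φ(u) = ∫ g(ξ) e^{-(2+2πiξ)u} dξ` with `g` Schwartz
(`exists_exponential_repr`). So `φ(tH)` has the kernel `∫ g(ξ) E_{t(2+2πiξ)} dξ`. The heat kernel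
bounds grow only polynomially in `ξ`, and the decay of `g` absorbs this. Uniformly in `0 < t ≤ 1`
the kernel therefore lies in Schur's class, has first moment `O(√t)` and `L¹`-modulus of continuity
`O(|w - w'| / √t)` (`exists_opKernel`). The semigroup law also makes the calculus multiplicative
(`symOp_mul`), and multiplicativity with self-adjointness bounds the `L²` norm by the supremum of
the symbol (`norm_symOp_two_le`).

A signed sum `∑ ε_j φ_j(4^{-j} H)` then has a uniform `L²` bound, because the symbols overlap
boundedly often. It also satisfies the Hörmander condition uniformly, because the near and far
estimates form a two-sided geometric series (`IsDyadicFamily.exists_czKernel`). A Calderón–Zygmund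
decomposition and interpolation give `1 < p < 2`, and duality gives `p > 2`
(`IsDyadicFamily.exists_norm_le`). Averaging over signs with Khinchine's inequality yields the upper
square function bound (`exists_sqFun_le`). By duality, `∑ φ_j(4^{-j}H) g_j` converges in `L^p`
whenever the square function of `(g_j)` lies in `L^p` (`exists_summable`).

For the lower bounds put `ψ(s) = m(√s)`. If the dilates of `m` cover the spectrum, `∑ ψ(4^{-i}s)²`
is positive on `[d, ∞)`, and its inverse is eventually invariant under `s ↦ 4s`. Multiplying by it
produces only finitely many distinct symbols, so the previous bounds apply to the reproducing
formula `hasSum_reproducing`. Inserting powers of `s` in that formula constructs the `g` with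
`H^{-α/2} g = f` (`exists_sobolevNorm_le`). The `L^p` statements are the case `α = 0`. -/

lemma HasSum.congr_both {ι E : Type*} [AddCommMonoid E] [TopologicalSpace E] {f g : ι → E} {a b : E}
    (h : HasSum f a) (hfg : ∀ k, f k = g k) (hab : a = b) : HasSum g b := by
  rwa [← funext hfg, ← hab]

lemma contDiff_gaussian : ContDiff ℝ ∞ (fun y : ℝ => Real.exp (-y ^ 2)) := by fun_prop

lemma ofReal_iteratedDeriv {f : ℝ → ℝ} (hf : ContDiff ℝ ∞ f) (k : ℕ) (x : ℝ) :
    ((iteratedDeriv k f x : ℝ) : ℂ) = iteratedDeriv k (fun y => (f y : ℂ)) x := by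
  induction k generalizing x with
  | zero => simp
  | succ k ih =>
    rw [iteratedDeriv_succ, iteratedDeriv_succ, ← funext ih]
    have h : DifferentiableAt ℝ (iteratedDeriv k f) x :=
      (hf.differentiable_iteratedDeriv k (by exact_mod_cast ENat.natCast_lt_top k)) x
    exact (h.hasDerivAt.ofReal_comp.deriv).symm

lemma integrable_pow_mul_gaussian (n : ℕ) :
    Integrable (fun x : ℝ => (x : ℝ) ^ n • Complex.exp (-Real.pi * Real.pi * x ^ 2)) := by
  have h := integrable_rpow_mul_exp_neg_mul_sq (b := Real.pi * Real.pi) (by positivity)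
    (s := n) (by have : (0 : ℝ) ≤ n := by positivity
                 linarith)
  refine (h.ofReal (𝕜 := ℂ)).congr (.of_forall fun x => ?_)
  simp [Complex.real_smul]

/-- The Gaussian is a Fourier transform of a Gaussian, so each derivative brings down a factor
`-2πis`. With every `k` now entering as a `k`-th power, the sum over `k` in Mehler's formula becomes
an exponential series under a double integral. -/
lemma gaussianDeriv_eq_integral (k : ℕ) (x : ℝ) :
    ((iteratedDeriv k (fun y : ℝ => Real.exp (-y ^ 2)) x : ℝ) : ℂ) =
      (Real.sqrt Real.pi : ℂ) * ∫ s : ℝ, (-2 * Real.pi * Complex.I * s) ^ k *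
        Complex.exp (-Real.pi ^ 2 * s ^ 2 - 2 * Real.pi * Complex.I * s * x) := by
  rw [ofReal_iteratedDeriv contDiff_gaussian]
  have h1 : (fun y : ℝ => ((Real.exp (-y ^ 2) : ℝ) : ℂ)) =
      fun t => (Real.sqrt Real.pi : ℂ) *
      (FourierTransform.fourier fun x : ℝ => Complex.exp (-Real.pi * Real.pi * x ^ 2)) t := by
    rw [fourier_gaussian_pi (by simpa using Real.pi_pos)]
    funext t
    have : ((Real.pi : ℂ) ^ (1 / 2 : ℂ)) = (Real.sqrt Real.pi : ℂ) := by
      rw [Real.sqrt_eq_rpow, Complex.ofReal_cpow Real.pi_pos.le]; simp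
    have hp : (Real.sqrt Real.pi : ℂ) ≠ 0 := by
      simpa using (Real.sqrt_pos.2 Real.pi_pos).ne'
    have hp' : (Real.pi : ℂ) ≠ 0 := by simp [Real.pi_pos.ne']
    rw [this]
    field_simp
    push_cast
    congr 1
  rw [h1, iteratedDeriv_const_mul_field,
    Real.iteratedDeriv_fourier (N := ⊤) (n := k) (fun n _ => integrable_pow_mul_gaussian n) le_top,
    Real.fourier_real_eq_integral_exp_smul]
  congr 1
  congr 1
  funext s
  rw [smul_eq_mul, smul_eq_mul, mul_left_comm, ← Complex.exp_add]
  congr 2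
  push_cast
  ring

/-- The ratio `(1 - r) / (1 + r)`, which is `tanh ζ` for `r = e^{-2ζ}`. -/
def cayley (r : ℂ) : ℂ := (1 - r) / (1 + r)

lemma integrable_exp_neg_mul_sq_prod {b : ℝ} (hb : 0 < b) :
    Integrable (fun z : ℝ × ℝ => Real.exp (-b * (z.1 ^ 2 + z.2 ^ 2))) := by
  refine ((integrable_exp_neg_mul_sq hb).mul_prod (integrable_exp_neg_mul_sq hb)).congr
    (.of_forall fun z => ?_)
  simp only [← Real.exp_add]
  congr 1; ring

lemma one_sub_sq_re_pos {r : ℂ} (hr : ‖r‖ < 1) : 0 < (1 - r ^ 2).re := by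
  have h : (r ^ 2).re ≤ ‖r ^ 2‖ := Complex.re_le_norm _
  rw [norm_pow] at h
  have : ‖r‖ ^ 2 < 1 := by nlinarith [norm_nonneg r]
  simp only [Complex.sub_re, Complex.one_re]; linarith

lemma one_add_ne_zero' {r : ℂ} (hr : ‖r‖ < 1) : 1 + r ≠ 0 := by
  intro h
  have : r = -1 := by linear_combination h
  rw [this] at hr; simp at hr

lemma one_sub_ne_zero' {r : ℂ} (hr : ‖r‖ < 1) : 1 - r ≠ 0 := by
  intro h
  have : r = 1 := by linear_combination -h
  rw [this] at hr; simp at hr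

/-- Two successive Gaussian integrations. The one in `u` leaves the quadratic coefficient `-π²(1 -
r²)` in `s`, so the second converges because `Re (1 - r²) > 0` in the unit disc. -/
lemma mehler_integral {r : ℂ} (hr : ‖r‖ < 1) (x y : ℝ) :
    ∫ s : ℝ, ∫ u : ℝ, Complex.exp (-2 * Real.pi ^ 2 * r * s * u +
      (-Real.pi ^ 2 * s ^ 2 - 2 * Real.pi * Complex.I * s * x) +
      (-Real.pi ^ 2 * u ^ 2 - 2 * Real.pi * Complex.I * u * y)) =
    (1 / Real.pi : ℂ) ^ (1 / 2 : ℂ) * ((1 / (Real.pi * (1 - r ^ 2)) : ℂ) ^ (1 / 2 : ℂ) *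
      Complex.exp (-y ^ 2 - (r * y - x) ^ 2 / (1 - r ^ 2))) := by
  have hp' : (Real.pi : ℂ) ≠ 0 := by simp [Real.pi_pos.ne']
  have hr2 : (1 - r ^ 2) ≠ 0 := fun h => by
    have := one_sub_sq_re_pos hr; rw [h] at this; simp at this
  have h1 : ∀ s : ℝ, ∫ u : ℝ, Complex.exp (-2 * Real.pi ^ 2 * r * s * u +
      (-Real.pi ^ 2 * s ^ 2 - 2 * Real.pi * Complex.I * s * x) +
      (-Real.pi ^ 2 * u ^ 2 - 2 * Real.pi * Complex.I * u * y)) =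
      (1 / Real.pi : ℂ) ^ (1 / 2 : ℂ) * Complex.exp (-(Real.pi ^ 2 * (1 - r ^ 2)) * s ^ 2 +
        (2 * Real.pi * Complex.I * (r * y - x)) * s + (-y ^ 2)) := by
    intro s
    have h := integral_cexp_quadratic (b := -(Real.pi : ℂ) ^ 2)
      (by rw [← Complex.ofReal_pow, Complex.neg_re, Complex.ofReal_re]; simp [Real.pi_pos])
      (-2 * Real.pi ^ 2 * r * s - 2 * Real.pi * Complex.I * y)
      (-Real.pi ^ 2 * s ^ 2 - 2 * Real.pi * Complex.I * s * x)
    convert h using 1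
    · congr 1; funext u; congr 1; ring
    · congr 2
      · field_simp
      · field_simp
        ring_nf
        rw [Complex.I_sq]; ring
  simp_rw [h1]
  rw [integral_const_mul]
  congr 1
  have h := integral_cexp_quadratic (b := -((Real.pi : ℂ) ^ 2 * (1 - r ^ 2)))
      (by rw [← Complex.ofReal_pow, Complex.neg_re, Complex.re_ofReal_mul]
          have := one_sub_sq_re_pos hr
          have : 0 < Real.pi ^ 2 * (1 - r ^ 2).re := by positivity
          linarith)
      (2 * Real.pi * Complex.I * (r * y - x)) (-y ^ 2)
  rw [h]
  congr 2
  · field_simp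
  · field_simp
    ring_nf
    rw [Complex.I_sq]; ring

lemma hermiteFun_mul (k : ℕ) (x y : ℝ) : hermiteFun k x * hermiteFun k y =
    (2 ^ k * (k.factorial : ℝ) * Real.sqrt Real.pi)⁻¹ *
    (iteratedDeriv k (fun y : ℝ => Real.exp (-y ^ 2)) x *
      iteratedDeriv k (fun y : ℝ => Real.exp (-y ^ 2)) y) *
    Real.exp ((x ^ 2 + y ^ 2) / 2) := by
  have h0 : (0 : ℝ) ≤ 2 ^ k * (k.factorial : ℝ) * Real.sqrt Real.pi := by positivity
  have h1 : ((-1 : ℝ) ^ k) * (-1) ^ k = 1 := by rw [← mul_pow]; simp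
  unfold hermiteFun
  rw [← Real.mul_self_sqrt h0, mul_inv, add_div, Real.exp_add, Real.mul_self_sqrt h0]
  linear_combination ((Real.sqrt (2 ^ k * (k.factorial : ℝ) * Real.sqrt Real.pi))⁻¹ ^ 2 *
    iteratedDeriv k (fun y : ℝ => Real.exp (-y ^ 2)) x * Real.exp (x ^ 2 / 2) *
    iteratedDeriv k (fun y : ℝ => Real.exp (-y ^ 2)) y * Real.exp (y ^ 2 / 2)) * h1

/-- The one-dimensional Mehler kernel. -/
def mehler (r : ℂ) (x y : ℝ) : ℂ :=
  (Real.pi * (1 - r ^ 2)) ^ (-(1 / 2) : ℂ) *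
    Complex.exp (-(cayley r * (x + y) ^ 2 + (cayley r)⁻¹ * (x - y) ^ 2) / 4)

lemma sum_integral_mehler {r : ℂ} (hr : ‖r‖ < 1) (x y : ℝ) :
    HasSum (fun k : ℕ => (r / 2) ^ k / (k.factorial : ℂ) *
      ((∫ s : ℝ, (-2 * Real.pi * Complex.I * s) ^ k *
        Complex.exp (-Real.pi ^ 2 * s ^ 2 - 2 * Real.pi * Complex.I * s * x)) *
       (∫ s : ℝ, (-2 * Real.pi * Complex.I * s) ^ k *
        Complex.exp (-Real.pi ^ 2 * s ^ 2 - 2 * Real.pi * Complex.I * s * y))))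
    (∫ s : ℝ, ∫ u : ℝ, Complex.exp (-2 * Real.pi ^ 2 * r * s * u +
      (-Real.pi ^ 2 * s ^ 2 - 2 * Real.pi * Complex.I * s * x) +
      (-Real.pi ^ 2 * u ^ 2 - 2 * Real.pi * Complex.I * u * y))) := by
  have hnorm : ∀ s x : ℝ, ‖Complex.exp (-Real.pi ^ 2 * s ^ 2 - 2 * Real.pi * Complex.I * s * x)‖ =
      Real.exp (-Real.pi ^ 2 * s ^ 2) := by
    intro s x
    rw [Complex.norm_exp]
    congr 1
    have : (-Real.pi ^ 2 * s ^ 2 - 2 * Real.pi * Complex.I * s * x : ℂ) =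
      ((-Real.pi ^ 2 * s ^ 2 : ℝ) : ℂ) + ((-2 * Real.pi * s * x : ℝ) : ℂ) * Complex.I := by
      push_cast; ring
    rw [this, Complex.add_re, Complex.ofReal_re, Complex.re_ofReal_mul, Complex.I_re]; ring
  have hb : 0 < Real.pi ^ 2 * (1 - ‖r‖) := by
    have : 0 < 1 - ‖r‖ := by linarith
    positivity
  -- From `2|s||u| ≤ s² + u²` the cross term costs at most the fraction `‖r‖ < 1` of the Gaussian
  -- decay, which leaves an integrable majorant of the whole series.
  have hdom : ∀ z : ℝ × ℝ, Real.exp (2 * Real.pi ^ 2 * ‖r‖ * |z.1| * |z.2|) *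
      (Real.exp (-Real.pi ^ 2 * z.1 ^ 2) * Real.exp (-Real.pi ^ 2 * z.2 ^ 2)) ≤
      Real.exp (-(Real.pi ^ 2 * (1 - ‖r‖)) * (z.1 ^ 2 + z.2 ^ 2)) := by
    intro z
    rw [← Real.exp_add, ← Real.exp_add]
    apply Real.exp_le_exp.2
    have h : 0 ≤ Real.pi ^ 2 * ‖r‖ * (|z.1| - |z.2|) ^ 2 := by positivity
    have h1 := sq_abs z.1
    have h2 := sq_abs z.2
    nlinarith
  set f : ℝ × ℝ → ℂ := fun z => Complex.exp (-2 * Real.pi ^ 2 * r * z.1 * z.2 +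
      (-Real.pi ^ 2 * z.1 ^ 2 - 2 * Real.pi * Complex.I * z.1 * x) +
      (-Real.pi ^ 2 * z.2 ^ 2 - 2 * Real.pi * Complex.I * z.2 * y)) with hf
  have hfi : Integrable f (volume.prod volume) := by
    refine (integrable_exp_neg_mul_sq_prod hb).mono' (by fun_prop) (.of_forall fun z => ?_)
    refine le_trans ?_ (hdom z)
    simp only [hf]
    rw [Complex.exp_add, Complex.exp_add, norm_mul, norm_mul, hnorm, hnorm, mul_assoc]
    gcongr
    rw [Complex.norm_exp]
    apply Real.exp_le_exp.2
    refine (Complex.re_le_norm _).trans (le_of_eq ?_)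
    simp [abs_of_pos Real.pi_pos]
  have key := hasSum_integral_of_dominated_convergence (μ := (volume : Measure (ℝ × ℝ)))
    (F := fun (k : ℕ) (z : ℝ × ℝ) => (r / 2) ^ k / (k.factorial : ℂ) *
      (((-2 * Real.pi * Complex.I * z.1) ^ k *
        Complex.exp (-Real.pi ^ 2 * z.1 ^ 2 - 2 * Real.pi * Complex.I * z.1 * x)) *
       ((-2 * Real.pi * Complex.I * z.2) ^ k *
        Complex.exp (-Real.pi ^ 2 * z.2 ^ 2 - 2 * Real.pi * Complex.I * z.2 * y)))) (f := f)
    (fun k z => (2 * Real.pi ^ 2 * ‖r‖ * |z.1| * |z.2|) ^ k / (k.factorial : ℝ) *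
      (Real.exp (-Real.pi ^ 2 * z.1 ^ 2) * Real.exp (-Real.pi ^ 2 * z.2 ^ 2)))
    (fun k => by fun_prop) (fun k => .of_forall fun z => ?_) (.of_forall fun z => ?_) ?_
    (.of_forall fun z => ?_)
  · have e1 : ∫ z, f z = ∫ s : ℝ, ∫ u : ℝ, f (s, u) := integral_prod _ hfi
    rw [e1] at key
    refine HasSum.congr_both key (fun k => ?_) rfl
    rw [integral_const_mul]
    congr 1
    exact integral_prod_mul
      (fun s : ℝ => (-2 * Real.pi * Complex.I * s) ^ k *
        Complex.exp (-Real.pi ^ 2 * s ^ 2 - 2 * Real.pi * Complex.I * s * x))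
      (fun s : ℝ => (-2 * Real.pi * Complex.I * s) ^ k *
        Complex.exp (-Real.pi ^ 2 * s ^ 2 - 2 * Real.pi * Complex.I * s * y))
  · simp only [norm_mul, norm_div, norm_pow, hnorm]
    simp [abs_of_pos Real.pi_pos]
    apply le_of_eq
    rw [div_pow, mul_pow, mul_pow, mul_pow, mul_pow, mul_pow, mul_pow, mul_pow, mul_pow]
    field_simp
    ring
  · exact (Real.summable_pow_div_factorial _).mul_right _
  · have : ∀ z : ℝ × ℝ, ∑' k : ℕ, (2 * Real.pi ^ 2 * ‖r‖ * |z.1| * |z.2|) ^ k / (k.factorial : ℝ) *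
      (Real.exp (-Real.pi ^ 2 * z.1 ^ 2) * Real.exp (-Real.pi ^ 2 * z.2 ^ 2)) =
      Real.exp (2 * Real.pi ^ 2 * ‖r‖ * |z.1| * |z.2|) *
      (Real.exp (-Real.pi ^ 2 * z.1 ^ 2) * Real.exp (-Real.pi ^ 2 * z.2 ^ 2)) := by
      intro z
      rw [tsum_mul_right, Real.exp_eq_exp_ℝ, NormedSpace.exp_eq_tsum_div]
    simp_rw [this]
    refine (integrable_exp_neg_mul_sq_prod hb).mono' (by fun_prop) (.of_forall fun z => ?_)
    rw [Real.norm_of_nonneg (by positivity)]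
    exact hdom z
  · have h := (NormedSpace.expSeries_div_hasSum_exp (𝔸 := ℂ) (-2 * Real.pi ^ 2 * r * z.1 * z.2)).mul_right
      (Complex.exp (-Real.pi ^ 2 * z.1 ^ 2 - 2 * Real.pi * Complex.I * z.1 * x) *
      Complex.exp (-Real.pi ^ 2 * z.2 ^ 2 - 2 * Real.pi * Complex.I * z.2 * y))
    rw [← Complex.exp_eq_exp_ℂ] at h
    simp only [hf]
    rw [Complex.exp_add, Complex.exp_add, mul_assoc]
    refine HasSum.congr_both h (fun k => ?_) (by ring)
    have : (-2 * Real.pi ^ 2 * r * z.1 * z.2 : ℂ) = (r / 2) * (-2 * Real.pi * Complex.I * z.1) *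
      (-2 * Real.pi * Complex.I * z.2) := by
      linear_combination (-2 * Real.pi ^ 2 * r * z.1 * z.2 : ℂ) * Complex.I_sq
    rw [this, mul_pow, mul_pow]
    ring

/-- The exponent is diagonalized in `x + y` and `x - y`, with coefficients `cayley r` and its
inverse. Both have positive real part for `‖r‖ < 1`, so norm bounds can be read off term by term. -/
lemma hasSum_mehler {r : ℂ} (hr : ‖r‖ < 1) (x y : ℝ) :
    HasSum (fun k : ℕ => r ^ k * ((hermiteFun k x * hermiteFun k y : ℝ) : ℂ)) (mehler r x y) := by
  have h := (sum_integral_mehler hr x y).mul_left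
    ((Real.sqrt Real.pi * Real.exp ((x ^ 2 + y ^ 2) / 2) : ℝ) : ℂ)
  have hp' : (Real.pi : ℂ) ≠ 0 := by simp [Real.pi_pos.ne']
  have hsq : (Real.sqrt Real.pi : ℂ) ≠ 0 := by simpa using (Real.sqrt_pos.2 Real.pi_pos).ne'
  have hr1 := one_add_ne_zero' hr
  have hr1' := one_sub_ne_zero' hr
  have hr2 : (1 - r ^ 2) ≠ 0 := fun h => by
    have := one_sub_sq_re_pos hr; rw [h] at this; simp at this
  refine HasSum.congr_both h (fun k => ?_) ?_
  · symm
    rw [hermiteFun_mul]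
    push_cast
    rw [gaussianDeriv_eq_integral, gaussianDeriv_eq_integral]
    have hf : (k.factorial : ℂ) ≠ 0 := by exact_mod_cast k.factorial_ne_zero
    rw [div_pow]
    field_simp
  · symm
    rw [mehler_integral hr, mehler]
    have e1 : (1 / Real.pi : ℂ) ^ (1 / 2 : ℂ) = (Real.sqrt Real.pi : ℂ)⁻¹ := by
      rw [Real.sqrt_eq_rpow, one_div, Complex.ofReal_cpow Real.pi_pos.le,
        Complex.inv_cpow _ _ (by rw [Complex.arg_ofReal_of_nonneg Real.pi_pos.le]; exact Real.pi_pos.ne)]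
      simp
    have e2 : (1 / (Real.pi * (1 - r ^ 2)) : ℂ) ^ (1 / 2 : ℂ) =
        (Real.pi * (1 - r ^ 2)) ^ (-(1 / 2) : ℂ) := by
      rw [one_div, Complex.inv_cpow, Complex.cpow_neg]
      intro h
      rw [Complex.arg_eq_pi_iff, Complex.re_ofReal_mul] at h
      have := mul_pos Real.pi_pos (one_sub_sq_re_pos hr)
      linarith [h.1]
    rw [e1, e2]
    have e3 : Complex.exp (-(cayley r * (x + y) ^ 2 + (cayley r)⁻¹ * (x - y) ^ 2) / 4) =
      Complex.exp ((x ^ 2 + y ^ 2) / 2) * Complex.exp (-y ^ 2 - (r * y - x) ^ 2 / (1 - r ^ 2)) := by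
      rw [← Complex.exp_add]
      congr 1
      have : 1 - r ^ 2 = (1 - r) * (1 + r) := by ring
      rw [cayley, this, inv_div]
      field_simp
      ring
    rw [e3]
    push_cast
    field_simp

/-! ### Multi-index sums and the Mehler kernel in dimension d -/

lemma sum_piAntidiag_insert {ι : Type*} [DecidableEq ι] {s : Finset ι} {i : ι} (hi : i ∉ s)
    (a : ι → ℕ → ℂ) (n : ℕ) :
    ∑ μ ∈ Finset.piAntidiag (insert i s) n, ∏ j ∈ insert i s, a j (μ j) =
      ∑ p ∈ Finset.HasAntidiagonal.antidiagonal n, a i p.1 * ∑ μ ∈ Finset.piAntidiag s p.2, ∏ j ∈ s, a j (μ j) := by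
  rw [← Finset.cons_eq_insert _ _ hi, Finset.piAntidiag_cons, Finset.sum_disjiUnion]
  refine Finset.sum_congr rfl fun p _ => ?_
  rw [Finset.sum_map, Finset.mul_sum]
  refine Finset.sum_congr rfl fun μ hμ => ?_
  have h0 : μ i = 0 := by
    by_contra h
    exact hi ((Finset.mem_piAntidiag.1 hμ).2 i h)
  rw [Finset.prod_cons]
  congr 1
  · simp [h0]
  · refine Finset.prod_congr rfl fun j hj => ?_
    have : j ≠ i := fun h => hi (h ▸ hj)
    simp [this]

/-- Grouping multi-indices by their length is an iterated Cauchy product. Absolute convergence has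
to be carried through the induction, since it is what permits the next product. -/
lemma summable_norm_sum_piAntidiag {ι : Type*} [DecidableEq ι] (s : Finset ι) (a : ι → ℕ → ℂ)
    (h : ∀ i, Summable fun n => ‖a i n‖) :
    (Summable fun k => ‖∑ μ ∈ Finset.piAntidiag s k, ∏ j ∈ s, a j (μ j)‖) ∧
      ∑' k, ∑ μ ∈ Finset.piAntidiag s k, ∏ j ∈ s, a j (μ j) = ∏ j ∈ s, ∑' n, a j n := by
  induction s using Finset.induction_on with
  | empty =>
    have : ∀ k : ℕ, ∑ μ ∈ Finset.piAntidiag (∅ : Finset ι) k, ∏ j ∈ (∅ : Finset ι), a j (μ j) =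
        if k = 0 then 1 else 0 := by
      intro k
      rw [Finset.piAntidiag_empty]
      split_ifs <;> simp
    simp_rw [this]
    refine ⟨summable_of_hasFiniteSupport ((Set.finite_singleton 0).subset ?_), by simp⟩
    intro k hk
    by_contra h
    simp_all
  | insert i s hi ih =>
    set g : ℕ → ℂ := fun k => ∑ μ ∈ Finset.piAntidiag s k, ∏ j ∈ s, a j (μ j) with hg
    have e : ∀ n, ∑ μ ∈ Finset.piAntidiag (insert i s) n, ∏ j ∈ insert i s, a j (μ j) =
        ∑ p ∈ Finset.HasAntidiagonal.antidiagonal n, a i p.1 * g p.2 :=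
      sum_piAntidiag_insert hi a
    simp only [e]
    refine ⟨summable_norm_sum_mul_antidiagonal_of_summable_norm (f := a i) (g := g) (h i) ih.1, ?_⟩
    rw [← tsum_mul_tsum_eq_tsum_sum_antidiagonal_of_summable_norm (f := a i) (g := g) (h i) ih.1,
      ih.2, Finset.prod_insert hi]

/-- The `d`-dimensional Mehler kernel. -/
def mehlerKernel {d : ℕ} (r : ℂ) (x y : EuclideanSpace ℝ (Fin d)) : ℂ :=
  (Real.pi * (1 - r ^ 2)) ^ (-(d / 2 : ℝ) : ℂ) *
    Complex.exp (-(cayley r * (‖x + y‖ ^ 2 : ℝ) + (cayley r)⁻¹ * (‖x - y‖ ^ 2 : ℝ)) / 4)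

lemma hasSum_mehlerKernel {d : ℕ} {r : ℂ} (hr : ‖r‖ < 1) (x y : EuclideanSpace ℝ (Fin d)) :
    (Summable fun k : ℕ => ‖r ^ k * (hermiteKernel k x y : ℂ)‖) ∧
    HasSum (fun k : ℕ => r ^ k * (hermiteKernel k x y : ℂ)) (mehlerKernel r x y) := by
  have h := summable_norm_sum_piAntidiag (Finset.univ : Finset (Fin d))
    (fun i n => r ^ n * ((hermiteFun n (x i) * hermiteFun n (y i) : ℝ) : ℂ))
    (fun i => (hasSum_mehler hr (x i) (y i)).summable.norm)
  have e : ∀ k : ℕ, ∑ μ ∈ Finset.piAntidiag (Finset.univ : Finset (Fin d)) k,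
      ∏ j, (r ^ μ j * ((hermiteFun (μ j) (x j) * hermiteFun (μ j) (y j) : ℝ) : ℂ)) =
      r ^ k * (hermiteKernel k x y : ℂ) := by
    intro k
    rw [hermiteKernel]
    push_cast
    rw [Finset.mul_sum]
    refine Finset.sum_congr rfl fun μ hμ => ?_
    rw [Finset.prod_mul_distrib, Finset.prod_pow_eq_pow_sum, (Finset.mem_piAntidiag.1 hμ).1,
      Finset.prod_mul_distrib, hermitePhi, hermitePhi]
    push_cast
    rfl
  simp_rw [e] at h
  refine ⟨h.1, HasSum.congr_both h.1.of_norm.hasSum (fun _ => rfl) (h.2.trans ?_)⟩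
  simp_rw [(hasSum_mehler hr _ _).tsum_eq, mehler]
  rw [Finset.prod_mul_distrib, Finset.prod_const, Finset.card_univ, Fintype.card_fin,
    ← Complex.cpow_nat_mul, mehlerKernel, ← Complex.exp_sum]
  congr 2
  · push_cast; ring
  · simp only [EuclideanSpace.norm_sq_eq, PiLp.add_apply, PiLp.sub_apply, Real.norm_eq_abs, sq_abs]
    push_cast
    rw [← Finset.sum_div, Finset.sum_neg_distrib, Finset.sum_add_distrib, Finset.mul_sum,
      Finset.mul_sum]

/-! ### Growth of the kernels of the spectral projections -/

lemma hermiteKernel_self_nonneg {d : ℕ} (k : ℕ) (x : EuclideanSpace ℝ (Fin d)) :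
    0 ≤ hermiteKernel k x x := Finset.sum_nonneg fun _ _ => mul_self_nonneg _

lemma abs_hermiteKernel_le {d : ℕ} (k : ℕ) (x y : EuclideanSpace ℝ (Fin d)) :
    |hermiteKernel k x y| ≤ (hermiteKernel k x x + hermiteKernel k y y) / 2 := by
  unfold hermiteKernel
  refine (Finset.abs_sum_le_sum_abs _ _).trans ?_
  rw [← Finset.sum_add_distrib, Finset.sum_div]
  refine Finset.sum_le_sum fun μ _ => ?_
  rw [abs_mul]
  nlinarith [sq_nonneg (|hermitePhi μ x| - |hermitePhi μ y|), sq_abs (hermitePhi μ x),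
    sq_abs (hermitePhi μ y)]

lemma norm_mehlerKernel_self_le {d : ℕ} {r : ℝ} (h0 : 0 ≤ r) (h1 : r < 1)
    (x : EuclideanSpace ℝ (Fin d)) :
    ‖mehlerKernel r x x‖ ≤ (1 - r)⁻¹ ^ d := by
  have hr : 0 < 1 - r := by linarith
  have e1 : (Real.pi * (1 - (r : ℂ) ^ 2)) = ((Real.pi * (1 - r ^ 2) : ℝ) : ℂ) := by push_cast; ring
  have e2 : (-(cayley r * (‖x + x‖ ^ 2 : ℝ) + (cayley r)⁻¹ * (‖x - x‖ ^ 2 : ℝ)) / 4) =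
      ((-((1 - r) / (1 + r) * ‖x + x‖ ^ 2) / 4 : ℝ) : ℂ) := by
    simp [cayley]
  rw [mehlerKernel, norm_mul, e2, Complex.norm_exp, Complex.ofReal_re, e1,
    show (-((d / 2 : ℝ) : ℂ)) = ((-(d / 2) : ℝ) : ℂ) by push_cast; ring,
    Complex.norm_cpow_real, Complex.norm_real, Real.norm_of_nonneg
      (by have : 0 ≤ 1 - r ^ 2 := by nlinarith
          have := Real.pi_pos
          positivity)]
  have h3 : Real.exp (-((1 - r) / (1 + r) * ‖x + x‖ ^ 2) / 4) ≤ 1 := by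
    apply Real.exp_le_one_iff.2
    have : 0 ≤ (1 - r) / (1 + r) * ‖x + x‖ ^ 2 := by positivity
    linarith
  have h4 : (Real.pi * (1 - r ^ 2)) ^ (-(d / 2 : ℝ)) ≤ (1 - r)⁻¹ ^ d := by
    have h5 : 1 - r ≤ Real.pi * (1 - r ^ 2) := by
      have h6 : 1 - r ≤ 1 - r ^ 2 := by nlinarith
      nlinarith [Real.pi_gt_three]
    calc (Real.pi * (1 - r ^ 2)) ^ (-(d / 2 : ℝ)) ≤ (1 - r) ^ (-(d / 2 : ℝ)) :=
          Real.rpow_le_rpow_of_nonpos hr h5 (by have : (0 : ℝ) ≤ d := by positivity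
                                                linarith)
      _ ≤ (1 - r) ^ (-(d : ℝ)) :=
          Real.rpow_le_rpow_of_exponent_ge hr (by linarith)
            (by have : (0 : ℝ) ≤ d := by positivity
                linarith)
      _ = _ := by rw [Real.rpow_neg hr.le, Real.rpow_natCast, inv_pow]
  calc _ ≤ (1 - r)⁻¹ ^ d * 1 := by gcongr
    _ = _ := mul_one _

/-- On the diagonal the terms of Mehler's series are nonnegative, so a single term is at most the
whole sum, which is at most `(1 - r)^{-d}`. The bound is polynomial in `k` and uniform in `x`; this
crude growth suffices for all later exchanges of sums and integrals. -/
lemma hermiteKernel_self_le {d : ℕ} (k : ℕ) (x : EuclideanSpace ℝ (Fin d)) :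
    hermiteKernel k x x ≤ 3 * (k + 2) ^ d := by
  -- With this radius `1 - r = 1/(k+2)`, while `r^{-k} ≤ (1 + 1/(k+1))^k ≤ e < 3`, which is the
  -- origin of the factor 3.
  set r : ℝ := (k + 1) / (k + 2) with hr
  have h0 : 0 ≤ r := by positivity
  have h1 : r < 1 := by rw [hr, div_lt_one (by positivity)]; linarith
  have h2 : 1 - r = ((k : ℝ) + 2)⁻¹ := by rw [hr]; field_simp; ring
  have hs := hasSum_mehlerKernel (r := (r : ℂ)) (by simpa [abs_of_nonneg h0] using h1) x x
  have hre : HasSum (fun k : ℕ => r ^ k * hermiteKernel k x x) (mehlerKernel (r : ℂ) x x).re := by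
    refine HasSum.congr_both (Complex.hasSum_re hs.2) (fun k => ?_) rfl
    rw [← Complex.ofReal_pow, ← Complex.ofReal_mul, Complex.ofReal_re]
  have h3 : r ^ k * hermiteKernel k x x ≤ (k + 2) ^ d := by
    calc _ ≤ (mehlerKernel (r : ℂ) x x).re :=
          le_hasSum hre k fun j _ => mul_nonneg (by positivity) (hermiteKernel_self_nonneg j x)
      _ ≤ ‖mehlerKernel (r : ℂ) x x‖ := Complex.re_le_norm _
      _ ≤ _ := norm_mehlerKernel_self_le h0 h1 x
      _ = _ := by rw [h2, inv_inv]
  have h4 : 1 ≤ 3 * r ^ k := by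
    have hk : (0 : ℝ) < k + 1 := by positivity
    have h5 : r⁻¹ ≤ Real.exp (1 / (k + 1)) := by
      refine le_trans (le_of_eq ?_) (Real.add_one_le_exp _)
      rw [hr]; field_simp; ring
    have h6 : (r ^ k)⁻¹ ≤ 3 := by
      calc (r ^ k)⁻¹ = r⁻¹ ^ k := (inv_pow _ _).symm
        _ ≤ Real.exp (1 / (k + 1)) ^ k := by gcongr
        _ = Real.exp (k * (1 / (k + 1))) := by rw [← Real.exp_nat_mul]
        _ ≤ Real.exp 1 := by
          apply Real.exp_le_exp.2
          rw [mul_one_div, div_le_one hk]; linarith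
        _ ≤ 3 := by linarith [Real.exp_one_lt_d9]
    have hrk : 0 < r ^ k := by positivity
    rw [inv_le_comm₀ hrk (by norm_num)] at h6
    linarith
  have h5 := hermiteKernel_self_nonneg k x
  nlinarith [mul_le_mul_of_nonneg_right h4 h5]

lemma norm_hermiteKernel_le {d : ℕ} (k : ℕ) (x y : EuclideanSpace ℝ (Fin d)) :
    ‖(hermiteKernel k x y : ℂ)‖ ≤ 3 * (k + 2) ^ d := by
  rw [Complex.norm_real, Real.norm_eq_abs]
  linarith [abs_hermiteKernel_le k x y, hermiteKernel_self_le k x, hermiteKernel_self_le k y]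

lemma contDiff_hermiteFun (k : ℕ) : ContDiff ℝ ∞ (hermiteFun k) := by
  unfold hermiteFun
  have h : ContDiff ℝ ∞ (iteratedDeriv k fun y : ℝ => Real.exp (-y ^ 2)) := by
    rw [iteratedDeriv_eq_iterate]
    exact contDiff_gaussian.iterate_deriv k
  fun_prop

lemma contDiff_hermitePhi {d : ℕ} (μ : Fin d → ℕ) : ContDiff ℝ ∞ (hermitePhi μ) := by
  unfold hermitePhi
  refine contDiff_prod fun i _ => ?_
  exact (contDiff_hermiteFun _).comp (by fun_prop)

lemma continuous_hermiteKernel {d : ℕ} (k : ℕ) :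
    Continuous fun q : EuclideanSpace ℝ (Fin d) × EuclideanSpace ℝ (Fin d) =>
      hermiteKernel k q.1 q.2 := by
  unfold hermiteKernel
  refine continuous_finsetSum _ fun μ _ => ?_
  exact ((contDiff_hermitePhi μ).continuous.comp continuous_fst).mul
    ((contDiff_hermitePhi μ).continuous.comp continuous_snd)

/-! ### The heat kernel with complex time -/

/-- The Cayley transform maps the disc to the right half-plane. It is used with `u = r`, `u = -r`
and `u = r²` for the coefficients of Mehler's kernel. -/
lemma re_one_add_div_one_sub {u : ℂ} (hu : ‖u‖ < 1) :
    ((1 + u) / (1 - u)).re = (1 - ‖u‖ ^ 2) / ‖1 - u‖ ^ 2 := by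
  rw [Complex.div_re, ← Complex.normSq_eq_norm_sq, ← Complex.normSq_eq_norm_sq]
  have h : Complex.normSq (1 - u) ≠ 0 := by
    exact (Complex.normSq_pos.2 (one_sub_ne_zero' hu)).ne'
  rw [Complex.normSq_apply u]
  field_simp
  simp
  ring

lemma re_one_add_div_one_sub_pos {u : ℂ} (hu : ‖u‖ < 1) : 0 < ((1 + u) / (1 - u)).re := by
  rw [re_one_add_div_one_sub hu]
  have h1 : 0 < 1 - ‖u‖ ^ 2 := by nlinarith [norm_nonneg u]
  have h2 : 0 < ‖1 - u‖ := norm_pos_iff.2 (one_sub_ne_zero' hu)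
  positivity

/-- Principal powers are not multiplicative, so composing Gaussian prefactors needs an argument
about branches. All four numbers lie in the right half-plane, which pins the logarithms down. -/
lemma cpow_mul_cpow_branch {A B C : ℂ} (hA : 0 < A.re) (hB : 0 < B.re) (hC : 0 < C.re)
    (hb : 0 < (C / (A * B)).re) (s : ℂ) :
    (Real.pi * A) ^ (-s) * (Real.pi * B) ^ (-s) * (Real.pi / (C / (A * B))) ^ s =
      (Real.pi * C) ^ (-s) := by
  have ne : ∀ {z : ℂ}, 0 < z.re → z ≠ 0 := fun h h0 => by simp [h0] at h
  have hA0 := ne hA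
  have hB0 := ne hB
  have hC0 := ne hC
  have hp : (Real.pi : ℂ) ≠ 0 := by simp [Real.pi_pos.ne']
  have him : ∀ {z : ℂ}, 0 < z.re → |(Complex.log z).im| < Real.pi / 2 := fun {z} h => by
    rw [Complex.log_im, Complex.abs_arg_lt_pi_div_two_iff]; exact Or.inl h
  have hlog : Complex.log (C / (A * B)) = Complex.log C - Complex.log A - Complex.log B := by
    have h1 : Complex.exp (Complex.log (C / (A * B))) =
        Complex.exp (Complex.log C - Complex.log A - Complex.log B) := by
      rw [Complex.exp_sub, Complex.exp_sub, Complex.exp_log (ne hb), Complex.exp_log hA0,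
        Complex.exp_log hB0, Complex.exp_log hC0, div_div]
    obtain ⟨n, hn⟩ := Complex.exp_eq_exp_iff_exists_int.1 h1
    have h2 := congrArg Complex.im hn
    simp only [Complex.add_im, Complex.sub_im] at h2
    have h3 : ((n : ℂ) * (2 * Real.pi * Complex.I)).im = n * (2 * Real.pi) := by simp
    rw [h3] at h2
    have a1 := abs_lt.1 (him hA)
    have a2 := abs_lt.1 (him hB)
    have a3 := abs_lt.1 (him hC)
    have a4 := abs_lt.1 (him hb)
    -- Each of the four arguments is less than `π/2` in absolute value, so their combination is less
    -- than `2π`, and the integer `n` counting the branches must vanish.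
    have hn1 : (n : ℝ) < 1 := by nlinarith [Real.pi_pos]
    have hn2 : (-1 : ℝ) < n := by nlinarith [Real.pi_pos]
    have hn0 : n = 0 := by
      have : n < 1 := by exact_mod_cast hn1
      have : -1 < n := by exact_mod_cast hn2
      omega
    rw [hn, hn0]; simp
  have hpi : ∀ {z : ℂ}, z ≠ 0 → Complex.log (Real.pi * z) = Complex.log Real.pi + Complex.log z :=
    fun {z} hz => by
      rw [Complex.log_ofReal_mul Real.pi_pos hz, Complex.ofReal_log Real.pi_pos.le]
  have hinv : Complex.log (C / (A * B))⁻¹ = -Complex.log (C / (A * B)) := by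
    apply Complex.log_inv
    have := him hb
    rw [Complex.log_im] at this
    have h4 := abs_lt.1 this
    intro h5
    linarith [Real.pi_pos]
  rw [div_eq_mul_inv, Complex.cpow_def_of_ne_zero (mul_ne_zero hp hA0),
    Complex.cpow_def_of_ne_zero (mul_ne_zero hp hB0),
    Complex.cpow_def_of_ne_zero (mul_ne_zero hp hC0),
    Complex.cpow_def_of_ne_zero (mul_ne_zero hp (inv_ne_zero (ne hb))), hpi hA0, hpi hB0, hpi hC0,
    hpi (inv_ne_zero (ne hb)), hinv, hlog, ← Complex.exp_add, ← Complex.exp_add]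
  congr 1
  ring

lemma norm_mul_lt_one {r q : ℂ} (hr : ‖r‖ < 1) (hq : ‖q‖ < 1) : ‖r * q‖ < 1 := by
  rw [norm_mul]; nlinarith [norm_nonneg r, norm_nonneg q]

lemma norm_sq_lt_one {r : ℂ} (hr : ‖r‖ < 1) : ‖r ^ 2‖ < 1 := by
  rw [sq]; exact norm_mul_lt_one hr hr

lemma one_sub_sq_ne_zero {r : ℂ} (hr : ‖r‖ < 1) : 1 - r ^ 2 ≠ 0 := one_sub_ne_zero' (norm_sq_lt_one hr)

lemma mehlerKernel_eq {d : ℕ} {r : ℂ} (hr : ‖r‖ < 1) (x y : EuclideanSpace ℝ (Fin d)) :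
    mehlerKernel r x y = (Real.pi * (1 - r ^ 2)) ^ (-(d / 2 : ℂ)) *
      Complex.exp (∑ i, (-((1 + r ^ 2) / (2 * (1 - r ^ 2))) * ((x i : ℂ) ^ 2 + (y i : ℂ) ^ 2) +
        2 * r / (1 - r ^ 2) * x i * y i)) := by
  have h1 := one_add_ne_zero' hr
  have h2 := one_sub_ne_zero' hr
  rw [mehlerKernel]
  congr 1
  · push_cast; rfl
  · congr 1
    simp only [EuclideanSpace.norm_sq_eq, PiLp.add_apply, PiLp.sub_apply, Real.norm_eq_abs, sq_abs]
    push_cast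
    rw [Finset.mul_sum, Finset.mul_sum, ← Finset.sum_add_distrib, ← Finset.sum_neg_distrib,
      Finset.sum_div]
    refine Finset.sum_congr rfl fun i _ => ?_
    have : 1 - r ^ 2 = (1 - r) * (1 + r) := by ring
    rw [cayley, this, inv_div]
    field_simp
    ring

/-- The semigroup law is obtained by integrating the Gaussians, one quadratic exponent in each
coordinate, instead of by orthogonality of the eigenfunctions. -/
lemma integral_mehlerKernel_mul {d : ℕ} {r q : ℂ} (hr : ‖r‖ < 1) (hq : ‖q‖ < 1)
    (x y : EuclideanSpace ℝ (Fin d)) :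
    ∫ v, mehlerKernel r x v * mehlerKernel q v y = mehlerKernel (r * q) x y := by
  have hA := one_sub_sq_re_pos hr
  have hB := one_sub_sq_re_pos hq
  have hC := one_sub_sq_re_pos (norm_mul_lt_one hr hq)
  have hA0 := one_sub_sq_ne_zero hr
  have hB0 := one_sub_sq_ne_zero hq
  have hC0 := one_sub_sq_ne_zero (norm_mul_lt_one hr hq)
  -- The quadratic coefficient in `v` is the mean of two Cayley transforms; in this form its real
  -- part is visibly positive.
  have hbe : (1 - (r * q) ^ 2) / ((1 - r ^ 2) * (1 - q ^ 2)) =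
      ((1 / 2 : ℝ) : ℂ) * ((1 + r ^ 2) / (1 - r ^ 2) + (1 + q ^ 2) / (1 - q ^ 2)) := by
    push_cast
    field_simp
    ring
  have hb : 0 < ((1 - (r * q) ^ 2) / ((1 - r ^ 2) * (1 - q ^ 2))).re := by
    rw [hbe, Complex.re_ofReal_mul, Complex.add_re]
    have := re_one_add_div_one_sub_pos (norm_sq_lt_one hr)
    have := re_one_add_div_one_sub_pos (norm_sq_lt_one hq)
    positivity
  rw [← (PiLp.volume_preserving_toLp (Fin d)).integral_comp
    (MeasurableEquiv.toLp 2 _).measurableEmbedding]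
  have e : ∀ v : Fin d → ℝ, mehlerKernel r x (WithLp.toLp 2 v) * mehlerKernel q (WithLp.toLp 2 v) y =
      (Real.pi * (1 - r ^ 2)) ^ (-(d / 2 : ℂ)) * (Real.pi * (1 - q ^ 2)) ^ (-(d / 2 : ℂ)) *
      Complex.exp (∑ i, (-((1 + r ^ 2) / (2 * (1 - r ^ 2))) * (x i : ℂ) ^ 2
        - ((1 + q ^ 2) / (2 * (1 - q ^ 2))) * (y i : ℂ) ^ 2)) *
      Complex.exp (-((1 - (r * q) ^ 2) / ((1 - r ^ 2) * (1 - q ^ 2))) * ∑ i, (v i : ℂ) ^ 2 +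
        ∑ i, (2 * r / (1 - r ^ 2) * x i + 2 * q / (1 - q ^ 2) * y i) * v i) := by
    intro v
    rw [mehlerKernel_eq hr, mehlerKernel_eq hq, mul_mul_mul_comm, mul_assoc (_ * _), ← Complex.exp_add,
      ← Complex.exp_add]
    congr 2
    rw [hbe, Finset.mul_sum, ← Finset.sum_add_distrib, ← Finset.sum_add_distrib,
      ← Finset.sum_add_distrib]
    refine Finset.sum_congr rfl fun i _ => ?_
    push_cast
    field_simp
    ring
  simp_rw [e]
  rw [integral_const_mul, GaussianFourier.integral_cexp_neg_mul_sum_add hb, Fintype.card_fin,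
    mehlerKernel_eq (norm_mul_lt_one hr hq), ← cpow_mul_cpow_branch hA hB hC hb (d / 2)]
  have : ∀ a b c e1 e2 e3 : ℂ, e1 * e2 = e3 → a * b * e1 * (c * e2) = a * b * c * e3 := by
    intro a b c e1 e2 e3 h; rw [← h]; ring
  apply this
  rw [← Complex.exp_add]
  congr 1
  rw [Finset.sum_div, ← Finset.sum_add_distrib]
  refine Finset.sum_congr rfl fun i _ => ?_
  have hC0' : 1 - r ^ 2 * q ^ 2 ≠ 0 := by rwa [← mul_pow]
  rw [mul_pow]
  field_simp
  ring

/-- The Euclidean square norm on `ℝ × ℝ^d`. -/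
def sqN {d : ℕ} (v : Space d) : ℝ := v.1 ^ 2 + ‖v.2‖ ^ 2

/-- The integral kernel of `e^{-ζ H_par}`, for `Re ζ > 0`. -/
def heatC {d : ℕ} (ζ : ℂ) (z w : Space d) : ℂ :=
  ((Real.pi * (4 * ζ)) ^ (-(1 / 2) : ℂ) * Complex.exp (-((z.1 - w.1) ^ 2 : ℝ) / (4 * ζ))) *
    (Complex.exp (-d * ζ) * mehlerKernel (Complex.exp (-2 * ζ)) z.2 w.2)

lemma norm_exp_neg_two_mul_lt {ζ : ℂ} (hζ : 0 < ζ.re) : ‖Complex.exp (-2 * ζ)‖ < 1 := by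
  rw [Complex.norm_exp, Real.exp_lt_one_iff]
  simp; exact hζ

lemma mehlerKernel_comm {d : ℕ} (r : ℂ) (x y : EuclideanSpace ℝ (Fin d)) :
    mehlerKernel r x y = mehlerKernel r y x := by
  rw [mehlerKernel, mehlerKernel, add_comm x y, norm_sub_rev]

lemma heatC_comm {d : ℕ} (ζ : ℂ) (z w : Space d) : heatC ζ z w = heatC ζ w z := by
  rw [heatC, heatC, mehlerKernel_comm, ← neg_sub z.1 w.1, neg_sq]

lemma re_inv_pos {ζ : ℂ} (hζ : 0 < ζ.re) : 0 < (1 / (4 * ζ)).re := by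
  have h : (1 / (4 * ζ)) = ((1 / 4 : ℝ) : ℂ) * ζ⁻¹ := by push_cast; rw [one_div, mul_inv]; ring
  rw [h, Complex.re_ofReal_mul, Complex.inv_re]
  have : 0 < Complex.normSq ζ := Complex.normSq_pos.2 fun h0 => by simp [h0] at hζ
  positivity

lemma integral_gaussian_mul {ζ η : ℂ} (hζ : 0 < ζ.re) (hη : 0 < η.re) (x y : ℝ) :
    ∫ v : ℝ, ((Real.pi * (4 * ζ)) ^ (-(1 / 2) : ℂ) * Complex.exp (-((x - v) ^ 2 : ℝ) / (4 * ζ))) *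
      ((Real.pi * (4 * η)) ^ (-(1 / 2) : ℂ) * Complex.exp (-((v - y) ^ 2 : ℝ) / (4 * η))) =
    (Real.pi * (4 * (ζ + η))) ^ (-(1 / 2) : ℂ) *
      Complex.exp (-((x - y) ^ 2 : ℝ) / (4 * (ζ + η))) := by
  have h4 : ∀ {z : ℂ}, 0 < z.re → 0 < (4 * z).re := fun {z} h => by
    have : (4 * z).re = 4 * z.re := by simp
    rw [this]; positivity
  have ne : ∀ {z : ℂ}, 0 < z.re → z ≠ 0 := fun h h0 => by simp [h0] at h
  have hs : 0 < (ζ + η).re := by rw [Complex.add_re]; positivity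
  have hζ0 := ne hζ
  have hη0 := ne hη
  have hs0 := ne hs
  have hbe : (4 * (ζ + η)) / ((4 * ζ) * (4 * η)) = 1 / (4 * ζ) + 1 / (4 * η) := by
    field_simp; ring
  have hb : 0 < ((4 * (ζ + η)) / ((4 * ζ) * (4 * η))).re := by
    rw [hbe, Complex.add_re]
    exact add_pos (re_inv_pos hζ) (re_inv_pos hη)
  have e : ∀ v : ℝ, ((Real.pi * (4 * ζ)) ^ (-(1 / 2) : ℂ) * Complex.exp (-((x - v) ^ 2 : ℝ) / (4 * ζ))) *
      ((Real.pi * (4 * η)) ^ (-(1 / 2) : ℂ) * Complex.exp (-((v - y) ^ 2 : ℝ) / (4 * η))) =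
      (Real.pi * (4 * ζ)) ^ (-(1 / 2) : ℂ) * (Real.pi * (4 * η)) ^ (-(1 / 2) : ℂ) *
      Complex.exp (-((4 * (ζ + η)) / ((4 * ζ) * (4 * η))) * v ^ 2 +
        (2 * x / (4 * ζ) + 2 * y / (4 * η)) * v + (-(x ^ 2 / (4 * ζ)) - y ^ 2 / (4 * η))) := by
    intro v
    rw [mul_mul_mul_comm, ← Complex.exp_add, hbe]
    congr 2
    push_cast
    field_simp
    ring
  simp_rw [e]
  rw [integral_const_mul, integral_cexp_quadratic (by rw [Complex.neg_re]; linarith), neg_neg,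
    ← cpow_mul_cpow_branch (h4 hζ) (h4 hη) (h4 hs) hb (1 / 2), ← mul_assoc]
  congr 2
  push_cast
  field_simp
  ring

lemma integral_heatC_mul {d : ℕ} {ζ η : ℂ} (hζ : 0 < ζ.re) (hη : 0 < η.re) (z w : Space d) :
    ∫ v, heatC ζ z v * heatC η v w = heatC (ζ + η) z w := by
  have e : ∀ v : Space d, heatC ζ z v * heatC η v w =
     (((Real.pi * (4 * ζ)) ^ (-(1 / 2) : ℂ) * Complex.exp (-((z.1 - v.1) ^ 2 : ℝ) / (4 * ζ))) *
      ((Real.pi * (4 * η)) ^ (-(1 / 2) : ℂ) * Complex.exp (-((v.1 - w.1) ^ 2 : ℝ) / (4 * η)))) *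
     ((Complex.exp (-d * ζ) * Complex.exp (-d * η)) * (mehlerKernel (Complex.exp (-2 * ζ)) z.2 v.2 *
       mehlerKernel (Complex.exp (-2 * η)) v.2 w.2)) := by
    intro v; rw [heatC, heatC]; ring
  simp_rw [e]
  have h := integral_prod_mul (μ := (volume : Measure ℝ))
    (ν := (volume : Measure (EuclideanSpace ℝ (Fin d))))
    (fun v : ℝ => ((Real.pi * (4 * ζ)) ^ (-(1 / 2) : ℂ) * Complex.exp (-((z.1 - v) ^ 2 : ℝ) / (4 * ζ))) *
      ((Real.pi * (4 * η)) ^ (-(1 / 2) : ℂ) * Complex.exp (-((v - w.1) ^ 2 : ℝ) / (4 * η))))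
    (fun v => (Complex.exp (-d * ζ) * Complex.exp (-d * η)) *
      (mehlerKernel (Complex.exp (-2 * ζ)) z.2 v * mehlerKernel (Complex.exp (-2 * η)) v w.2))
  refine h.trans ?_
  rw [integral_gaussian_mul hζ hη, integral_const_mul,
    integral_mehlerKernel_mul (norm_exp_neg_two_mul_lt hζ) (norm_exp_neg_two_mul_lt hη), heatC,
    ← Complex.exp_add, ← Complex.exp_add, ← mul_add, ← mul_add]

lemma continuous_heatC {d : ℕ} : ContinuousOn (fun q : ℂ × Space d × Space d => heatC q.1 q.2.1 q.2.2)
    {q | 0 < q.1.re} := by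
  unfold heatC mehlerKernel cayley
  have hp : ∀ q ∈ {q : ℂ × Space d × Space d | 0 < q.1.re}, 0 < (1 - Complex.exp (-2 * q.1) ^ 2).re :=
    fun q hq => one_sub_sq_re_pos (norm_exp_neg_two_mul_lt hq)
  have h1 : ∀ q ∈ {q : ℂ × Space d × Space d | 0 < q.1.re}, (1 + Complex.exp (-2 * q.1)) ≠ 0 :=
    fun q hq => one_add_ne_zero' (norm_exp_neg_two_mul_lt hq)
  have h2 : ∀ q ∈ {q : ℂ × Space d × Space d | 0 < q.1.re}, (1 - Complex.exp (-2 * q.1)) ≠ 0 :=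
    fun q hq => one_sub_ne_zero' (norm_exp_neg_two_mul_lt hq)
  have h0 : ∀ q ∈ {q : ℂ × Space d × Space d | 0 < q.1.re}, (4 * q.1) ≠ 0 :=
    fun q hq h => by
      have : q.1 = 0 := by simpa using h
      simp [this] at hq
  have hT : ContinuousOn (fun q : ℂ × Space d × Space d => (1 - Complex.exp (-2 * q.1)) /
      (1 + Complex.exp (-2 * q.1))) {q | 0 < q.1.re} :=
    ContinuousOn.div (by fun_prop) (by fun_prop) h1
  refine ContinuousOn.mul (ContinuousOn.mul ?_ ?_) (ContinuousOn.mul (by fun_prop)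
    (ContinuousOn.mul ?_ ?_))
  · refine ContinuousOn.cpow (by fun_prop) (by fun_prop) fun q hq => ?_
    left
    rw [Complex.re_ofReal_mul]
    have : (4 * q.1).re = 4 * q.1.re := by simp
    rw [this]
    have := Real.pi_pos
    have : 0 < q.1.re := hq
    positivity
  · refine Complex.continuous_exp.comp_continuousOn (ContinuousOn.div ?_ (by fun_prop) h0)
    exact (Complex.continuous_ofReal.comp (by fun_prop)).neg.continuousOn
  · refine ContinuousOn.cpow (by fun_prop) (by fun_prop) fun q hq => ?_
    left
    rw [Complex.re_ofReal_mul]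
    exact mul_pos Real.pi_pos (hp q hq)
  · refine Complex.continuous_exp.comp_continuousOn (ContinuousOn.div_const (ContinuousOn.neg
      (ContinuousOn.add (ContinuousOn.mul hT ?_) (ContinuousOn.mul (hT.inv₀ ?_) ?_))) _)
    · exact (Complex.continuous_ofReal.comp (by fun_prop)).continuousOn
    · exact fun q hq => div_ne_zero (h2 q hq) (h1 q hq)
    · exact (Complex.continuous_ofReal.comp (by fun_prop)).continuousOn

lemma mehlerKernel_conj {d : ℕ} {r : ℂ} (hr : ‖r‖ < 1) (x y : EuclideanSpace ℝ (Fin d)) :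
    mehlerKernel (starRingEnd ℂ r) x y = starRingEnd ℂ (mehlerKernel r x y) := by
  have hpos : 0 < (Real.pi * (1 - r ^ 2)).re := by
    rw [Complex.re_ofReal_mul]; exact mul_pos Real.pi_pos (one_sub_sq_re_pos hr)
  have harg : (Real.pi * (1 - r ^ 2)).arg ≠ Real.pi := fun h => by
    rw [Complex.arg_eq_pi_iff] at h; linarith [h.1]
  rw [mehlerKernel, mehlerKernel, map_mul, ← Complex.exp_conj]
  congr 1
  · have := Complex.conj_cpow _ (-(d / 2 : ℝ) : ℂ) harg
    have e : (starRingEnd ℂ) (-(d / 2 : ℝ) : ℂ) = (-(d / 2 : ℝ) : ℂ) := by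
      rw [map_neg, Complex.conj_ofReal]
    rw [e] at this
    rw [← this]
    simp
  · simp only [cayley, map_div₀, map_neg, map_add, map_mul, map_sub, map_one, map_inv₀,
      Complex.conj_ofReal]
    have e4 : (starRingEnd ℂ) (4 : ℂ) = 4 := Complex.conj_ofNat 4
    simp [e4]

lemma heatC_conj {d : ℕ} {ζ : ℂ} (hζ : 0 < ζ.re) (z w : Space d) :
    heatC (starRingEnd ℂ ζ) z w = starRingEnd ℂ (heatC ζ z w) := by
  have hpos : 0 < (Real.pi * (4 * ζ)).re := by
    rw [Complex.re_ofReal_mul]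
    have : (4 * ζ).re = 4 * ζ.re := by simp
    rw [this]
    have := Real.pi_pos
    positivity
  have harg : (Real.pi * (4 * ζ)).arg ≠ Real.pi := fun h => by
    rw [Complex.arg_eq_pi_iff] at h; linarith [h.1]
  have e4 : (starRingEnd ℂ) (4 : ℂ) = 4 := Complex.conj_ofNat 4
  have e2 : (starRingEnd ℂ) (2 : ℂ) = 2 := Complex.conj_ofNat 2
  rw [heatC, heatC, map_mul, map_mul, map_mul, ← Complex.exp_conj, ← Complex.exp_conj,
    ← mehlerKernel_conj (norm_exp_neg_two_mul_lt hζ), ← Complex.exp_conj]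
  congr 1
  · congr 1
    · have := Complex.conj_cpow _ (-(1 / 2) : ℂ) harg
      have e : (starRingEnd ℂ) (-(1 / 2) : ℂ) = (-(1 / 2) : ℂ) := by
        simp [e2]
      rw [e] at this
      rw [← this]
      simp [e4]
    · simp only [map_div₀, map_neg, map_mul, Complex.conj_ofReal, e4]
  · simp [e2]

/-! ### Gaussian bounds for the heat kernel -/

instance isAddHaarMeasure_volume {d : ℕ} : (volume : Measure (Space d)).IsAddHaarMeasure :=
  Measure.prod.instIsAddHaarMeasure (volume : Measure ℝ)
    (volume : Measure (EuclideanSpace ℝ (Fin d)))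

lemma sqN_nonneg {d : ℕ} (v : Space d) : 0 ≤ sqN v := by unfold sqN; positivity

lemma norm_le_sqrt_sqN {d : ℕ} (v : Space d) : ‖v‖ ≤ Real.sqrt (sqN v) := by
  apply Real.le_sqrt_of_sq_le
  rw [Prod.norm_def, sqN]
  rcases max_cases ‖v.1‖ ‖v.2‖ with h | h <;> rw [h.1]
  · rw [Real.norm_eq_abs, sq_abs]; nlinarith [sq_nonneg ‖v.2‖]
  · nlinarith [sq_nonneg v.1]

lemma sqN_sub_comm {d : ℕ} (a b : Space d) : sqN (a - b) = sqN (b - a) := by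
  have e1 : sqN (a - b) = (a.1 - b.1) ^ 2 + ‖a.2 - b.2‖ ^ 2 := rfl
  have e2 : sqN (b - a) = (b.1 - a.1) ^ 2 + ‖b.2 - a.2‖ ^ 2 := rfl
  rw [e1, e2, norm_sub_rev]; ring

/-- Half the dimension of `ℝ × ℝ^d`. -/
def hdim (d : ℕ) : ℝ := (d + 1) / 2

lemma hdim_pos (d : ℕ) : 0 < hdim d := by unfold hdim; positivity

lemma integral_exp_neg_sqN {d : ℕ} {b : ℝ} (hb : 0 < b) :
    Integrable (fun v : Space d => Real.exp (-b * sqN v)) ∧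
      ∫ v : Space d, Real.exp (-b * sqN v) = (Real.pi / b) ^ hdim d := by
  have e : ∀ v : Space d, Real.exp (-b * sqN v) =
      Real.exp (-b * v.1 ^ 2) * Real.exp (-b * ‖v.2‖ ^ 2) := by
    intro v; rw [← Real.exp_add, sqN]; congr 1; ring
  have h2 : Integrable (fun v : EuclideanSpace ℝ (Fin d) => Real.exp (-b * ‖v‖ ^ 2)) := by
    have h := GaussianFourier.integrable_cexp_neg_mul_sq_norm_add (b := (b : ℂ))
      (V := EuclideanSpace ℝ (Fin d)) (by simpa using hb) 0 0
    refine h.norm.congr (.of_forall fun v => ?_)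
    simp only [Complex.norm_exp]
    congr 1
    rw [zero_mul, add_zero, ← Complex.ofReal_neg, ← Complex.ofReal_pow, ← Complex.ofReal_mul,
      Complex.ofReal_re]
  refine ⟨((integrable_exp_neg_mul_sq hb).mul_prod h2).congr (.of_forall fun v => (e v).symm), ?_⟩
  simp_rw [e]
  refine (integral_prod_mul (μ := (volume : Measure ℝ))
    (ν := (volume : Measure (EuclideanSpace ℝ (Fin d)))) (fun v : ℝ => Real.exp (-b * v ^ 2))
    (fun v : EuclideanSpace ℝ (Fin d) => Real.exp (-b * ‖v‖ ^ 2))).trans ?_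
  rw [integral_gaussian, GaussianFourier.integral_rexp_neg_mul_sq_norm hb, finrank_euclideanSpace_fin,
    Real.sqrt_eq_rpow, ← Real.rpow_add (by have := Real.pi_pos; positivity), hdim]
  congr 1; ring

lemma integral_exp_neg_sqN_sub {d : ℕ} {b : ℝ} (hb : 0 < b) (z : Space d) :
    Integrable (fun v : Space d => Real.exp (-b * sqN (z - v))) ∧
      ∫ v : Space d, Real.exp (-b * sqN (z - v)) = (Real.pi / b) ^ hdim d := by
  simp_rw [sqN_sub_comm z]
  refine ⟨(integral_exp_neg_sqN hb).1.comp_sub_right z, ?_⟩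
  rw [integral_sub_right_eq_self (fun v : Space d => Real.exp (-b * sqN v)) z]
  exact (integral_exp_neg_sqN hb).2

/-- Mean value inequality on the closed right half-plane, where the derivative of `e^{-z}` has norm
at most 1. -/
lemma norm_one_sub_exp_neg_le {w : ℂ} (hw : 0 ≤ w.re) : ‖1 - Complex.exp (-w)‖ ≤ ‖w‖ := by
  have h := Convex.norm_image_sub_le_of_norm_hasDerivWithin_le (𝕜 := ℂ) (f := fun z => Complex.exp (-z))
    (f' := fun z => Complex.exp (-z) * (-1)) (s := {z : ℂ | 0 ≤ z.re}) (C := 1) (x := 0) (y := w)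
    (fun z _ => ((hasDerivAt_neg z).cexp).hasDerivWithinAt) (fun z hz => by
      rw [norm_mul, Complex.norm_exp]
      have : 0 ≤ z.re := hz
      simpa using this) (convex_halfSpace_re_ge 0) (by simp) hw
  rw [norm_sub_rev]
  simpa using h

/-- The term in `x + y` only helps and is dropped. The Gaussian in `x - y` has rate `(1 - |r|²) / |1
- r|²` over 4, where the numerator is comparable to `Re ζ` and the denominator is at most `4|ζ|²`.
-/
lemma norm_mehlerKernel_le {d : ℕ} {ζ : ℂ} (h0 : 0 < ζ.re) (h2 : ζ.re ≤ 2)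
    (x y : EuclideanSpace ℝ (Fin d)) :
    ‖mehlerKernel (Complex.exp (-2 * ζ)) x y‖ ≤
      ζ.re ^ (-(d / 2 : ℝ)) * Real.exp (-(ζ.re / (36 * ‖ζ‖ ^ 2)) * ‖x - y‖ ^ 2) := by
  set a := ζ.re with ha
  set r := Complex.exp (-2 * ζ) with hr
  have hr1 : ‖r‖ < 1 := norm_exp_neg_two_mul_lt h0
  have hnr : ‖r‖ ^ 2 = Real.exp (-(4 * a)) := by
    rw [hr, Complex.norm_exp, ← Real.exp_nat_mul]
    congr 1
    simp; ring
  -- From `1 - e^{-4a} ≥ 4a / (1 + 4a)` and `a ≤ 2`. This 9 and the quarter in Mehler's exponent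
  -- make the 36 of the statement.
  have hexp : 4 * a / 9 ≤ 1 - ‖r‖ ^ 2 := by
    rw [hnr, Real.exp_neg]
    have h3 := Real.add_one_le_exp (4 * a)
    have h4 : (Real.exp (4 * a))⁻¹ ≤ (4 * a + 1)⁻¹ := by
      apply inv_anti₀ _ h3
      positivity
    have h5 : (4 * a + 1)⁻¹ ≤ 1 - 4 * a / 9 := by
      rw [inv_le_iff_one_le_mul₀ (by positivity)]
      nlinarith
    linarith
  have hζ : 0 < ‖ζ‖ := norm_pos_iff.2 fun h => by simp [ha, h] at h0
  have hT : 0 ≤ (cayley r).re := by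
    have := re_one_add_div_one_sub_pos (u := -r) (by simpa using hr1)
    rw [cayley]
    simpa [sub_eq_add_neg] using this.le
  have hTi : a / (9 * ‖ζ‖ ^ 2) ≤ ((cayley r)⁻¹).re := by
    rw [cayley, inv_div, re_one_add_div_one_sub hr1]
    have h3 : ‖1 - r‖ ≤ 2 * ‖ζ‖ := by
      have := norm_one_sub_exp_neg_le (w := 2 * ζ) (by simpa using h0.le)
      rw [hr, neg_mul]
      simpa using this
    have h4 : 0 < ‖1 - r‖ := norm_pos_iff.2 (one_sub_ne_zero' hr1)
    calc a / (9 * ‖ζ‖ ^ 2) = (4 * a / 9) / (2 * ‖ζ‖) ^ 2 := by field_simp; ring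
      _ ≤ (1 - ‖r‖ ^ 2) / ‖1 - r‖ ^ 2 := by
        have : 0 ≤ 1 - ‖r‖ ^ 2 := le_trans (by positivity) hexp
        gcongr
  rw [mehlerKernel, norm_mul, ← Complex.ofReal_neg, Complex.norm_cpow_real, Complex.norm_exp]
  have hbase : a ≤ ‖(Real.pi : ℂ) * (1 - r ^ 2)‖ := by
    rw [norm_mul, Complex.norm_real, Real.norm_of_nonneg Real.pi_pos.le]
    have h3 : 1 - ‖r‖ ^ 2 ≤ ‖1 - r ^ 2‖ := by
      have := norm_sub_norm_le (1 : ℂ) (r ^ 2)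
      rwa [norm_one, norm_pow] at this
    have h4 : 4 * a / 9 ≤ ‖1 - r ^ 2‖ := hexp.trans h3
    nlinarith [Real.pi_gt_three]
  have hd : -(d / 2 : ℝ) ≤ 0 := by
    have : (0 : ℝ) ≤ d := by positivity
    linarith
  refine mul_le_mul (Real.rpow_le_rpow_of_nonpos h0 hbase hd) ?_ (Real.exp_pos _).le (by positivity)
  apply Real.exp_le_exp.2
  have e : (-(cayley r * (‖x + y‖ ^ 2 : ℝ) + (cayley r)⁻¹ * (‖x - y‖ ^ 2 : ℝ)) / 4).re =
      -((cayley r).re * ‖x + y‖ ^ 2 + ((cayley r)⁻¹).re * ‖x - y‖ ^ 2) / 4 := by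
    have : ∀ w : ℂ, (-w / 4).re = -w.re / 4 := by
      intro w
      rw [show (-w / 4 : ℂ) = -w / ((4 : ℝ) : ℂ) by norm_num, Complex.div_ofReal_re, Complex.neg_re]
    rw [this, Complex.add_re, Complex.re_mul_ofReal, Complex.re_mul_ofReal]
  rw [e]
  have h5 : 0 ≤ (cayley r).re * ‖x + y‖ ^ 2 := by positivity
  have h6 : a / (9 * ‖ζ‖ ^ 2) * ‖x - y‖ ^ 2 ≤ ((cayley r)⁻¹).re * ‖x - y‖ ^ 2 := by gcongr
  have h7 : a / (36 * ‖ζ‖ ^ 2) = a / (9 * ‖ζ‖ ^ 2) / 4 := by field_simp; norm_num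
  rw [h7]
  linarith

lemma norm_heatC_le {d : ℕ} {ζ : ℂ} (h0 : 0 < ζ.re) (h2 : ζ.re ≤ 2) (z w : Space d) :
    ‖heatC ζ z w‖ ≤ ζ.re ^ (-hdim d) * Real.exp (-(ζ.re / (36 * ‖ζ‖ ^ 2)) * sqN (z - w)) := by
  have hζ : 0 < ‖ζ‖ := norm_pos_iff.2 fun h => by simp [h] at h0
  have h1 : ‖(Real.pi * (4 * ζ)) ^ (-(1 / 2) : ℂ)‖ ≤ ζ.re ^ (-(1 / 2) : ℝ) := by
    rw [show (-(1 / 2) : ℂ) = ((-(1 / 2) : ℝ) : ℂ) by push_cast; rfl, Complex.norm_cpow_real]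
    refine Real.rpow_le_rpow_of_nonpos h0 ?_ (by norm_num)
    rw [norm_mul, norm_mul, Complex.norm_real, Real.norm_of_nonneg Real.pi_pos.le]
    have := (Complex.re_le_norm ζ)
    have h4 : ‖(4 : ℂ)‖ = 4 := by simp
    rw [h4]
    nlinarith [Real.pi_gt_three]
  have h3 : ‖Complex.exp (-((z.1 - w.1) ^ 2 : ℝ) / (4 * ζ))‖ ≤
      Real.exp (-(ζ.re / (36 * ‖ζ‖ ^ 2)) * (z.1 - w.1) ^ 2) := by
    rw [Complex.norm_exp]
    apply Real.exp_le_exp.2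
    have e : (-((z.1 - w.1) ^ 2 : ℝ) / (4 * ζ) : ℂ) =
      ((-((z.1 - w.1) ^ 2) / 4 : ℝ) : ℂ) * ζ⁻¹ := by
      push_cast; rw [div_eq_mul_inv, mul_inv]; ring
    rw [e, Complex.re_ofReal_mul, Complex.inv_re, Complex.normSq_eq_norm_sq]
    have : ζ.re / (36 * ‖ζ‖ ^ 2) = ζ.re / ‖ζ‖ ^ 2 / 36 := by field_simp
    rw [this]
    have : 0 ≤ ζ.re / ‖ζ‖ ^ 2 * (z.1 - w.1) ^ 2 := by positivity
    linarith
  have h4 : ‖Complex.exp (-d * ζ)‖ ≤ 1 := by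
    rw [Complex.norm_exp, Real.exp_le_one_iff]
    simp
    positivity
  have h5 := norm_mehlerKernel_le h0 h2 z.2 w.2
  rw [heatC, norm_mul, norm_mul, norm_mul]
  calc _ ≤ (ζ.re ^ (-(1 / 2) : ℝ) * Real.exp (-(ζ.re / (36 * ‖ζ‖ ^ 2)) * (z.1 - w.1) ^ 2)) *
        (1 * (ζ.re ^ (-(d / 2 : ℝ)) * Real.exp (-(ζ.re / (36 * ‖ζ‖ ^ 2)) * ‖z.2 - w.2‖ ^ 2))) := by
        gcongr
    _ = _ := by
      have e : sqN (z - w) = (z.1 - w.1) ^ 2 + ‖z.2 - w.2‖ ^ 2 := rfl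
      rw [e, mul_add, Real.exp_add, show -hdim d = -(1 / 2) + -(d / 2 : ℝ) by rw [hdim]; ring,
        Real.rpow_add h0]
      ring

lemma lintegral_enorm_le_of_le {X : Type*} [MeasurableSpace X] {μ : Measure X} {f : X → ℂ} {g : X → ℝ}
    (hg : Integrable g μ) (h : ∀ x, ‖f x‖ ≤ g x) :
    ∫⁻ x, ‖f x‖ₑ ∂μ ≤ ENNReal.ofReal (∫ x, g x ∂μ) := by
  rw [ofReal_integral_eq_lintegral_ofReal hg (.of_forall fun x => (norm_nonneg _).trans (h x))]
  refine lintegral_mono fun x => ?_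
  rw [← ofReal_norm]
  exact ENNReal.ofReal_le_ofReal (h x)

/-- `sqrt` of a nonnegative number is dominated by its exponential. -/
lemma sqrt_le_exp_half {u : ℝ} (hu : 0 ≤ u) : Real.sqrt u ≤ Real.exp (u / 2) := by
  have h1 := Real.add_one_le_exp (u / 2)
  have h2 : Real.sqrt u ≤ u / 2 + 1 := by
    nlinarith [Real.sq_sqrt hu, sq_nonneg (Real.sqrt u - 1)]
  linarith

/-- The prefactor `(Re ζ)^{-(d+1)/2}` cancels against the Gaussian volume, so the bound depends only
on the angle of `ζ` and not on its size. -/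
lemma lintegral_heatC_le {d : ℕ} {ζ : ℂ} (h0 : 0 < ζ.re) (h2 : ζ.re ≤ 2) (z : Space d) :
    ∫⁻ w, ‖heatC ζ z w‖ₑ ≤ ENNReal.ofReal ((36 * Real.pi * (‖ζ‖ / ζ.re) ^ 2) ^ hdim d) := by
  have hζ : 0 < ‖ζ‖ := norm_pos_iff.2 fun h => by simp [h] at h0
  have hb : 0 < ζ.re / (36 * ‖ζ‖ ^ 2) := by positivity
  refine (lintegral_enorm_le_of_le ((integral_exp_neg_sqN_sub hb z).1.const_mul _)
    (norm_heatC_le h0 h2 z)).trans (ENNReal.ofReal_le_ofReal (le_of_eq ?_))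
  have := Real.pi_pos
  rw [integral_const_mul, (integral_exp_neg_sqN_sub hb z).2, Real.rpow_neg h0.le,
    ← Real.inv_rpow h0.le, ← Real.mul_rpow (by positivity) (by positivity)]
  congr 1
  field_simp

/-- Half of the Gaussian exponent absorbs the weight through `√b |z - w| ≤ e^{b|z-w|²/2}`. What
remains is the gain `b^{-1/2}`, that is `√(Re ζ)` up to the angle. -/
lemma lintegral_heatC_mul_norm_le {d : ℕ} {ζ : ℂ} (h0 : 0 < ζ.re) (h2 : ζ.re ≤ 2) (z : Space d) :
    ∫⁻ w, ‖heatC ζ z w‖ₑ * ‖z - w‖ₑ ≤ ENNReal.ofReal (Real.sqrt ζ.re * (6 * (‖ζ‖ / ζ.re)) *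
      (72 * Real.pi * (‖ζ‖ / ζ.re) ^ 2) ^ hdim d) := by
  have hζ : 0 < ‖ζ‖ := norm_pos_iff.2 fun h => by simp [h] at h0
  set b := ζ.re / (36 * ‖ζ‖ ^ 2) with hb'
  have hb : 0 < b := by positivity
  have hb2 : 0 < b / 2 := by positivity
  have e0 : ∀ w, ‖heatC ζ z w‖ₑ * ‖z - w‖ₑ = ‖heatC ζ z w * ((‖z - w‖ : ℝ) : ℂ)‖ₑ := by
    intro w
    rw [enorm_mul]
    congr 1
    rw [← ofReal_norm, ← ofReal_norm, Complex.norm_real, norm_norm]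
  simp_rw [e0]
  refine (lintegral_enorm_le_of_le (g := fun w => ζ.re ^ (-hdim d) * (Real.sqrt b)⁻¹ *
    Real.exp (-(b / 2) * sqN (z - w))) ((integral_exp_neg_sqN_sub hb2 z).1.const_mul _)
    fun w => ?_).trans (ENNReal.ofReal_le_ofReal (le_of_eq ?_))
  · rw [norm_mul, Complex.norm_real, norm_norm]
    have h3 : ‖z - w‖ ≤ (Real.sqrt b)⁻¹ * Real.exp (b * sqN (z - w) / 2) := by
      refine (norm_le_sqrt_sqN _).trans ?_
      rw [← div_eq_inv_mul, le_div_iff₀' (Real.sqrt_pos.2 hb), ← Real.sqrt_mul hb.le]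
      exact sqrt_le_exp_half (mul_nonneg hb.le (sqN_nonneg _))
    calc _ ≤ (ζ.re ^ (-hdim d) * Real.exp (-b * sqN (z - w))) *
          ((Real.sqrt b)⁻¹ * Real.exp (b * sqN (z - w) / 2)) := by
          gcongr
          exact norm_heatC_le h0 h2 z w
      _ = _ := by
          rw [mul_mul_mul_comm, ← Real.exp_add]
          congr 2; ring
  · have := Real.pi_pos
    have hsb : (Real.sqrt b)⁻¹ = Real.sqrt ζ.re * (6 * (‖ζ‖ / ζ.re)) := by
      rw [← Real.sqrt_inv, Real.sqrt_eq_iff_mul_self_eq (by positivity) (by positivity),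
        mul_mul_mul_comm, Real.mul_self_sqrt h0.le, hb']
      field_simp
      norm_num
    rw [integral_const_mul, (integral_exp_neg_sqN_sub hb2 z).2, hsb, mul_comm (ζ.re ^ (-hdim d)),
      mul_assoc _ (ζ.re ^ (-hdim d)), Real.rpow_neg h0.le,
      ← Real.inv_rpow h0.le, ← Real.mul_rpow (by positivity) (by positivity)]
    congr 2
    rw [hb']
    field_simp
    norm_num

/-- The exponent of the heat kernel at real time. -/
def heatQ {d : ℕ} (t : ℝ) (z w : Space d) : ℝ :=
  (z.1 - w.1) ^ 2 / (4 * t) + (1 - Real.exp (-2 * t)) / (1 + Real.exp (-2 * t)) / 4 * ‖z.2 + w.2‖ ^ 2 +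
    (1 + Real.exp (-2 * t)) / (1 - Real.exp (-2 * t)) / 4 * ‖z.2 - w.2‖ ^ 2

lemma exists_heatC_ofReal {d : ℕ} {t : ℝ} (h0 : 0 < t) (h1 : t ≤ 1) :
    ∃ c : ℂ, ‖c‖ ≤ t ^ (-hdim d) ∧ ∀ z w : Space d, heatC (t : ℂ) z w = c * (Real.exp (-heatQ t z w) : ℝ) := by
  have key : ∀ z w : Space d, heatC (t : ℂ) z w = (Real.pi * (4 * (t : ℂ))) ^ (-(1 / 2) : ℂ) *
    (Complex.exp (-d * t) * (Real.pi * (1 - Complex.exp (-2 * t) ^ 2)) ^ (-(d / 2 : ℝ) : ℂ)) *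
      (Real.exp (-heatQ t z w) : ℝ) := by
    intro z w
    rw [heatC, mehlerKernel]
    have e : ((Real.exp (-heatQ t z w) : ℝ) : ℂ) = Complex.exp (-((z.1 - w.1) ^ 2 : ℝ) / (4 * t)) *
      Complex.exp (-(cayley (Complex.exp (-2 * t)) * (‖z.2 + w.2‖ ^ 2 : ℝ) +
        (cayley (Complex.exp (-2 * t)))⁻¹ * (‖z.2 - w.2‖ ^ 2 : ℝ)) / 4) := by
      rw [Complex.ofReal_exp, ← Complex.exp_add, cayley, inv_div, heatQ]
      congr 1
      push_cast
      ring
    rw [e]; ring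
  refine ⟨_, ?_, key⟩
  -- The prefactor does not depend on the points and `heatQ` vanishes at the origin, so the general
  -- bound at `z = w = 0` estimates it.
  have h := norm_heatC_le (d := d) (ζ := (t : ℂ)) (by simpa using h0) (by simp; linarith) 0 0
  rw [key 0 0] at h
  simpa [heatQ, sqN] using h

lemma le_heatQ {d : ℕ} {t : ℝ} (h0 : 0 < t) (z w : Space d) : sqN (z - w) / (8 * t) ≤ heatQ t z w := by
  have hr : 0 < Real.exp (-2 * t) := Real.exp_pos _
  have hr1 : Real.exp (-2 * t) < 1 := Real.exp_lt_one_iff.2 (by linarith)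
  have h2 : 1 - Real.exp (-2 * t) ≤ 2 * t := by linarith [Real.add_one_le_exp (-2 * t)]
  have h3 : 1 / (2 * t) ≤ (1 + Real.exp (-2 * t)) / (1 - Real.exp (-2 * t)) := by
    have : 0 < 1 - Real.exp (-2 * t) := by linarith
    gcongr; linarith
  have h4 : 0 ≤ (1 - Real.exp (-2 * t)) / (1 + Real.exp (-2 * t)) / 4 * ‖z.2 + w.2‖ ^ 2 := by
    have : 0 < 1 - Real.exp (-2 * t) := by linarith
    positivity
  have h5 : 1 / (2 * t) * ‖z.2 - w.2‖ ^ 2 ≤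
      (1 + Real.exp (-2 * t)) / (1 - Real.exp (-2 * t)) * ‖z.2 - w.2‖ ^ 2 := by gcongr
  have e : sqN (z - w) / (8 * t) = (z.1 - w.1) ^ 2 / (4 * t) / 2 + 1 / (2 * t) * ‖z.2 - w.2‖ ^ 2 / 4 := by
    have : sqN (z - w) = (z.1 - w.1) ^ 2 + ‖z.2 - w.2‖ ^ 2 := rfl
    rw [this]; field_simp; ring
  have h6 : 0 ≤ (z.1 - w.1) ^ 2 / (4 * t) := by positivity
  rw [e, heatQ]
  linarith

/-- The exponent is a sum of three terms `c u²` with `c ≤ 1/t`, and moving `w` by `δ ≤ √t` changes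
each length `u` by at most `δ`. So the exponent changes by `O((δ/√t)(√Q + 1))`, and the exponential
on the right absorbs `√Q`. The term in `z.2 + w.2` is not translation invariant but has the same
structure. -/
lemma heatQ_sub_le {d : ℕ} {t : ℝ} (h0 : 0 < t) (h1 : t ≤ 1) (z w w' : Space d)
    (hw : ‖w - w'‖ ≤ Real.sqrt t) :
    |heatQ t z w' - heatQ t z w| ≤ 9 * (‖w - w'‖ / Real.sqrt t) * Real.exp (heatQ t z w / 2) := by
  set δ := ‖w - w'‖ with hδ
  set s := Real.sqrt t with hs
  have hs0 : 0 < s := Real.sqrt_pos.2 h0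
  have hss : s ^ 2 = t := Real.sq_sqrt h0.le
  have hr : 0 < Real.exp (-2 * t) := Real.exp_pos _
  have hr1 : Real.exp (-2 * t) < 1 := Real.exp_lt_one_iff.2 (by linarith)
  set α := 1 / (4 * t) with hα
  set A := (1 - Real.exp (-2 * t)) / (1 + Real.exp (-2 * t)) / 4 with hA
  set B := (1 + Real.exp (-2 * t)) / (1 - Real.exp (-2 * t)) / 4 with hB
  have hm : 0 < 1 - Real.exp (-2 * t) := by linarith
  have hα0 : 0 ≤ α := by positivity
  have hA0 : 0 ≤ A := by positivity
  have hB0 : 0 ≤ B := by positivity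
  have hαt : α ≤ (1 / s) ^ 2 := by
    rw [div_pow, hss, hα]
    gcongr <;> linarith
  have hBt : B ≤ (1 / s) ^ 2 := by
    rw [div_pow, hss, hB, one_pow, div_div, div_le_div_iff₀ (by positivity) h0]
    have h3 : Real.exp (-2 * t) ≤ (1 + 2 * t)⁻¹ := by
      rw [neg_mul, Real.exp_neg]
      apply inv_anti₀ (by positivity)
      linarith [Real.add_one_le_exp (2 * t)]
    have h4 : (1 + 2 * t)⁻¹ ≤ 1 - 2 * t / 3 := by
      rw [inv_le_iff_one_le_mul₀ (by positivity)]
      nlinarith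
    nlinarith
  have hAt : A ≤ (1 / s) ^ 2 := by
    refine le_trans ?_ hBt
    rw [hA, hB]
    have : (1 - Real.exp (-2 * t)) / (1 + Real.exp (-2 * t)) ≤
        (1 + Real.exp (-2 * t)) / (1 - Real.exp (-2 * t)) := by
      rw [div_le_div_iff₀ (by positivity) hm]
      nlinarith
    linarith
  have hd1 : |w.1 - w'.1| ≤ δ := by
    have := norm_fst_le (w - w'); simpa using this
  have hd2 : ‖w.2 - w'.2‖ ≤ δ := norm_snd_le (w - w')
  have hQ : heatQ t z w = α * |z.1 - w.1| ^ 2 + A * ‖z.2 + w.2‖ ^ 2 + B * ‖z.2 - w.2‖ ^ 2 := by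
    rw [heatQ, sq_abs]; ring
  have hQ' : heatQ t z w' = α * |z.1 - w'.1| ^ 2 + A * ‖z.2 + w'.2‖ ^ 2 + B * ‖z.2 - w'.2‖ ^ 2 := by
    rw [heatQ, sq_abs]; ring
  have ha : |(|z.1 - w'.1| - |z.1 - w.1|)| ≤ δ := by
    refine (abs_abs_sub_abs_le _ _).trans ?_
    rw [sub_sub_sub_cancel_left]; exact hd1
  have hp : |‖z.2 + w'.2‖ - ‖z.2 + w.2‖| ≤ δ := by
    refine (abs_norm_sub_norm_le _ _).trans ?_
    rw [add_sub_add_left_eq_sub, norm_sub_rev]; exact hd2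
  have hq : |‖z.2 - w'.2‖ - ‖z.2 - w.2‖| ≤ δ := by
    refine (abs_norm_sub_norm_le _ _).trans ?_
    rw [sub_sub_sub_cancel_left]; exact hd2
  set Q := heatQ t z w with hQdef
  have hQ0 : 0 ≤ Q := by rw [hQ]; positivity
  have hδ0 : 0 ≤ δ := norm_nonneg _
  -- The estimate for one quadratic term: `c u² ≤ Q` and `√c ≤ 1/√t` give `c u ≤ √Q / √t`, which
  -- controls the cross term in `c (u'² - u²)`.
  have gen : ∀ c u u' : ℝ, 0 ≤ c → c ≤ (1 / s) ^ 2 → 0 ≤ u → 0 ≤ u' → |u' - u| ≤ δ → c * u ^ 2 ≤ Q →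
      |c * u' ^ 2 - c * u ^ 2| ≤ δ / s * (2 * Real.sqrt Q + 1) := by
    intro c u u' hc hcs hu hu' huu hcQ
    have h3 : |u' + u| ≤ 2 * u + δ := by
      rw [abs_of_nonneg (by positivity)]
      linarith [(abs_le.1 huu).2]
    have h4 : c * u ≤ 1 / s * Real.sqrt Q := by
      have h5 : Real.sqrt c ≤ 1 / s := Real.sqrt_le_iff.2 ⟨by positivity, hcs⟩
      have h6 : Real.sqrt c * u ≤ Real.sqrt Q := by
        apply Real.le_sqrt_of_sq_le
        rw [mul_pow, Real.sq_sqrt hc]; exact hcQ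
      calc c * u = Real.sqrt c * (Real.sqrt c * u) := by rw [← mul_assoc, Real.mul_self_sqrt hc]
        _ ≤ _ := by gcongr
    have h5 : c * δ ≤ 1 / s := by
      calc c * δ ≤ (1 / s) ^ 2 * s := by gcongr
        _ = 1 / s := by field_simp
    calc |c * u' ^ 2 - c * u ^ 2| = c * (|u' - u| * |u' + u|) := by
          rw [← mul_sub, abs_mul, abs_of_nonneg hc, ← abs_mul]; congr 2; ring
      _ ≤ c * (δ * (2 * u + δ)) := by gcongr
      _ = δ * (2 * (c * u) + c * δ) := by ring
      _ ≤ δ * (2 * (1 / s * Real.sqrt Q) + 1 / s) := by gcongr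
      _ = _ := by ring
  have n1 : 0 ≤ α * |z.1 - w.1| ^ 2 := by positivity
  have n2 : 0 ≤ A * ‖z.2 + w.2‖ ^ 2 := by positivity
  have n3 : 0 ≤ B * ‖z.2 - w.2‖ ^ 2 := by positivity
  have g1 := gen α _ _ hα0 hαt (abs_nonneg (z.1 - w.1)) (abs_nonneg (z.1 - w'.1)) ha (by linarith)
  have g2 := gen A _ _ hA0 hAt (norm_nonneg (z.2 + w.2)) (norm_nonneg (z.2 + w'.2)) hp (by linarith)
  have g3 := gen B _ _ hB0 hBt (norm_nonneg (z.2 - w.2)) (norm_nonneg (z.2 - w'.2)) hq (by linarith)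
  have hQQ : heatQ t z w' - Q = (α * |z.1 - w'.1| ^ 2 - α * |z.1 - w.1| ^ 2) +
      (A * ‖z.2 + w'.2‖ ^ 2 - A * ‖z.2 + w.2‖ ^ 2) + (B * ‖z.2 - w'.2‖ ^ 2 - B * ‖z.2 - w.2‖ ^ 2) := by
    rw [hQ', hQ]; ring
  rw [hQQ]
  refine (abs_add_three _ _ _).trans ?_
  have h6 := sqrt_le_exp_half hQ0
  have h7 : 1 ≤ Real.exp (Q / 2) := Real.one_le_exp (by positivity)
  calc _ ≤ 3 * (δ / s * (2 * Real.sqrt Q + 1)) := by linarith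
    _ ≤ 3 * (δ / s * (2 * Real.exp (Q / 2) + Real.exp (Q / 2))) := by gcongr
    _ = _ := by ring

lemma abs_exp_neg_sub_le {a b : ℝ} (h : a ≤ b) : |Real.exp (-a) - Real.exp (-b)| ≤ |b - a| * Real.exp (-a) := by
  have h1 : Real.exp (-b) = Real.exp (-a) * Real.exp (-(b - a)) := by rw [← Real.exp_add]; congr 1; ring
  have h2 := Real.add_one_le_exp (-(b - a))
  have h3 : Real.exp (-b) ≤ Real.exp (-a) := Real.exp_le_exp.2 (by linarith)
  rw [abs_of_nonneg (by linarith), abs_of_nonneg (by linarith), h1]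
  nlinarith [Real.exp_pos (-a)]

/-- The difference of exponentials is measured against the point with the smaller exponent `Q`,
where losing `e^{Q/2}` still leaves `e^{-Q/2}`, a Gaussian of rate `1/(16t)`. Which of `w`, `w'`
this is depends on `z`, so both Gaussians appear. -/
lemma norm_heatC_sub_le {d : ℕ} {t : ℝ} (h0 : 0 < t) (h1 : t ≤ 1) (z w w' : Space d)
    (hw : ‖w - w'‖ ≤ Real.sqrt t) :
    ‖heatC (t : ℂ) z w - heatC (t : ℂ) z w'‖ ≤ t ^ (-hdim d) * (9 * (‖w - w'‖ / Real.sqrt t)) *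
      (Real.exp (-(1 / (16 * t)) * sqN (w - z)) + Real.exp (-(1 / (16 * t)) * sqN (w' - z))) := by
  obtain ⟨c, hc, hE⟩ := exists_heatC_ofReal (d := d) h0 h1
  have aux : ∀ u u' : Space d, ‖u - u'‖ = ‖w - w'‖ → heatQ t z u ≤ heatQ t z u' →
      |Real.exp (-heatQ t z u) - Real.exp (-heatQ t z u')| ≤ 9 * (‖w - w'‖ / Real.sqrt t) *
        Real.exp (-(1 / (16 * t)) * sqN (u - z)) := by
    intro u u' huu hle
    have h2 := heatQ_sub_le h0 h1 z u u' (huu ▸ hw)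
    rw [huu] at h2
    have h3 := le_heatQ h0 z u
    calc _ ≤ |heatQ t z u' - heatQ t z u| * Real.exp (-heatQ t z u) := abs_exp_neg_sub_le hle
      _ ≤ (9 * (‖w - w'‖ / Real.sqrt t) * Real.exp (heatQ t z u / 2)) * Real.exp (-heatQ t z u) := by
        gcongr
      _ = 9 * (‖w - w'‖ / Real.sqrt t) * Real.exp (-(heatQ t z u / 2)) := by
        rw [mul_assoc, ← Real.exp_add]; congr 2; ring
      _ ≤ _ := by
        gcongr
        rw [sqN_sub_comm u z]
        have : 1 / (16 * t) * sqN (z - u) = sqN (z - u) / (8 * t) / 2 := by field_simp; ring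
        linarith
  rw [hE, hE, ← mul_sub, norm_mul, ← Complex.ofReal_sub, Complex.norm_real, Real.norm_eq_abs, mul_assoc]
  have hn : 0 ≤ 9 * (‖w - w'‖ / Real.sqrt t) := by positivity
  gcongr
  rw [mul_add]
  rcases le_total (heatQ t z w) (heatQ t z w') with h | h
  · refine (aux w w' rfl h).trans (le_add_of_nonneg_right (by positivity))
  · rw [abs_sub_comm]
    refine (aux w' w (norm_sub_rev _ _) h).trans (le_add_of_nonneg_left (by positivity))

/-- The constant in the Lipschitz estimate for the heat kernel. -/
def heatLip (d : ℕ) : ℝ := 18 * (16 * Real.pi) ^ hdim d + 2 * (36 * Real.pi) ^ hdim d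

lemma heatLip_nonneg (d : ℕ) : 0 ≤ heatLip d := by
  have := Real.pi_pos
  unfold heatLip; positivity

/-- The pointwise estimate covers `‖w - w'‖ ≤ √t`. For larger separation the ratio on the right is
at least 1 and the triangle inequality with the uniform `L¹` bound is enough. -/
lemma lintegral_heatC_sub_le {d : ℕ} {t : ℝ} (h0 : 0 < t) (h1 : t ≤ 1) (w w' : Space d) :
    ∫⁻ z, ‖heatC (t : ℂ) z w - heatC (t : ℂ) z w'‖ₑ ≤
      ENNReal.ofReal (heatLip d * (‖w - w'‖ / Real.sqrt t)) := by
  have := Real.pi_pos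
  have hs0 : 0 < Real.sqrt t := Real.sqrt_pos.2 h0
  rcases le_total ‖w - w'‖ (Real.sqrt t) with hw | hw
  · have hb : 0 < 1 / (16 * t) := by positivity
    have i1 := integral_exp_neg_sqN_sub hb w
    have i2 := integral_exp_neg_sqN_sub hb w'
    refine (lintegral_enorm_le_of_le ((i1.1.add i2.1).const_mul _)
      fun z => norm_heatC_sub_le h0 h1 z w w' hw).trans (ENNReal.ofReal_le_ofReal ?_)
    simp only [Pi.add_apply]
    rw [integral_const_mul, integral_add i1.1 i2.1, i1.2, i2.2]
    have e : t ^ (-hdim d) * (Real.pi / (1 / (16 * t))) ^ hdim d = (16 * Real.pi) ^ hdim d := by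
      rw [Real.rpow_neg h0.le, ← Real.inv_rpow h0.le, ← Real.mul_rpow (by positivity) (by positivity)]
      congr 1
      field_simp
    have : t ^ (-hdim d) * (9 * (‖w - w'‖ / Real.sqrt t)) *
        ((Real.pi / (1 / (16 * t))) ^ hdim d + (Real.pi / (1 / (16 * t))) ^ hdim d) =
        18 * (t ^ (-hdim d) * (Real.pi / (1 / (16 * t))) ^ hdim d) * (‖w - w'‖ / Real.sqrt t) := by ring
    rw [this, e, heatLip]
    gcongr
    linarith [show 0 ≤ 2 * (36 * Real.pi) ^ hdim d by positivity]
  · have hone : 1 ≤ ‖w - w'‖ / Real.sqrt t := by rwa [le_div_iff₀ hs0, one_mul]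
    have hE : ∀ w : Space d, ∫⁻ z, ‖heatC (t : ℂ) z w‖ₑ ≤ ENNReal.ofReal ((36 * Real.pi) ^ hdim d) := by
      intro w
      simp_rw [heatC_comm _ _ w]
      refine (lintegral_heatC_le (ζ := (t : ℂ)) (by simpa using h0) (by simp; linarith) w).trans ?_
      rw [Complex.norm_real, Complex.ofReal_re, Real.norm_of_nonneg h0.le, div_self h0.ne', one_pow,
        mul_one]
    have hmeas : Measurable fun z => ‖heatC (t : ℂ) z w‖ₑ := by
      have : Continuous fun z => heatC (t : ℂ) z w :=
        continuous_heatC.comp_continuous (f := fun z : Space d => ((t : ℂ), z, w)) (by fun_prop)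
          (fun z => by simpa using h0)
      exact this.measurable.enorm
    calc _ ≤ ∫⁻ z, (‖heatC (t : ℂ) z w‖ₑ + ‖heatC (t : ℂ) z w'‖ₑ) := lintegral_mono fun z => enorm_sub_le
      _ = (∫⁻ z, ‖heatC (t : ℂ) z w‖ₑ) + ∫⁻ z, ‖heatC (t : ℂ) z w'‖ₑ := lintegral_add_left hmeas _
      _ ≤ ENNReal.ofReal ((36 * Real.pi) ^ hdim d) + ENNReal.ofReal ((36 * Real.pi) ^ hdim d) :=
        add_le_add (hE w) (hE w')
      _ = ENNReal.ofReal (2 * (36 * Real.pi) ^ hdim d) := by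
        rw [← ENNReal.ofReal_add (by positivity) (by positivity)]; congr 1; ring
      _ ≤ _ := by
        apply ENNReal.ofReal_le_ofReal
        rw [heatLip]
        have h3 : (0 : ℝ) ≤ 18 * (16 * Real.pi) ^ hdim d := by positivity
        have h4 : (0 : ℝ) ≤ 2 * (36 * Real.pi) ^ hdim d := by positivity
        nlinarith

/-! ### Spectral resolution of test functions -/

/-- The measure `count × dτ` on the joint spectrum. -/
def specMeas : Measure (ℕ × ℝ) := (Measure.count : Measure ℕ).prod (volume : Measure ℝ)

instance : SFinite specMeas := by unfold specMeas; infer_instance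

/-- The spectral value at a point `(k, τ)` of the joint spectrum. -/
def sv (d : ℕ) (θ : ℕ × ℝ) : ℝ := spectralValue d θ.2 θ.1

lemma sv_eq (d : ℕ) (θ : ℕ × ℝ) : sv d θ = θ.2 ^ 2 + 2 * θ.1 + d := rfl

/-- The component of `u` at the point `θ` of the joint spectrum, evaluated at `z`. -/
def kap {d : ℕ} (u : Space d → ℂ) (z : Space d) (θ : ℕ × ℝ) : ℂ :=
  ((Real.sqrt (2 * Real.pi))⁻¹ : ℂ) *
    (Complex.exp (Complex.I * θ.2 * z.1) * hermiteProj θ.1 (fourierRho u θ.2) z.2)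

/-- The series of integrals defining `T_σ` becomes one integral over `ℕ × ℝ`. Fubini and dominated
convergence then apply to the sum and the integral together. -/
lemma multiplierOp_eq_integral {d : ℕ} {σ : ℝ → ℕ → ℂ} {u : Space d → ℂ} {z : Space d}
    (h : Integrable (fun θ : ℕ × ℝ => σ θ.2 θ.1 * kap u z θ) specMeas) :
    multiplierOp σ u z = ∫ θ, σ θ.2 θ.1 * kap u z θ ∂specMeas := by
  rw [specMeas, integral_prod _ h, integral_countable h.integral_prod_left]
  unfold multiplierOp
  refine tsum_congr fun k => ?_
  rw [measureReal_def, Measure.count_singleton, ENNReal.toReal_one, one_smul, ← integral_const_mul]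
  refine integral_congr_ae (.of_forall fun τ => ?_)
  simp only [kap]
  ring

/-- The kernel of the spectral component at `θ`. -/
def ekern {d : ℕ} (θ : ℕ × ℝ) (z w : Space d) : ℂ :=
  ((2 * Real.pi)⁻¹ : ℂ) * (Complex.exp (Complex.I * θ.2 * (z.1 - w.1)) * (hermiteKernel θ.1 z.2 w.2 : ℂ))

lemma norm_ekern_le {d : ℕ} (θ : ℕ × ℝ) (z w : Space d) : ‖ekern θ z w‖ ≤ (θ.1 + 2) ^ d := by
  rw [ekern, norm_mul, norm_mul]
  have h1 : ‖Complex.exp (Complex.I * θ.2 * (z.1 - w.1))‖ = 1 := by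
    rw [show Complex.I * θ.2 * (z.1 - w.1) = ((θ.2 * (z.1 - w.1) : ℝ) : ℂ) * Complex.I by
      push_cast; ring, Complex.norm_exp_ofReal_mul_I]
  have h2 : ‖((2 * Real.pi)⁻¹ : ℂ)‖ = (2 * Real.pi)⁻¹ := by
    rw [show ((2 * Real.pi)⁻¹ : ℂ) = (((2 * Real.pi)⁻¹ : ℝ) : ℂ) by push_cast; rfl,
      Complex.norm_real, Real.norm_of_nonneg (by have := Real.pi_pos; positivity)]
  rw [h1, h2, one_mul, inv_mul_le_iff₀ (by have := Real.pi_pos; positivity)]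
  refine (norm_hermiteKernel_le _ _ _).trans ?_
  have : (0 : ℝ) ≤ (θ.1 + 2) ^ d := by positivity
  nlinarith [Real.pi_gt_three]

lemma continuous_ekern {d : ℕ} :
    Continuous fun q : (ℕ × ℝ) × Space d × Space d => ekern q.1 q.2.1 q.2.2 := by
  have h : Continuous fun q : ℕ × ℝ × Space d × Space d => ekern (q.1, q.2.1) q.2.2.1 q.2.2.2 := by
    rw [continuous_prod_of_discrete_left]
    intro k
    unfold ekern
    have h1 : Continuous fun q : ℝ × Space d × Space d => hermiteKernel k q.2.1.2 q.2.2.2 :=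
      (continuous_hermiteKernel k).comp
        (f := fun q : ℝ × Space d × Space d => (q.2.1.2, q.2.2.2)) (by fun_prop)
    have h2 := Complex.continuous_ofReal.comp h1
    refine continuous_const.mul (Continuous.mul (by fun_prop) h2)
  exact h.comp (f := fun q : (ℕ × ℝ) × Space d × Space d => (q.1.1, q.1.2, q.2.1, q.2.2)) (by fun_prop)

lemma kap_eq_integral {d : ℕ} {u : Space d → ℂ} (hu : Integrable u) (z : Space d) (θ : ℕ × ℝ) :
    kap u z θ = ∫ w, ekern θ z w * u w := by
  have hc : Continuous fun w : Space d => ekern θ z w :=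
    continuous_ekern.comp (f := fun w => (θ, z, w)) (by fun_prop)
  have hi : Integrable (fun w : Space d => ekern θ z w * u w)
      ((volume : Measure ℝ).prod (volume : Measure (EuclideanSpace ℝ (Fin d)))) :=
    hu.bdd_mul (c := (θ.1 + 2) ^ d) hc.aestronglyMeasurable (.of_forall fun w => norm_ekern_le θ z w)
  have h2 : ∫ w, ekern θ z w * u w = ∫ x, ∫ ρ : ℝ, ekern θ z (ρ, x) * u (ρ, x) :=
    integral_prod_symm _ hi
  rw [h2, kap, hermiteProj, ← integral_const_mul, ← integral_const_mul]
  refine integral_congr_ae (.of_forall fun x => ?_)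
  simp only [fourierRho, ekern]
  rw [← integral_const_mul, ← integral_const_mul, ← integral_const_mul, ← integral_const_mul]
  refine integral_congr_ae (.of_forall fun ρ => ?_)
  have hs : ((Real.sqrt (2 * Real.pi))⁻¹ : ℂ) * ((Real.sqrt (2 * Real.pi))⁻¹ : ℂ) = ((2 * Real.pi)⁻¹ : ℂ) := by
    rw [← mul_inv, ← Complex.ofReal_mul, Real.mul_self_sqrt (by have := Real.pi_pos; positivity)]
    push_cast; rfl
  have he : Complex.exp (Complex.I * θ.2 * (z.1 - ρ)) = Complex.exp (Complex.I * θ.2 * z.1) *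
      Complex.exp (-(Complex.I * θ.2 * ρ)) := by
    rw [← Complex.exp_add]; congr 1; ring
  simp only []
  rw [he, ← hs]
  ring

lemma summable_pow_mul_exp (d : ℕ) {a : ℝ} (ha : 0 < a) :
    Summable fun k : ℕ => Real.exp (-a * (2 * k + d)) * ((k : ℝ) + 2) ^ d := by
  have h1 : ‖Real.exp (-(2 * a))‖ < 1 := by
    rw [Real.norm_of_nonneg (Real.exp_pos _).le, Real.exp_lt_one_iff]; linarith
  have h0 : Summable fun n : ℕ => (n : ℝ) ^ d * Real.exp (-(2 * a)) ^ n :=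
    summable_pow_mul_geometric_of_norm_lt_one d h1
  have h : Summable fun n : ℕ => ((n + 2 : ℕ) : ℝ) ^ d * Real.exp (-(2 * a)) ^ (n + 2) :=
    (summable_nat_add_iff (f := fun n : ℕ => (n : ℝ) ^ d * Real.exp (-(2 * a)) ^ n) 2).2 h0
  refine (h.mul_left (Real.exp (4 * a) * Real.exp (-a * d))).congr fun k => ?_
  have e : Real.exp (-a * (2 * k + d)) =
      Real.exp (4 * a) * Real.exp (-a * d) * Real.exp (-(2 * a)) ^ (k + 2) := by
    rw [← Real.exp_nat_mul, ← Real.exp_add, ← Real.exp_add]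
    congr 1; push_cast; ring
  rw [e]
  push_cast
  ring

lemma integrable_specMeas_exp (d : ℕ) {a : ℝ} (ha : 0 < a) :
    Integrable (fun θ : ℕ × ℝ => Real.exp (-a * sv d θ) * ((θ.1 : ℝ) + 2) ^ d) specMeas := by
  have h1 : Integrable (fun k : ℕ => Real.exp (-a * (2 * k + d)) * ((k : ℝ) + 2) ^ d) Measure.count := by
    rw [integrable_count_iff]
    exact (summable_pow_mul_exp d ha).norm
  refine (h1.mul_prod (integrable_exp_neg_mul_sq ha)).congr (.of_forall fun θ => ?_)
  simp only []
  rw [sv_eq, show -a * (θ.2 ^ 2 + 2 * θ.1 + d) = -a * (2 * θ.1 + d) + -a * θ.2 ^ 2 by ring, Real.exp_add]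
  ring

/-- The `τ`-integral is the Fourier transform of a Gaussian and the `k`-sum is Mehler's series at `r
= e^{-2ζ}`. This identifies the explicit kernel `heatC` with `e^{-ζ H_par}`. -/
lemma integral_exp_mul_ekern {d : ℕ} {ζ : ℂ} (hζ : 0 < ζ.re) (z w : Space d) :
    ∫ θ, Complex.exp (-ζ * sv d θ) * ekern θ z w ∂specMeas = heatC ζ z w := by
  have hne : ζ ≠ 0 := fun h => by simp [h] at hζ
  have hnorm : ∀ θ : ℕ × ℝ, ‖Complex.exp (-ζ * sv d θ)‖ = Real.exp (-ζ.re * sv d θ) := by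
    intro θ; rw [Complex.norm_exp, Complex.re_mul_ofReal, Complex.neg_re]
  have hsv : Continuous (sv d) := by unfold sv spectralValue; fun_prop
  have hi : Integrable (fun θ => Complex.exp (-ζ * sv d θ) * ekern θ z w) specMeas := by
    refine (integrable_specMeas_exp d hζ).mono' ?_ (.of_forall fun θ => ?_)
    · refine Continuous.aestronglyMeasurable (Continuous.mul ?_ ?_)
      · exact Complex.continuous_exp.comp (continuous_const.mul (Complex.continuous_ofReal.comp hsv))
      · exact continuous_ekern.comp (f := fun θ => (θ, z, w)) (by fun_prop)
    · rw [norm_mul, hnorm]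
      gcongr
      exact norm_ekern_le θ z w
  -- Matching the normalizations `(2π)^{-1}(π/ζ)^{1/2}` and `(4πζ)^{-1/2}` goes through logarithms,
  -- since the principal square root only splits off positive real factors freely.
  have hg : ((2 * Real.pi)⁻¹ : ℂ) * (Real.pi / ζ) ^ (1 / 2 : ℂ) = (Real.pi * (4 * ζ)) ^ (-(1 / 2) : ℂ) := by
    have hp := Real.pi_pos
    have h4 : 0 < (4 * ζ).re := by simpa using hζ
    have e1 : (Real.pi / ζ : ℂ) = ((4 * Real.pi ^ 2 : ℝ) : ℂ) * (Real.pi * (4 * ζ))⁻¹ := by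
      have : (Real.pi : ℂ) ≠ 0 := by simp [hp.ne']
      push_cast; field_simp
    have hre : 0 < (Real.pi * (4 * ζ)).re := by rw [Complex.re_ofReal_mul]; positivity
    have hne' : (Real.pi * (4 * ζ)) ≠ 0 := fun h => by simp [h] at hre
    have harg : (Real.pi * (4 * ζ)).arg ≠ Real.pi := fun h => by
      rw [Complex.arg_eq_pi_iff] at h; linarith [h.1]
    rw [e1, Complex.cpow_def_of_ne_zero (mul_ne_zero (by exact_mod_cast (by positivity)) (inv_ne_zero hne')),
      Complex.log_ofReal_mul (by positivity) (inv_ne_zero hne'), Complex.log_inv _ harg,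
      Complex.cpow_def_of_ne_zero hne', add_mul, Complex.exp_add, ← mul_assoc]
    have e2 : Complex.exp (((Real.log (4 * Real.pi ^ 2) : ℝ) : ℂ) * (1 / 2)) = 2 * Real.pi := by
      have : Real.log (4 * Real.pi ^ 2) = 2 * Real.log (2 * Real.pi) := by
        rw [show (4 * Real.pi ^ 2) = (2 * Real.pi) ^ 2 by ring, Real.log_pow]; norm_num
      rw [this, show (((2 * Real.log (2 * Real.pi) : ℝ) : ℂ) * (1 / 2)) = ((Real.log (2 * Real.pi) : ℝ) : ℂ) by
        push_cast; ring, ← Complex.ofReal_exp, Real.exp_log (by positivity)]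
      push_cast; rfl
    rw [e2, inv_mul_cancel₀ (by simp [hp.ne']), one_mul]
    congr 1; ring
  have hinner : ∀ k : ℕ, ∫ τ : ℝ, Complex.exp (-ζ * sv d (k, τ)) * ekern (k, τ) z w =
      ((Real.pi * (4 * ζ)) ^ (-(1 / 2) : ℂ) * Complex.exp (-((z.1 - w.1) ^ 2 : ℝ) / (4 * ζ))) *
        (Complex.exp (-d * ζ) * (Complex.exp (-2 * ζ) ^ k * hermiteKernel k z.2 w.2)) := by
    intro k
    have h := fourierIntegral_gaussian hζ ((z.1 - w.1 : ℝ) : ℂ)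
    rw [← hg]
    have e1 : -(((z.1 - w.1 : ℝ) : ℂ)) ^ 2 / (4 * ζ) = (-((z.1 - w.1) ^ 2 : ℝ) / (4 * ζ) : ℂ) := by
      push_cast; rfl
    rw [e1] at h
    rw [mul_assoc ((2 * Real.pi)⁻¹ : ℂ), ← h, ← integral_const_mul, ← integral_mul_const]
    refine integral_congr_ae (.of_forall fun τ => ?_)
    simp only [ekern, sv_eq]
    have e2 : Complex.exp (-ζ * ((τ ^ 2 + 2 * k + d : ℝ) : ℂ)) = Complex.exp (-ζ * τ ^ 2) *
        (Complex.exp (-d * ζ) * Complex.exp (-2 * ζ) ^ k) := by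
      rw [← Complex.exp_nat_mul, ← Complex.exp_add, ← Complex.exp_add]
      congr 1; push_cast; ring
    have e3 : Complex.exp (Complex.I * τ * (z.1 - w.1)) =
        Complex.exp (Complex.I * ((z.1 - w.1 : ℝ) : ℂ) * τ) := by
      congr 1; push_cast; ring
    rw [e2, e3]
    ring
  rw [specMeas, integral_prod _ hi, integral_countable hi.integral_prod_left]
  simp_rw [measureReal_def, Measure.count_singleton, ENNReal.toReal_one, one_smul, hinner]
  rw [tsum_mul_left, tsum_mul_left, (hasSum_mehlerKernel (norm_exp_neg_two_mul_lt hζ) _ _).2.tsum_eq, heatC]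

lemma norm_kap_le {d : ℕ} {u : Space d → ℂ} (hu : Integrable u) (z : Space d) (θ : ℕ × ℝ) :
    ‖kap u z θ‖ ≤ (θ.1 + 2) ^ d * ∫ w, ‖u w‖ := by
  rw [kap_eq_integral hu, ← integral_const_mul]
  refine norm_integral_le_of_norm_le (hu.norm.const_mul _) (.of_forall fun w => ?_)
  rw [norm_mul]
  gcongr
  exact norm_ekern_le θ z w

lemma stronglyMeasurable_kap {d : ℕ} {u : Space d → ℂ} (hu : Continuous u) (hu' : Integrable u)
    (z : Space d) : StronglyMeasurable (kap u z) := by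
  have e : kap u z = fun θ => ∫ w, ekern θ z w * u w := funext fun θ => kap_eq_integral hu' z θ
  rw [e]
  refine StronglyMeasurable.integral_prod_right (f := fun θ w => ekern θ z w * u w) ?_
  have h1 := continuous_ekern.comp (f := fun q : (ℕ × ℝ) × Space d => (q.1, z, q.2)) (by fun_prop)
  exact (h1.mul (hu.comp continuous_snd)).stronglyMeasurable

lemma integrable_exp_mul_kap {d : ℕ} {u : Space d → ℂ} (hc : Continuous u) (hu : Integrable u)
    {a : ℝ} (ha : 0 < a) (z : Space d) :
    Integrable (fun θ => Real.exp (-a * sv d θ) * ‖kap u z θ‖) specMeas := by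
  have hsv : Continuous (sv d) := by unfold sv spectralValue; fun_prop
  refine ((integrable_specMeas_exp d ha).mul_const (∫ w, ‖u w‖)).mono' ?_ (.of_forall fun θ => ?_)
  · exact (Continuous.aestronglyMeasurable (by fun_prop)).mul
      (stronglyMeasurable_kap hc hu z).norm.aestronglyMeasurable
  · rw [norm_mul, norm_norm, Real.norm_of_nonneg (Real.exp_pos _).le, mul_assoc]
    gcongr
    exact norm_kap_le hu z θ

/-- The heat semigroup acts on the spectral components by `e^{-ζ s}`. -/
lemma integral_heatC_mul_eq {d : ℕ} {u : Space d → ℂ} (hc : Continuous u) (hu : Integrable u)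
    {ζ : ℂ} (hζ : 0 < ζ.re) (z : Space d) :
    ∫ w, heatC ζ z w * u w = ∫ θ, Complex.exp (-ζ * sv d θ) * kap u z θ ∂specMeas := by
  have hsv : Continuous (sv d) := by unfold sv spectralValue; fun_prop
  simp_rw [← integral_exp_mul_ekern hζ, kap_eq_integral hu, ← integral_mul_const, ← integral_const_mul,
    ← mul_assoc]
  refine integral_integral_swap ?_
  have h2 : Integrable (fun q : Space d × (ℕ × ℝ) => ‖u q.1‖ *
      (Real.exp (-ζ.re * sv d q.2) * ((q.2.1 : ℝ) + 2) ^ d)) (volume.prod specMeas) :=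
    hu.norm.mul_prod (integrable_specMeas_exp d hζ)
  refine h2.mono' ?_ (.of_forall fun q => ?_)
  · refine Continuous.aestronglyMeasurable (Continuous.mul (Continuous.mul ?_ ?_) (hc.comp continuous_fst))
    · exact Complex.continuous_exp.comp (continuous_const.mul
        (Complex.continuous_ofReal.comp (hsv.comp continuous_snd)))
    · exact continuous_ekern.comp (f := fun q : Space d × (ℕ × ℝ) => (q.2, z, q.1)) (by fun_prop)
  · simp only [Function.uncurry]
    rw [norm_mul, norm_mul, Complex.norm_exp, Complex.re_mul_ofReal, Complex.neg_re, mul_comm (‖u q.1‖)]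
    gcongr
    exact norm_ekern_le _ z _

/-! ### Eigenfunction equation and integration by parts -/

lemma iteratedDeriv_gaussian_add_two (k : ℕ) (x : ℝ) :
    iteratedDeriv (k + 2) (fun y : ℝ => Real.exp (-y ^ 2)) x =
      -(2 * x * iteratedDeriv (k + 1) (fun y : ℝ => Real.exp (-y ^ 2)) x) -
        2 * (k + 1) * iteratedDeriv k (fun y : ℝ => Real.exp (-y ^ 2)) x := by
  have hd : ∀ (n : ℕ) (x : ℝ), HasDerivAt (iteratedDeriv n (fun y : ℝ => Real.exp (-y ^ 2)))
      (iteratedDeriv (n + 1) (fun y : ℝ => Real.exp (-y ^ 2)) x) x := by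
    intro n x
    rw [iteratedDeriv_succ]
    exact ((contDiff_gaussian.differentiable_iteratedDeriv n
      (by exact_mod_cast ENat.natCast_lt_top n)) x).hasDerivAt
  have h1 : ∀ x : ℝ, iteratedDeriv 1 (fun y : ℝ => Real.exp (-y ^ 2)) x =
      -(2 * x * iteratedDeriv 0 (fun y : ℝ => Real.exp (-y ^ 2)) x) := by
    intro x
    rw [iteratedDeriv_one, iteratedDeriv_zero]
    have := ((hasDerivAt_pow 2 x).neg.exp).deriv
    refine this.trans ?_
    simp only [Nat.cast_ofNat, Nat.add_one_sub_one, pow_one, Pi.neg_apply]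
    ring
  induction k generalizing x with
  | zero =>
    have h2 := hd 1 x
    rw [show iteratedDeriv 1 (fun y : ℝ => Real.exp (-y ^ 2)) =
      fun x => -(2 * x * iteratedDeriv 0 (fun y : ℝ => Real.exp (-y ^ 2)) x) from funext h1] at h2
    have h3 := ((((hasDerivAt_id x).const_mul 2).mul (hd 0 x)).neg)
    have := h2.unique h3
    rw [this]
    simp
    ring
  | succ k ih =>
    have h2 := hd (k + 2) x
    rw [show iteratedDeriv (k + 2) (fun y : ℝ => Real.exp (-y ^ 2)) =
      fun x => -(2 * x * iteratedDeriv (k + 1) (fun y : ℝ => Real.exp (-y ^ 2)) x) -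
        2 * (k + 1) * iteratedDeriv k (fun y : ℝ => Real.exp (-y ^ 2)) x from funext ih] at h2
    have h3 := ((((hasDerivAt_id x).const_mul 2).mul (hd (k + 1) x)).neg).sub
      ((hd k x).const_mul (2 * ((k : ℝ) + 1)))
    have := h2.unique h3
    rw [this]
    simp only [id]
    push_cast
    ring

/-- The Hermite functions are eigenfunctions of the harmonic oscillator. -/
lemma deriv_deriv_hermiteFun (k : ℕ) (x : ℝ) :
    deriv (deriv (hermiteFun k)) x = (x ^ 2 - (2 * k + 1)) * hermiteFun k x := by
  have hd : ∀ (n : ℕ) (x : ℝ), HasDerivAt (iteratedDeriv n (fun y : ℝ => Real.exp (-y ^ 2)))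
      (iteratedDeriv (n + 1) (fun y : ℝ => Real.exp (-y ^ 2)) x) x := by
    intro n x
    rw [iteratedDeriv_succ]
    exact ((contDiff_gaussian.differentiable_iteratedDeriv n
      (by exact_mod_cast ENat.natCast_lt_top n)) x).hasDerivAt
  set c : ℝ := (Real.sqrt (2 ^ k * (k.factorial : ℝ) * Real.sqrt Real.pi))⁻¹ * (-1) ^ k with hc
  have he : ∀ x : ℝ, HasDerivAt (fun x : ℝ => Real.exp (x ^ 2 / 2)) (x * Real.exp (x ^ 2 / 2)) x := by
    intro x
    have := ((hasDerivAt_pow 2 x).div_const 2).exp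
    convert this using 1
    push_cast; ring
  have h1 : ∀ x, HasDerivAt (hermiteFun k) (c * (iteratedDeriv (k + 1) (fun y : ℝ => Real.exp (-y ^ 2)) x +
      x * iteratedDeriv k (fun y : ℝ => Real.exp (-y ^ 2)) x) * Real.exp (x ^ 2 / 2)) x := by
    intro x
    have := ((hd k x).const_mul c).mul (he x)
    refine (this.congr_deriv ?_)
    ring
  have h2 : HasDerivAt (fun x => c * (iteratedDeriv (k + 1) (fun y : ℝ => Real.exp (-y ^ 2)) x +
      x * iteratedDeriv k (fun y : ℝ => Real.exp (-y ^ 2)) x) * Real.exp (x ^ 2 / 2))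
      ((x ^ 2 - (2 * k + 1)) * hermiteFun k x) x := by
    have := (((hd (k + 1) x).add ((hasDerivAt_id x).mul (hd k x))).const_mul c).mul (he x)
    refine (this.congr_deriv ?_)
    have e : k + 1 + 1 = k + 2 := rfl
    simp only [Pi.add_apply, Pi.mul_apply, id]
    rw [e, iteratedDeriv_gaussian_add_two, hermiteFun]
    ring
  rw [show deriv (hermiteFun k) = fun x => c * (iteratedDeriv (k + 1) (fun y : ℝ => Real.exp (-y ^ 2)) x +
      x * iteratedDeriv k (fun y : ℝ => Real.exp (-y ^ 2)) x) * Real.exp (x ^ 2 / 2) from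
    funext fun x => (h1 x).deriv]
  exact h2.deriv

/-- The coordinates on `ℝ × ℝ^d`. -/
def coordL {d : ℕ} : Option (Fin d) → Space d →L[ℝ] ℝ
  | none => ContinuousLinearMap.fst ℝ ℝ (EuclideanSpace ℝ (Fin d))
  | some i => (EuclideanSpace.proj i).comp (ContinuousLinearMap.snd ℝ ℝ (EuclideanSpace ℝ (Fin d)))

/-- The coordinate vectors of `ℝ × ℝ^d`. -/
def coordV {d : ℕ} : Option (Fin d) → Space d
  | none => (1, 0)
  | some i => (0, EuclideanSpace.single i 1)

lemma coordL_coordV {d : ℕ} (o o' : Option (Fin d)) : coordL o (coordV o') = if o = o' then 1 else 0 := by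
  rcases o with _ | i <;> rcases o' with _ | j <;> simp [coordL, coordV, PiLp.single_apply]

/-- A product of functions of the coordinates. -/
def prodFun {d : ℕ} (F : Option (Fin d) → ℝ → ℂ) (w : Space d) : ℂ := ∏ o, F o (coordL o w)

/-- The second derivative in direction `v`. -/
def d2 {d : ℕ} (v : Space d) (u : Space d → ℂ) (w : Space d) : ℂ :=
  fderiv ℝ (fun w => fderiv ℝ u w v) w v

lemma contDiff_prodFun {d : ℕ} {F : Option (Fin d) → ℝ → ℂ} (hF : ∀ o, ContDiff ℝ ∞ (F o)) :
    ContDiff ℝ ∞ (prodFun F) := by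
  unfold prodFun
  exact contDiff_prod fun o _ => (hF o).comp (coordL o).contDiff

lemma fderiv_prodFun {d : ℕ} {F : Option (Fin d) → ℝ → ℂ} (hF : ∀ o, Differentiable ℝ (F o))
    (o : Option (Fin d)) (w : Space d) :
    fderiv ℝ (prodFun F) w (coordV o) = prodFun (Function.update F o (deriv (F o))) w := by
  have h1 : ∀ o, HasFDerivAt (fun w => F o (coordL o w))
      ((ContinuousLinearMap.toSpanSingleton ℝ (deriv (F o) (coordL o w))).comp (coordL o : Space d →L[ℝ] ℝ)) w := by
    intro o
    exact ((hF o (coordL o w)).hasDerivAt.hasFDerivAt).comp w (coordL o).hasFDerivAt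
  have h2 := HasFDerivAt.finsetProd (u := Finset.univ) fun o _ => h1 o
  have h3 : fderiv ℝ (prodFun F) w = _ := h2.fderiv
  rw [h3, sum_apply, Finset.sum_eq_single o]
  · rw [prodFun, ← Finset.mul_prod_erase Finset.univ _ (Finset.mem_univ o)]
    simp only [smul_apply, ContinuousLinearMap.comp_apply, coordL_coordV,
      Function.update_self]
    simp only [if_true, ContinuousLinearMap.toSpanSingleton_apply, one_smul, smul_eq_mul]
    rw [mul_comm]
    congr 1
    refine Finset.prod_congr rfl fun j hj => ?_
    rw [Function.update_of_ne (Finset.ne_of_mem_erase hj)]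
  · intro j _ hj
    simp [coordL_coordV, hj]
  · simp

/-- The eigenvalue equation is asked only at the point considered, so `c` may vary with `w`. For a
Hermite factor `c = x² - (2k+1)`, and the potential `|x|²` later cancels the variable part. -/
lemma d2_prodFun {d : ℕ} {F : Option (Fin d) → ℝ → ℂ} (hF : ∀ o, ContDiff ℝ ∞ (F o))
    (o : Option (Fin d)) (w : Space d) {c : ℂ}
    (hc : deriv (deriv (F o)) (coordL o w) = c * F o (coordL o w)) :
    d2 (coordV o) (prodFun F) w = c * prodFun F w := by
  have hd : ∀ o, Differentiable ℝ (F o) := fun o => (hF o).differentiable (by simp)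
  have h1 : (fun w => fderiv ℝ (prodFun F) w (coordV o)) = prodFun (Function.update F o (deriv (F o))) :=
    funext fun w => fderiv_prodFun hd o w
  have hd' : ∀ o', Differentiable ℝ (Function.update F o (deriv (F o)) o') := by
    intro o'
    by_cases h : o' = o
    · subst h
      rw [Function.update_self]
      exact (ContDiff.iterate_deriv 1 (hF o')).differentiable (by simp)
    · rw [Function.update_of_ne h]; exact hd o'
  rw [d2, h1, fderiv_prodFun hd', Function.update_idem, Function.update_self, prodFun, prodFun,
    ← Finset.mul_prod_erase Finset.univ _ (Finset.mem_univ o),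
    ← Finset.mul_prod_erase Finset.univ (fun o => F o (coordL o w)) (Finset.mem_univ o),
    Function.update_self, hc, mul_assoc]
  congr 2
  refine Finset.prod_congr rfl fun j hj => ?_
  rw [Function.update_of_ne (Finset.ne_of_mem_erase hj)]

/-- The partial harmonic oscillator on smooth functions. -/
def Hpar {d : ℕ} (u : Space d → ℂ) (w : Space d) : ℂ :=
  -(∑ o, d2 (coordV o) u w) + (‖w.2‖ ^ 2 : ℝ) * u w

lemma contDiff_fderiv_apply {d : ℕ} {u : Space d → ℂ} (hu : ContDiff ℝ ∞ u) (v : Space d) :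
    ContDiff ℝ ∞ fun w => fderiv ℝ u w v :=
  (hu.fderiv_right (m := ∞) (by simp)).clm_apply contDiff_const

lemma contDiff_d2 {d : ℕ} {u : Space d → ℂ} (hu : ContDiff ℝ ∞ u) (v : Space d) :
    ContDiff ℝ ∞ (d2 v u) := contDiff_fderiv_apply (contDiff_fderiv_apply hu v) v

lemma hasCompactSupport_fderiv_apply {d : ℕ} {u : Space d → ℂ} (hu : HasCompactSupport u) (v : Space d) :
    HasCompactSupport fun w => fderiv ℝ u w v :=
  (hu.fderiv (𝕜 := ℝ)).comp_left (g := fun L : Space d →L[ℝ] ℂ => L v) rfl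

lemma contDiff_Hpar {d : ℕ} {u : Space d → ℂ} (hu : ContDiff ℝ ∞ u) : ContDiff ℝ ∞ (Hpar u) := by
  unfold Hpar
  have h1 : ContDiff ℝ ∞ fun w : Space d => ∑ o, d2 (coordV o) u w :=
    ContDiff.sum fun o _ => contDiff_d2 hu _
  have h2 : ContDiff ℝ ∞ fun w : Space d => ((‖w.2‖ ^ 2 : ℝ) : ℂ) :=
    Complex.ofRealCLM.contDiff.comp (contDiff_snd.norm_sq ℝ)
  exact h1.neg.add (h2.mul hu)

lemma hasCompactSupport_Hpar {d : ℕ} {u : Space d → ℂ} (hu : HasCompactSupport u) :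
    HasCompactSupport (Hpar u) := by
  have h1 : HasCompactSupport fun w : Space d => ∑ o, d2 (coordV o) u w := by
    refine HasCompactSupport.intro hu.isCompact fun w hw => ?_
    refine Finset.sum_eq_zero fun o _ => ?_
    have h3 : ∀ f : Space d → ℂ, tsupport (fun w => fderiv ℝ f w (coordV o)) ⊆ tsupport f := fun f =>
      closure_minimal (fun x hx => support_fderiv_subset ℝ (f := f) (by
        intro h; exact hx (by simp [h]))) (isClosed_tsupport f)
    have h4 : w ∉ tsupport (d2 (coordV o) u) := fun h => hw (h3 u (h3 _ h))
    exact image_eq_zero_of_notMem_tsupport h4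
  have h2 : HasCompactSupport fun w : Space d => ((‖w.2‖ ^ 2 : ℝ) : ℂ) * u w := hu.mul_left
  exact h1.neg.add h2

lemma integrable_mul_of_hasCompactSupport {d : ℕ} {e u : Space d → ℂ} (he : Continuous e)
    (hu : Continuous u) (hc : HasCompactSupport u) : Integrable fun w => e w * u w :=
  (he.mul hu).integrable_of_hasCompactSupport hc.mul_left

lemma integral_mul_d2 {d : ℕ} {e u : Space d → ℂ} (he : ContDiff ℝ ∞ e) (hu : ContDiff ℝ ∞ u)
    (hc : HasCompactSupport u) (v : Space d) :
    ∫ w, e w * d2 v u w = ∫ w, d2 v e w * u w := by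
  have hu1 := contDiff_fderiv_apply hu v
  have hc1 := hasCompactSupport_fderiv_apply hc v
  have he1 := contDiff_fderiv_apply he v
  have dif : ∀ {f : Space d → ℂ}, ContDiff ℝ ∞ f → ∀ x, DifferentiableAt ℝ f x := fun hf x =>
    (hf.differentiable (by simp)) x
  unfold d2
  rw [integral_mul_fderiv_eq_neg_fderiv_mul_of_integrable
    (integrable_mul_of_hasCompactSupport he1.continuous hu1.continuous hc1)
    (integrable_mul_of_hasCompactSupport he.continuous (contDiff_d2 hu v).continuous
      (hasCompactSupport_fderiv_apply hc1 v))
    (integrable_mul_of_hasCompactSupport he.continuous hu1.continuous hc1)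
    (fun x _ => dif he x) (fun x _ => dif hu1 x),
    integral_mul_fderiv_eq_neg_fderiv_mul_of_integrable
    (integrable_mul_of_hasCompactSupport (contDiff_d2 he v).continuous hu.continuous hc)
    (integrable_mul_of_hasCompactSupport he1.continuous hu1.continuous hc1)
    (integrable_mul_of_hasCompactSupport he1.continuous hu.continuous hc)
    (fun x _ => dif he1 x) (fun x _ => dif hu x), neg_neg]

lemma integral_mul_Hpar {d : ℕ} {e u : Space d → ℂ} (he : ContDiff ℝ ∞ e) (hu : ContDiff ℝ ∞ u)
    (hc : HasCompactSupport u) : ∫ w, e w * Hpar u w = ∫ w, Hpar e w * u w := by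
  have hq : Continuous fun w : Space d => ((‖w.2‖ ^ 2 : ℝ) : ℂ) :=
    Complex.continuous_ofReal.comp (by fun_prop)
  have i1 : ∀ o, Integrable fun w => e w * d2 (coordV o) u w := fun o =>
    integrable_mul_of_hasCompactSupport he.continuous (contDiff_d2 hu _).continuous
      (hasCompactSupport_fderiv_apply (hasCompactSupport_fderiv_apply hc _) _)
  have i2 : ∀ o, Integrable fun w => d2 (coordV o) e w * u w := fun o =>
    integrable_mul_of_hasCompactSupport (contDiff_d2 he _).continuous hu.continuous hc
  have i3 : Integrable fun w : Space d => e w * ((‖w.2‖ ^ 2 : ℝ) : ℂ) * u w :=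
    integrable_mul_of_hasCompactSupport (he.continuous.mul hq) hu.continuous hc
  have e1 : ∀ w, e w * Hpar u w = -(∑ o, e w * d2 (coordV o) u w) + e w * ((‖w.2‖ ^ 2 : ℝ) : ℂ) * u w := by
    intro w; rw [Hpar, ← Finset.mul_sum]; ring
  have e2 : ∀ w, Hpar e w * u w = -(∑ o, d2 (coordV o) e w * u w) + e w * ((‖w.2‖ ^ 2 : ℝ) : ℂ) * u w := by
    intro w; rw [Hpar, ← Finset.sum_mul]; ring
  have i1' : Integrable fun w => -(∑ o, e w * d2 (coordV o) u w) :=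
    (integrable_finsetSum _ fun o _ => i1 o).neg
  have i2' : Integrable fun w => -(∑ o, d2 (coordV o) e w * u w) :=
    (integrable_finsetSum _ fun o _ => i2 o).neg
  simp_rw [e1, e2]
  rw [integral_add i1' i3, integral_add i2' i3, integral_neg, integral_neg,
    integral_finsetSum _ fun o _ => i1 o, integral_finsetSum _ fun o _ => i2 o]
  simp_rw [integral_mul_d2 he hu hc]

/-- The joint eigenfunctions as products. -/
def eigenFactor {d : ℕ} (τ : ℝ) (μ : Fin d → ℕ) : Option (Fin d) → ℝ → ℂ
  | none => fun ρ => Complex.exp (-(Complex.I * τ * ρ))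
  | some i => fun x => (hermiteFun (μ i) x : ℂ)

lemma contDiff_eigenFactor {d : ℕ} (τ : ℝ) (μ : Fin d → ℕ) (o : Option (Fin d)) :
    ContDiff ℝ ∞ (eigenFactor τ μ o) := by
  rcases o with _ | i
  · have : ContDiff ℝ ∞ fun ρ : ℝ => (ρ : ℂ) := Complex.ofRealCLM.contDiff
    exact Complex.contDiff_exp.comp ((contDiff_const.mul this).neg)
  · exact Complex.ofRealCLM.contDiff.comp (contDiff_hermiteFun _)

lemma Hpar_prodFun_eigenFactor {d : ℕ} (τ : ℝ) (μ : Fin d → ℕ) (w : Space d) :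
    Hpar (prodFun (eigenFactor τ μ)) w =
      ((τ ^ 2 + 2 * (∑ i, μ i : ℕ) + d : ℝ) : ℂ) * prodFun (eigenFactor τ μ) w := by
  have h0 : d2 (coordV none) (prodFun (eigenFactor τ μ)) w = (-(τ : ℂ) ^ 2) * prodFun (eigenFactor τ μ) w := by
    refine d2_prodFun (contDiff_eigenFactor τ μ) none w ?_
    have h : ∀ (c : ℂ) (x : ℝ), HasDerivAt (fun ρ : ℝ => c * Complex.exp (-(Complex.I * τ * ρ)))
        ((c * (-(Complex.I * τ))) * Complex.exp (-(Complex.I * τ * x))) x := by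
      intro c x
      have h1 : HasDerivAt (fun ρ : ℝ => -(Complex.I * τ * ρ)) (-(Complex.I * τ)) x := by
        have := ((hasDerivAt_id x).ofReal_comp.const_mul (Complex.I * τ)).neg
        exact this.congr_deriv (by simp)
      exact (h1.cexp.const_mul c).congr_deriv (by ring)
    have h1 : deriv (eigenFactor τ μ none) = fun x : ℝ => (1 * (-(Complex.I * τ))) * Complex.exp (-(Complex.I * τ * x)) := by
      funext x
      have := (h 1 x).deriv
      simpa [eigenFactor] using this
    rw [h1, (h _ _).deriv, eigenFactor]
    linear_combination ((τ : ℂ) ^ 2 * Complex.exp (-(Complex.I * τ * (coordL none w : ℝ)))) * Complex.I_sq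
  have h1 : ∀ i, d2 (coordV (some i)) (prodFun (eigenFactor τ μ)) w =
      (((w.2 i) ^ 2 - (2 * μ i + 1) : ℝ) : ℂ) * prodFun (eigenFactor τ μ) w := by
    intro i
    refine d2_prodFun (contDiff_eigenFactor τ μ) (some i) w ?_
    have hs := contDiff_hermiteFun (μ i)
    have hs' : ContDiff ℝ ∞ (deriv (hermiteFun (μ i))) := ContDiff.iterate_deriv 1 hs
    have h2 : deriv (eigenFactor τ μ (some i)) = fun x => ((deriv (hermiteFun (μ i)) x : ℝ) : ℂ) := by
      funext x
      exact ((hs.differentiable (by simp)) x).hasDerivAt.ofReal_comp.deriv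
    have h3 : coordL (some i) w = w.2 i := rfl
    rw [h2, (((hs'.differentiable (by simp)) _).hasDerivAt.ofReal_comp).deriv, deriv_deriv_hermiteFun,
      eigenFactor, h3]
    push_cast; rfl
  rw [Hpar, Fintype.sum_option, h0]
  simp_rw [h1]
  rw [← Finset.sum_mul, EuclideanSpace.norm_sq_eq]
  simp only [Real.norm_eq_abs, sq_abs]
  push_cast
  rw [Finset.sum_sub_distrib, Finset.sum_add_distrib, ← Finset.mul_sum]
  simp
  ring

/-- At fixed `θ` the kernel is a finite combination of eigenfunctions with the common eigenvalue `sv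
d θ`, and `H_par` is moved onto them by parts. They do not decay in `ρ`, but the compact support of
`u` removes all boundary terms. -/
lemma integral_ekern_mul_Hpar {d : ℕ} {u : Space d → ℂ} (hu : ContDiff ℝ ∞ u)
    (hc : HasCompactSupport u) (z : Space d) (θ : ℕ × ℝ) :
    ∫ w, ekern θ z w * Hpar u w = sv d θ * ∫ w, ekern θ z w * u w := by
  have e0 : ∀ w : Space d, ekern θ z w = ∑ μ ∈ Finset.piAntidiag (Finset.univ : Finset (Fin d)) θ.1,
      (((2 * Real.pi)⁻¹ : ℂ) * Complex.exp (Complex.I * θ.2 * z.1) * hermitePhi μ z.2) *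
        prodFun (eigenFactor θ.2 μ) w := by
    intro w
    rw [ekern, hermiteKernel, Complex.ofReal_sum, Finset.mul_sum, Finset.mul_sum]
    refine Finset.sum_congr rfl fun μ _ => ?_
    have : prodFun (eigenFactor θ.2 μ) w = Complex.exp (-(Complex.I * θ.2 * w.1)) * (hermitePhi μ w.2 : ℂ) := by
      rw [prodFun, Fintype.prod_option, hermitePhi, Complex.ofReal_prod]
      rfl
    rw [this, mul_sub, Complex.exp_sub, Complex.exp_neg, Complex.ofReal_mul]
    field_simp
  have ic : ∀ μ, ContDiff ℝ ∞ (prodFun (eigenFactor θ.2 μ) : Space d → ℂ) := fun μ =>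
    contDiff_prodFun (contDiff_eigenFactor _ _)
  simp_rw [e0, Finset.sum_mul, mul_assoc]
  rw [integral_finsetSum, integral_finsetSum, Finset.mul_sum]
  · refine Finset.sum_congr rfl fun μ hμ => ?_
    simp_rw [← mul_assoc (((2 * Real.pi)⁻¹ : ℂ))]
    have hsum : (∑ i, μ i) = θ.1 := (Finset.mem_piAntidiag.1 hμ).1
    simp only [integral_const_mul]
    rw [integral_mul_Hpar (ic μ) hu hc]
    simp_rw [Hpar_prodFun_eigenFactor, mul_assoc, integral_const_mul, hsum, sv_eq]
    ring
  · intro μ _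
    have := ((integrable_mul_of_hasCompactSupport (ic μ).continuous hu.continuous hc).const_mul
      (((2 * Real.pi)⁻¹ : ℂ) * Complex.exp (Complex.I * θ.2 * z.1) * hermitePhi μ z.2))
    simpa only [mul_assoc] using this
  · intro μ _
    have := ((integrable_mul_of_hasCompactSupport (ic μ).continuous (contDiff_Hpar hu).continuous
      (hasCompactSupport_Hpar hc)).const_mul
      (((2 * Real.pi)⁻¹ : ℂ) * Complex.exp (Complex.I * θ.2 * z.1) * hermitePhi μ z.2))
    simpa only [mul_assoc] using this

/-! ### Decay and integrability of the spectral components -/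

lemma integrable_of_test {d : ℕ} {u : Space d → ℂ} (hu : ContDiff ℝ ∞ u) (hc : HasCompactSupport u) :
    Integrable u := hu.continuous.integrable_of_hasCompactSupport hc

lemma kap_Hpar {d : ℕ} {u : Space d → ℂ} (hu : ContDiff ℝ ∞ u)
    (hc : HasCompactSupport u) (z : Space d) (θ : ℕ × ℝ) : kap (Hpar u) z θ = sv d θ * kap u z θ := by
  rw [kap_eq_integral (integrable_of_test (contDiff_Hpar hu) (hasCompactSupport_Hpar hc)),
    kap_eq_integral (integrable_of_test hu hc), integral_ekern_mul_Hpar hu hc]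

/-- Replacing `u` by `Hpar u`, again a test function, multiplies the component by the spectral
value. Repetition gives decay of any polynomial order along the spectrum. -/
lemma exists_kap_pow {d : ℕ} (n : ℕ) {u : Space d → ℂ} (hu : ContDiff ℝ ∞ u) (hc : HasCompactSupport u) :
    ∃ C : ℝ, ∀ z θ, |sv d θ| ^ n * ‖kap u z θ‖ ≤ C * (θ.1 + 2) ^ d := by
  induction n generalizing u with
  | zero =>
    refine ⟨∫ w, ‖u w‖, fun z θ => ?_⟩
    rw [pow_zero, one_mul, mul_comm]
    exact norm_kap_le (integrable_of_test hu hc) z θ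
  | succ n ih =>
    obtain ⟨C, hC⟩ := ih (contDiff_Hpar hu) (hasCompactSupport_Hpar hc)
    refine ⟨C, fun z θ => ?_⟩
    have := hC z θ
    rw [kap_Hpar hu hc, norm_mul, Complex.norm_real, Real.norm_eq_abs] at this
    rw [pow_succ, mul_assoc]; exact this

lemma one_le_sv {d : ℕ} (hd : 1 ≤ d) (θ : ℕ × ℝ) : 1 ≤ sv d θ := by
  rw [sv_eq]
  have : (1 : ℝ) ≤ d := by exact_mod_cast hd
  have : (0 : ℝ) ≤ θ.1 := by positivity
  nlinarith [sq_nonneg θ.2]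

lemma integrable_kap {d : ℕ} (hd : 1 ≤ d) {u : Space d → ℂ} (hu : ContDiff ℝ ∞ u)
    (hc : HasCompactSupport u) (z : Space d) : Integrable (kap u z) specMeas := by
  -- Of the `d + 3` powers, one yields `1/(1 + τ²)`, `d` compensate the growth `(k+2)^d` of the
  -- kernels, and two make the sum over `k` converge.
  obtain ⟨C, hC⟩ := exists_kap_pow (d + 3) hu hc
  have hC0 : 0 ≤ C := by
    have h1 := hC z (0, 0)
    have h2 : 0 ≤ C * (((0 : ℕ) : ℝ) + 2) ^ d := le_trans (by positivity) h1
    by_contra h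
    have : C * (((0 : ℕ) : ℝ) + 2) ^ d < 0 := mul_neg_of_neg_of_pos (by linarith) (by positivity)
    linarith
  have h1 : Integrable (fun k : ℕ => C * 2 ^ d * (((k : ℝ) + 1) ^ 2)⁻¹) Measure.count := by
    rw [integrable_count_iff]
    have := (summable_nat_add_iff 1).2 (Real.summable_nat_pow_inv.2 (one_lt_two))
    simpa using (this.mul_left (C * 2 ^ d)).norm
  refine (h1.mul_prod integrable_inv_one_add_sq).mono'
    (stronglyMeasurable_kap hu.continuous (integrable_of_test hu hc) z).aestronglyMeasurable
    (.of_forall fun θ => ?_)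
  have hs1 := one_le_sv hd θ
  have hk : (0 : ℝ) ≤ θ.1 := by positivity
  have hd' : (1 : ℝ) ≤ d := by exact_mod_cast hd
  have hs2 : 1 + θ.2 ^ 2 ≤ sv d θ := by rw [sv_eq]; linarith
  have hs3 : (θ.1 : ℝ) + 1 ≤ sv d θ := by rw [sv_eq]; nlinarith [sq_nonneg θ.2]
  have h := hC z θ
  rw [abs_of_pos (by linarith)] at h
  have h4 : (1 + θ.2 ^ 2) * ((θ.1 : ℝ) + 1) ^ (d + 2) ≤ sv d θ ^ (d + 3) := by
    calc _ ≤ sv d θ * sv d θ ^ (d + 2) := by gcongr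
      _ = _ := by ring
  have h5 : (1 + θ.2 ^ 2) * ((θ.1 : ℝ) + 1) ^ (d + 2) * ‖kap u z θ‖ ≤ C * (2 * ((θ.1 : ℝ) + 1)) ^ d := by
    calc _ ≤ sv d θ ^ (d + 3) * ‖kap u z θ‖ := by gcongr
      _ ≤ C * (θ.1 + 2) ^ d := h
      _ ≤ _ := by gcongr; linarith
  have hp : 0 < 1 + θ.2 ^ 2 := by positivity
  have hp2 : 0 < ((θ.1 : ℝ) + 1) := by positivity
  rw [← div_eq_mul_inv, ← div_eq_mul_inv, div_div, le_div_iff₀ (by positivity)]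
  have h6 : ‖kap u z θ‖ * (((θ.1 : ℝ) + 1) ^ 2 * (1 + θ.2 ^ 2)) * ((θ.1 : ℝ) + 1) ^ d ≤
      C * 2 ^ d * ((θ.1 : ℝ) + 1) ^ d := by
    rw [mul_pow] at h5
    calc _ = (1 + θ.2 ^ 2) * ((θ.1 : ℝ) + 1) ^ (d + 2) * ‖kap u z θ‖ := by ring
      _ ≤ _ := h5
      _ = _ := by ring
  exact le_of_mul_le_mul_right h6 (by positivity)

/-! ### Completeness: the heat semigroup is an approximate identity -/

lemma heatC_ofReal {d : ℕ} {t : ℝ} (h0 : 0 < t) (z w : Space d) :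
    heatC (t : ℂ) z w = ((4 * Real.pi * t) ^ (-(1 / 2) : ℝ) * (Real.exp (-d * t) *
      (Real.pi * (1 - Real.exp (-4 * t))) ^ (-(d / 2) : ℝ)) * Real.exp (-heatQ t z w) : ℝ) := by
  have hp := Real.pi_pos
  have h4 : 0 ≤ 1 - Real.exp (-4 * t) := by
    have : Real.exp (-4 * t) ≤ 1 := Real.exp_le_one_iff.2 (by linarith)
    linarith
  have e : ((Real.exp (-heatQ t z w) : ℝ) : ℂ) = Complex.exp (-((z.1 - w.1) ^ 2 : ℝ) / (4 * t)) *
      Complex.exp (-(cayley (Complex.exp (-2 * t)) * (‖z.2 + w.2‖ ^ 2 : ℝ) +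
        (cayley (Complex.exp (-2 * t)))⁻¹ * (‖z.2 - w.2‖ ^ 2 : ℝ)) / 4) := by
    rw [Complex.ofReal_exp, ← Complex.exp_add, cayley, inv_div, heatQ]
    congr 1
    push_cast
    ring
  rw [Complex.ofReal_mul, e, Complex.ofReal_mul, Complex.ofReal_mul, Complex.ofReal_cpow (by positivity),
    Complex.ofReal_cpow (by positivity), heatC, mehlerKernel]
  have e1 : ((4 * Real.pi * t : ℝ) : ℂ) = Real.pi * (4 * t) := by push_cast; ring
  have e2 : ((Real.pi * (1 - Real.exp (-4 * t)) : ℝ) : ℂ) = Real.pi * (1 - Complex.exp (-2 * t) ^ 2) := by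
    rw [← Complex.exp_nat_mul]
    push_cast
    congr 3
    ring
  rw [e1, e2]
  push_cast
  ring

lemma tendsto_one_sub_exp_div (c : ℝ) :
    Filter.Tendsto (fun t : ℝ => (1 - Real.exp (-c * t)) / t) (nhdsWithin 0 (Set.Ioi 0)) (nhds c) := by
  have h : HasDerivAt (fun t : ℝ => 1 - Real.exp (-c * t)) c 0 := by
    have := (((hasDerivAt_id (0 : ℝ)).const_mul (-c)).exp).const_sub 1
    simpa using this
  have h2 := (hasDerivAt_iff_tendsto_slope_zero.1 h).mono_left
    (nhdsWithin_mono 0 (fun t (ht : t ∈ Set.Ioi (0 : ℝ)) => (ne_of_gt ht : t ∈ ({0}ᶜ : Set ℝ))))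
  refine h2.congr fun t => ?_
  simp [div_eq_inv_mul]

/-- The dimension of `ℝ × ℝ^d`. -/
lemma finrank_space (d : ℕ) : Module.finrank ℝ (Space d) = d + 1 := by
  rw [Module.finrank_prod, finrank_euclideanSpace_fin, Module.finrank_self]; ring

lemma heatQ_scaled {d : ℕ} {t : ℝ} (h0 : 0 < t) (z v : Space d) :
    heatQ t z (z + Real.sqrt t • v) = v.1 ^ 2 / 4 +
      (1 - Real.exp (-2 * t)) / (1 + Real.exp (-2 * t)) / 4 * ‖z.2 + (z.2 + Real.sqrt t • v.2)‖ ^ 2 +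
      (1 + Real.exp (-2 * t)) / ((1 - Real.exp (-2 * t)) / t) / 4 * ‖v.2‖ ^ 2 := by
  have hs := Real.sq_sqrt h0.le
  have e1 : (z.1 - (z + Real.sqrt t • v).1) ^ 2 / (4 * t) = v.1 ^ 2 / 4 := by
    have : (z.1 - (z + Real.sqrt t • v).1) ^ 2 = Real.sqrt t ^ 2 * v.1 ^ 2 := by simp; ring
    rw [this, hs]; field_simp
  have e2 : ‖z.2 - (z + Real.sqrt t • v).2‖ ^ 2 = t * ‖v.2‖ ^ 2 := by
    have : z.2 - (z + Real.sqrt t • v).2 = -(Real.sqrt t • v.2) := by simp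
    rw [this, norm_neg, norm_smul, mul_pow, Real.norm_eq_abs, sq_abs, hs]
  rw [heatQ, e1, e2]
  have e3 : (z + Real.sqrt t • v).2 = z.2 + Real.sqrt t • v.2 := rfl
  rw [e3]
  have hr1 : 0 < 1 - Real.exp (-2 * t) := by
    have : Real.exp (-2 * t) < 1 := Real.exp_lt_one_iff.2 (by linarith)
    linarith
  field_simp

lemma tendsto_heatC_scaled {d : ℕ} (z v : Space d) :
    Filter.Tendsto (fun t : ℝ => ((t ^ hdim d : ℝ) : ℂ) * heatC (t : ℂ) z (z + Real.sqrt t • v))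
      (nhdsWithin 0 (Set.Ioi 0))
      (nhds ((((4 * Real.pi) ^ (-hdim d) * Real.exp (-(1 / 4) * sqN v) : ℝ)) : ℂ)) := by
  have hp := Real.pi_pos
  have hQ : Filter.Tendsto (fun t : ℝ => heatQ t z (z + Real.sqrt t • v)) (nhdsWithin 0 (Set.Ioi 0))
      (nhds (1 / 4 * sqN v)) := by
    have hc : Filter.Tendsto (fun t : ℝ => v.1 ^ 2 / 4 +
      (1 - Real.exp (-2 * t)) / (1 + Real.exp (-2 * t)) / 4 * ‖z.2 + (z.2 + Real.sqrt t • v.2)‖ ^ 2 +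
      (1 + Real.exp (-2 * t)) / ((1 - Real.exp (-2 * t)) / t) / 4 * ‖v.2‖ ^ 2) (nhdsWithin 0 (Set.Ioi 0))
      (nhds (v.1 ^ 2 / 4 + (1 - Real.exp (-2 * 0)) / (1 + Real.exp (-2 * 0)) / 4 *
        ‖z.2 + (z.2 + Real.sqrt 0 • v.2)‖ ^ 2 + (1 + Real.exp (-2 * 0)) / 2 / 4 * ‖v.2‖ ^ 2)) := by
      refine Filter.Tendsto.add ?_ ?_
      · have : Continuous fun t : ℝ => v.1 ^ 2 / 4 +
          (1 - Real.exp (-2 * t)) / (1 + Real.exp (-2 * t)) / 4 * ‖z.2 + (z.2 + Real.sqrt t • v.2)‖ ^ 2 := by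
          have h : ∀ t : ℝ, 1 + Real.exp (-2 * t) ≠ 0 := fun t => by positivity
          fun_prop (disch := exact h _)
        exact (this.tendsto 0).mono_left nhdsWithin_le_nhds
      · have h1 : Filter.Tendsto (fun t : ℝ => 1 + Real.exp (-2 * t)) (nhdsWithin 0 (Set.Ioi 0))
          (nhds (1 + Real.exp (-2 * 0))) := by
          have : Continuous fun t : ℝ => 1 + Real.exp (-2 * t) := by fun_prop
          exact (this.tendsto 0).mono_left nhdsWithin_le_nhds
        exact ((h1.div (tendsto_one_sub_exp_div 2) two_ne_zero).div_const 4).mul_const _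
    have e : v.1 ^ 2 / 4 + (1 - Real.exp (-2 * 0)) / (1 + Real.exp (-2 * 0)) / 4 *
        ‖z.2 + (z.2 + Real.sqrt 0 • v.2)‖ ^ 2 + (1 + Real.exp (-2 * 0)) / 2 / 4 * ‖v.2‖ ^ 2 = 1 / 4 * sqN v := by
      rw [sqN]; simp; ring
    rw [e] at hc
    refine hc.congr' ?_
    filter_upwards [self_mem_nhdsWithin] with t ht
    exact (heatQ_scaled ht z v).symm
  have hc : Filter.Tendsto (fun t : ℝ => (4 * Real.pi) ^ (-(1 / 2) : ℝ) * (Real.exp (-d * t) *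
      (Real.pi * ((1 - Real.exp (-4 * t)) / t)) ^ (-(d / 2) : ℝ)) *
        Real.exp (-heatQ t z (z + Real.sqrt t • v))) (nhdsWithin 0 (Set.Ioi 0))
      (nhds ((4 * Real.pi) ^ (-(1 / 2) : ℝ) * (Real.exp (-d * 0) *
      (Real.pi * 4) ^ (-(d / 2) : ℝ)) * Real.exp (-(1 / 4 * sqN v)))) := by
    have h1 : Filter.Tendsto (fun t : ℝ => Real.exp (-d * t)) (nhdsWithin 0 (Set.Ioi 0))
        (nhds (Real.exp (-d * 0))) := by
      have : Continuous fun t : ℝ => Real.exp (-d * t) := by fun_prop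
      exact (this.tendsto 0).mono_left nhdsWithin_le_nhds
    have h2 := ((tendsto_one_sub_exp_div 4).const_mul Real.pi).rpow_const (p := -(d / 2 : ℝ))
      (Or.inl (by positivity))
    exact ((h1.mul h2).const_mul _).mul ((Real.continuous_exp.tendsto _).comp hQ.neg)
  have e : (4 * Real.pi) ^ (-(1 / 2) : ℝ) * (Real.exp (-d * 0) *
      (Real.pi * 4) ^ (-(d / 2) : ℝ)) * Real.exp (-(1 / 4 * sqN v)) =
      (4 * Real.pi) ^ (-hdim d) * Real.exp (-(1 / 4) * sqN v) := by
    rw [show -hdim d = -(1 / 2) + -(d / 2 : ℝ) by rw [hdim]; ring, Real.rpow_add (by positivity),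
      mul_comm Real.pi 4]
    simp
  rw [e] at hc
  refine ((Complex.continuous_ofReal.tendsto _).comp hc).congr' ?_
  filter_upwards [self_mem_nhdsWithin] with t ht
  have ht0 : 0 < t := ht
  have h4 : 0 < 1 - Real.exp (-4 * t) := by
    have : Real.exp (-4 * t) < 1 := Real.exp_lt_one_iff.2 (by linarith)
    linarith
  rw [heatC_ofReal ht0, ← Complex.ofReal_mul, Function.comp_apply]
  congr 1
  have e2 : (4 * Real.pi * t) ^ (-(1 / 2) : ℝ) = (4 * Real.pi) ^ (-(1 / 2) : ℝ) * t ^ (-(1 / 2) : ℝ) :=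
    Real.mul_rpow (by positivity) ht0.le
  have e3 : (Real.pi * (1 - Real.exp (-4 * t))) ^ (-(d / 2) : ℝ) =
      (Real.pi * ((1 - Real.exp (-4 * t)) / t)) ^ (-(d / 2) : ℝ) * t ^ (-(d / 2) : ℝ) := by
    rw [← Real.mul_rpow (by positivity) ht0.le]
    congr 1; field_simp
  have e4 : t ^ hdim d * (t ^ (-(1 / 2) : ℝ) * t ^ (-(d / 2) : ℝ)) = 1 := by
    rw [← Real.rpow_add ht0, ← Real.rpow_add ht0, hdim]
    ring_nf
    exact Real.rpow_zero t
  rw [e2, e3]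
  linear_combination (-(4 * Real.pi) ^ (-(1 / 2) : ℝ) * (Real.exp (-d * t) *
      (Real.pi * ((1 - Real.exp (-4 * t)) / t)) ^ (-(d / 2) : ℝ)) *
        Real.exp (-heatQ t z (z + Real.sqrt t • v))) * e4

/-- After the parabolic substitution `w = z + √t v` the kernel converges pointwise to a Gaussian of
mass one, under the fixed majorant `e^{-|v|²/36}` coming from `norm_heatC_le` at real time. -/
lemma tendsto_heatC_test {d : ℕ} {u : Space d → ℂ} (hc : Continuous u) (hu : HasCompactSupport u)
    (z : Space d) :
    Filter.Tendsto (fun t : ℝ => ∫ w, heatC (t : ℂ) z w * u w) (nhdsWithin 0 (Set.Ioi 0)) (nhds (u z)) := by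
  have hp := Real.pi_pos
  obtain ⟨M, hM⟩ := hu.exists_bound_of_continuous hc
  have hM0 : 0 ≤ M := (norm_nonneg _).trans (hM 0)
  have hq : (0 : ℝ) < 1 / 4 := by norm_num
  have e1 : ∀ᶠ t : ℝ in nhdsWithin 0 (Set.Ioi 0), ∫ v, ((t ^ hdim d : ℝ) : ℂ) *
      heatC (t : ℂ) z (z + Real.sqrt t • v) * u (z + Real.sqrt t • v) = ∫ w, heatC (t : ℂ) z w * u w := by
    filter_upwards [self_mem_nhdsWithin] with t ht
    have ht0 : 0 < t := ht
    have h1 := Measure.integral_comp_smul (volume : Measure (Space d))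
      (fun x => ((t ^ hdim d : ℝ) : ℂ) * heatC (t : ℂ) z (z + x) * u (z + x)) (Real.sqrt t)
    rw [h1, finrank_space]
    have h2 := integral_add_left_eq_self (μ := (volume : Measure (Space d)))
      (fun x => ((t ^ hdim d : ℝ) : ℂ) * heatC (t : ℂ) z x * u x) z
    rw [h2]
    simp_rw [mul_assoc]
    rw [integral_const_mul, Complex.real_smul, ← mul_assoc, ← Complex.ofReal_mul]
    have h3 : |(Real.sqrt t ^ (d + 1))⁻¹| * t ^ hdim d = 1 := by
      rw [abs_of_nonneg (by positivity), Real.sqrt_eq_rpow, ← Real.rpow_natCast, ← Real.rpow_mul ht0.le, hdim]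
      push_cast
      rw [show (1 / 2 : ℝ) * (d + 1) = (d + 1) / 2 by ring]
      exact inv_mul_cancel₀ (by positivity)
    rw [h3]; simp
  have e2 : ∫ v : Space d, ((((4 * Real.pi) ^ (-hdim d) * Real.exp (-(1 / 4) * sqN v) : ℝ)) : ℂ) * u z = u z := by
    rw [integral_mul_const, integral_complex_ofReal, integral_const_mul, (integral_exp_neg_sqN hq).2]
    rw [show Real.pi / (1 / 4) = 4 * Real.pi by ring, ← Real.rpow_add (by positivity)]
    simp
  refine Filter.Tendsto.congr' e1 ?_
  rw [← e2]
  refine tendsto_integral_filter_of_dominated_convergence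
    (fun v : Space d => Real.exp (-(1 / 36) * sqN v) * M) ?_ ?_
    ((integral_exp_neg_sqN (by norm_num)).1.mul_const M) (.of_forall fun v => ?_)
  · filter_upwards [self_mem_nhdsWithin] with t ht
    have h1 : Continuous fun v : Space d => heatC (t : ℂ) z (z + Real.sqrt t • v) :=
      continuous_heatC.comp_continuous
        (f := fun v : Space d => ((t : ℂ), z, (z + Real.sqrt t • v : Space d))) (by fun_prop)
        (fun v => by simpa using ht)
    exact (Continuous.mul (continuous_const.mul h1) (hc.comp (by fun_prop))).aestronglyMeasurable
  · have hlt : ∀ᶠ t : ℝ in nhdsWithin 0 (Set.Ioi 0), t ≤ 1 :=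
      nhdsWithin_le_nhds (Iic_mem_nhds one_pos)
    filter_upwards [self_mem_nhdsWithin, hlt] with t ht ht1
    have ht0 : 0 < t := ht
    refine .of_forall fun v => ?_
    rw [norm_mul, norm_mul, Complex.norm_real, Real.norm_of_nonneg (by positivity)]
    have h1 := norm_heatC_le (ζ := (t : ℂ)) (by simpa using ht0) (by simp; linarith) z (z + Real.sqrt t • v)
    rw [Complex.ofReal_re, Complex.norm_real, Real.norm_of_nonneg ht0.le] at h1
    have h2 : sqN (z - (z + Real.sqrt t • v)) = t * sqN v := by
      have e3 : z - (z + Real.sqrt t • v) = -(Real.sqrt t • v) := by abel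
      rw [e3, sqN, sqN]
      simp only [Prod.fst_neg, Prod.snd_neg, Prod.smul_fst, Prod.smul_snd, norm_neg, norm_smul, smul_eq_mul]
      rw [neg_sq, mul_pow, mul_pow, Real.norm_eq_abs, sq_abs, Real.sq_sqrt ht0.le]; ring
    rw [h2] at h1
    have h3 : -(t / (36 * t ^ 2)) * (t * sqN v) = -(1 / 36) * sqN v := by field_simp
    rw [h3] at h1
    have h4 : t ^ hdim d * t ^ (-hdim d) = 1 := by rw [← Real.rpow_add ht0]; simp
    calc _ ≤ t ^ hdim d * (t ^ (-hdim d) * Real.exp (-(1 / 36) * sqN v)) * M := by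
          gcongr
          exact hM _
      _ = _ := by rw [← mul_assoc, h4, one_mul]
  · refine (tendsto_heatC_scaled z v).mul ?_
    have : Continuous fun t : ℝ => u (z + Real.sqrt t • v) := hc.comp (by fun_prop)
    have h1 := (this.tendsto 0).mono_left (nhdsWithin_le_nhds (s := Set.Ioi 0))
    simpa using h1

/-- Inversion formula: the spectral components of a test function add up to it. -/
lemma integral_kap {d : ℕ} (hd : 1 ≤ d) {u : Space d → ℂ} (hu : ContDiff ℝ ∞ u)
    (hc : HasCompactSupport u) (z : Space d) : ∫ θ, kap u z θ ∂specMeas = u z := by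
  have hi := integrable_kap hd hu hc z
  have h1 := tendsto_heatC_test hu.continuous hc z
  -- Abel summation: `e^{-tH} u (z)` tends to the full spectral integral by dominated convergence,
  -- and to `u z` because the heat kernel is an approximate identity.
  have h2 : Filter.Tendsto (fun t : ℝ => ∫ θ, Complex.exp (-(t : ℂ) * sv d θ) * kap u z θ ∂specMeas)
      (nhdsWithin 0 (Set.Ioi 0)) (nhds (∫ θ, kap u z θ ∂specMeas)) := by
    refine tendsto_integral_filter_of_dominated_convergence (fun θ => ‖kap u z θ‖) ?_ ?_ hi.norm
      (.of_forall fun θ => ?_)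
    · refine .of_forall fun t => ?_
      have hsv : Continuous (sv d) := by unfold sv spectralValue; fun_prop
      exact (Complex.continuous_exp.comp (continuous_const.mul
        (Complex.continuous_ofReal.comp hsv))).aestronglyMeasurable.mul hi.aestronglyMeasurable
    · filter_upwards [self_mem_nhdsWithin] with t ht
      have ht0 : 0 < t := ht
      refine .of_forall fun θ => ?_
      rw [norm_mul, Complex.norm_exp]
      have h3 : (-(t : ℂ) * sv d θ).re = -(t * sv d θ) := by
        rw [Complex.re_mul_ofReal]; simp
      have h4 : Real.exp (-(t * sv d θ)) ≤ 1 := by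
        apply Real.exp_le_one_iff.2
        have := one_le_sv hd θ
        have : 0 ≤ t * sv d θ := by positivity
        linarith
      rw [h3]
      exact mul_le_of_le_one_left (norm_nonneg _) h4
    · have : Continuous fun t : ℝ => Complex.exp (-(t : ℂ) * sv d θ) * kap u z θ := by fun_prop
      have h3 := (this.tendsto 0).mono_left (nhdsWithin_le_nhds (s := Set.Ioi 0))
      simpa using h3
  refine tendsto_nhds_unique h2 (h1.congr' ?_)
  filter_upwards [self_mem_nhdsWithin] with t ht
  exact integral_heatC_mul_eq hu.continuous (integrable_of_test hu hc) (by simpa using ht) z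

/-! ### Representing a compactly supported symbol by exponentials -/

/-- Every compactly supported smooth symbol is a superposition of `e^{-(2 + 2πiξ)u}`. -/
lemma exists_exponential_repr {φ : ℝ → ℝ} (hφ : ContDiff ℝ ∞ φ) (hc : HasCompactSupport φ) :
    ∃ g : SchwartzMap ℝ ℂ,
      (∀ u : ℝ, (φ u : ℂ) = ∫ ξ : ℝ, g ξ * Complex.exp (-(2 + 2 * Real.pi * Complex.I * ξ) * u)) ∧
      ∀ ξ, (starRingEnd ℂ) (g ξ) = g (-ξ) := by
  -- The factor `e^{2u}` is harmless on a compact support. Undoing it gives every exponential the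
  -- real part `-2u`, so after scaling by `t` all heat kernels have time with real part `2t > 0`.
  -- Since `H` is real its inverse transform is conjugate symmetric, which later makes the kernels
  -- real.
  set H : ℝ → ℂ := fun u => ((φ u * Real.exp (2 * u) : ℝ) : ℂ) with hH
  have h1 : ContDiff ℝ ∞ H := Complex.ofRealCLM.contDiff.comp
    (hφ.mul (Real.contDiff_exp.comp (contDiff_const.mul contDiff_id)))
  have h2 : HasCompactSupport H := by
    have : HasCompactSupport fun u => φ u * Real.exp (2 * u) := hc.mul_right
    exact this.comp_left (g := fun x : ℝ => (x : ℂ)) (by simp)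
  set S : SchwartzMap ℝ ℂ := h2.toSchwartzMap h1 with hS
  refine ⟨FourierTransform.fourierInv S, fun u => ?_, fun ξ => ?_⟩
  swap
  · have hS : ∀ v, (starRingEnd ℂ) (S v) = S v := fun v => Complex.conj_ofReal _
    simp only [SchwartzMap.fourierInv_coe]
    rw [Real.fourierInv_eq', Real.fourierInv_eq', ← integral_conj]
    refine integral_congr_ae (.of_forall fun v => ?_)
    simp only [smul_eq_mul, map_mul, hS, ← Complex.exp_conj]
    congr 2
    simp [Complex.conj_ofReal, map_ofNat]
  have h3 : FourierTransform.fourier (FourierTransform.fourierInv S) = S := FourierTransform.fourier_fourierInv_eq S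
  have h4 := congrArg (fun f : SchwartzMap ℝ ℂ => f u) h3
  simp only [SchwartzMap.fourier_coe] at h4
  rw [Real.fourier_real_eq_integral_exp_smul] at h4
  have h5 : S u = ((φ u * Real.exp (2 * u) : ℝ) : ℂ) := rfl
  rw [h5] at h4
  have h6 : (φ u : ℂ) = Complex.exp (-2 * u) * ((φ u * Real.exp (2 * u) : ℝ) : ℂ) := by
    push_cast
    rw [mul_left_comm, ← Complex.exp_add]
    simp
  rw [h6, ← h4, ← integral_const_mul]
  refine integral_congr_ae (.of_forall fun ξ => ?_)
  simp only [smul_eq_mul]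
  rw [← mul_assoc, ← Complex.exp_add, mul_comm]
  congr 2
  push_cast; ring

/-! ### Schur's test -/

/-- Hölder's inequality after splitting `k = k^{1/q} k^{1/r}`, that is Jensen for the measure `k
dμ`. It is the pointwise half of Schur's test. -/
lemma rpow_lintegral_mul_le {X : Type*} [MeasurableSpace X] {μ : Measure X} {k f : X → ℝ≥0∞}
    (hk : AEMeasurable k μ) (hf : AEMeasurable f μ) {r : ℝ} (hr : 1 ≤ r) :
    (∫⁻ x, k x * f x ∂μ) ^ r ≤ (∫⁻ x, k x ∂μ) ^ (r - 1) * ∫⁻ x, k x * f x ^ r ∂μ := by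
  rcases hr.eq_or_lt with rfl | hr1
  · simp
  have hpq := Real.HolderConjugate.conjExponent hr1
  set q := Real.conjExponent r with hq
  have hq0 : 0 < q := hpq.symm.pos
  have hr0 : 0 < r := hpq.pos
  have h := ENNReal.lintegral_mul_le_Lp_mul_Lq μ hpq.symm (hk.pow_const (1 / q))
    ((hk.pow_const (1 / r)).mul hf)
  have e1 : ∀ x, ((fun x => k x ^ (1 / q)) * ((fun x => k x ^ (1 / r)) * f)) x = k x * f x := by
    intro x
    simp only [Pi.mul_apply]
    rw [← mul_assoc, ← ENNReal.rpow_add_of_nonneg _ _ (by positivity) (by positivity), add_comm, hpq.one_div_add_one_div]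
    simp
  have e2 : ∀ x, (k x ^ (1 / q)) ^ q = k x := fun x => by
    rw [← ENNReal.rpow_mul, one_div_mul_cancel hq0.ne', ENNReal.rpow_one]
  have e3 : ∀ x, ((fun x => k x ^ (1 / r)) * f) x ^ r = k x * f x ^ r := fun x => by
    rw [Pi.mul_apply, ENNReal.mul_rpow_of_nonneg _ _ hr0.le, ← ENNReal.rpow_mul, one_div_mul_cancel hr0.ne',
      ENNReal.rpow_one]
  simp_rw [e1, e2, e3] at h
  refine (ENNReal.rpow_le_rpow h hr0.le).trans (le_of_eq ?_)
  rw [ENNReal.mul_rpow_of_nonneg _ _ hr0.le, ← ENNReal.rpow_mul, ← ENNReal.rpow_mul, one_div_mul_cancel hr0.ne',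
    ENNReal.rpow_one]
  congr 2
  have := hpq.one_div_add_one_div
  field_simp at this ⊢
  nlinarith

/-- Hölder's inequality for functions with values in `[0, ∞]`. -/
lemma lintegral_mul_le_eLpNorm_mul_eLpNorm {X : Type*} [MeasurableSpace X] {μ : Measure X} {F G : X → ℝ≥0∞}
    {p q : ℝ≥0∞} (hp : 1 < p) (hp' : p ≠ ⊤) (hpq : ENNReal.HolderConjugate p q) (hF : AEMeasurable F μ)
    (hG : AEMeasurable G μ) : ∫⁻ x, F x * G x ∂μ ≤ eLpNorm F p μ * eLpNorm G q μ := by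
  have hq' : q ≠ ⊤ := (ENNReal.HolderConjugate.lt_top_iff_one_lt q p).2 hp |>.ne
  have hq : 1 < q := (ENNReal.HolderConjugate.lt_top_iff_one_lt p q).1 hp'.lt_top
  have h := ENNReal.lintegral_mul_le_Lp_mul_Lq μ (hpq.toReal_of_ne_top hp' hq') hF hG
  rw [eLpNorm_eq_lintegral_rpow_enorm_toReal (zero_lt_one.trans hp).ne' hp',
    eLpNorm_eq_lintegral_rpow_enorm_toReal (zero_lt_one.trans hq).ne' hq']
  simpa using h

/-- A kernel on `ℝ × ℝ^d` satisfying the hypothesis of Schur's test with constant `C`. -/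
structure IsSchurKernel {d : ℕ} (K : Space d → Space d → ℂ) (C : ℝ≥0) : Prop where
  meas : StronglyMeasurable (Function.uncurry K)
  left : ∀ z, ∫⁻ w, ‖K z w‖ₑ ≤ C
  right : ∀ w, ∫⁻ z, ‖K z w‖ₑ ≤ C

/-- The integral operator with kernel `K`. -/
def kerOp {d : ℕ} (K : Space d → Space d → ℂ) (f : Space d → ℂ) (z : Space d) : ℂ := ∫ w, K z w * f w

namespace IsSchurKernel

variable {d : ℕ} {K : Space d → Space d → ℂ} {C : ℝ≥0}

lemma meas_left (hK : IsSchurKernel K C) (z : Space d) : StronglyMeasurable (K z) :=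
  hK.meas.comp_measurable (measurable_const.prodMk measurable_id)

lemma meas_right (hK : IsSchurKernel K C) (w : Space d) : StronglyMeasurable (fun z => K z w) :=
  hK.meas.comp_measurable (measurable_id.prodMk measurable_const)

lemma mono (hK : IsSchurKernel K C) {C' : ℝ≥0} (h : C ≤ C') : IsSchurKernel K C' :=
  ⟨hK.meas, fun z => (hK.left z).trans (by exact_mod_cast h), fun z => (hK.right z).trans (by exact_mod_cast h)⟩

lemma lintegral_rpow_le (hK : IsSchurKernel K C) {f : Space d → ℂ} (hf : AEStronglyMeasurable f volume)
    {r : ℝ} (hr : 1 ≤ r) :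
    ∫⁻ z, (∫⁻ w, ‖K z w‖ₑ * ‖f w‖ₑ) ^ r ≤ (C : ℝ≥0∞) ^ r * ∫⁻ w, ‖f w‖ₑ ^ r := by
  have hm : AEMeasurable (fun q : Space d × Space d => ‖K q.1 q.2‖ₑ * ‖f q.2‖ₑ ^ r)
      ((volume : Measure (Space d)).prod (volume : Measure (Space d))) :=
    hK.meas.enorm.aemeasurable.mul ((hf.comp_snd).enorm.pow_const r)
  calc ∫⁻ z, (∫⁻ w, ‖K z w‖ₑ * ‖f w‖ₑ) ^ r
      ≤ ∫⁻ z, (C : ℝ≥0∞) ^ (r - 1) * ∫⁻ w, ‖K z w‖ₑ * ‖f w‖ₑ ^ r := by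
        refine lintegral_mono fun z => ?_
        refine (rpow_lintegral_mul_le (hK.meas_left z).enorm.aemeasurable hf.enorm hr).trans ?_
        have := hK.left z
        gcongr
    _ = (C : ℝ≥0∞) ^ (r - 1) * ∫⁻ w, ∫⁻ z, ‖K z w‖ₑ * ‖f w‖ₑ ^ r := by
        rw [lintegral_const_mul'' _ (AEMeasurable.lintegral_prod_right' hm), lintegral_lintegral_swap hm]
    _ ≤ (C : ℝ≥0∞) ^ (r - 1) * ∫⁻ w, C * ‖f w‖ₑ ^ r := by
        gcongr with w
        rw [lintegral_mul_const _ (hK.meas_right w).enorm]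
        gcongr
        exact hK.right w
    _ = _ := by
        rw [lintegral_const_mul' _ _ ENNReal.coe_ne_top, ← mul_assoc]
        congr 1
        nth_rewrite 2 [← ENNReal.rpow_one (C : ℝ≥0∞)]
        rw [← ENNReal.rpow_add_of_nonneg _ _ (by linarith) zero_le_one]
        simp

lemma aestronglyMeasurable_kerOp (hK : IsSchurKernel K C) {f : Space d → ℂ}
    (hf : AEStronglyMeasurable f volume) : AEStronglyMeasurable (kerOp K f) volume :=
  AEStronglyMeasurable.integral_prod_right'
    (f := fun q : Space d × Space d => K q.1 q.2 * f q.2) (hK.meas.aestronglyMeasurable.mul hf.comp_snd)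

lemma eLpNorm_lintegral_le (hK : IsSchurKernel K C) {p : ℝ≥0∞} (hp : 1 ≤ p) (hp' : p ≠ ⊤) {f : Space d → ℂ}
    (hf : AEStronglyMeasurable f volume) :
    eLpNorm (fun z => ∫⁻ w, ‖K z w‖ₑ * ‖f w‖ₑ) p volume ≤ C * eLpNorm f p volume := by
  have hp0 : p ≠ 0 := (zero_lt_one.trans_le hp).ne'
  have hr : 1 ≤ p.toReal := by simpa using ENNReal.toReal_mono hp' hp
  rw [eLpNorm_eq_lintegral_rpow_enorm_toReal hp0 hp', eLpNorm_eq_lintegral_rpow_enorm_toReal hp0 hp']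
  have h0 : 0 < p.toReal := by linarith
  refine (ENNReal.rpow_le_rpow (hK.lintegral_rpow_le hf hr) (by positivity)).trans (le_of_eq ?_)
  rw [ENNReal.mul_rpow_of_nonneg _ _ (by positivity), ← ENNReal.rpow_mul, mul_one_div_cancel h0.ne', ENNReal.rpow_one]

lemma eLpNorm_kerOp_le (hK : IsSchurKernel K C) {p : ℝ≥0∞} (hp : 1 ≤ p) (hp' : p ≠ ⊤) {f : Space d → ℂ}
    (hf : AEStronglyMeasurable f volume) :
    eLpNorm (kerOp K f) p volume ≤ C * eLpNorm f p volume := by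
  refine le_trans (eLpNorm_mono_enorm fun z => ?_) (hK.eLpNorm_lintegral_le hp hp' hf)
  refine (enorm_integral_le_lintegral_enorm _).trans (le_of_eq ?_)
  simp [enorm_mul]

lemma memLp_kerOp (hK : IsSchurKernel K C) {p : ℝ≥0∞} (hp : 1 ≤ p) (hp' : p ≠ ⊤) {f : Space d → ℂ}
    (hf : MemLp f p volume) : MemLp (kerOp K f) p volume :=
  ⟨hK.aestronglyMeasurable_kerOp hf.1, (hK.eLpNorm_kerOp_le hp hp' hf.1).trans_lt
    (ENNReal.mul_lt_top ENNReal.coe_lt_top hf.2)⟩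

/-- The integral of absolute values is itself in `L^p`, hence finite almost everywhere. Without this
`kerOp` would not be additive on `L^p`. -/
lemma ae_integrable (hK : IsSchurKernel K C) {p : ℝ≥0∞} (hp : 1 ≤ p) (hp' : p ≠ ⊤) {f : Space d → ℂ}
    (hf : MemLp f p volume) : ∀ᵐ z, Integrable (fun w => K z w * f w) volume := by
  have hp0 : p ≠ 0 := (zero_lt_one.trans_le hp).ne'
  have h : eLpNorm (fun z => ∫⁻ w, ‖K z w‖ₑ * ‖f w‖ₑ) p volume < ⊤ :=
    (hK.eLpNorm_lintegral_le hp hp' hf.1).trans_lt (ENNReal.mul_lt_top ENNReal.coe_lt_top hf.2)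
  rw [eLpNorm_lt_top_iff_lintegral_rpow_enorm_lt_top hp0 hp'] at h
  have hm : AEMeasurable (fun z => ∫⁻ w, ‖K z w‖ₑ * ‖f w‖ₑ) volume :=
    AEMeasurable.lintegral_prod_right' (f := fun q : Space d × Space d => ‖K q.1 q.2‖ₑ * ‖f q.2‖ₑ)
      (hK.meas.enorm.aemeasurable.mul hf.1.comp_snd.enorm)
  have h2 := ae_lt_top' (by simpa using hm.pow_const p.toReal) h.ne
  filter_upwards [h2] with z hz
  refine ⟨(hK.meas_left z).aestronglyMeasurable.mul hf.1, ?_⟩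
  rw [hasFiniteIntegral_iff_enorm]
  simp only [enorm_mul]
  by_contra hn
  rw [not_lt, top_le_iff] at hn
  simp only [enorm_eq_self] at hz
  rw [hn, ENNReal.top_rpow_of_pos (ENNReal.toReal_pos hp0 hp')] at hz
  exact lt_irrefl _ hz

end IsSchurKernel

lemma kerOp_congr {d : ℕ} (K : Space d → Space d → ℂ) {f g : Space d → ℂ} (h : f =ᵐ[volume] g) :
    kerOp K f = kerOp K g := by
  ext z
  exact integral_congr_ae (h.mono fun w hw => by simp [hw])

/-- The bounded operator on `L^p` with a Schur kernel. -/
lemma IsSchurKernel.exists_clm {d : ℕ} {K : Space d → Space d → ℂ} {C : ℝ≥0} (hK : IsSchurKernel K C)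
    (p : ℝ≥0∞) [hp : Fact (1 ≤ p)] (hp' : p ≠ ⊤) :
    ∃ A : LpSpace d p →L[ℂ] LpSpace d p, (∀ f : LpSpace d p, A f =ᵐ[volume] kerOp K f) ∧ ‖A‖ ≤ C := by
  set L : LpSpace d p →ₗ[ℂ] LpSpace d p :=
    { toFun := fun f => (hK.memLp_kerOp hp.out hp' (Lp.memLp f)).toLp
      map_add' := fun f g => by
        refine Lp.ext ?_
        refine (MemLp.coeFn_toLp _).trans ?_
        refine Filter.EventuallyEq.trans ?_ (Lp.coeFn_add _ _).symm
        filter_upwards [(MemLp.coeFn_toLp (hK.memLp_kerOp hp.out hp' (Lp.memLp f))),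
          (MemLp.coeFn_toLp (hK.memLp_kerOp hp.out hp' (Lp.memLp g))),
          hK.ae_integrable hp.out hp' (Lp.memLp f), hK.ae_integrable hp.out hp' (Lp.memLp g)] with z h1 h2 h3 h4
        rw [Pi.add_apply, h1, h2, kerOp_congr K (Lp.coeFn_add f g), kerOp, kerOp, kerOp, ← integral_add h3 h4]
        simp [mul_add]
      map_smul' := fun c f => by
        refine Lp.ext ?_
        refine (MemLp.coeFn_toLp _).trans ?_
        refine Filter.EventuallyEq.trans ?_ (Lp.coeFn_smul _ _).symm
        filter_upwards [(MemLp.coeFn_toLp (hK.memLp_kerOp hp.out hp' (Lp.memLp f)))] with z h1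
        rw [Pi.smul_apply, RingHom.id_apply, h1, kerOp_congr K (Lp.coeFn_smul c f), kerOp, kerOp, smul_eq_mul,
          ← integral_const_mul]
        simp [mul_left_comm] } with hL
  have hb : ∀ f, ‖L f‖ ≤ C * ‖f‖ := fun f => by
    have h1 := hK.eLpNorm_kerOp_le hp.out hp' (Lp.memLp f).1
    have h2 : L f = (hK.memLp_kerOp hp.out hp' (Lp.memLp f)).toLp := rfl
    rw [h2, Lp.norm_toLp, Lp.norm_def]
    have := ENNReal.toReal_mono (ENNReal.mul_ne_top ENNReal.coe_ne_top (Lp.eLpNorm_ne_top f)) h1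
    simpa using this
  refine ⟨L.mkContinuous C hb, fun f => ?_, L.mkContinuous_norm_le C.2 hb⟩
  exact MemLp.coeFn_toLp (hK.memLp_kerOp hp.out hp' (Lp.memLp f))

/-- Symmetric kernels give symmetric operators. -/
lemma IsSchurKernel.integral_kerOp_mul {d : ℕ} {K : Space d → Space d → ℂ} {C : ℝ≥0} (hK : IsSchurKernel K C)
    (hs : ∀ z w, K z w = K w z) {p q : ℝ≥0∞} (hp : 1 < p) (hp' : p ≠ ⊤) (hpq : ENNReal.HolderConjugate p q)
    {f v : Space d → ℂ} (hf : MemLp f p volume) (hv : MemLp v q volume) :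
    ∫ z, kerOp K f z * v z = ∫ z, f z * kerOp K v z := by
  have hm : AEStronglyMeasurable (fun r : Space d × Space d => K r.1 r.2 * f r.2 * v r.1)
      ((volume : Measure (Space d)).prod (volume : Measure (Space d))) :=
    (hK.meas.aestronglyMeasurable.mul hf.1.comp_snd).mul hv.1.comp_fst
  have hi : Integrable (fun r : Space d × Space d => K r.1 r.2 * f r.2 * v r.1)
      ((volume : Measure (Space d)).prod (volume : Measure (Space d))) := by
    refine ⟨hm, ?_⟩
    rw [hasFiniteIntegral_iff_enorm, lintegral_prod _ hm.enorm]
    simp only [enorm_mul]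
    have hm2 : AEMeasurable (fun z => ∫⁻ w, ‖K z w‖ₑ * ‖f w‖ₑ) volume :=
      AEMeasurable.lintegral_prod_right' (f := fun q : Space d × Space d => ‖K q.1 q.2‖ₑ * ‖f q.2‖ₑ)
        (hK.meas.enorm.aemeasurable.mul hf.1.comp_snd.enorm)
    have e : ∀ z, ∫⁻ w, ‖K z w‖ₑ * ‖f w‖ₑ * ‖v z‖ₑ = (∫⁻ w, ‖K z w‖ₑ * ‖f w‖ₑ) * ‖v z‖ₑ := fun z =>
      lintegral_mul_const'' _ ((hK.meas_left z).enorm.aemeasurable.mul hf.1.enorm)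
    simp_rw [e]
    refine (lintegral_mul_le_eLpNorm_mul_eLpNorm hp hp' hpq hm2 hv.1.enorm).trans_lt ?_
    rw [eLpNorm_enorm]
    exact ENNReal.mul_lt_top ((hK.eLpNorm_lintegral_le hp.le hp' hf.1).trans_lt
      (ENNReal.mul_lt_top ENNReal.coe_lt_top hf.2)) hv.2
  have h1 : ∀ z, kerOp K f z * v z = ∫ w, K z w * f w * v z := fun z => by
    rw [kerOp, integral_mul_const]
  have h2 : ∀ w, f w * kerOp K v w = ∫ z, K z w * f w * v z := fun w => by
    rw [kerOp, ← integral_const_mul]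
    refine integral_congr_ae (.of_forall fun z => ?_)
    simp only [hs w z]; ring
  simp_rw [h1, h2]
  exact integral_integral_swap hi

/-! ### Kernels of smooth compactly supported functions of the operator -/

/-- The complex time `t (2 + 2πiξ)`. -/
def ctime (t ξ : ℝ) : ℂ := (t : ℂ) * (2 + 2 * Real.pi * Complex.I * ξ)

lemma ctime_re (t ξ : ℝ) : (ctime t ξ).re = 2 * t := by
  simp [ctime]; ring

lemma continuous_ctime_right (t : ℝ) : Continuous (ctime t) := by unfold ctime; fun_prop

lemma conj_ctime (t ξ : ℝ) : (starRingEnd ℂ) (ctime t ξ) = ctime t (-ξ) := by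
  simp [ctime, Complex.conj_ofReal, map_ofNat]

/-- The half-step time `t (1 + 2πiξ)`. -/
lemma ctime_sub_eq (t ξ : ℝ) : ctime t ξ = (ctime t ξ - t) + t := by ring

lemma ctime_sub_re (t ξ : ℝ) : (ctime t ξ - t).re = t := by
  rw [Complex.sub_re, ctime_re, Complex.ofReal_re]; ring

/-- The angle of the time depends on `ξ` alone and not on `t`; this is why the kernel estimates are
uniform over the scales. -/
lemma sq_norm_ctime_sub_div {t : ℝ} (h0 : 0 < t) (ξ : ℝ) :
    (‖ctime t ξ - t‖ / (ctime t ξ - t).re) ^ 2 = 1 + 4 * Real.pi ^ 2 * ξ ^ 2 := by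
  rw [ctime_sub_re, div_pow, ← Complex.normSq_eq_norm_sq, Complex.normSq_apply, ctime_sub_re]
  have : (ctime t ξ - t).im = t * (2 * Real.pi * ξ) := by simp [ctime]
  rw [this]; field_simp; ring

lemma sq_norm_ctime_div {t : ℝ} (h0 : 0 < t) (ξ : ℝ) :
    (‖ctime t ξ‖ / (ctime t ξ).re) ^ 2 = 1 + Real.pi ^ 2 * ξ ^ 2 := by
  rw [ctime_re, div_pow, ← Complex.normSq_eq_norm_sq, Complex.normSq_apply, ctime_re]
  have : (ctime t ξ).im = t * (2 * Real.pi * ξ) := by simp [ctime]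
  rw [this]; field_simp

/-- The weight controlling the dependence of the heat kernel bounds on the angle of the time. -/
def angleWeight (d : ℕ) (ξ : ℝ) : ℝ := (72 * Real.pi * (1 + 4 * Real.pi ^ 2 * ξ ^ 2)) ^ (d + 2)

lemma one_le_angle (ξ : ℝ) : 1 ≤ 72 * Real.pi * (1 + 4 * Real.pi ^ 2 * ξ ^ 2) := by
  have := Real.pi_gt_three
  nlinarith [mul_nonneg (sq_nonneg Real.pi) (sq_nonneg ξ)]

lemma angleWeight_nonneg (d : ℕ) (ξ : ℝ) : 0 ≤ angleWeight d ξ :=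
  pow_nonneg (zero_le_one.trans (one_le_angle ξ)) _

lemma continuous_angleWeight (d : ℕ) : Continuous (angleWeight d) := by unfold angleWeight; fun_prop

lemma rpow_hdim_le_angleWeight {d : ℕ} {x ξ : ℝ} (h0 : 0 ≤ x) (h : x ≤ 72 * Real.pi * (1 + 4 * Real.pi ^ 2 * ξ ^ 2)) :
    x ^ hdim d ≤ (72 * Real.pi * (1 + 4 * Real.pi ^ 2 * ξ ^ 2)) ^ (d + 1) := by
  refine (Real.rpow_le_rpow h0 h (hdim_pos d).le).trans ?_
  rw [← Real.rpow_natCast _ (d + 1)]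
  refine Real.rpow_le_rpow_of_exponent_le (one_le_angle ξ) ?_
  rw [hdim]; push_cast
  have : (0 : ℝ) ≤ d := d.cast_nonneg
  linarith

lemma lintegral_heatC_ctime_le {d : ℕ} {t : ℝ} (h0 : 0 < t) (h1 : t ≤ 1) (ξ : ℝ) (z : Space d) :
    ∫⁻ w, ‖heatC (ctime t ξ) z w‖ₑ ≤ ENNReal.ofReal (angleWeight d ξ) := by
  refine (lintegral_heatC_le (by rw [ctime_re]; linarith) (by rw [ctime_re]; linarith) z).trans
    (ENNReal.ofReal_le_ofReal ?_)
  rw [sq_norm_ctime_div h0]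
  have hp := Real.pi_pos
  refine (rpow_hdim_le_angleWeight (d := d) (ξ := ξ) (by positivity) ?_).trans
    (pow_le_pow_right₀ (one_le_angle ξ) (by omega))
  gcongr <;> nlinarith

/-- The first moment costs one further factor `‖ζ‖ / Re ζ` beyond the power `hdim d ≤ d + 1`. This
accounts for the exponent `d + 2` in `angleWeight`. -/
lemma lintegral_heatC_ctime_mul_norm_le {d : ℕ} {t : ℝ} (h0 : 0 < t) (h1 : t ≤ 1) (ξ : ℝ) (z : Space d) :
    ∫⁻ w, ‖heatC (ctime t ξ) z w‖ₑ * ‖z - w‖ₑ ≤ ENNReal.ofReal (Real.sqrt t * angleWeight d ξ) := by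
  refine (lintegral_heatC_mul_norm_le (by rw [ctime_re]; linarith) (by rw [ctime_re]; linarith) z).trans
    (ENNReal.ofReal_le_ofReal ?_)
  have hp := Real.pi_gt_three
  have hq : 1 ≤ 1 + Real.pi ^ 2 * ξ ^ 2 := by nlinarith [mul_nonneg (sq_nonneg Real.pi) (sq_nonneg ξ)]
  have hr : ‖ctime t ξ‖ / (ctime t ξ).re ≤ 1 + Real.pi ^ 2 * ξ ^ 2 := by
    have h2 := sq_norm_ctime_div h0 ξ
    have h3 : 0 ≤ ‖ctime t ξ‖ / (ctime t ξ).re := by rw [ctime_re]; positivity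
    nlinarith
  rw [sq_norm_ctime_div h0, ctime_re, Real.sqrt_mul (by norm_num)]
  have h2 : Real.sqrt 2 ≤ 2 := by rw [Real.sqrt_le_left] <;> norm_num
  have h3 := rpow_hdim_le_angleWeight (d := d) (x := 72 * Real.pi * (1 + Real.pi ^ 2 * ξ ^ 2)) (ξ := ξ)
    (by positivity) (by gcongr; nlinarith)
  calc Real.sqrt 2 * Real.sqrt t * (6 * (‖ctime t ξ‖ / (2 * t))) *
        (72 * Real.pi * (1 + Real.pi ^ 2 * ξ ^ 2)) ^ hdim d
      ≤ 2 * Real.sqrt t * (6 * (1 + Real.pi ^ 2 * ξ ^ 2)) *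
        (72 * Real.pi * (1 + 4 * Real.pi ^ 2 * ξ ^ 2)) ^ (d + 1) := by
        rw [ctime_re] at hr
        gcongr
    _ = Real.sqrt t * ((12 * (1 + Real.pi ^ 2 * ξ ^ 2)) * (72 * Real.pi * (1 + 4 * Real.pi ^ 2 * ξ ^ 2)) ^ (d + 1)) := by
        ring
    _ ≤ Real.sqrt t * ((72 * Real.pi * (1 + 4 * Real.pi ^ 2 * ξ ^ 2)) * (72 * Real.pi * (1 + 4 * Real.pi ^ 2 * ξ ^ 2)) ^ (d + 1)) := by
        gcongr <;> nlinarith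
    _ = _ := by rw [angleWeight]; ring

lemma continuous_heatC_left {d : ℕ} {ζ : ℂ} (h : 0 < ζ.re) :
    Continuous fun q : Space d × Space d => heatC ζ q.1 q.2 :=
  continuous_heatC.comp_continuous (f := fun q : Space d × Space d => (ζ, q.1, q.2)) (by fun_prop) (fun _ => h)

lemma continuous_heatC_fst {d : ℕ} {ζ : ℂ} (h : 0 < ζ.re) (w : Space d) :
    Continuous fun v : Space d => heatC ζ v w :=
  continuous_heatC.comp_continuous (f := fun v : Space d => (ζ, v, w)) (by fun_prop) (fun _ => h)

/-- The Lipschitz estimate is available at real time only. Since the complex time has real part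
`2t`, the semigroup law splits off a real step `t`: that factor carries the difference, and the
remaining factor, of time `t(1 + 2πiξ)`, is bounded in `L¹` by the angle weight. -/
lemma lintegral_heatC_ctime_sub_le {d : ℕ} {t : ℝ} (h0 : 0 < t) (h1 : t ≤ 1) (ξ : ℝ) (w w' : Space d) :
    ∫⁻ z, ‖heatC (ctime t ξ) z w - heatC (ctime t ξ) z w'‖ₑ ≤
      ENNReal.ofReal (angleWeight d ξ) * ENNReal.ofReal (heatLip d * (‖w - w'‖ / Real.sqrt t)) := by
  have hr := ctime_sub_re t ξ
  have hr0 : 0 < (ctime t ξ - t).re := by rw [hr]; exact h0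
  have hc1 := continuous_heatC_left (d := d) hr0
  have hc2 := continuous_heatC_fst (d := d) (ζ := (t : ℂ)) (by simpa using h0)
  have hi : ∀ z w : Space d, Integrable fun v => heatC (ctime t ξ - t) z v * heatC (t : ℂ) v w := by
    intro z w
    refine Integrable.mul_bdd (c := t ^ (-hdim d)) ?_ ?_ (.of_forall fun v => ?_)
    · refine ⟨(hc1.comp (by fun_prop : Continuous fun v : Space d => (z, v))).aestronglyMeasurable, ?_⟩
      rw [hasFiniteIntegral_iff_enorm]
      exact (lintegral_heatC_le hr0 (by rw [hr]; linarith) z).trans_lt ENNReal.ofReal_lt_top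
    · exact (hc2 w).aestronglyMeasurable
    · refine (norm_heatC_le (by simpa using h0) (by simp; linarith) v w).trans ?_
      rw [Complex.ofReal_re]
      refine mul_le_of_le_one_right (by positivity) (Real.exp_le_one_iff.2 ?_)
      have := sqN_nonneg (v - w)
      have : 0 ≤ t / (36 * ‖(t : ℂ)‖ ^ 2) * sqN (v - w) := by positivity
      linarith
  have e : ∀ z, heatC (ctime t ξ) z w - heatC (ctime t ξ) z w' =
      ∫ v, heatC (ctime t ξ - t) z v * (heatC (t : ℂ) v w - heatC (t : ℂ) v w') := by
    intro z
    simp_rw [mul_sub]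
    rw [integral_sub (hi z w) (hi z w'), integral_heatC_mul hr0 (by simpa using h0),
      integral_heatC_mul hr0 (by simpa using h0), ← ctime_sub_eq]
  have hcm : Continuous fun q : Space d × Space d =>
      heatC (ctime t ξ - t) q.1 q.2 * (heatC (t : ℂ) q.2 w - heatC (t : ℂ) q.2 w') := by
    exact hc1.mul (((hc2 w).comp continuous_snd).sub ((hc2 w').comp continuous_snd))
  have hb : ∀ v : Space d, ∫⁻ z, ‖heatC (ctime t ξ - t) z v‖ₑ ≤ ENNReal.ofReal (angleWeight d ξ) := by
    intro v
    simp_rw [fun z => heatC_comm (ctime t ξ - t) z v]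
    refine (lintegral_heatC_le hr0 (by rw [hr]; linarith) v).trans (ENNReal.ofReal_le_ofReal ?_)
    rw [sq_norm_ctime_sub_div h0]
    have hp := Real.pi_pos
    refine (rpow_hdim_le_angleWeight (d := d) (ξ := ξ) (by positivity) ?_).trans
      (pow_le_pow_right₀ (one_le_angle ξ) (by omega))
    exact mul_le_mul_of_nonneg_right (by linarith) (by positivity)
  calc ∫⁻ z, ‖heatC (ctime t ξ) z w - heatC (ctime t ξ) z w'‖ₑ
      ≤ ∫⁻ z, ∫⁻ v, ‖heatC (ctime t ξ - t) z v * (heatC (t : ℂ) v w - heatC (t : ℂ) v w')‖ₑ := by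
        refine lintegral_mono fun z => ?_
        simp only [e z]
        exact enorm_integral_le_lintegral_enorm _
    _ = ∫⁻ v, ∫⁻ z, ‖heatC (ctime t ξ - t) z v * (heatC (t : ℂ) v w - heatC (t : ℂ) v w')‖ₑ :=
        lintegral_lintegral_swap hcm.enorm.aemeasurable
    _ ≤ ∫⁻ v, ENNReal.ofReal (angleWeight d ξ) * ‖heatC (t : ℂ) v w - heatC (t : ℂ) v w'‖ₑ := by
        refine lintegral_mono fun v => ?_
        simp only [enorm_mul]
        rw [lintegral_mul_const _
          (continuous_heatC_fst hr0 v).enorm.measurable]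
        exact mul_le_mul_left (hb v) _
    _ ≤ _ := by
        rw [lintegral_const_mul' _ _ ENNReal.ofReal_ne_top]
        gcongr
        exact lintegral_heatC_sub_le h0 h1 w w'

/-- The constant controlling the kernels built from the spectral density `g`. -/
def densityNorm (d : ℕ) (g : ℝ → ℂ) : ℝ≥0∞ := ∫⁻ ξ, ‖g ξ‖ₑ * ENNReal.ofReal (angleWeight d ξ)

/-- `angleWeight` is polynomial in `ξ` and `g` is a Schwartz function. -/
lemma densityNorm_lt_top (d : ℕ) (g : SchwartzMap ℝ ℂ) : densityNorm d g < ⊤ := by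
  have h : Integrable fun ξ : ℝ => g ξ * (angleWeight d ξ : ℂ) := by
    have h1 : Integrable fun ξ : ℝ => (72 * Real.pi * 2 ^ 2 * Real.pi ^ 2) ^ (d + 2) * 2 ^ (d + 1) *
        (‖ξ‖ ^ 0 * ‖g ξ‖ + ‖ξ‖ ^ (2 * (d + 2)) * ‖g ξ‖) :=
      ((g.integrable_pow_mul volume 0).add (g.integrable_pow_mul volume (2 * (d + 2)))).const_mul _
    refine h1.mono' (g.continuous.mul (Complex.continuous_ofReal.comp
      (continuous_angleWeight d))).aestronglyMeasurable (.of_forall fun ξ => ?_)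
    rw [norm_mul, Complex.norm_real, Real.norm_of_nonneg (angleWeight_nonneg d ξ), angleWeight]
    have hp := Real.pi_gt_three
    have h2 : (72 * Real.pi * (1 + 4 * Real.pi ^ 2 * ξ ^ 2)) ^ (d + 2) ≤
        (72 * Real.pi * 2 ^ 2 * Real.pi ^ 2) ^ (d + 2) * (2 ^ (d + 1) * (1 + (ξ ^ 2) ^ (d + 2))) := by
      calc (72 * Real.pi * (1 + 4 * Real.pi ^ 2 * ξ ^ 2)) ^ (d + 2)
          ≤ (72 * Real.pi * 2 ^ 2 * Real.pi ^ 2 * (1 + ξ ^ 2)) ^ (d + 2) := by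
            refine pow_le_pow_left₀ (by positivity) ?_ _
            have : 1 ≤ 4 * Real.pi ^ 2 := by nlinarith
            nlinarith
        _ = (72 * Real.pi * 2 ^ 2 * Real.pi ^ 2) ^ (d + 2) * (1 + ξ ^ 2) ^ (d + 2) := mul_pow _ _ _
        _ ≤ _ := by
            gcongr
            have := add_pow_le (zero_le_one (α := ℝ)) (sq_nonneg ξ) (d + 2)
            simpa using this
    calc ‖g ξ‖ * (72 * Real.pi * (1 + 4 * Real.pi ^ 2 * ξ ^ 2)) ^ (d + 2)
        ≤ ‖g ξ‖ * ((72 * Real.pi * 2 ^ 2 * Real.pi ^ 2) ^ (d + 2) * (2 ^ (d + 1) * (1 + (ξ ^ 2) ^ (d + 2)))) := by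
          gcongr
      _ = _ := by
          rw [pow_mul ‖ξ‖ 2, Real.norm_eq_abs, sq_abs]; ring
  have h2 := h.2
  rw [hasFiniteIntegral_iff_enorm] at h2
  refine lt_of_le_of_lt (le_of_eq ?_) h2
  refine lintegral_congr fun ξ => ?_
  rw [enorm_mul, ← ofReal_norm (angleWeight d ξ : ℂ), Complex.norm_real, Real.norm_of_nonneg (angleWeight_nonneg d ξ)]

/-- The kernel `∫ g(ξ) E_{t(2+2πiξ)}(z, w) dξ`. -/
def specKernel {d : ℕ} (g : ℝ → ℂ) (t : ℝ) (z w : Space d) : ℂ := ∫ ξ, g ξ * heatC (ctime t ξ) z w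

lemma continuous_specKernel_integrand {d : ℕ} (g : SchwartzMap ℝ ℂ) {t : ℝ} (h0 : 0 < t) :
    Continuous fun q : (Space d × Space d) × ℝ => g q.2 * heatC (ctime t q.2) q.1.1 q.1.2 := by
  refine (g.continuous.comp continuous_snd).mul ?_
  refine continuous_heatC.comp_continuous
    (f := fun q : (Space d × Space d) × ℝ => (ctime t q.2, q.1.1, q.1.2)) ?_ (fun q => ?_)
  · exact ((continuous_ctime_right t).comp continuous_snd).prodMk continuous_fst
  · show 0 < (ctime t q.2).re
    rw [ctime_re]; linarith

lemma stronglyMeasurable_specKernel {d : ℕ} (g : SchwartzMap ℝ ℂ) {t : ℝ} (h0 : 0 < t) :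
    StronglyMeasurable (Function.uncurry (specKernel (d := d) g t)) :=
  StronglyMeasurable.integral_prod_right (f := fun (q : Space d × Space d) ξ => g ξ * heatC (ctime t ξ) q.1 q.2)
    (continuous_specKernel_integrand g h0).stronglyMeasurable

lemma specKernel_comm {d : ℕ} (g : ℝ → ℂ) (t : ℝ) (z w : Space d) : specKernel g t z w = specKernel g t w z := by
  simp only [specKernel, heatC_comm _ z w]

lemma conj_specKernel {d : ℕ} {g : ℝ → ℂ} (hg : ∀ ξ, (starRingEnd ℂ) (g ξ) = g (-ξ)) {t : ℝ} (h0 : 0 < t)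
    (z w : Space d) : (starRingEnd ℂ) (specKernel g t z w) = specKernel g t z w := by
  rw [specKernel, ← integral_conj, ← integral_neg_eq_self]
  refine integral_congr_ae (.of_forall fun ξ => ?_)
  simp only [map_mul]
  rw [hg, neg_neg, ← heatC_conj (by rw [ctime_re]; linarith), conj_ctime, neg_neg]

lemma norm_heatC_le_const {d : ℕ} {ζ : ℂ} (h0 : 0 < ζ.re) (h2 : ζ.re ≤ 2) (z w : Space d) :
    ‖heatC ζ z w‖ ≤ ζ.re ^ (-hdim d) := by
  refine (norm_heatC_le h0 h2 z w).trans ?_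
  refine mul_le_of_le_one_right (by positivity) (Real.exp_le_one_iff.2 ?_)
  have := sqN_nonneg (z - w)
  have : 0 ≤ ζ.re / (36 * ‖ζ‖ ^ 2) * sqN (z - w) := by positivity
  linarith

lemma integrable_specKernel_integrand {d : ℕ} (g : SchwartzMap ℝ ℂ) {t : ℝ} (h0 : 0 < t) (h1 : t ≤ 1)
    (z w : Space d) : Integrable fun ξ => g ξ * heatC (ctime t ξ) z w := by
  refine Integrable.mul_bdd (c := (2 * t) ^ (-hdim d)) g.integrable ?_ (.of_forall fun ξ => ?_)
  · have : Continuous fun ξ => heatC (ctime t ξ) z w :=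
      continuous_heatC.comp_continuous (f := fun ξ : ℝ => (ctime t ξ, z, w))
        ((continuous_ctime_right t).prodMk continuous_const)
        (fun ξ => by show 0 < (ctime t ξ).re; rw [ctime_re]; linarith)
    exact this.aestronglyMeasurable
  · have := norm_heatC_le_const (d := d) (ζ := ctime t ξ) (by rw [ctime_re]; linarith)
      (by rw [ctime_re]; linarith) z w
    rwa [ctime_re] at this

lemma norm_specKernel_le {d : ℕ} (g : SchwartzMap ℝ ℂ) {t : ℝ} (h0 : 0 < t) (h1 : t ≤ 1) (z w : Space d) :
    ‖specKernel g t z w‖ ≤ (∫ ξ, ‖g ξ‖) * (2 * t) ^ (-hdim d) := by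
  rw [← integral_mul_const]
  refine norm_integral_le_of_norm_le (g.integrable.norm.mul_const _) (.of_forall fun ξ => ?_)
  rw [norm_mul]
  have := norm_heatC_le_const (d := d) (ζ := ctime t ξ) (by rw [ctime_re]; linarith)
    (by rw [ctime_re]; linarith) z w
  rw [ctime_re] at this
  gcongr

/-- Tonelli passes a weighted `L¹` bound from the heat kernels to their superposition. It is used
with the weight 1 for Schur's test and with the weight `‖z - w‖` for the first moment. -/
lemma lintegral_specKernel_mul_le {d : ℕ} (g : SchwartzMap ℝ ℂ) {t : ℝ} (h0 : 0 < t) (z : Space d)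
    {φ : Space d → ℝ≥0∞} (hφ : Measurable φ) {b : ℝ≥0∞}
    (h : ∀ ξ, ∫⁻ w, ‖heatC (ctime t ξ) z w‖ₑ * φ w ≤ b * ENNReal.ofReal (angleWeight d ξ)) :
    ∫⁻ w, ‖specKernel g t z w‖ₑ * φ w ≤ b * densityNorm d g := by
  have hc : Continuous fun q : Space d × ℝ => g q.2 * heatC (ctime t q.2) z q.1 :=
    (continuous_specKernel_integrand g h0).comp (by fun_prop : Continuous fun q : Space d × ℝ => ((z, q.1), q.2))
  have hm : AEMeasurable (fun q : Space d × ℝ => ‖g q.2 * heatC (ctime t q.2) z q.1‖ₑ * φ q.1)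
      ((volume : Measure (Space d)).prod (volume : Measure ℝ)) :=
    hc.enorm.aemeasurable.mul (hφ.comp measurable_fst).aemeasurable
  calc ∫⁻ w, ‖specKernel g t z w‖ₑ * φ w
      ≤ ∫⁻ w, ∫⁻ ξ, ‖g ξ * heatC (ctime t ξ) z w‖ₑ * φ w := by
        refine lintegral_mono fun w => ?_
        dsimp only
        rw [lintegral_mul_const]
        · gcongr
          exact enorm_integral_le_lintegral_enorm _
        · exact (hc.comp (by fun_prop : Continuous fun ξ : ℝ => (w, ξ))).enorm.measurable
    _ = ∫⁻ ξ, ∫⁻ w, ‖g ξ * heatC (ctime t ξ) z w‖ₑ * φ w := lintegral_lintegral_swap hm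
    _ ≤ ∫⁻ ξ, b * (‖g ξ‖ₑ * ENNReal.ofReal (angleWeight d ξ)) := by
        refine lintegral_mono fun ξ => ?_
        simp only [enorm_mul, mul_assoc]
        rw [lintegral_const_mul' _ _ enorm_ne_top, mul_left_comm]
        gcongr
        exact h ξ
    _ = _ := by
        rw [lintegral_const_mul, densityNorm]
        exact g.continuous.enorm.measurable.mul (continuous_angleWeight d).measurable.ennreal_ofReal

lemma lintegral_specKernel_le {d : ℕ} (g : SchwartzMap ℝ ℂ) {t : ℝ} (h0 : 0 < t) (h1 : t ≤ 1) (z : Space d) :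
    ∫⁻ w, ‖specKernel g t z w‖ₑ ≤ densityNorm d g := by
  have := lintegral_specKernel_mul_le g h0 z (φ := fun _ => 1) measurable_const (b := 1)
    (fun ξ => by simpa using lintegral_heatC_ctime_le h0 h1 ξ z)
  simpa using this

lemma lintegral_specKernel_mul_norm_le {d : ℕ} (g : SchwartzMap ℝ ℂ) {t : ℝ} (h0 : 0 < t) (h1 : t ≤ 1)
    (z : Space d) :
    ∫⁻ w, ‖specKernel g t z w‖ₑ * ‖z - w‖ₑ ≤ ENNReal.ofReal (Real.sqrt t) * densityNorm d g :=
  lintegral_specKernel_mul_le g h0 z (by fun_prop) (fun ξ => by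
    rw [← ENNReal.ofReal_mul (Real.sqrt_nonneg t)]
    exact lintegral_heatC_ctime_mul_norm_le h0 h1 ξ z)

lemma lintegral_specKernel_sub_le {d : ℕ} (g : SchwartzMap ℝ ℂ) {t : ℝ} (h0 : 0 < t) (h1 : t ≤ 1)
    (w w' : Space d) :
    ∫⁻ z, ‖specKernel g t z w - specKernel g t z w'‖ₑ ≤
      ENNReal.ofReal (heatLip d * (‖w - w'‖ / Real.sqrt t)) * densityNorm d g := by
  have hc : ∀ w : Space d, Continuous fun q : Space d × ℝ => g q.2 * heatC (ctime t q.2) q.1 w := fun w =>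
    (continuous_specKernel_integrand g h0).comp (by fun_prop : Continuous fun q : Space d × ℝ => ((q.1, w), q.2))
  have hc2 := (hc w).sub (hc w')
  calc ∫⁻ z, ‖specKernel g t z w - specKernel g t z w'‖ₑ
      ≤ ∫⁻ z, ∫⁻ ξ, ‖g ξ * heatC (ctime t ξ) z w - g ξ * heatC (ctime t ξ) z w'‖ₑ := by
        refine lintegral_mono fun z => ?_
        dsimp only
        rw [specKernel, specKernel, ← integral_sub (integrable_specKernel_integrand g h0 h1 z w)
          (integrable_specKernel_integrand g h0 h1 z w')]
        exact enorm_integral_le_lintegral_enorm _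
    _ = ∫⁻ ξ, ∫⁻ z, ‖g ξ * heatC (ctime t ξ) z w - g ξ * heatC (ctime t ξ) z w'‖ₑ :=
        lintegral_lintegral_swap hc2.enorm.aemeasurable
    _ ≤ ∫⁻ ξ, ENNReal.ofReal (heatLip d * (‖w - w'‖ / Real.sqrt t)) *
          (‖g ξ‖ₑ * ENNReal.ofReal (angleWeight d ξ)) := by
        refine lintegral_mono fun ξ => ?_
        simp only [← mul_sub, enorm_mul]
        rw [lintegral_const_mul' _ _ enorm_ne_top, mul_left_comm, mul_comm (ENNReal.ofReal (heatLip d * _))]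
        gcongr
        exact lintegral_heatC_ctime_sub_le h0 h1 ξ w w'
    _ = _ := by
        rw [lintegral_const_mul, densityNorm]
        exact g.continuous.enorm.measurable.mul (continuous_angleWeight d).measurable.ennreal_ofReal

lemma isSchurKernel_specKernel {d : ℕ} (g : SchwartzMap ℝ ℂ) {t : ℝ} (h0 : 0 < t) (h1 : t ≤ 1) :
    IsSchurKernel (specKernel (d := d) g t) (densityNorm d g).toNNReal where
  meas := stronglyMeasurable_specKernel g h0
  left z := by
    rw [ENNReal.coe_toNNReal (densityNorm_lt_top d g).ne]
    exact lintegral_specKernel_le g h0 h1 z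
  right w := by
    rw [ENNReal.coe_toNNReal (densityNorm_lt_top d g).ne]
    simp_rw [fun z => specKernel_comm g t z w]
    exact lintegral_specKernel_le g h0 h1 w

/-! ### The action on spectral components -/

lemma sv_nonneg {d : ℕ} (θ : ℕ × ℝ) : 0 ≤ sv d θ := by rw [sv_eq]; positivity

lemma continuous_sv (d : ℕ) : Continuous (sv d) := by unfold sv spectralValue; fun_prop

lemma norm_cexp_neg_mul (ζ : ℂ) (s : ℝ) : ‖Complex.exp (-ζ * s)‖ = Real.exp (-ζ.re * s) := by
  rw [Complex.norm_exp, Complex.re_mul_ofReal, Complex.neg_re]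

lemma kerOp_specKernel {d : ℕ} (g : SchwartzMap ℝ ℂ) {t : ℝ} (h0 : 0 < t) (h1 : t ≤ 1) {u : Space d → ℂ}
    (hu : Integrable u) (z : Space d) :
    kerOp (specKernel g t) u z = ∫ ξ, g ξ * ∫ w, heatC (ctime t ξ) z w * u w := by
  have hc : Continuous fun q : Space d × ℝ => g q.2 * heatC (ctime t q.2) z q.1 :=
    (continuous_specKernel_integrand g h0).comp (by fun_prop : Continuous fun q : Space d × ℝ => ((z, q.1), q.2))
  have hi : Integrable (fun q : Space d × ℝ => g q.2 * heatC (ctime t q.2) z q.1 * u q.1)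
      ((volume : Measure (Space d)).prod (volume : Measure ℝ)) := by
    refine Integrable.mono' ((hu.norm.mul_prod g.integrable.norm).mul_const ((2 * t) ^ (-hdim d)))
      (hc.aestronglyMeasurable.mul hu.1.comp_fst) (.of_forall fun q => ?_)
    rw [norm_mul, norm_mul]
    have := norm_heatC_le_const (d := d) (ζ := ctime t q.2) (by rw [ctime_re]; linarith)
      (by rw [ctime_re]; linarith) z q.1
    rw [ctime_re] at this
    calc ‖g q.2‖ * ‖heatC (ctime t q.2) z q.1‖ * ‖u q.1‖ ≤ ‖g q.2‖ * (2 * t) ^ (-hdim d) * ‖u q.1‖ := by gcongr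
      _ = _ := by ring
  rw [kerOp]
  simp_rw [specKernel, ← integral_mul_const, ← integral_const_mul, ← mul_assoc]
  exact integral_integral_swap hi

lemma integral_density_mul {d : ℕ} (g : SchwartzMap ℝ ℂ) (t : ℝ) {k : ℕ × ℝ → ℂ}
    (hk : AEStronglyMeasurable k specMeas)
    (hi : Integrable (fun θ => Real.exp (-(2 * t) * sv d θ) * ‖k θ‖) specMeas) :
    ∫ ξ, g ξ * ∫ θ, Complex.exp (-ctime t ξ * sv d θ) * k θ ∂specMeas =
      ∫ θ, (∫ ξ, g ξ * Complex.exp (-ctime t ξ * sv d θ)) * k θ ∂specMeas := by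
  have hc : Continuous fun q : ℝ × (ℕ × ℝ) => g q.1 * Complex.exp (-ctime t q.1 * sv d q.2) := by
    have h1 := continuous_ctime_right t
    have h2 := continuous_sv d
    have h3 := g.continuous
    fun_prop
  have hint : Integrable (fun q : ℝ × (ℕ × ℝ) => g q.1 * Complex.exp (-ctime t q.1 * sv d q.2) * k q.2)
      ((volume : Measure ℝ).prod specMeas) := by
    refine Integrable.mono' (g.integrable.norm.mul_prod hi) (hc.aestronglyMeasurable.mul hk.comp_snd)
      (.of_forall fun q => ?_)
    rw [norm_mul, norm_mul, norm_cexp_neg_mul, ctime_re, mul_assoc]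
  simp_rw [← integral_const_mul, ← integral_mul_const, ← mul_assoc]
  exact integral_integral_swap hint

lemma kerOp_specKernel_eq_integral {d : ℕ} (g : SchwartzMap ℝ ℂ) {t : ℝ} (h0 : 0 < t) (h1 : t ≤ 1)
    {u : Space d → ℂ} (hc : Continuous u) (hu : Integrable u) (z : Space d) :
    kerOp (specKernel g t) u z =
      ∫ θ, (∫ ξ, g ξ * Complex.exp (-ctime t ξ * sv d θ)) * kap u z θ ∂specMeas := by
  rw [kerOp_specKernel g h0 h1 hu, ← integral_density_mul g t
    (stronglyMeasurable_kap hc hu z).aestronglyMeasurable (integrable_exp_mul_kap hc hu (by linarith) z)]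
  refine integral_congr_ae (.of_forall fun ξ => ?_)
  simp only
  rw [integral_heatC_mul_eq hc hu (by rw [ctime_re]; linarith)]

/-- The heat semigroup acting on functions. -/
lemma integral_heatC_integral_heatC {d : ℕ} {ζ η : ℂ} (hζ : 0 < ζ.re) (hζ2 : ζ.re ≤ 2) (hη : 0 < η.re)
    (hη2 : η.re ≤ 2) {u : Space d → ℂ} (hu : Integrable u) (z : Space d) :
    ∫ v, heatC ζ z v * ∫ w, heatC η v w * u w = ∫ w, heatC (ζ + η) z w * u w := by
  have hz : Continuous fun v : Space d => heatC ζ z v := by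
    simp_rw [fun v => heatC_comm ζ z v]
    exact continuous_heatC_fst hζ z
  have hzi : Integrable fun v : Space d => heatC ζ z v := by
    refine ⟨hz.aestronglyMeasurable, ?_⟩
    rw [hasFiniteIntegral_iff_enorm]
    exact (lintegral_heatC_le hζ hζ2 z).trans_lt ENNReal.ofReal_lt_top
  have hi : Integrable (fun q : Space d × Space d => heatC ζ z q.1 * heatC η q.1 q.2 * u q.2)
      ((volume : Measure (Space d)).prod (volume : Measure (Space d))) := by
    refine Integrable.mono' ((hzi.norm.mul_prod hu.norm).mul_const (η.re ^ (-hdim d)))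
      (((hz.comp continuous_fst).mul (continuous_heatC_left hη)).aestronglyMeasurable.mul hu.1.comp_snd)
      (.of_forall fun q => ?_)
    rw [norm_mul, norm_mul]
    have := norm_heatC_le_const hη hη2 q.1 q.2
    calc ‖heatC ζ z q.1‖ * ‖heatC η q.1 q.2‖ * ‖u q.2‖ ≤ ‖heatC ζ z q.1‖ * η.re ^ (-hdim d) * ‖u q.2‖ := by gcongr
      _ = _ := by ring
  simp_rw [← integral_const_mul, ← mul_assoc]
  rw [integral_integral_swap hi]
  refine integral_congr_ae (.of_forall fun w => ?_)
  simp only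
  rw [integral_mul_const, integral_heatC_mul hζ hη]

/-- The image of `u` is no longer compactly supported, so its spectral components are not computed.
Composing the heat kernels first, and only then applying the result to `u`, avoids this. -/
lemma integral_heatC_kerOp {d : ℕ} (g : SchwartzMap ℝ ℂ) {t : ℝ} (h0 : 0 < t) (h1 : t ≤ 1)
    {ζ : ℂ} (hζ : 0 < ζ.re) (hζ2 : ζ.re ≤ 2) {u : Space d → ℂ} (hc : Continuous u) (hu : Integrable u)
    (z : Space d) :
    ∫ v, heatC ζ z v * kerOp (specKernel g t) u v =
      ∫ θ, Complex.exp (-ζ * sv d θ) *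
        ((∫ ξ, g ξ * Complex.exp (-ctime t ξ * sv d θ)) * kap u z θ) ∂specMeas := by
  have hz : Continuous fun v : Space d => heatC ζ z v := by
    simp_rw [fun v => heatC_comm ζ z v]
    exact continuous_heatC_fst hζ z
  have hzi : Integrable fun v : Space d => heatC ζ z v := by
    refine ⟨hz.aestronglyMeasurable, ?_⟩
    rw [hasFiniteIntegral_iff_enorm]
    exact (lintegral_heatC_le hζ hζ2 z).trans_lt ENNReal.ofReal_lt_top
  have hre : ∀ ξ, 0 < (ctime t ξ).re := fun ξ => by rw [ctime_re]; linarith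
  have hre2 : ∀ ξ, (ctime t ξ).re ≤ 2 := fun ξ => by rw [ctime_re]; linarith
  set M : ℝ := (2 * t) ^ (-hdim d) * ∫ w, ‖u w‖ with hM
  have hb : ∀ ξ v, ‖∫ w, heatC (ctime t ξ) v w * u w‖ ≤ M := fun ξ v => by
    rw [hM, ← integral_const_mul]
    refine norm_integral_le_of_norm_le (hu.norm.const_mul _) (.of_forall fun w => ?_)
    rw [norm_mul]
    have := norm_heatC_le_const (hre ξ) (hre2 ξ) v w
    rw [ctime_re] at this
    gcongr
  have hm : StronglyMeasurable fun q : Space d × ℝ => ∫ w, heatC (ctime t q.2) q.1 w * u w := by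
    refine StronglyMeasurable.integral_prod_right
      (f := fun (q : Space d × ℝ) (w : Space d) => heatC (ctime t q.2) q.1 w * u w) ?_
    refine Continuous.stronglyMeasurable (Continuous.mul ?_ (hc.comp continuous_snd))
    exact continuous_heatC.comp_continuous
      (f := fun q : (Space d × ℝ) × Space d => (ctime t q.1.2, q.1.1, q.2))
      (((continuous_ctime_right t).comp (by fun_prop)).prodMk (by fun_prop)) (fun q => hre _)
  have hi : Integrable (fun q : Space d × ℝ => heatC ζ z q.1 * (g q.2 * ∫ w, heatC (ctime t q.2) q.1 w * u w))
      ((volume : Measure (Space d)).prod (volume : Measure ℝ)) := by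
    refine Integrable.mono' ((hzi.norm.mul_prod g.integrable.norm).mul_const M)
      (((hz.comp continuous_fst).aestronglyMeasurable).mul
        ((g.continuous.comp continuous_snd).aestronglyMeasurable.mul hm.aestronglyMeasurable))
      (.of_forall fun q => ?_)
    rw [norm_mul, norm_mul, ← mul_assoc]
    gcongr
    exact hb _ _
  have e0 : ∀ v, heatC ζ z v * kerOp (specKernel g t) u v =
      ∫ ξ, heatC ζ z v * (g ξ * ∫ w, heatC (ctime t ξ) v w * u w) := fun v => by
    rw [kerOp_specKernel g h0 h1 hu v]
    exact (integral_const_mul _ _).symm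
  simp_rw [e0]
  rw [integral_integral_swap hi]
  have e : ∀ ξ, ∫ v, heatC ζ z v * (g ξ * ∫ w, heatC (ctime t ξ) v w * u w) =
      g ξ * ∫ θ, Complex.exp (-ctime t ξ * sv d θ) * (Complex.exp (-ζ * sv d θ) * kap u z θ) ∂specMeas := by
    intro ξ
    simp_rw [mul_left_comm _ (g ξ)]
    rw [integral_const_mul, integral_heatC_integral_heatC hζ hζ2 (hre ξ) (hre2 ξ) hu,
      integral_heatC_mul_eq hc hu (by rw [Complex.add_re]; have := hre ξ; linarith)]
    congr 1
    refine integral_congr_ae (.of_forall fun θ => ?_)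
    simp only
    rw [← mul_assoc, ← Complex.exp_add]
    congr 2; ring
  simp_rw [e]
  have hk := (stronglyMeasurable_kap hc hu z).aestronglyMeasurable (μ := specMeas)
  have hec : Continuous fun θ => Complex.exp (-ζ * sv d θ) := by
    have := continuous_sv d
    fun_prop
  rw [integral_density_mul g t (k := fun θ => Complex.exp (-ζ * sv d θ) * kap u z θ)
    (hec.aestronglyMeasurable.mul hk)]
  · refine integral_congr_ae (.of_forall fun θ => ?_)
    simp only; ring
  · refine (integrable_exp_mul_kap hc hu (by linarith : 0 < 2 * t) z).mono ?_ (.of_forall fun θ => ?_)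
    · have : Continuous fun θ => Real.exp (-(2 * t) * sv d θ) := by
        have := continuous_sv d
        fun_prop
      exact this.aestronglyMeasurable.mul (hec.aestronglyMeasurable.mul hk).norm
    · simp only [norm_mul, norm_cexp_neg_mul, Real.norm_eq_abs, Real.abs_exp, abs_norm]
      gcongr
      refine mul_le_of_le_one_left (norm_nonneg _) (Real.exp_le_one_iff.2 ?_)
      have := sv_nonneg (d := d) θ
      nlinarith [mul_nonneg hζ.le this]

/-- Multiplicativity of the calculus on the level of kernels: both operators are superpositions of
heat operators, whose exponents add. -/
lemma kerOp_kerOp_specKernel {d : ℕ} (g g' : SchwartzMap ℝ ℂ) {t t' : ℝ} (h0 : 0 < t) (h1 : t ≤ 1)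
    (h0' : 0 < t') (h1' : t' ≤ 1) {u : Space d → ℂ} (hc : Continuous u) (hu : Integrable u) (z : Space d) :
    kerOp (specKernel g t) (kerOp (specKernel g' t') u) z =
      ∫ θ, (∫ ξ, g ξ * Complex.exp (-ctime t ξ * sv d θ)) *
        ((∫ ξ, g' ξ * Complex.exp (-ctime t' ξ * sv d θ)) * kap u z θ) ∂specMeas := by
  have hi : Integrable (kerOp (specKernel g' t') u) := memLp_one_iff_integrable.1
    ((isSchurKernel_specKernel g' h0' h1').memLp_kerOp le_rfl ENNReal.one_ne_top (memLp_one_iff_integrable.2 hu))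
  rw [kerOp_specKernel g h0 h1 hi]
  have hs : Continuous fun q : (ℕ × ℝ) × ℝ => g' q.2 * Complex.exp (-ctime t' q.2 * sv d q.1) := by
    have h1 := continuous_ctime_right t'
    have h2 := continuous_sv d
    have h3 := g'.continuous
    fun_prop
  have hm : StronglyMeasurable fun θ => ∫ ξ, g' ξ * Complex.exp (-ctime t' ξ * sv d θ) :=
    StronglyMeasurable.integral_prod_right
      (f := fun (θ : ℕ × ℝ) ξ => g' ξ * Complex.exp (-ctime t' ξ * sv d θ)) hs.stronglyMeasurable
  have hb : ∀ θ, ‖∫ ξ, g' ξ * Complex.exp (-ctime t' ξ * sv d θ)‖ ≤ ∫ ξ, ‖g' ξ‖ := fun θ => by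
    refine norm_integral_le_of_norm_le g'.integrable.norm (.of_forall fun ξ => ?_)
    rw [norm_mul, norm_cexp_neg_mul, ctime_re]
    refine mul_le_of_le_one_right (norm_nonneg _) (Real.exp_le_one_iff.2 ?_)
    have := sv_nonneg (d := d) θ
    nlinarith [mul_nonneg h0'.le this]
  have hk := (stronglyMeasurable_kap hc hu z)
  rw [← integral_density_mul g t
    (k := fun θ => (∫ ξ, g' ξ * Complex.exp (-ctime t' ξ * sv d θ)) * kap u z θ) (hm.mul hk).aestronglyMeasurable]
  · refine integral_congr_ae (.of_forall fun ξ => ?_)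
    simp only
    rw [integral_heatC_kerOp g' h0' h1' (by rw [ctime_re]; linarith) (by rw [ctime_re]; linarith) hc hu]
  · refine ((integrable_exp_mul_kap hc hu (by linarith : 0 < 2 * t) z).mul_const (∫ ξ, ‖g' ξ‖)).mono' ?_
      (.of_forall fun θ => ?_)
    · have : Continuous fun θ => Real.exp (-(2 * t) * sv d θ) := by
        have := continuous_sv d
        fun_prop
      exact this.aestronglyMeasurable.mul (hm.mul hk).norm.aestronglyMeasurable
    · rw [norm_mul, norm_norm, norm_mul, Real.norm_eq_abs, Real.abs_exp]
      calc _ ≤ Real.exp (-(2 * t) * sv d θ) * ((∫ ξ, ‖g' ξ‖) * ‖kap u z θ‖) := by gcongr; exact hb θ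
        _ = _ := by ring

/-! ### Functional calculus on `L^p` -/

/-- Smooth compactly supported real symbols. -/
structure IsTestSymbol (F : ℝ → ℝ) : Prop where
  smooth : ContDiff ℝ ∞ F
  compact : HasCompactSupport F

/-- Measurable functions that are bounded on `[1, ∞)`, which contains the spectrum. -/
def IsBddSymbol (F : ℝ → ℝ) : Prop := Measurable F ∧ ∃ M, ∀ s, 1 ≤ s → |F s| ≤ M

lemma IsTestSymbol.exists_bound {F : ℝ → ℝ} (hF : IsTestSymbol F) : ∃ M, ∀ s, |F s| ≤ M :=
  hF.compact.exists_bound_of_continuous hF.smooth.continuous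

lemma IsTestSymbol.isBddSymbol {F : ℝ → ℝ} (hF : IsTestSymbol F) : IsBddSymbol F := by
  obtain ⟨M, hM⟩ := hF.exists_bound
  exact ⟨hF.smooth.continuous.measurable, M, fun s _ => hM s⟩

lemma IsTestSymbol.mul {F G : ℝ → ℝ} (hF : IsTestSymbol F) (hG : IsTestSymbol G) : IsTestSymbol fun s => F s * G s :=
  ⟨hF.smooth.mul hG.smooth, hF.compact.mul_right⟩

lemma IsTestSymbol.const_mul {F : ℝ → ℝ} (hF : IsTestSymbol F) (c : ℝ) : IsTestSymbol fun s => c * F s :=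
  ⟨contDiff_const.mul hF.smooth, hF.compact.mul_left⟩

lemma IsTestSymbol.comp_mul_left {F : ℝ → ℝ} (hF : IsTestSymbol F) {t : ℝ} (ht : 0 < t) :
    IsTestSymbol fun s => F (t * s) := by
  refine ⟨hF.smooth.comp (contDiff_const.mul contDiff_id), ?_⟩
  have := hF.compact.comp_homeomorph (Homeomorph.mulLeft₀ t ht.ne')
  exact this

lemma IsTestSymbol.add {F G : ℝ → ℝ} (hF : IsTestSymbol F) (hG : IsTestSymbol G) : IsTestSymbol fun s => F s + G s :=
  ⟨hF.smooth.add hG.smooth, hF.compact.add hG.compact⟩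

lemma isTestSymbol_zero : IsTestSymbol fun _ => 0 := ⟨contDiff_const, HasCompactSupport.zero⟩

lemma IsTestSymbol.sum {ι : Type*} {F : ι → ℝ → ℝ} (S : Finset ι) (hF : ∀ i ∈ S, IsTestSymbol (F i)) :
    IsTestSymbol fun s => ∑ i ∈ S, F i s := by
  classical
  induction S using Finset.induction_on with
  | empty => simpa using isTestSymbol_zero
  | insert i S hi ih =>
    simp only [Finset.sum_insert hi]
    exact (hF i (Finset.mem_insert_self _ _)).add (ih fun j hj => hF j (Finset.mem_insert_of_mem hj))

/-- Test functions on `ℝ × ℝ^d`. -/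
structure IsTestFun {d : ℕ} (u : Space d → ℂ) : Prop where
  smooth : ContDiff ℝ ∞ u
  compact : HasCompactSupport u

lemma IsTestFun.memLp {d : ℕ} {u : Space d → ℂ} (hu : IsTestFun u) (p : ℝ≥0∞) : MemLp u p volume :=
  hu.smooth.continuous.memLp_of_hasCompactSupport hu.compact

/-- The value of `F(H_par) u`. -/
def symbolOp {d : ℕ} (F : ℝ → ℝ) (u : Space d → ℂ) (z : Space d) : ℂ := ∫ θ, (F (sv d θ) : ℂ) * kap u z θ ∂specMeas

lemma integrable_symbol_mul_kap {d : ℕ} (hd : 1 ≤ d) {F : ℝ → ℝ} (hF : IsBddSymbol F) {u : Space d → ℂ}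
    (hu : IsTestFun u) (z : Space d) : Integrable (fun θ => (F (sv d θ) : ℂ) * kap u z θ) specMeas := by
  obtain ⟨hm, M, hM⟩ := hF
  refine (integrable_kap hd hu.smooth hu.compact z).bdd_mul (c := M) ?_ (.of_forall fun θ => ?_)
  · exact (Complex.measurable_ofReal.comp (hm.comp (continuous_sv d).measurable)).aestronglyMeasurable
  · rw [Complex.norm_real]
    exact hM _ (one_le_sv hd θ)

/-- The bounded operator `A` acts on test functions as `F(H_par)`. -/
def Represents {d : ℕ} {p : ℝ≥0∞} [Fact (1 ≤ p)] (F : ℝ → ℝ) (A : LpSpace d p →L[ℂ] LpSpace d p) : Prop :=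
  ∀ u : Space d → ℂ, IsTestFun u → ∀ hu : MemLp u p volume, A (hu.toLp u) =ᵐ[volume] symbolOp F u

/-- The symbol on `ℝ × ℕ` defined by a function of the spectral value. -/
def toSymbol (d : ℕ) (F : ℝ → ℝ) (τ : ℝ) (k : ℕ) : ℂ := (F (spectralValue d τ k) : ℂ)

lemma multiplierOp_toSymbol {d : ℕ} (hd : 1 ≤ d) {F : ℝ → ℝ} (hF : IsBddSymbol F) {u : Space d → ℂ}
    (hu : IsTestFun u) (z : Space d) : multiplierOp (toSymbol d F) u z = symbolOp F u z :=
  multiplierOp_eq_integral (integrable_symbol_mul_kap hd hF hu z)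

lemma Represents.isMultiplierExtension {d : ℕ} (hd : 1 ≤ d) {p : ℝ≥0∞} [Fact (1 ≤ p)] {F : ℝ → ℝ}
    (hF : IsBddSymbol F) {A : LpSpace d p →L[ℂ] LpSpace d p} :
    Represents F A ↔ IsMultiplierExtension (toSymbol d F) A := by
  constructor
  · intro h u hu hc hu'
    refine (h u ⟨hu, hc⟩ hu').trans (.of_forall fun z => ?_)
    exact (multiplierOp_toSymbol hd hF ⟨hu, hc⟩ z).symm
  · intro h u hu hu'
    refine (h u hu.smooth hu.compact hu').trans (.of_forall fun z => ?_)
    exact (multiplierOp_toSymbol hd hF hu z)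

/-- Bounded operators that agree on test functions are equal. -/
lemma clm_ext_of_test {d : ℕ} {p : ℝ≥0∞} [hp : Fact (1 ≤ p)] (hp' : p ≠ ⊤) {A B : LpSpace d p →L[ℂ] LpSpace d p}
    (h : ∀ u : Space d → ℂ, IsTestFun u → ∀ hu : MemLp u p volume, A (hu.toLp u) = B (hu.toLp u)) : A = B := by
  refine ContinuousLinearMap.ext fun f => ?_
  have hd := Lp.dense_hasCompactSupport_contDiff (E := Space d) (F := ℂ) (μ := volume) hp'
  refine congrFun (Continuous.ext_on hd A.continuous B.continuous ?_) f
  rintro f ⟨u, hfu, hc, hs⟩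
  have hu : MemLp u p volume := (memLp_congr_ae hfu).1 (Lp.memLp f)
  have : f = hu.toLp u := Lp.ext (hfu.trans hu.coeFn_toLp.symm)
  rw [this]
  exact h u ⟨hs, hc⟩ hu

/-- Only the values on `[1, ∞)` matter because the spectral values are at least `d ≥ 1`. Symbols
such as negative powers may therefore behave arbitrarily near 0. -/
lemma Represents.unique {d : ℕ} {p : ℝ≥0∞} [Fact (1 ≤ p)] (hp' : p ≠ ⊤) {F G : ℝ → ℝ} (hd : 1 ≤ d)
    (hFG : ∀ s, 1 ≤ s → F s = G s)
    {A B : LpSpace d p →L[ℂ] LpSpace d p} (hA : Represents F A) (hB : Represents G B) : A = B := by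
  refine clm_ext_of_test hp' fun u hu hu' => Lp.ext ((hA u hu hu').trans (.trans (.of_forall fun z => ?_)
    (hB u hu hu').symm))
  refine integral_congr_ae (.of_forall fun θ => ?_)
  simp only [hFG _ (one_le_sv hd θ)]

lemma Represents.add {d : ℕ} (hd : 1 ≤ d) {p : ℝ≥0∞} [Fact (1 ≤ p)] {F G : ℝ → ℝ}
    (hF : IsBddSymbol F) (hG : IsBddSymbol G)
    {A B : LpSpace d p →L[ℂ] LpSpace d p} (hA : Represents F A) (hB : Represents G B) :
    Represents (fun s => F s + G s) (A + B) := by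
  intro u hu hu'
  filter_upwards [Lp.coeFn_add (A (hu'.toLp u)) (B (hu'.toLp u)), hA u hu hu', hB u hu hu'] with z h1 h2 h3
  rw [add_apply, h1, Pi.add_apply, h2, h3, symbolOp, symbolOp, symbolOp,
    ← integral_add (integrable_symbol_mul_kap hd hF hu z) (integrable_symbol_mul_kap hd hG hu z)]
  simp [add_mul]

lemma Represents.const_mul {d : ℕ} {p : ℝ≥0∞} [Fact (1 ≤ p)] {F : ℝ → ℝ} (c : ℝ)
    {A : LpSpace d p →L[ℂ] LpSpace d p} (hA : Represents F A) :
    Represents (fun s => c * F s) ((c : ℂ) • A) := by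
  intro u hu hu'
  filter_upwards [Lp.coeFn_smul (c : ℂ) (A (hu'.toLp u)), hA u hu hu'] with z h1 h2
  rw [smul_apply, h1, Pi.smul_apply, h2, symbolOp, symbolOp, smul_eq_mul, ← integral_const_mul]
  simp [mul_assoc]

lemma Represents.zero {d : ℕ} {p : ℝ≥0∞} [Fact (1 ≤ p)] :
    Represents (fun _ => 0) (0 : LpSpace d p →L[ℂ] LpSpace d p) := by
  intro u hu hu'
  filter_upwards [Lp.coeFn_zero ℂ p (volume : Measure (Space d))] with z _
  simp [symbolOp]

lemma represents_one {d : ℕ} (hd : 1 ≤ d) {p : ℝ≥0∞} [Fact (1 ≤ p)] :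
    Represents (fun _ => 1) (ContinuousLinearMap.id ℂ (LpSpace d p)) := by
  intro u hu hu'
  filter_upwards [hu'.coeFn_toLp] with z h1
  simp [symbolOp, h1, integral_kap hd hu.smooth hu.compact z]

/-- The operator `F(H_par)` on `L^p`. -/
def symOp (d : ℕ) (p : ℝ≥0∞) [Fact (1 ≤ p)] (F : ℝ → ℝ) : LpSpace d p →L[ℂ] LpSpace d p :=
  multiplierExt d p (toSymbol d F)

/-- By density of test functions the extension is unique, so the choice made in `multiplierExt` is
immaterial. -/
lemma Represents.symOp_eq {d : ℕ} (hd : 1 ≤ d) {p : ℝ≥0∞} [Fact (1 ≤ p)] (hp' : p ≠ ⊤) {F : ℝ → ℝ}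
    (hF : IsBddSymbol F) {A : LpSpace d p →L[ℂ] LpSpace d p} (hA : Represents F A) : symOp d p F = A := by
  have h : ∃ A : LpSpace d p →L[ℂ] LpSpace d p, IsMultiplierExtension (toSymbol d F) A :=
    ⟨A, (Represents.isMultiplierExtension hd hF).1 hA⟩
  rw [symOp, multiplierExt, dif_pos h]
  exact ((Represents.isMultiplierExtension hd hF).2 h.choose_spec).unique hp' hd (fun _ _ => rfl) hA

/-- `K` is the integral kernel of `F(H_par)`. -/
structure IsOpKernel {d : ℕ} (F : ℝ → ℝ) (K : Space d → Space d → ℂ) : Prop where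
  schur : ∃ C : ℝ≥0, IsSchurKernel K C
  bdd : ∃ M : ℝ, ∀ z w, ‖K z w‖ ≤ M
  symm : ∀ z w, K z w = K w z
  conj : ∀ z w, (starRingEnd ℂ) (K z w) = K z w
  repr : ∀ u : Space d → ℂ, IsTestFun u → ∀ z, kerOp K u z = symbolOp F u z

lemma isTestFun_integrable {d : ℕ} {u : Space d → ℂ} (hu : IsTestFun u) : Integrable u :=
  memLp_one_iff_integrable.1 (hu.memLp 1)

lemma exists_density {φ : ℝ → ℝ} (hφ : IsTestSymbol φ) :
    ∃ g : SchwartzMap ℝ ℂ, (∀ t s : ℝ, ∫ ξ, g ξ * Complex.exp (-ctime t ξ * s) = (φ (t * s) : ℂ)) ∧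
      ∀ ξ, (starRingEnd ℂ) (g ξ) = g (-ξ) := by
  obtain ⟨g, h1, h2⟩ := exists_exponential_repr hφ.smooth hφ.compact
  refine ⟨g, fun t s => ?_, h2⟩
  rw [h1]
  refine integral_congr_ae (.of_forall fun ξ => ?_)
  simp only [ctime]
  push_cast
  congr 2; ring

lemma isOpKernel_specKernel {d : ℕ} {φ : ℝ → ℝ} {g : SchwartzMap ℝ ℂ}
    (hg : ∀ t s : ℝ, ∫ ξ, g ξ * Complex.exp (-ctime t ξ * s) = (φ (t * s) : ℂ))
    (hc : ∀ ξ, (starRingEnd ℂ) (g ξ) = g (-ξ)) {t : ℝ} (h0 : 0 < t) (h1 : t ≤ 1) :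
    IsOpKernel (d := d) (fun s => φ (t * s)) (specKernel g t) where
  schur := ⟨_, isSchurKernel_specKernel g h0 h1⟩
  bdd := ⟨_, norm_specKernel_le g h0 h1⟩
  symm := specKernel_comm g t
  conj := conj_specKernel hc h0
  repr u hu z := by
    rw [kerOp_specKernel_eq_integral g h0 h1 hu.smooth.continuous (isTestFun_integrable hu), symbolOp]
    simp_rw [hg]

/-- One constant serves all scales `t ≤ 1`. These three estimates are all that the Calderón–Zygmund
argument needs about a single dyadic piece, apart from its symbol. -/
lemma exists_opKernel (d : ℕ) {φ : ℝ → ℝ} (hφ : IsTestSymbol φ) :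
    ∃ C : ℝ≥0, ∀ t : ℝ, 0 < t → t ≤ 1 → ∃ K : Space d → Space d → ℂ,
      IsOpKernel (fun s => φ (t * s)) K ∧ IsSchurKernel K C ∧
      (∀ z, ∫⁻ w, ‖K z w‖ₑ * ‖z - w‖ₑ ≤ ENNReal.ofReal (Real.sqrt t) * C) ∧
      (∀ w w', ∫⁻ z, ‖K z w - K z w'‖ₑ ≤ ENNReal.ofReal (‖w - w'‖ / Real.sqrt t) * C) := by
  obtain ⟨g, hg, hc⟩ := exists_density hφ
  have hD := (densityNorm_lt_top d g).ne
  refine ⟨(densityNorm d g).toNNReal + (ENNReal.ofReal (heatLip d) * densityNorm d g).toNNReal,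
    fun t h0 h1 => ⟨specKernel g t, isOpKernel_specKernel hg hc h0 h1,
      (isSchurKernel_specKernel g h0 h1).mono (by simp), fun z => ?_, fun w w' => ?_⟩⟩
  · refine (lintegral_specKernel_mul_norm_le g h0 h1 z).trans ?_
    rw [ENNReal.coe_add, ENNReal.coe_toNNReal hD]
    gcongr
    exact le_self_add
  · refine (lintegral_specKernel_sub_le g h0 h1 w w').trans ?_
    rw [ENNReal.coe_add, ENNReal.coe_toNNReal (ENNReal.mul_ne_top ENNReal.ofReal_ne_top hD), mul_add,
      ENNReal.ofReal_mul (heatLip_nonneg d), mul_assoc, mul_left_comm]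
    exact le_add_self

lemma IsOpKernel.exists_represents {d : ℕ} {p : ℝ≥0∞} [hp : Fact (1 ≤ p)] (hp' : p ≠ ⊤) {F : ℝ → ℝ}
    {K : Space d → Space d → ℂ} (hK : IsOpKernel F K) :
    ∃ A : LpSpace d p →L[ℂ] LpSpace d p, Represents F A ∧ ∀ f : LpSpace d p, A f =ᵐ[volume] kerOp K f := by
  obtain ⟨C, hC⟩ := hK.schur
  obtain ⟨A, hA, -⟩ := hC.exists_clm p hp'
  refine ⟨A, fun u hu hu' => ?_, hA⟩
  refine (hA _).trans (.of_forall fun z => ?_)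
  rw [kerOp_congr K hu'.coeFn_toLp, hK.repr u hu]

lemma IsOpKernel.symOp_apply {d : ℕ} (hd : 1 ≤ d) {p : ℝ≥0∞} [hp : Fact (1 ≤ p)] (hp' : p ≠ ⊤) {F : ℝ → ℝ}
    (hF : IsBddSymbol F) {K : Space d → Space d → ℂ} (hK : IsOpKernel F K) (f : LpSpace d p) :
    symOp d p F f =ᵐ[volume] kerOp K f := by
  obtain ⟨A, hA, h⟩ := hK.exists_represents (p := p) hp'
  rw [hA.symOp_eq hd hp' hF]
  exact h f

lemma IsTestSymbol.exists_kernel (d : ℕ) {F : ℝ → ℝ} (hF : IsTestSymbol F) :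
    ∃ K : Space d → Space d → ℂ, IsOpKernel F K := by
  obtain ⟨C, h⟩ := exists_opKernel d hF
  obtain ⟨K, hK, -⟩ := h 1 one_pos le_rfl
  exact ⟨K, by simpa using hK⟩

lemma IsTestSymbol.represents {d : ℕ} (hd : 1 ≤ d) {p : ℝ≥0∞} [hp : Fact (1 ≤ p)] (hp' : p ≠ ⊤) {F : ℝ → ℝ}
    (hF : IsTestSymbol F) : Represents F (symOp d p F) := by
  obtain ⟨K, hK⟩ := hF.exists_kernel d
  obtain ⟨A, hA, h⟩ := hK.exists_represents (p := p) hp'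
  rwa [hA.symOp_eq hd hp' hF.isBddSymbol]

lemma symOp_congr {d : ℕ} (hd : 1 ≤ d) {p : ℝ≥0∞} [hp : Fact (1 ≤ p)] (hp' : p ≠ ⊤) {F G : ℝ → ℝ}
    (hF : IsTestSymbol F) (hG : IsTestSymbol G) (h : ∀ s, 1 ≤ s → F s = G s) : symOp d p F = symOp d p G :=
  (hF.represents hd hp').unique hp' hd h (hG.represents hd hp')

lemma symOp_add {d : ℕ} (hd : 1 ≤ d) {p : ℝ≥0∞} [hp : Fact (1 ≤ p)] (hp' : p ≠ ⊤) {F G : ℝ → ℝ}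
    (hF : IsTestSymbol F) (hG : IsTestSymbol G) : symOp d p (fun s => F s + G s) = symOp d p F + symOp d p G :=
  ((hF.represents hd hp').add hd hF.isBddSymbol hG.isBddSymbol (hG.represents hd hp')).symOp_eq hd hp'
    (hF.add hG).isBddSymbol

lemma symOp_const_mul {d : ℕ} (hd : 1 ≤ d) {p : ℝ≥0∞} [hp : Fact (1 ≤ p)] (hp' : p ≠ ⊤) {F : ℝ → ℝ}
    (hF : IsTestSymbol F) (c : ℝ) : symOp d p (fun s => c * F s) = (c : ℂ) • symOp d p F :=
  ((hF.represents hd hp').const_mul c).symOp_eq hd hp' (hF.const_mul c).isBddSymbol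

lemma symOp_zero {d : ℕ} (hd : 1 ≤ d) {p : ℝ≥0∞} [hp : Fact (1 ≤ p)] (hp' : p ≠ ⊤) :
    symOp d p (fun _ => 0) = 0 :=
  Represents.zero.symOp_eq hd hp' isTestSymbol_zero.isBddSymbol

lemma symOp_sum {d : ℕ} (hd : 1 ≤ d) {p : ℝ≥0∞} [hp : Fact (1 ≤ p)] (hp' : p ≠ ⊤) {ι : Type*} {F : ι → ℝ → ℝ}
    (S : Finset ι) (hF : ∀ i ∈ S, IsTestSymbol (F i)) :
    symOp d p (fun s => ∑ i ∈ S, F i s) = ∑ i ∈ S, symOp d p (F i) := by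
  classical
  induction S using Finset.induction_on with
  | empty => simpa using symOp_zero hd hp'
  | insert i S hi ih =>
    have h := fun j hj => hF j (Finset.mem_insert_of_mem hj)
    simp only [Finset.sum_insert hi]
    rw [symOp_add hd hp' (hF i (Finset.mem_insert_self _ _)) (IsTestSymbol.sum S h), ih h]

lemma symOp_mul {d : ℕ} (hd : 1 ≤ d) {p : ℝ≥0∞} [hp : Fact (1 ≤ p)] (hp' : p ≠ ⊤) {F G : ℝ → ℝ}
    (hF : IsTestSymbol F) (hG : IsTestSymbol G) :
    symOp d p (fun s => F s * G s) = (symOp d p F).comp (symOp d p G) := by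
  refine Represents.symOp_eq hd hp' (hF.mul hG).isBddSymbol fun u hu hu' => ?_
  obtain ⟨g, hg, hgc⟩ := exists_density hF
  obtain ⟨g', hg', hgc'⟩ := exists_density hG
  have hKF := isOpKernel_specKernel (d := d) hg hgc one_pos le_rfl
  have hKG := isOpKernel_specKernel (d := d) hg' hgc' one_pos le_rfl
  simp only [one_mul] at hKF hKG
  rw [ContinuousLinearMap.comp_apply]
  refine (hKF.symOp_apply hd hp' hF.isBddSymbol _).trans (.of_forall fun z => ?_)
  rw [kerOp_congr _ (hKG.symOp_apply hd hp' hG.isBddSymbol _), kerOp_congr _ hu'.coeFn_toLp,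
    kerOp_kerOp_specKernel g g' one_pos le_rfl one_pos le_rfl hu.smooth.continuous (isTestFun_integrable hu), symbolOp]
  simp_rw [hg, hg', one_mul, Complex.ofReal_mul, mul_assoc]

/-- The operators `F(H_par)` are symmetric. -/
lemma integral_symOp_mul {d : ℕ} (hd : 1 ≤ d) {p q : ℝ≥0∞} [Fact (1 ≤ p)] [Fact (1 ≤ q)] (hp : 1 < p)
    (hp' : p ≠ ⊤) (hq' : q ≠ ⊤) (hpq : ENNReal.HolderConjugate p q) {F : ℝ → ℝ} (hF : IsTestSymbol F)
    (f : LpSpace d p) (v : LpSpace d q) :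
    ∫ z, symOp d p F f z * v z = ∫ z, f z * symOp d q F v z := by
  obtain ⟨K, hK⟩ := hF.exists_kernel d
  obtain ⟨C, hC⟩ := hK.schur
  refine .trans (integral_congr_ae ?_) ((hC.integral_kerOp_mul hK.symm hp hp' hpq (Lp.memLp f) (Lp.memLp v)).trans
    (integral_congr_ae ?_))
  · filter_upwards [hK.symOp_apply hd hp' hF.isBddSymbol f] with z hz
    rw [hz]
  · filter_upwards [hK.symOp_apply hd hq' hF.isBddSymbol v] with z hz
    rw [hz]

lemma conj_kerOp {d : ℕ} {F : ℝ → ℝ} {K : Space d → Space d → ℂ} (hK : IsOpKernel F K) (f : Space d → ℂ)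
    (z : Space d) : (starRingEnd ℂ) (kerOp K f z) = kerOp K (fun w => (starRingEnd ℂ) (f w)) z := by
  rw [kerOp, ← integral_conj, kerOp]
  simp only [map_mul, hK.conj]

/-- The operators `F(H_par)` are self-adjoint on `L²`. -/
lemma inner_symOp {d : ℕ} (hd : 1 ≤ d) {F : ℝ → ℝ} (hF : IsTestSymbol F) (f g : LpSpace d 2) :
    inner ℂ (symOp d 2 F f) g = inner ℂ f (symOp d 2 F g) := by
  obtain ⟨K, hK⟩ := hF.exists_kernel d
  obtain ⟨C, hC⟩ := hK.schur
  have hf : MemLp (fun w => (starRingEnd ℂ) (f w)) 2 volume :=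
    (Lp.memLp f).continuousLinearMap_comp (Complex.conjCLE.toContinuousLinearMap)
  have h := hC.integral_kerOp_mul hK.symm ENNReal.one_lt_two ENNReal.ofNat_ne_top inferInstance hf (Lp.memLp g)
  rw [L2.inner_def, L2.inner_def]
  refine .trans (integral_congr_ae ?_) (h.trans (integral_congr_ae ?_))
  · filter_upwards [hK.symOp_apply hd ENNReal.ofNat_ne_top hF.isBddSymbol f] with z hz
    rw [hz, ← conj_kerOp hK]
    simp [mul_comm]
  · filter_upwards [hK.symOp_apply hd ENNReal.ofNat_ne_top hF.isBddSymbol g] with z hz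
    rw [hz]
    simp [mul_comm]

/-- The operator norm of `F(H_par)` on `L²` is controlled by the supremum of `F`. -/
lemma norm_symOp_two_le {d : ℕ} (hd : 1 ≤ d) {F : ℝ → ℝ} (hF : IsTestSymbol F) {M : ℝ} (hM0 : 0 < M)
    (hM : ∀ s, |F s| ≤ M) (f : LpSpace d 2) : ‖symOp d 2 F f‖ ≤ 2 * M * ‖f‖ := by
  have h2 : (2 : ℝ≥0∞) ≠ ⊤ := ENNReal.ofNat_ne_top
  -- The root `√(1 - (F/2M)²)` would do the job but is not compactly supported, so 1 is subtracted.
  -- Dividing by `2M` instead of `M` keeps the radicand away from 0 and hence `G` smooth, at the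
  -- price of a factor 2 in the bound.
  set G : ℝ → ℝ := fun s => Real.sqrt (1 - (F s / (2 * M)) ^ 2) - 1 with hG
  have hpos : ∀ s, 0 < 1 - (F s / (2 * M)) ^ 2 := fun s => by
    have h1 : |F s / (2 * M)| ≤ 1 / 2 := by
      rw [abs_div, abs_of_pos (by positivity : 0 < 2 * M), div_le_div_iff₀ (by positivity) (by norm_num)]
      linarith [hM s]
    have := sq_abs (F s / (2 * M))
    nlinarith [abs_nonneg (F s / (2 * M))]
  have hGt : IsTestSymbol G := by
    refine ⟨ContDiff.sub (ContDiff.sqrt (contDiff_const.sub ((hF.smooth.div_const _).pow 2))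
      (fun s => (hpos s).ne')) contDiff_const, ?_⟩
    exact hF.compact.comp_left (g := fun x => Real.sqrt (1 - (x / (2 * M)) ^ 2) - 1) (by simp)
  -- This is `(1 + G)² = 1 - (F/2M)²` with the constant 1 removed from both sides, so that only test
  -- symbols occur.
  have e : symOp d 2 G + symOp d 2 G + (symOp d 2 G).comp (symOp d 2 G) =
      ((-(1 / (2 * M)) ^ 2 : ℝ) : ℂ) • (symOp d 2 F).comp (symOp d 2 F) := by
    rw [← symOp_mul hd h2 hGt hGt, ← symOp_add hd h2 hGt hGt, ← symOp_add hd h2 (hGt.add hGt) (hGt.mul hGt),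
      ← symOp_mul hd h2 hF hF, ← symOp_const_mul hd h2 (hF.mul hF)]
    congr 1
    ext s
    have := Real.sq_sqrt (hpos s).le
    simp only [hG]
    field_simp at this ⊢
    linear_combination this
  have e2 := congrArg (fun A : LpSpace d 2 →L[ℂ] LpSpace d 2 => inner ℂ f (A f)) e
  simp only [add_apply, smul_apply, ContinuousLinearMap.comp_apply, inner_add_right, inner_smul_right] at e2
  rw [← inner_symOp hd hGt f (symOp d 2 G f), ← inner_symOp hd hF f (symOp d 2 F f)] at e2
  -- Pairing the identity with `f` and using self-adjointness turns it into an identity of norms,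
  -- whose left side is nonnegative.
  have e3 : ‖f + symOp d 2 G f‖ ^ 2 = ‖f‖ ^ 2 - (1 / (2 * M)) ^ 2 * ‖symOp d 2 F f‖ ^ 2 := by
    have := congrArg Complex.re e2
    rw [@norm_add_sq ℂ]
    have r : ∀ x : LpSpace d 2, (inner ℂ x x).re = ‖x‖ ^ 2 := inner_self_eq_norm_sq (𝕜 := ℂ)
    simp only [Complex.add_re, Complex.re_ofReal_mul, r] at this
    simp only [RCLike.re_eq_complex_re]
    linarith
  have h4 : (1 / (2 * M)) ^ 2 * ‖symOp d 2 F f‖ ^ 2 ≤ ‖f‖ ^ 2 := by nlinarith [sq_nonneg ‖f + symOp d 2 G f‖]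
  rw [← mul_pow] at h4
  have h5 := abs_le_of_sq_le_sq h4 (norm_nonneg f)
  have h6 := (le_abs_self _).trans h5
  field_simp at h6
  linarith

/-! ### Dyadic cells and a Calderón–Zygmund covering -/

/-- The label of the cell of side length `s⁻¹` containing a point. -/
def cell {d : ℕ} (s : ℝ) (z : Space d) : ℤ × (Fin d → ℤ) := (⌊s * z.1⌋, fun k => ⌊s * z.2 k⌋)

/-- The center of a cell. -/
def cellCenter {d : ℕ} (s : ℝ) (q : ℤ × (Fin d → ℤ)) : Space d :=
  ((q.1 + 1 / 2) / s, WithLp.toLp 2 fun k => ((q.2 k : ℝ) + 1 / 2) / s)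

lemma measurable_cell {d : ℕ} (s : ℝ) : Measurable (cell (d := d) s) := by
  refine Measurable.prodMk (Int.measurable_floor.comp (measurable_fst.const_mul s)) (measurable_pi_lambda _ fun k => ?_)
  refine Int.measurable_floor.comp (Measurable.const_mul ?_ s)
  have : Continuous fun z : Space d => z.2 k := by fun_prop
  exact this.measurable

lemma floor_eq_of_floor_two_mul_eq {x y : ℝ} (h : ⌊2 * x⌋ = ⌊2 * y⌋) : ⌊x⌋ = ⌊y⌋ := by
  rw [Int.floor_eq_iff]
  have h1 : 2 * ⌊y⌋ ≤ ⌊2 * y⌋ := by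
    rw [Int.le_floor]; push_cast; linarith [Int.floor_le y]
  have h2 : ⌊2 * y⌋ < 2 * ⌊y⌋ + 2 := by
    rw [Int.floor_lt]; push_cast; linarith [Int.lt_floor_add_one y]
  rw [← h, Int.le_floor] at h1
  rw [← h, Int.floor_lt] at h2
  push_cast at h1 h2
  constructor <;> linarith

lemma cell_eq_of_cell_two_mul {d : ℕ} {s : ℝ} {z w : Space d} (h : cell (2 * s) z = cell (2 * s) w) :
    cell s z = cell s w := by
  simp only [cell, Prod.mk.injEq, mul_assoc] at h ⊢
  exact ⟨floor_eq_of_floor_two_mul_eq h.1, funext fun k => floor_eq_of_floor_two_mul_eq (congrFun h.2 k)⟩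

lemma abs_sub_center_le {s x : ℝ} (hs : 0 < s) : |x - ((⌊s * x⌋ : ℝ) + 1 / 2) / s| ≤ 1 / s := by
  have h1 := Int.floor_le (s * x)
  have h2 := Int.lt_floor_add_one (s * x)
  have e : x - ((⌊s * x⌋ : ℝ) + 1 / 2) / s = (s * x - ⌊s * x⌋ - 1 / 2) / s := by field_simp; ring
  rw [e, abs_div, abs_of_pos hs]
  gcongr
  rw [abs_le]; constructor <;> linarith

lemma euclideanNorm_le_of_coord {d : ℕ} {x : EuclideanSpace ℝ (Fin d)} {r : ℝ} (hr : 0 ≤ r) (h : ∀ k, |x k| ≤ r) :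
    ‖x‖ ≤ d * r := by
  rw [EuclideanSpace.norm_eq, Real.sqrt_le_left (by positivity)]
  calc ∑ i, ‖x i‖ ^ 2 ≤ ∑ _i : Fin d, r ^ 2 := by
        refine Finset.sum_le_sum fun i _ => ?_
        rw [Real.norm_eq_abs]
        exact pow_le_pow_left₀ (abs_nonneg _) (h i) 2
    _ = d * r ^ 2 := by simp
    _ ≤ (d * r) ^ 2 := by
        rw [mul_pow]
        gcongr
        have : d ≤ d ^ 2 := Nat.le_self_pow two_ne_zero d
        exact_mod_cast this

lemma norm_sub_cellCenter_le {d : ℕ} {s : ℝ} (hs : 0 < s) (z : Space d) :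
    ‖z - cellCenter s (cell s z)‖ ≤ (d + 1) / s := by
  rw [Prod.norm_def]
  refine max_le ?_ ?_
  · refine (abs_sub_center_le hs).trans ?_
    gcongr
    simp
  · refine (euclideanNorm_le_of_coord (r := 1 / s) (by positivity) fun k => abs_sub_center_le hs).trans ?_
    rw [mul_one_div]
    gcongr
    linarith

lemma floor_eq_of_abs_sub_lt {s x : ℝ} (hs : 0 < s) {q : ℤ} (h : |x - ((q : ℝ) + 1 / 2) / s| < 1 / (2 * s)) :
    ⌊s * x⌋ = q := by
  have e : x - ((q : ℝ) + 1 / 2) / s = (s * x - q - 1 / 2) / s := by field_simp; ring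
  rw [e, abs_div, abs_of_pos hs, div_lt_div_iff₀ hs (by positivity)] at h
  have h2 : |s * x - q - 1 / 2| < 1 / 2 := by nlinarith
  rw [abs_lt] at h2
  rw [Int.floor_eq_iff]
  constructor <;> linarith

lemma ball_subset_cell {d : ℕ} {s : ℝ} (hs : 0 < s) (q : ℤ × (Fin d → ℤ)) :
    Metric.ball (cellCenter (d := d) s q) (1 / (2 * s)) ⊆ cell s ⁻¹' {q} := by
  intro z hz
  rw [Metric.mem_ball, dist_eq_norm, Prod.norm_def, max_lt_iff] at hz
  refine Prod.ext (floor_eq_of_abs_sub_lt hs hz.1) (funext fun k => floor_eq_of_abs_sub_lt hs ?_)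
  refine lt_of_le_of_lt ?_ hz.2
  exact PiLp.norm_apply_le (p := 2) (z - cellCenter s q).2 k

lemma cell_subset_closedBall {d : ℕ} {s : ℝ} (hs : 0 < s) (q : ℤ × (Fin d → ℤ)) :
    cell s ⁻¹' {q} ⊆ Metric.closedBall (cellCenter (d := d) s q) ((d + 1) / s) := by
  rintro z rfl
  rw [Metric.mem_closedBall, dist_eq_norm]
  exact norm_sub_cellCenter_le hs z

/-- The volume of balls. -/
lemma volume_ball {d : ℕ} (x : Space d) {r : ℝ} (hr : 0 ≤ r) :
    volume (Metric.ball x r) = ENNReal.ofReal r ^ (d + 1) * volume (Metric.ball (0 : Space d) 1) := by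
  rw [Measure.addHaar_ball _ _ hr, finrank_space, ENNReal.ofReal_pow hr]

/-- The doubling constant relating neighboring scales. -/
def czConst (d : ℕ) : ℝ≥0 := (8 * (d + 1)) ^ (d + 1)

/-- A cell of the next finer scale contains a ball of radius `1/(4s)`, and `2(d+1)/s` is `8(d+1)`
times as large, which is the base of `czConst`. -/
lemma volume_ball_le_cell {d : ℕ} {s : ℝ} (hs : 0 < s) (x : Space d) (q : ℤ × (Fin d → ℤ)) :
    volume (Metric.ball x (2 * ((d + 1) / s))) ≤ czConst d * volume (cell (d := d) (2 * s) ⁻¹' {q}) := by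
  refine le_trans (le_of_eq ?_) (mul_le_mul_right (measure_mono (ball_subset_cell (by positivity) q)) _)
  rw [volume_ball x (by positivity), volume_ball (cellCenter (2 * s) q) (by positivity), ← mul_assoc, czConst, ENNReal.coe_pow, ← mul_pow]
  congr 2
  have : ((8 * ((d : ℝ≥0) + 1) : ℝ≥0) : ℝ≥0∞) = ENNReal.ofReal (8 * (d + 1)) := by
    rw [ENNReal.ofReal]
    congr 1
    rw [← NNReal.coe_inj, Real.coe_toNNReal _ (by positivity)]
    push_cast; ring
  rw [this, ← ENNReal.ofReal_mul (by positivity)]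
  congr 1
  field_simp; ring

lemma volume_cell_pos {d : ℕ} {s : ℝ} (hs : 0 < s) (q : ℤ × (Fin d → ℤ)) : 0 < volume (cell (d := d) s ⁻¹' {q}) :=
  (Metric.measure_ball_pos volume _ (by positivity : 0 < 1 / (2 * s))).trans_le (measure_mono (ball_subset_cell hs q))

lemma volume_cell_lt_top {d : ℕ} {s : ℝ} (hs : 0 < s) (q : ℤ × (Fin d → ℤ)) : volume (cell (d := d) s ⁻¹' {q}) < ⊤ :=
  (measure_mono (cell_subset_closedBall hs q)).trans_lt measure_closedBall_lt_top

/-- A family of disjoint sets of bounded eccentricity on which the averages of `h` are comparable to `lam`,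
and off which `h` is not locally large. -/
structure IsCZCover {d : ℕ} {ι : Type} (h : Space d → ℝ≥0∞) (lam : ℝ≥0) (P : ι → Set (Space d)) (c : ι → Space d)
    (r : ι → ℝ) : Prop where
  meas : ∀ k, MeasurableSet (P k)
  pos : ∀ k, volume (P k) ≠ 0
  disj : Pairwise (Function.onFun Disjoint P)
  subset : ∀ k, P k ⊆ Metric.closedBall (c k) (r k)
  ball : ∀ k, volume (Metric.ball (c k) (2 * r k)) ≤ czConst d * volume (P k)
  lower : ∀ k, lam * volume (P k) ≤ ∫⁻ z in P k, h z
  upper : ∀ k, ∫⁻ z in P k, h z ≤ czConst d * lam * volume (P k)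
  off : ∀ z, (∀ k, z ∉ P k) → ¬ ∀ᶠ w in nhds z, 2 * lam ≤ h w

/-- A stopping-time argument over nested dyadic cells: the pieces are the coarsest cells whose
average of `h` exceeds `lam`. Off the pieces no differentiation theorem is invoked. The last clause
says only that `h` is not at least `2 lam` on a whole neighbourhood, which is all that continuous
functions will require. -/
lemma exists_czCover {d : ℕ} {h : Space d → ℝ≥0∞} (hfin : ∫⁻ z, h z ≠ ⊤) {lam : ℝ≥0} (hl : 0 < lam) :
    ∃ (ι : Type) (_ : Countable ι) (P : ι → Set (Space d)) (c : ι → Space d) (r : ι → ℝ), IsCZCover h lam P c r := by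
  classical
  have hv1 : 0 < volume (Metric.ball (0 : Space d) 1) := Metric.measure_ball_pos _ _ one_pos
  have hv2 : volume (Metric.ball (0 : Space d) 1) < ⊤ := measure_ball_lt_top
  -- The initial cells, of side `1/R`, are so large that even the total mass is below `lam` times
  -- their volume. None of them is selected, and every selected cell has a parent.
  obtain ⟨R, hR, hRh⟩ : ∃ R : ℝ, 0 < R ∧ ∀ q, ∫⁻ z, h z ≤ lam * volume (cell (d := d) R ⁻¹' {q}) := by
    set A : ℝ≥0∞ := (∫⁻ z, h z) / (lam * volume (Metric.ball (0 : Space d) 1)) with hA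
    have hlv : (lam * volume (Metric.ball (0 : Space d) 1) : ℝ≥0∞) ≠ 0 :=
      mul_ne_zero (by exact_mod_cast hl.ne') hv1.ne'
    have hlv2 : (lam * volume (Metric.ball (0 : Space d) 1) : ℝ≥0∞) ≠ ⊤ := ENNReal.mul_ne_top ENNReal.coe_ne_top hv2.ne
    have hA2 : A ≠ ⊤ := ENNReal.div_ne_top hfin hlv
    set y : ℝ := A.toReal + 1 with hy
    have hy1 : 1 ≤ y := by rw [hy]; linarith [ENNReal.toReal_nonneg (a := A)]
    refine ⟨1 / (2 * y), by positivity, fun q => ?_⟩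
    have h1 := measure_mono (μ := volume) (ball_subset_cell (d := d) (s := 1 / (2 * y)) (by positivity) q)
    have e : 1 / (2 * (1 / (2 * y))) = y := by field_simp
    rw [e, volume_ball _ (by linarith)] at h1
    calc ∫⁻ z, h z = A * (lam * volume (Metric.ball (0 : Space d) 1)) := (ENNReal.div_mul_cancel hlv hlv2).symm
      _ ≤ ENNReal.ofReal y ^ (d + 1) * (lam * volume (Metric.ball (0 : Space d) 1)) := by
          gcongr
          calc A ≤ ENNReal.ofReal y := by
                rw [← ENNReal.ofReal_toReal hA2]
                exact ENNReal.ofReal_le_ofReal (by linarith)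
            _ ≤ ENNReal.ofReal y ^ (d + 1) := le_self_pow₀ (by
                rw [← ENNReal.ofReal_one]; exact ENNReal.ofReal_le_ofReal hy1) (by omega)
      _ = lam * (ENNReal.ofReal y ^ (d + 1) * volume (Metric.ball (0 : Space d) 1)) := by ring
      _ ≤ _ := by gcongr
  set s : ℕ → ℝ := fun i => 2 ^ i * R with hs
  have hs0 : ∀ i, 0 < s i := fun i => by positivity
  have hs1 : ∀ i, s (i + 1) = 2 * s i := fun i => by simp only [hs]; ring
  have hnest : ∀ i j, j ≤ i → ∀ z w : Space d, cell (s i) z = cell (s i) w → cell (s j) z = cell (s j) w := by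
    intro i j hij
    induction i, hij using Nat.le_induction with
    | base => exact fun z w h => h
    | succ i _ ih => exact fun z w h => ih z w (cell_eq_of_cell_two_mul (by rwa [← hs1 i]))
  set Q : ℕ → (ℤ × (Fin d → ℤ)) → Set (Space d) := fun i q => cell (s i) ⁻¹' {q} with hQ
  have hQm : ∀ i q, MeasurableSet (Q i q) := fun i q => measurable_cell _ (measurableSet_singleton _)
  set bad : ℕ → (ℤ × (Fin d → ℤ)) → Prop := fun i q => lam * volume (Q i q) < ∫⁻ z in Q i q, h z with hbad
  set sel : ℕ × (ℤ × (Fin d → ℤ)) → Prop := fun k =>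
    bad k.1 k.2 ∧ ∀ z ∈ Q k.1 k.2, ∀ j < k.1, ¬ bad j (cell (s j) z) with hsel
  have hpos : ∀ k, sel k → ∃ i, k.1 = i + 1 := by
    rintro ⟨i, q⟩ hk
    rcases i with _ | i
    · exfalso
      have h1 : bad 0 q := hk.1
      have h2 := hRh q
      have e : s 0 = R := by simp [hs]
      simp only [hbad, hQ, e] at h1
      exact absurd (setLIntegral_le_lintegral _ _) (not_le.2 (h2.trans_lt h1))
    · exact ⟨i, rfl⟩
  refine ⟨{k // sel k}, inferInstance, fun k => Q k.1.1 k.1.2, fun k => cellCenter (s k.1.1) k.1.2,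
    fun k => (d + 1) / s k.1.1, ⟨fun k => hQm _ _,
    fun k => (volume_cell_pos (hs0 _) _).ne', ?_, fun k => cell_subset_closedBall (hs0 _) _, ?_, fun k => k.2.1.le,
      ?_, ?_⟩⟩
  · rintro ⟨⟨i, q⟩, hk⟩ ⟨⟨i', q'⟩, hk'⟩ hne
    rw [Function.onFun, Set.disjoint_left]
    intro z hz hz'
    have e1 : cell (s i) z = q := hz
    have e2 : cell (s i') z = q' := hz'
    rcases lt_trichotomy i i' with hlt | heq | hlt
    · exact hk'.2 z hz' i hlt (by rw [e1]; exact hk.1)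
    · subst heq
      exact hne (by simp only [Subtype.mk.injEq, Prod.mk.injEq, true_and]; rw [← e1, ← e2])
    · exact hk.2 z hz i' hlt (by rw [e2]; exact hk'.1)
  · rintro ⟨⟨i, q⟩, hk⟩
    obtain ⟨j, hj⟩ := hpos _ hk
    simp only at hj
    subst hj
    refine le_trans (measure_mono (Metric.ball_subset_ball ?_)) ((volume_ball_le_cell (hs0 j) _ q).trans (le_of_eq ?_))
    · simp only [hs1]
      have := hs0 j
      gcongr
      linarith
    · simp only [hQ, hs1]
  · rintro ⟨⟨i, q⟩, hk⟩
    obtain ⟨j, hj⟩ := hpos _ hk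
    simp only at hj
    subst hj
    have hne : (Q (j + 1) q).Nonempty := nonempty_of_measure_ne_zero (volume_cell_pos (hs0 _) q).ne'
    obtain ⟨z, hz⟩ := hne
    -- The parent was not selected, so its average is at most `lam`; passing to the child costs the
    -- doubling constant.
    have hnb := hk.2 z hz j (Nat.lt_succ_self j)
    have hsub : Q (j + 1) q ⊆ Q j (cell (s j) z) := fun w hw => by
      have e1 : cell (s (j + 1)) w = q := hw
      have e2 : cell (s (j + 1)) z = q := hz
      exact hnest (j + 1) j (Nat.le_succ j) w z (e1.trans e2.symm)
    calc ∫⁻ w in Q (j + 1) q, h w ≤ ∫⁻ w in Q j (cell (s j) z), h w := lintegral_mono_set hsub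
      _ ≤ lam * volume (Q j (cell (s j) z)) := not_lt.1 hnb
      _ ≤ lam * (czConst d * volume (Q (j + 1) q)) := by
          gcongr
          have h1 := volume_ball_le_cell (hs0 j) (cellCenter (s j) (cell (s j) z)) q
          rw [← hs1] at h1
          refine le_trans (measure_mono ((cell_subset_closedBall (hs0 j) _).trans
            (Metric.closedBall_subset_ball ?_))) h1
          have : 0 < ((d : ℝ) + 1) / s j := by have := hs0 j; positivity
          linarith
      _ = _ := by ring
  · intro z hz hev
    obtain ⟨ε, hε, hball⟩ := Metric.eventually_nhds_iff_ball.1 hev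
    obtain ⟨i, hi⟩ : ∃ i, 2 * ((d + 1) / s i) < ε := by
      obtain ⟨i, hi⟩ := pow_unbounded_of_one_lt (2 * (d + 1) / (R * ε)) (one_lt_two (α := ℝ))
      refine ⟨i, ?_⟩
      rw [div_lt_iff₀ (by positivity)] at hi
      rw [← mul_div_assoc, div_lt_iff₀ (hs0 i)]
      simp only [hs]; linarith
    -- A small cell around `z` lies in the ball where `h ≥ 2 lam`, so its average is strictly larger
    -- than `lam`. The coarsest such cell containing `z` is then selected, contradicting the choice
    -- of `z`.
    have hbi : ∃ i, bad i (cell (s i) z) := by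
      refine ⟨i, ?_⟩
      have h1 : ∀ w ∈ Q i (cell (s i) z), 2 * (lam : ℝ≥0∞) ≤ h w := by
        intro w hw
        refine hball w ?_
        have e1 : cell (s i) w = cell (s i) z := hw
        have h2 := norm_sub_cellCenter_le (hs0 i) w
        have h3 := norm_sub_cellCenter_le (hs0 i) z
        rw [e1] at h2
        rw [Metric.mem_ball, dist_eq_norm]
        calc ‖w - z‖ = ‖(w - cellCenter (s i) (cell (s i) z)) - (z - cellCenter (s i) (cell (s i) z))‖ := by
              congr 1; abel
          _ ≤ _ := norm_sub_le _ _
          _ < ε := by linarith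
      calc lam * volume (Q i (cell (s i) z)) < 2 * lam * volume (Q i (cell (s i) z)) := by
            have h4 := volume_cell_pos (hs0 i) (cell (s i) z)
            have h5 := volume_cell_lt_top (hs0 i) (cell (s i) z)
            rw [mul_assoc, two_mul]
            refine ENNReal.lt_add_right (ENNReal.mul_ne_top ENNReal.coe_ne_top h5.ne)
              (mul_ne_zero (by exact_mod_cast hl.ne') h4.ne')
        _ = ∫⁻ _w in Q i (cell (s i) z), 2 * (lam : ℝ≥0∞) := by rw [setLIntegral_const]
        _ ≤ _ := setLIntegral_mono' (hQm _ _) h1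
    have hfind := Nat.find_spec hbi
    refine hz ⟨(Nat.find hbi, cell (s (Nat.find hbi)) z), hfind, fun w hw j hj => ?_⟩ rfl
    have hw' : cell (s (Nat.find hbi)) w = cell (s (Nat.find hbi)) z := hw
    rw [hnest _ j hj.le w z hw']
    exact Nat.find_min hbi hj

/-! ### Calderón–Zygmund theory for kernel operators -/

/-- Quantitative hypotheses of the Calderón–Zygmund theorem: an `L²` bound and the Hörmander condition. -/
structure IsCZKernel {d : ℕ} (K : Space d → Space d → ℂ) (B : ℝ≥0) : Prop where
  schur : ∃ C : ℝ≥0, IsSchurKernel K C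
  bdd : ∃ M : ℝ, ∀ z w, ‖K z w‖ ≤ M
  two : ∀ f : Space d → ℂ, MemLp f 2 volume → eLpNorm (kerOp K f) 2 volume ≤ B * eLpNorm f 2 volume
  hormander : ∀ w w', ∫⁻ z in {z | 2 * ‖w - w'‖ ≤ ‖z - w'‖}, ‖K z w - K z w'‖ₑ ≤ B

lemma IsCZKernel.integrable {d : ℕ} {K : Space d → Space d → ℂ} {B : ℝ≥0} (hK : IsCZKernel K B) {f : Space d → ℂ}
    (hf : Integrable f) (z : Space d) : Integrable fun w => K z w * f w := by
  obtain ⟨C, hC⟩ := hK.schur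
  obtain ⟨M, hM⟩ := hK.bdd
  exact hf.bdd_mul (c := M) (hC.meas_left z).aestronglyMeasurable (.of_forall (hM z))

/-- A function with mean zero on every piece of a Calderón–Zygmund cover is mapped to a function that
is integrable away from the pieces. -/
lemma lintegral_kerOp_bad_le {d : ℕ} {K : Space d → Space d → ℂ} {B : ℝ≥0} (hK : IsCZKernel K B) {ι : Type}
    [Countable ι] {P : ι → Set (Space d)} {c : ι → Space d} {r : ι → ℝ} (hm : ∀ k, MeasurableSet (P k))
    (hd : Pairwise (Function.onFun Disjoint P)) (hs : ∀ k, P k ⊆ Metric.closedBall (c k) (r k))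
    {b : Space d → ℂ} (hb : Integrable b) (hb0 : ∀ z, (∀ k, z ∉ P k) → b z = 0)
    (hmean : ∀ k, ∫ w in P k, b w = 0) :
    ∫⁻ z in (⋃ k, Metric.ball (c k) (2 * r k))ᶜ, ‖kerOp K b z‖ₑ ≤ B * ∫⁻ w, ‖b w‖ₑ := by
  obtain ⟨C, hC⟩ := hK.schur
  set Ω := (⋃ k, Metric.ball (c k) (2 * r k))ᶜ with hΩ
  have hΩm : MeasurableSet Ω := (MeasurableSet.iUnion fun k => measurableSet_ball).compl
  have hbd : ∀ z, ‖kerOp K b z‖ₑ ≤ ∑' k, ∫⁻ w in P k, ‖K z w - K z (c k)‖ₑ * ‖b w‖ₑ := by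
    intro z
    have hi := hK.integrable hb z
    -- The mean value zero on each piece allows the value of the kernel at the center to be
    -- subtracted for free.
    have e1 : kerOp K b z = ∑' k, ∫ w in P k, (K z w - K z (c k)) * b w := by
      rw [kerOp, ← setIntegral_eq_integral_of_forall_compl_eq_zero (s := ⋃ k, P k),
        integral_iUnion hm hd hi.integrableOn]
      · refine tsum_congr fun k => ?_
        have e2 : ∫ w in P k, K z (c k) * b w = 0 := by rw [integral_const_mul, hmean k, mul_zero]
        simp_rw [sub_mul]
        rw [integral_sub hi.integrableOn (hb.const_mul _).integrableOn, e2, sub_zero]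
      · intro w hw
        rw [hb0 w (by simpa using hw), mul_zero]
    rw [e1]
    refine enorm_tsum_le_tsum_enorm.trans (ENNReal.tsum_le_tsum fun k => ?_)
    refine (enorm_integral_le_lintegral_enorm _).trans (le_of_eq ?_)
    simp only [enorm_mul]
  have hmm : ∀ k, AEMeasurable (fun q : Space d × Space d => ‖K q.1 q.2 - K q.1 (c k)‖ₑ * ‖b q.2‖ₑ)
      ((volume.restrict Ω).prod (volume.restrict (P k))) := by
    intro k
    have h1 : StronglyMeasurable fun q : Space d × Space d => K q.1 q.2 - K q.1 (c k) :=
      hC.meas.sub ((hC.meas_right (c k)).comp_measurable measurable_fst)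
    exact h1.enorm.aemeasurable.mul (hb.1.restrict.comp_snd).enorm
  calc ∫⁻ z in Ω, ‖kerOp K b z‖ₑ
      ≤ ∫⁻ z in Ω, ∑' k, ∫⁻ w in P k, ‖K z w - K z (c k)‖ₑ * ‖b w‖ₑ := lintegral_mono hbd
    _ = ∑' k, ∫⁻ z in Ω, ∫⁻ w in P k, ‖K z w - K z (c k)‖ₑ * ‖b w‖ₑ :=
        lintegral_tsum fun k => AEMeasurable.lintegral_prod_right' (hmm k)
    _ ≤ ∑' k, ∫⁻ w in P k, B * ‖b w‖ₑ := by
        refine ENNReal.tsum_le_tsum fun k => ?_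
        rw [lintegral_lintegral_swap (hmm k)]
        refine setLIntegral_mono' (hm k) fun w hw => ?_
        rw [lintegral_mul_const' _ _ enorm_ne_top]
        gcongr
        -- Outside the doubled ball, `‖z - c k‖ ≥ 2 r k ≥ 2 ‖w - c k‖`, which is the region of the
        -- Hörmander condition.
        refine (lintegral_mono_set (t := {z | 2 * ‖w - c k‖ ≤ ‖z - c k‖}) fun z hz => ?_).trans (hK.hormander w (c k))
        have h1 : z ∉ Metric.ball (c k) (2 * r k) := fun h => hz (Set.mem_iUnion.2 ⟨k, h⟩)
        have h2 := hs k hw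
        rw [Metric.mem_ball, dist_eq_norm, not_lt] at h1
        rw [Metric.mem_closedBall, dist_eq_norm] at h2
        show 2 * ‖w - c k‖ ≤ ‖z - c k‖
        linarith
    _ = ∫⁻ w in ⋃ k, P k, B * ‖b w‖ₑ := (lintegral_iUnion hm hd _).symm
    _ ≤ ∫⁻ w, B * ‖b w‖ₑ := setLIntegral_le_lintegral _ _
    _ = _ := lintegral_const_mul' _ _ ENNReal.coe_ne_top

/-- The Calderón–Zygmund decomposition. -/
lemma exists_cz_decomposition {d : ℕ} {u : Space d → ℂ} (hc : Continuous u) (hu : HasCompactSupport u)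
    {lam : ℝ≥0} (hl : 0 < lam) :
    ∃ (ι : Type) (_ : Countable ι) (P : ι → Set (Space d)) (c : ι → Space d) (r : ι → ℝ) (b : Space d → ℂ),
      (∀ k, MeasurableSet (P k)) ∧ Pairwise (Function.onFun Disjoint P) ∧
      (∀ k, P k ⊆ Metric.closedBall (c k) (r k)) ∧ Integrable b ∧ (∀ z, (∀ k, z ∉ P k) → b z = 0) ∧
      (∀ k, ∫ w in P k, b w = 0) ∧
      lam * volume (⋃ k, Metric.ball (c k) (2 * r k)) ≤ czConst d * ∫⁻ z in {z | lam < ‖u z‖₊}, ‖u z‖ₑ ∧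
      ∫⁻ z, ‖b z‖ₑ ≤ 2 * ∫⁻ z in {z | lam < ‖u z‖₊}, ‖u z‖ₑ ∧
      ∫⁻ z, ‖u z - b z‖ₑ ^ 2 ≤ (∫⁻ z in {z | ‖u z‖₊ ≤ 2 * lam}, ‖u z‖ₑ ^ 2) +
        (1 + czConst d) ^ 2 * lam * ∫⁻ z in {z | lam < ‖u z‖₊}, ‖u z‖ₑ := by
  classical
  have hui : Integrable u := hc.integrable_of_hasCompactSupport hu
  set S : Set (Space d) := {z | lam < ‖u z‖₊} with hS
  have hSm : MeasurableSet S := measurableSet_lt measurable_const hc.nnnorm.measurable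
  -- Only the part of `u` above the level is decomposed. The estimates then involve the `L¹` mass of
  -- `{|u| > lam}` alone, in the form that can be integrated over all levels without a separate
  -- interpolation theorem.
  set v : Space d → ℂ := S.indicator u with hv
  have hvi : Integrable v := hui.indicator hSm
  have hve : ∀ z, ‖v z‖ₑ = S.indicator (fun z => ‖u z‖ₑ) z := fun z => by
    by_cases hz : z ∈ S <;> simp [hv, hz]
  have hvS : ∫⁻ z, ‖v z‖ₑ = ∫⁻ z in S, ‖u z‖ₑ := by
    simp_rw [hve]; exact lintegral_indicator hSm _
  have hfin : ∫⁻ z, ‖v z‖ₑ ≠ ⊤ := hvi.2.ne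
  obtain ⟨ι, hι, P, c, r, hP⟩ := exists_czCover hfin hl
  have hPfin : ∀ k, volume (P k) < ⊤ := fun k =>
    (measure_mono (hP.subset k)).trans_lt measure_closedBall_lt_top
  set avg : ι → ℂ := fun k => ⨍ w in P k, v w with havg
  set b : Space d → ℂ := fun z => if h : ∃ k, z ∈ P k then v z - avg h.choose else 0 with hb
  have hbP : ∀ k, ∀ z ∈ P k, b z = v z - avg k := by
    intro k z hz
    have h : ∃ k, z ∈ P k := ⟨k, hz⟩
    have e : h.choose = k := by
      by_contra hne
      exact Set.disjoint_left.1 (hP.disj hne) h.choose_spec hz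
    simp only [hb, dif_pos h]
    rw [e]
  have hb0 : ∀ z, (∀ k, z ∉ P k) → b z = 0 := fun z hz => by
    simp only [hb]
    rw [dif_neg (by push Not; exact hz)]
  have hUm : MeasurableSet (⋃ k, P k) := MeasurableSet.iUnion hP.meas
  have hbm : AEStronglyMeasurable b volume := by
    have h1 : AEStronglyMeasurable b (volume.restrict (⋃ k, P k)) := by
      rw [aestronglyMeasurable_iUnion_iff]
      intro k
      refine (hvi.1.restrict.sub (aestronglyMeasurable_const (b := avg k))).congr ?_
      filter_upwards [ae_restrict_mem (hP.meas k)] with z hz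
      rw [hbP k z hz]; rfl
    have h2 : AEStronglyMeasurable b (volume.restrict (⋃ k, P k)ᶜ) := by
      refine (aestronglyMeasurable_const (b := (0 : ℂ))).congr ?_
      filter_upwards [ae_restrict_mem hUm.compl] with z hz
      rw [hb0 z (by simpa using hz)]
    have := aestronglyMeasurable_union_iff.2 ⟨h1, h2⟩
    rwa [Set.union_compl_self, Measure.restrict_univ] at this
  have havgE : ∀ k, ‖avg k‖ₑ * volume (P k) ≤ ∫⁻ w in P k, ‖v w‖ₑ := by
    intro k
    rcases eq_or_ne (volume (P k)) 0 with h0 | h0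
    · simp [h0]
    · have e : (volume (P k)).toReal • avg k = ∫ w in P k, v w := by
        have := measure_smul_setAverage v (hPfin k).ne
        simpa [Measure.real] using this
      have e2 := congrArg (fun x : ℂ => ‖x‖ₑ) e
      simp only [enorm_smul] at e2
      rw [Real.enorm_of_nonneg ENNReal.toReal_nonneg, ENNReal.ofReal_toReal (hPfin k).ne, mul_comm] at e2
      rw [e2]
      exact enorm_integral_le_lintegral_enorm _
  have hbk : ∀ k, ∫⁻ w in P k, ‖b w‖ₑ ≤ 2 * ∫⁻ w in P k, ‖v w‖ₑ := by
    intro k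
    calc ∫⁻ w in P k, ‖b w‖ₑ ≤ ∫⁻ w in P k, (‖v w‖ₑ + ‖avg k‖ₑ) := by
          refine setLIntegral_mono' (hP.meas k) fun w hw => ?_
          rw [hbP k w hw]
          exact enorm_sub_le
      _ = (∫⁻ w in P k, ‖v w‖ₑ) + ‖avg k‖ₑ * volume (P k) := by
          rw [lintegral_add_right _ measurable_const, setLIntegral_const]
      _ ≤ _ := by
          rw [two_mul]
          gcongr
          exact havgE k
  have hbU : ∫⁻ z, ‖b z‖ₑ = ∫⁻ z in ⋃ k, P k, ‖b z‖ₑ := by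
    rw [setLIntegral_eq_of_support_subset]
    intro z hz
    by_contra hn
    refine hz ?_
    show ‖b z‖ₑ = 0
    rw [hb0 z (by simpa using hn), enorm_zero]
  have hb1 : ∫⁻ z, ‖b z‖ₑ ≤ 2 * ∫⁻ z in S, ‖u z‖ₑ := by
    rw [hbU, lintegral_iUnion hP.meas hP.disj, ← hvS]
    calc ∑' k, ∫⁻ z in P k, ‖b z‖ₑ ≤ ∑' k, 2 * ∫⁻ z in P k, ‖v z‖ₑ := ENNReal.tsum_le_tsum hbk
      _ = 2 * ∫⁻ z in ⋃ k, P k, ‖v z‖ₑ := by rw [ENNReal.tsum_mul_left, lintegral_iUnion hP.meas hP.disj]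
      _ ≤ _ := by gcongr; exact Measure.restrict_le_self
  have hvol : lam * ∑' k, volume (P k) ≤ ∫⁻ z in S, ‖u z‖ₑ := by
    rw [← ENNReal.tsum_mul_left, ← hvS]
    calc ∑' k, lam * volume (P k) ≤ ∑' k, ∫⁻ z in P k, ‖v z‖ₑ := ENNReal.tsum_le_tsum hP.lower
      _ = ∫⁻ z in ⋃ k, P k, ‖v z‖ₑ := (lintegral_iUnion hP.meas hP.disj _).symm
      _ ≤ _ := setLIntegral_le_lintegral _ _
  refine ⟨ι, hι, P, c, r, b, hP.meas, hP.disj, hP.subset, ⟨hbm, ?_⟩, hb0, fun k => ?_, ?_, hb1, ?_⟩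
  · rw [hasFiniteIntegral_iff_enorm]
    refine hb1.trans_lt (ENNReal.mul_lt_top ENNReal.ofNat_lt_top ?_)
    rw [← hvS]; exact hfin.lt_top
  · rw [setIntegral_congr_fun (hP.meas k) (hbP k)]
    have : IsFiniteMeasure (volume.restrict (P k)) := ⟨by rw [Measure.restrict_apply_univ]; exact hPfin k⟩
    exact integral_sub_average (volume.restrict (P k)) v
  · calc lam * volume (⋃ k, Metric.ball (c k) (2 * r k))
        ≤ lam * ∑' k, czConst d * volume (P k) := by
          gcongr
          exact (measure_iUnion_le _).trans (ENNReal.tsum_le_tsum hP.ball)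
      _ = czConst d * (lam * ∑' k, volume (P k)) := by rw [ENNReal.tsum_mul_left]; ring
      _ ≤ _ := by gcongr
  -- Here continuity of `u` replaces Lebesgue differentiation: a value above `2 lam` would persist
  -- on a neighbourhood, which the last clause of the cover excludes.
  · have hoff : ∀ z, (∀ k, z ∉ P k) → ‖u z‖₊ ≤ 2 * lam := by
      intro z hz
      by_contra hn
      rw [not_le] at hn
      refine hP.off z hz ?_
      filter_upwards [hc.nnnorm.continuousAt.eventually (lt_mem_nhds hn)] with w hw
      have hwS : w ∈ S := lt_of_le_of_lt (by rw [two_mul]; exact le_self_add) hw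
      simp only [hv, Set.indicator_of_mem hwS]
      have := hw.le
      rw [enorm_eq_nnnorm]
      exact_mod_cast this
    -- On a piece the good part is `(u - v) + avg`, that is the values of `u` below the level plus
    -- the average of the rest.
    have hon : ∀ k, ∀ z ∈ P k, ‖u z - b z‖ₑ ≤ (1 + czConst d) * lam := by
      intro k z hz
      have h0 := hP.pos k
      have h1 : ‖u z - v z‖ₑ ≤ lam := by
        by_cases hzS : z ∈ S
        · simp [hv, hzS]
        · simp only [hv, Set.indicator_of_notMem hzS, sub_zero]
          have : ‖u z‖₊ ≤ lam := not_lt.1 hzS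
          rw [enorm_eq_nnnorm]
          exact_mod_cast this
      have h2 : ‖avg k‖ₑ ≤ czConst d * lam := by
        have h3 := (havgE k).trans (hP.upper k)
        exact (ENNReal.mul_le_mul_iff_left h0 (hPfin k).ne).1 h3
      rw [hbP k z hz, ← sub_add]
      refine (enorm_add_le _ _).trans ?_
      rw [add_mul, one_mul]
      exact add_le_add h1 h2
    rw [← lintegral_add_compl _ hUm, add_comm]
    refine add_le_add ?_ ?_
    · calc ∫⁻ z in (⋃ k, P k)ᶜ, ‖u z - b z‖ₑ ^ 2 = ∫⁻ z in (⋃ k, P k)ᶜ, ‖u z‖ₑ ^ 2 := by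
            refine setLIntegral_congr_fun hUm.compl fun z hz => ?_
            simp only [hb0 z (by simpa using hz), sub_zero]
        _ ≤ _ := lintegral_mono_set fun z hz => hoff z (by simpa using hz)
    · calc ∫⁻ z in ⋃ k, P k, ‖u z - b z‖ₑ ^ 2
          ≤ ∫⁻ _z in ⋃ k, P k, ((1 + czConst d) * (lam : ℝ≥0∞)) ^ 2 := by
            refine setLIntegral_mono' hUm fun z hz => ?_
            obtain ⟨k, hk⟩ := Set.mem_iUnion.1 hz
            exact pow_le_pow_left₀ zero_le (hon k z hk) 2
        _ ≤ (1 + czConst d) ^ 2 * lam * (lam * ∑' k, volume (P k)) := by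
            rw [setLIntegral_const, mul_pow]
            have := measure_iUnion_le (μ := volume) P
            calc _ ≤ (1 + (czConst d : ℝ≥0∞)) ^ 2 * (lam : ℝ≥0∞) ^ 2 * ∑' k, volume (P k) := by gcongr
              _ = _ := by ring
        _ ≤ _ := by gcongr

/-- The constant in the weak type estimate. -/
def czWeakConst (d : ℕ) (B : ℝ≥0) : ℝ≥0 := B ^ 2 + B ^ 2 * (1 + czConst d) ^ 2 + czConst d + 2 * B

/-- The good part is handled by Chebyshev and the `L²` bound, and the bad part by the Hörmander
condition off the doubled balls, whose union is small. The right side keeps the low part in `L²` and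
the high part in `L¹`, at the same level. -/
lemma IsCZKernel.weak_type {d : ℕ} {K : Space d → Space d → ℂ} {B : ℝ≥0} (hK : IsCZKernel K B)
    {u : Space d → ℂ} (hc : Continuous u) (hu : HasCompactSupport u) {lam : ℝ≥0} (hl : 0 < lam) :
    (lam : ℝ≥0∞) ^ 2 * volume {z | 2 * (lam : ℝ≥0∞) < ‖kerOp K u z‖ₑ} ≤
      czWeakConst d B * ((∫⁻ z in {z | ‖u z‖₊ ≤ 2 * lam}, ‖u z‖ₑ ^ 2) +
        lam * ∫⁻ z in {z | lam < ‖u z‖₊}, ‖u z‖ₑ) := by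
  obtain ⟨ι, hι, P, c, r, b, hm, hdj, hs, hb, hb0, hmean, hvol, hb1, hg2⟩ := exists_cz_decomposition hc hu hl
  obtain ⟨C, hC⟩ := hK.schur
  have hui : Integrable u := hc.integrable_of_hasCompactSupport hu
  set I2 := ∫⁻ z in {z | ‖u z‖₊ ≤ 2 * lam}, ‖u z‖ₑ ^ 2 with hI2
  set I1 := ∫⁻ z in {z | lam < ‖u z‖₊}, ‖u z‖ₑ with hI1
  set Ω := ⋃ k, Metric.ball (c k) (2 * r k) with hΩ
  set g : Space d → ℂ := fun z => u z - b z with hg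
  have hgi : Integrable g := hui.sub hb
  have hI1fin : I1 < ⊤ := lt_of_le_of_lt (setLIntegral_le_lintegral _ _) hui.2
  have hI2fin : I2 < ⊤ := by
    have h2 : MemLp u 2 volume := hc.memLp_of_hasCompactSupport hu
    have h3 := (eLpNorm_lt_top_iff_lintegral_rpow_enorm_lt_top two_ne_zero ENNReal.ofNat_ne_top).1 h2.2
    refine lt_of_le_of_lt (setLIntegral_le_lintegral _ _) ?_
    simpa using h3
  have hsq : ∀ f : Space d → ℂ, eLpNorm f 2 volume ^ 2 = ∫⁻ z, ‖f z‖ₑ ^ 2 := fun f => by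
    rw [eLpNorm_eq_lintegral_rpow_enorm_toReal two_ne_zero ENNReal.ofNat_ne_top]
    rw [← ENNReal.rpow_natCast, ← ENNReal.rpow_mul]
    simp
  have hgL : MemLp g 2 volume := by
    refine ⟨hgi.1, ?_⟩
    have h1 : eLpNorm g 2 volume ^ 2 < ⊤ := by
      rw [hsq]
      refine hg2.trans_lt (ENNReal.add_lt_top.2 ⟨hI2fin, ENNReal.mul_lt_top (ENNReal.mul_lt_top ?_ ENNReal.coe_lt_top) hI1fin⟩)
      exact ENNReal.pow_lt_top (by simp)
    by_contra hn
    rw [not_lt, top_le_iff] at hn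
    rw [hn] at h1
    simp at h1
  have hTg : ∫⁻ z, ‖kerOp K g z‖ₑ ^ 2 ≤ B ^ 2 * (I2 + (1 + czConst d) ^ 2 * lam * I1) := by
    rw [← hsq]
    calc eLpNorm (kerOp K g) 2 volume ^ 2 ≤ (B * eLpNorm g 2 volume) ^ 2 := pow_le_pow_left₀ zero_le (hK.two g hgL) 2
      _ = B ^ 2 * ∫⁻ z, ‖g z‖ₑ ^ 2 := by rw [mul_pow, hsq]
      _ ≤ _ := by gcongr
  have hTb := lintegral_kerOp_bad_le hK hm hdj hs hb hb0 hmean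
  have hsub : {z | 2 * (lam : ℝ≥0∞) < ‖kerOp K u z‖ₑ} ⊆
      {z | (lam : ℝ≥0∞) ^ 2 ≤ ‖kerOp K g z‖ₑ ^ 2} ∪ (Ω ∪ {z | z ∈ Ωᶜ ∧ (lam : ℝ≥0∞) ≤ ‖kerOp K b z‖ₑ}) := by
    intro z hz
    by_contra hn
    simp only [Set.mem_union, Set.mem_ofPred_eq, not_or, not_and, not_le] at hn
    obtain ⟨h1, h2, h3⟩ := hn
    have h4 : ‖kerOp K g z‖ₑ < lam := by
      by_contra hh
      exact absurd (pow_le_pow_left₀ zero_le (not_lt.1 hh) 2) (not_le.2 h1)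
    have h5 := h3 h2
    have e : kerOp K u z = kerOp K g z + kerOp K b z := by
      rw [kerOp, kerOp, kerOp, ← integral_add (hK.integrable hgi z) (hK.integrable hb z)]
      simp [hg, mul_sub]
    have h6 : ‖kerOp K u z‖ₑ < 2 * lam := by
      rw [e, two_mul]
      exact (enorm_add_le _ _).trans_lt (ENNReal.add_lt_add h4 h5)
    exact lt_asymm hz h6
  have hΩm : MeasurableSet Ω := MeasurableSet.iUnion fun k => measurableSet_ball
  have hm1 : (lam : ℝ≥0∞) ^ 2 * volume {z | (lam : ℝ≥0∞) ^ 2 ≤ ‖kerOp K g z‖ₑ ^ 2} ≤ ∫⁻ z, ‖kerOp K g z‖ₑ ^ 2 :=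
    mul_meas_ge_le_lintegral₀ ((hC.aestronglyMeasurable_kerOp hgi.1).enorm.pow_const 2) _
  have hm2 : (lam : ℝ≥0∞) * volume {z | z ∈ Ωᶜ ∧ (lam : ℝ≥0∞) ≤ ‖kerOp K b z‖ₑ} ≤ ∫⁻ z in Ωᶜ, ‖kerOp K b z‖ₑ := by
    have h1 := mul_meas_ge_le_lintegral₀ (μ := volume.restrict Ωᶜ)
      ((hC.aestronglyMeasurable_kerOp hb.1).enorm.restrict) (lam : ℝ≥0∞)
    rw [Measure.restrict_apply' hΩm.compl] at h1
    refine le_trans ?_ h1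
    gcongr
    intro z hz
    exact ⟨hz.2, hz.1⟩
  calc (lam : ℝ≥0∞) ^ 2 * volume {z | 2 * (lam : ℝ≥0∞) < ‖kerOp K u z‖ₑ}
      ≤ (lam : ℝ≥0∞) ^ 2 * (volume {z | (lam : ℝ≥0∞) ^ 2 ≤ ‖kerOp K g z‖ₑ ^ 2} +
          (volume Ω + volume {z | z ∈ Ωᶜ ∧ (lam : ℝ≥0∞) ≤ ‖kerOp K b z‖ₑ})) := by
        gcongr
        exact (measure_mono hsub).trans ((measure_union_le _ _).trans (by gcongr; exact measure_union_le _ _))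
    _ = (lam : ℝ≥0∞) ^ 2 * volume {z | (lam : ℝ≥0∞) ^ 2 ≤ ‖kerOp K g z‖ₑ ^ 2} +
          (lam * (lam * volume Ω) + lam * (lam * volume {z | z ∈ Ωᶜ ∧ (lam : ℝ≥0∞) ≤ ‖kerOp K b z‖ₑ})) := by ring
    _ ≤ B ^ 2 * (I2 + (1 + czConst d) ^ 2 * lam * I1) + (lam * (czConst d * I1) + lam * (B * (2 * I1))) := by
        exact add_le_add (hm1.trans hTg) (add_le_add (mul_le_mul_right hvol _)
          (mul_le_mul_right (hm2.trans (hTb.trans (mul_le_mul_right hb1 _))) _))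
    -- Nonnegative terms are added so that `I2` and `lam * I1` carry the same coefficient
    -- `czWeakConst d B`.
    _ ≤ (B ^ 2 * I2 + B ^ 2 * (lam * I1)) + ((B ^ 2 * (1 + czConst d) ^ 2 + czConst d + 2 * B) * (lam * I1) +
          (B ^ 2 * (1 + czConst d) ^ 2 + czConst d + 2 * B) * I2) := by
        calc _ = B ^ 2 * I2 + (B ^ 2 * (1 + czConst d) ^ 2 + czConst d + 2 * B) * (lam * I1) := by ring
          _ ≤ _ := add_le_add le_self_add le_self_add
    _ = _ := by
        rw [czWeakConst]; push_cast; ring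

/-! ### Interpolation -/

/-- Together with the next lemma this is the integral over the levels for a fixed value `x =
|u(z)|`. The low part contributes for `t ≥ x` and converges because `p < 2`; the high part
contributes for `t < 2x` and converges because `p > 1`. -/
lemma lintegral_rpow_tail_le {p : ℝ} (hp : p < 2) (x : ℝ≥0) :
    ∫⁻ t in Set.Ioi (0 : ℝ), ENNReal.ofReal (t ^ (p - 3)) * (Set.Ici (x : ℝ)).indicator (fun _ => (x : ℝ≥0∞) ^ 2) t ≤
      ENNReal.ofReal (1 / (2 - p)) * (x : ℝ≥0∞) ^ p := by
  rcases eq_or_ne x 0 with rfl | hx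
  · have : ∀ t : ℝ, (Set.Ici ((0 : ℝ≥0) : ℝ)).indicator (fun _ => ((0 : ℝ≥0) : ℝ≥0∞) ^ 2) t = 0 := fun t => by
      simp
    simp_rw [this]; simp
  have hx0 : (0 : ℝ) < x := by exact_mod_cast pos_iff_ne_zero.2 hx
  have hi := integrableOn_Ioi_rpow_of_lt (a := p - 3) (by linarith) hx0
  have e1 : ∀ t : ℝ, ENNReal.ofReal (t ^ (p - 3)) * (Set.Ici (x : ℝ)).indicator (fun _ => (x : ℝ≥0∞) ^ 2) t =
      (Set.Ici (x : ℝ)).indicator (fun t => ENNReal.ofReal (t ^ (p - 3)) * (x : ℝ≥0∞) ^ 2) t := fun t => by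
    by_cases ht : t ∈ Set.Ici (x : ℝ) <;> simp [ht]
  simp_rw [e1]
  rw [setLIntegral_indicator measurableSet_Ici]
  have e2 : Set.Ici (x : ℝ) ∩ Set.Ioi 0 = Set.Ici (x : ℝ) := Set.inter_eq_left.2 fun t ht => lt_of_lt_of_le hx0 ht
  rw [e2, setLIntegral_congr (Ioi_ae_eq_Ici (a := (x : ℝ))).symm,
    lintegral_mul_const' _ _ (by simp), ← ofReal_integral_eq_lintegral_ofReal hi
      ((ae_restrict_mem measurableSet_Ioi).mono fun t ht => Real.rpow_nonneg (hx0.trans ht).le _),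
    integral_Ioi_rpow_of_lt (by linarith) hx0]
  have e3 : (x : ℝ≥0∞) = ENNReal.ofReal (x : ℝ) := by simp
  rw [e3, ENNReal.ofReal_rpow_of_pos hx0, ← ENNReal.ofReal_pow hx0.le, ← ENNReal.ofReal_mul' (by positivity),
    ← ENNReal.ofReal_mul' (by positivity)]
  refine ENNReal.ofReal_le_ofReal (le_of_eq ?_)
  have e4 : (x : ℝ) ^ p = (x : ℝ) ^ (p - 3 + 1) * (x : ℝ) ^ 2 := by
    rw [← Real.rpow_natCast, ← Real.rpow_add hx0]; congr 1; push_cast; ring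
  rw [e4]
  have : p - 3 + 1 ≠ 0 := by linarith
  have : 2 - p ≠ 0 := by linarith
  rw [show p - 3 + 1 = -(2 - p) by ring]
  field_simp

lemma lintegral_rpow_head_le {p : ℝ} (hp : 1 < p) (x : ℝ≥0) :
    ∫⁻ t in Set.Ioi (0 : ℝ), ENNReal.ofReal (t ^ (p - 2)) * (Set.Iio (2 * x : ℝ)).indicator (fun _ => (x : ℝ≥0∞)) t ≤
      ENNReal.ofReal (2 ^ (p - 1) / (p - 1)) * (x : ℝ≥0∞) ^ p := by
  rcases eq_or_ne x 0 with rfl | hx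
  · have : ∀ t : ℝ, (Set.Iio (2 * (0 : ℝ≥0) : ℝ)).indicator (fun _ => ((0 : ℝ≥0) : ℝ≥0∞)) t = 0 := fun t => by
      simp
    simp_rw [this]; simp
  have hx0 : (0 : ℝ) < x := by exact_mod_cast pos_iff_ne_zero.2 hx
  have hi := (intervalIntegral.intervalIntegrable_rpow' (a := 0) (b := 2 * x) (r := p - 2) (by linarith))
  rw [intervalIntegrable_iff_integrableOn_Ioc_of_le (by positivity)] at hi
  have e1 : ∀ t : ℝ, ENNReal.ofReal (t ^ (p - 2)) * (Set.Iio (2 * x : ℝ)).indicator (fun _ => (x : ℝ≥0∞)) t =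
      (Set.Iio (2 * x : ℝ)).indicator (fun t => ENNReal.ofReal (t ^ (p - 2)) * (x : ℝ≥0∞)) t := fun t => by
    by_cases ht : t ∈ Set.Iio (2 * x : ℝ) <;> simp [ht]
  simp_rw [e1]
  rw [setLIntegral_indicator measurableSet_Iio]
  refine (lintegral_mono_set (t := Set.Ioc 0 (2 * x : ℝ)) fun t ht => ⟨ht.2, le_of_lt ht.1⟩).trans ?_
  rw [lintegral_mul_const' _ _ (by simp), ← ofReal_integral_eq_lintegral_ofReal hi
      ((ae_restrict_mem measurableSet_Ioc).mono fun t ht => Real.rpow_nonneg ht.1.le _),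
    ← intervalIntegral.integral_of_le (by positivity), integral_rpow (Or.inl (by linarith))]
  have e3 : (x : ℝ≥0∞) = ENNReal.ofReal (x : ℝ) := by simp
  rw [e3, ENNReal.ofReal_rpow_of_pos hx0, ← ENNReal.ofReal_mul' (by positivity),
    ← ENNReal.ofReal_mul' (by positivity)]
  refine ENNReal.ofReal_le_ofReal (le_of_eq ?_)
  have e4 : (x : ℝ) ^ p = (x : ℝ) ^ (p - 1) * (x : ℝ) := by
    nth_rewrite 3 [← Real.rpow_one (x : ℝ)]
    rw [← Real.rpow_add hx0]; congr 1; ring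
  rw [e4, show p - 2 + 1 = p - 1 by ring, Real.zero_rpow (by linarith), Real.mul_rpow (by norm_num) hx0.le]
  ring

/-- The constant in the strong type estimate. -/
def czStrongConst (d : ℕ) (B : ℝ≥0) (p : ℝ) : ℝ≥0 :=
  p.toNNReal * (czWeakConst d B * (4 * (1 / (2 - p)).toNNReal + 2 * (2 ^ (p - 1) / (p - 1)).toNNReal))

/-- Marcinkiewicz interpolation by hand: the layer cake formula, the weak estimate at every level,
and Tonelli to integrate over the levels first. -/
lemma IsCZKernel.lintegral_rpow_le {d : ℕ} {K : Space d → Space d → ℂ} {B : ℝ≥0} (hK : IsCZKernel K B)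
    {u : Space d → ℂ} (hc : Continuous u) (hu : HasCompactSupport u) {p : ℝ} (hp : 1 < p) (hp2 : p < 2) :
    ∫⁻ z, ‖kerOp K u z‖ₑ ^ p ≤ czStrongConst d B p * ∫⁻ z, ‖u z‖ₑ ^ p := by
  obtain ⟨C, hC⟩ := hK.schur
  have hp0 : 0 < p := by linarith
  have hui : Integrable u := hc.integrable_of_hasCompactSupport hu
  have hTm := hC.aestronglyMeasurable_kerOp hui.1
  set A : ℝ → ℝ≥0∞ := fun t => ∫⁻ z, (Set.Ici (‖u z‖₊ : ℝ)).indicator (fun _ => (‖u z‖₊ : ℝ≥0∞) ^ 2) t with hA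
  set D : ℝ → ℝ≥0∞ := fun t => ∫⁻ z, (Set.Iio (2 * ‖u z‖₊ : ℝ)).indicator (fun _ => (‖u z‖₊ : ℝ≥0∞)) t with hD
  have hweak : ∀ t ∈ Set.Ioi (0 : ℝ), volume {z | t < ‖kerOp K u z‖} * ENNReal.ofReal (t ^ (p - 1)) ≤
      czWeakConst d B * (4 * (ENNReal.ofReal (t ^ (p - 3)) * A t) + 2 * (ENNReal.ofReal (t ^ (p - 2)) * D t)) := by
    intro t ht
    have ht0 : 0 < t := ht
    -- The weak estimate controls the set where `|Ku| > 2 lam`, so the level `t` of the layer cake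
    -- corresponds to `lam = t/2`.
    set lam : ℝ≥0 := (t / 2).toNNReal with hlam
    have hlv : (lam : ℝ) = t / 2 := Real.coe_toNNReal _ (by positivity)
    have hlE : (lam : ℝ≥0∞) = ENNReal.ofReal (t / 2) := rfl
    have hl : 0 < lam := Real.toNNReal_pos.2 (by positivity)
    have h1 := hK.weak_type hc hu hl
    have e1 : {z | 2 * (lam : ℝ≥0∞) < ‖kerOp K u z‖ₑ} = {z | t < ‖kerOp K u z‖} := by
      ext z
      show 2 * (lam : ℝ≥0∞) < ‖kerOp K u z‖ₑ ↔ t < ‖kerOp K u z‖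
      rw [enorm_eq_nnnorm, show (2 * (lam : ℝ≥0∞)) = ((2 * lam : ℝ≥0) : ℝ≥0∞) by push_cast; rfl, ENNReal.coe_lt_coe,
        ← NNReal.coe_lt_coe, NNReal.coe_mul, hlv, coe_nnnorm]
      norm_num
      rw [mul_div_cancel₀ _ two_ne_zero]
    have e2 : ∫⁻ z in {z | ‖u z‖₊ ≤ 2 * lam}, ‖u z‖ₑ ^ 2 = A t := by
      rw [← lintegral_indicator (measurableSet_le hc.nnnorm.measurable measurable_const)]
      refine lintegral_congr fun z => ?_
      have : z ∈ {z | ‖u z‖₊ ≤ 2 * lam} ↔ t ∈ Set.Ici (‖u z‖₊ : ℝ) := by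
        show ‖u z‖₊ ≤ 2 * lam ↔ (‖u z‖₊ : ℝ) ≤ t
        rw [← NNReal.coe_le_coe, NNReal.coe_mul, hlv]
        norm_num
        rw [mul_div_cancel₀ _ two_ne_zero]
      by_cases hz : z ∈ {z | ‖u z‖₊ ≤ 2 * lam}
      · rw [Set.indicator_of_mem hz, Set.indicator_of_mem (this.1 hz)]; rfl
      · rw [Set.indicator_of_notMem hz, Set.indicator_of_notMem (fun h => hz (this.2 h))]
    have e3 : ∫⁻ z in {z | lam < ‖u z‖₊}, ‖u z‖ₑ = D t := by
      rw [← lintegral_indicator (measurableSet_lt measurable_const hc.nnnorm.measurable)]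
      refine lintegral_congr fun z => ?_
      have : z ∈ {z | lam < ‖u z‖₊} ↔ t ∈ Set.Iio (2 * ‖u z‖₊ : ℝ) := by
        show lam < ‖u z‖₊ ↔ t < 2 * (‖u z‖₊ : ℝ)
        rw [← NNReal.coe_lt_coe, hlv]
        constructor <;> intro h <;> linarith
      by_cases hz : z ∈ {z | lam < ‖u z‖₊}
      · rw [Set.indicator_of_mem hz, Set.indicator_of_mem (this.1 hz)]; rfl
      · rw [Set.indicator_of_notMem hz, Set.indicator_of_notMem (fun h => hz (this.2 h))]
    rw [e1, e2, e3] at h1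
    have e4 : ENNReal.ofReal (t ^ (p - 1)) = ENNReal.ofReal (4 * t ^ (p - 3)) * (lam : ℝ≥0∞) ^ 2 := by
      rw [hlE, ← ENNReal.ofReal_pow (by positivity), ← ENNReal.ofReal_mul (by positivity)]
      congr 1
      have : t ^ (p - 1) = t ^ (p - 3) * t ^ 2 := by
        rw [← Real.rpow_natCast, ← Real.rpow_add ht0]; congr 1; push_cast; ring
      rw [this]; ring
    have e5 : ENNReal.ofReal (4 * t ^ (p - 3)) * (lam : ℝ≥0∞) = ENNReal.ofReal (2 * t ^ (p - 2)) := by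
      rw [hlE, ← ENNReal.ofReal_mul (by positivity)]
      congr 1
      have : t ^ (p - 2) = t ^ (p - 3) * t := by
        nth_rewrite 3 [← Real.rpow_one t]
        rw [← Real.rpow_add ht0]; congr 1; ring
      rw [this]; ring
    calc volume {z | t < ‖kerOp K u z‖} * ENNReal.ofReal (t ^ (p - 1))
        = ENNReal.ofReal (4 * t ^ (p - 3)) * ((lam : ℝ≥0∞) ^ 2 * volume {z | t < ‖kerOp K u z‖}) := by rw [e4]; ring
      _ ≤ ENNReal.ofReal (4 * t ^ (p - 3)) * (czWeakConst d B * (A t + lam * D t)) := by gcongr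
      _ = czWeakConst d B * (ENNReal.ofReal (4 * t ^ (p - 3)) * A t +
            ENNReal.ofReal (4 * t ^ (p - 3)) * lam * D t) := by ring
      _ = _ := by
          rw [e5, ENNReal.ofReal_mul (by norm_num), ENNReal.ofReal_mul (by norm_num)]
          simp only [ENNReal.ofReal_ofNat, mul_assoc]
  have hnm : Measurable fun q : ℝ × Space d => (‖u q.2‖₊ : ℝ) := (hc.nnnorm.measurable.comp measurable_snd).coe_nnreal_real
  have hnE : Measurable fun q : ℝ × Space d => (‖u q.2‖₊ : ℝ≥0∞) := (hc.nnnorm.measurable.comp measurable_snd).coe_nnreal_ennreal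
  have hmA : Measurable fun q : ℝ × Space d => ENNReal.ofReal (q.1 ^ (p - 3)) *
      (Set.Ici (‖u q.2‖₊ : ℝ)).indicator (fun _ => (‖u q.2‖₊ : ℝ≥0∞) ^ 2) q.1 := by
    refine Measurable.mul (by fun_prop) ?_
    exact Measurable.ite (measurableSet_le hnm measurable_fst) (hnE.pow_const 2) measurable_const
  have hmD : Measurable fun q : ℝ × Space d => ENNReal.ofReal (q.1 ^ (p - 2)) *
      (Set.Iio (2 * ‖u q.2‖₊ : ℝ)).indicator (fun _ => (‖u q.2‖₊ : ℝ≥0∞)) q.1 := by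
    refine Measurable.mul (by fun_prop) ?_
    exact Measurable.ite (measurableSet_lt measurable_fst (hnm.const_mul 2)) hnE measurable_const
  have hIA : ∫⁻ t in Set.Ioi (0 : ℝ), ENNReal.ofReal (t ^ (p - 3)) * A t ≤
      ENNReal.ofReal (1 / (2 - p)) * ∫⁻ z, ‖u z‖ₑ ^ p := by
    simp only [hA]
    calc _ = ∫⁻ t in Set.Ioi (0 : ℝ), ∫⁻ z, ENNReal.ofReal (t ^ (p - 3)) *
          (Set.Ici (‖u z‖₊ : ℝ)).indicator (fun _ => (‖u z‖₊ : ℝ≥0∞) ^ 2) t := by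
          refine lintegral_congr fun t => (lintegral_const_mul' _ _ ENNReal.ofReal_ne_top).symm
      _ = ∫⁻ z, ∫⁻ t in Set.Ioi (0 : ℝ), ENNReal.ofReal (t ^ (p - 3)) *
          (Set.Ici (‖u z‖₊ : ℝ)).indicator (fun _ => (‖u z‖₊ : ℝ≥0∞) ^ 2) t :=
          lintegral_lintegral_swap hmA.aemeasurable
      _ ≤ ∫⁻ z, ENNReal.ofReal (1 / (2 - p)) * ‖u z‖ₑ ^ p := lintegral_mono fun z => lintegral_rpow_tail_le hp2 _
      _ = _ := lintegral_const_mul' _ _ ENNReal.ofReal_ne_top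
  have hID : ∫⁻ t in Set.Ioi (0 : ℝ), ENNReal.ofReal (t ^ (p - 2)) * D t ≤
      ENNReal.ofReal (2 ^ (p - 1) / (p - 1)) * ∫⁻ z, ‖u z‖ₑ ^ p := by
    simp only [hD]
    calc _ = ∫⁻ t in Set.Ioi (0 : ℝ), ∫⁻ z, ENNReal.ofReal (t ^ (p - 2)) *
          (Set.Iio (2 * ‖u z‖₊ : ℝ)).indicator (fun _ => (‖u z‖₊ : ℝ≥0∞)) t := by
          refine lintegral_congr fun t => (lintegral_const_mul' _ _ ENNReal.ofReal_ne_top).symm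
      _ = ∫⁻ z, ∫⁻ t in Set.Ioi (0 : ℝ), ENNReal.ofReal (t ^ (p - 2)) *
          (Set.Iio (2 * ‖u z‖₊ : ℝ)).indicator (fun _ => (‖u z‖₊ : ℝ≥0∞)) t :=
          lintegral_lintegral_swap hmD.aemeasurable
      _ ≤ ∫⁻ z, ENNReal.ofReal (2 ^ (p - 1) / (p - 1)) * ‖u z‖ₑ ^ p := lintegral_mono fun z => lintegral_rpow_head_le hp _
      _ = _ := lintegral_const_mul' _ _ ENNReal.ofReal_ne_top
  have hlayer := lintegral_rpow_eq_lintegral_meas_lt_mul (volume : Measure (Space d))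
    (f := fun z => ‖kerOp K u z‖) (.of_forall fun z => norm_nonneg _) hTm.norm.aemeasurable hp0
  have e6 : ∀ z, ENNReal.ofReal (‖kerOp K u z‖ ^ p) = ‖kerOp K u z‖ₑ ^ p := fun z => by
    rw [← ENNReal.ofReal_rpow_of_nonneg (norm_nonneg _) hp0.le, ofReal_norm]
  simp_rw [e6] at hlayer
  rw [hlayer]
  have hmA' : AEMeasurable (fun t => ENNReal.ofReal (t ^ (p - 3)) * A t) (volume.restrict (Set.Ioi (0 : ℝ))) := by
    have := hmA.lintegral_prod_right' (ν := (volume : Measure (Space d)))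
    simp_rw [lintegral_const_mul' _ _ ENNReal.ofReal_ne_top] at this
    exact this.aemeasurable
  calc ENNReal.ofReal p * ∫⁻ t in Set.Ioi (0 : ℝ), volume {z | t < ‖kerOp K u z‖} * ENNReal.ofReal (t ^ (p - 1))
      ≤ ENNReal.ofReal p * ∫⁻ t in Set.Ioi (0 : ℝ), czWeakConst d B * (4 * (ENNReal.ofReal (t ^ (p - 3)) * A t) +
          2 * (ENNReal.ofReal (t ^ (p - 2)) * D t)) := by
        gcongr ENNReal.ofReal p * ?_
        exact setLIntegral_mono' measurableSet_Ioi hweak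
    _ = ENNReal.ofReal p * (czWeakConst d B * (4 * (∫⁻ t in Set.Ioi (0 : ℝ), ENNReal.ofReal (t ^ (p - 3)) * A t) +
          2 * ∫⁻ t in Set.Ioi (0 : ℝ), ENNReal.ofReal (t ^ (p - 2)) * D t)) := by
        rw [lintegral_const_mul' _ _ ENNReal.coe_ne_top, lintegral_add_left' (hmA'.const_mul 4),
          lintegral_const_mul' _ _ (by simp), lintegral_const_mul' _ _ (by simp)]
    _ ≤ ENNReal.ofReal p * (czWeakConst d B * (4 * (ENNReal.ofReal (1 / (2 - p)) * ∫⁻ z, ‖u z‖ₑ ^ p) +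
          2 * (ENNReal.ofReal (2 ^ (p - 1) / (p - 1)) * ∫⁻ z, ‖u z‖ₑ ^ p))) := by gcongr
    _ = _ := by
        rw [czStrongConst]
        push_cast
        simp only [ENNReal.ofReal]
        ring

/-! ### Duality -/

/-- The norm of a function in `L^q` is attained by pairing with the dual space. -/
lemma norm_le_of_forall_integral_mul_le {d : ℕ} {p q : ℝ≥0∞} [Fact (1 ≤ p)] [Fact (1 ≤ q)] (hq : 1 < q)
    (hp' : p ≠ ⊤) (hq' : q ≠ ⊤) (hpq : ENNReal.HolderConjugate p q) (h : LpSpace d q) {C : ℝ} (hC : 0 ≤ C)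
    (hh : ∀ v : LpSpace d p, ‖∫ z, h z * v z‖ ≤ C * ‖v‖) : ‖h‖ ≤ C := by
  have hr := hpq.toReal_of_ne_top hp' hq'
  set r : ℝ := q.toReal with hrdef
  have hr1 : 1 < r := by simpa using (ENNReal.toReal_lt_toReal ENNReal.one_ne_top hq').2 hq
  -- The extremal function of Hölder's inequality, for which the pairing with `h` equals `‖h‖^r`.
  -- The conjugate factor makes it vanish where `h` does, whatever the power `r - 2`.
  set v : Space d → ℂ := fun z => ((‖h z‖ ^ (r - 2) : ℝ) : ℂ) * (starRingEnd ℂ) (h z) with hv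
  have hnv : ∀ z, ‖v z‖ = ‖h z‖ ^ (r - 1) := fun z => by
    simp only [hv]
    rw [norm_mul, Complex.norm_real, RCLike.norm_conj, Real.norm_of_nonneg (by positivity)]
    rcases eq_or_ne ‖h z‖ 0 with h0 | h0
    · rw [h0, mul_zero, Real.zero_rpow (by linarith)]
    · rw [← Real.rpow_add_one h0]; congr 1; ring
  have hhm := (Lp.memLp h).1
  have hvm : AEStronglyMeasurable v volume :=
    (Complex.continuous_ofReal.comp_aestronglyMeasurable
      (hhm.norm.aemeasurable.pow_const (r - 2)).aestronglyMeasurable).mul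
      (Complex.continuous_conj.comp_aestronglyMeasurable hhm)
  have hpe : p * ENNReal.ofReal (r - 1) = q := by
    have h1 : p = ENNReal.ofReal p.toReal := (ENNReal.ofReal_toReal hp').symm
    have h2 : q = ENNReal.ofReal r := (ENNReal.ofReal_toReal hq').symm
    rw [h1, h2, ← ENNReal.ofReal_mul ENNReal.toReal_nonneg]
    congr 1
    have := hr.mul_eq_add
    linarith
  have hvn : eLpNorm v p volume = eLpNorm h q volume ^ (r - 1) := by
    have e := eLpNorm_norm_rpow (p := p) (μ := volume) (h : Space d → ℂ) (by linarith : 0 < r - 1)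
    rw [hpe] at e
    rw [← e]
    refine eLpNorm_congr_norm_ae (.of_forall fun z => ?_)
    rw [hnv, Real.norm_of_nonneg (by positivity)]
  have hvL : MemLp v p volume := ⟨hvm, by
    rw [hvn]; exact ENNReal.rpow_lt_top_of_nonneg (by linarith) (Lp.eLpNorm_ne_top h)⟩
  have h1 := hh (hvL.toLp v)
  rw [Lp.norm_toLp, hvn, ← ENNReal.toReal_rpow, ← Lp.norm_def] at h1
  have h2 : ∫ z, h z * hvL.toLp v z = ((‖h‖ ^ r : ℝ) : ℂ) := by
    have e1 : ∫ z, h z * hvL.toLp v z = ∫ z, ((‖h z‖ ^ r : ℝ) : ℂ) := by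
      refine integral_congr_ae ?_
      filter_upwards [hvL.coeFn_toLp] with z hz
      rw [hz]
      simp only [hv]
      rw [mul_left_comm, Complex.mul_conj, Complex.normSq_eq_norm_sq, ← Complex.ofReal_mul]
      congr 1
      rcases eq_or_ne ‖h z‖ 0 with h0 | h0
      · rw [h0, Real.zero_rpow (by linarith : r ≠ 0)]; simp
      · rw [← Real.rpow_natCast, ← Real.rpow_add (lt_of_le_of_ne (norm_nonneg _) h0.symm)]
        congr 1; push_cast; ring
    rw [e1, integral_complex_ofReal]
    congr 1
    have h3 := (Lp.memLp h).eLpNorm_eq_integral_rpow_norm (zero_lt_one.trans hq).ne' hq'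
    have h4 : 0 ≤ ∫ z, ‖h z‖ ^ r := integral_nonneg fun z => by positivity
    rw [Lp.norm_def, h3, ENNReal.toReal_ofReal (by positivity), ← Real.rpow_mul h4, inv_mul_cancel₀ (by linarith),
      Real.rpow_one]
  rw [h2, Complex.norm_real, Real.norm_of_nonneg (by positivity)] at h1
  rcases eq_or_ne ‖h‖ 0 with h0 | h0
  · rw [h0]; exact hC
  · have hpos : 0 < ‖h‖ := lt_of_le_of_ne (norm_nonneg _) h0.symm
    have e : ‖h‖ ^ r = ‖h‖ * ‖h‖ ^ (r - 1) := by
      rw [mul_comm, ← Real.rpow_add_one h0]; congr 1; ring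
    rw [e] at h1
    exact le_of_mul_le_mul_right h1 (by positivity)

/-- Hölder's inequality for the bilinear pairing. -/
lemma norm_integral_mul_le {d : ℕ} {p q : ℝ≥0∞} [Fact (1 ≤ p)] [Fact (1 ≤ q)] (hp : 1 < p) (hp' : p ≠ ⊤)
    (hpq : ENNReal.HolderConjugate p q) (f : LpSpace d p) (v : LpSpace d q) :
    ‖∫ z, f z * v z‖ ≤ ‖f‖ * ‖v‖ := by
  have h1 := lintegral_mul_le_eLpNorm_mul_eLpNorm hp hp' hpq (Lp.memLp f).1.enorm (Lp.memLp v).1.enorm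
  rw [eLpNorm_enorm, eLpNorm_enorm] at h1
  have h2 : ‖∫ z, f z * v z‖ₑ ≤ eLpNorm f p volume * eLpNorm v q volume := by
    refine (enorm_integral_le_lintegral_enorm _).trans ?_
    simpa only [enorm_mul] using h1
  have h3 := ENNReal.toReal_mono (ENNReal.mul_ne_top (Lp.eLpNorm_ne_top f) (Lp.eLpNorm_ne_top v)) h2
  rw [ENNReal.toReal_mul, ← Lp.norm_def, ← Lp.norm_def, toReal_enorm] at h3
  exact h3

/-! ### Sums of dyadic pieces -/

/-- A family of symbols `φ_j`, taken from a finite set and supported in `[a, b] ⊂ (0, ∞)`. -/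
structure IsDyadicFamily (a b : ℝ) (φ : ℕ → ℝ → ℝ) : Prop where
  pos : 0 < a
  finite : (Set.range φ).Finite
  test : ∀ j, IsTestSymbol (φ j)
  supp : ∀ j s, φ j s ≠ 0 → s ∈ Set.Icc a b

/-- The symbol `φ(4^{-j} s)`. -/
def dil (φ : ℕ → ℝ → ℝ) (j : ℕ) (s : ℝ) : ℝ := φ j ((4 : ℝ)⁻¹ ^ j * s)

lemma IsDyadicFamily.dil_test {a b : ℝ} {φ : ℕ → ℝ → ℝ} (h : IsDyadicFamily a b φ) (j : ℕ) : IsTestSymbol (dil φ j) :=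
  (h.test j).comp_mul_left (by positivity)

/-- At a given `s` only indices with `4^j ∈ [s/b, s/a]` contribute, and there are at most `n` of
them once `4^n > b/a`. The summands are uniformly bounded because the family takes finitely many
values. -/
lemma IsDyadicFamily.exists_bound {a b : ℝ} {φ : ℕ → ℝ → ℝ} (h : IsDyadicFamily a b φ) :
    ∃ M : ℝ, 0 < M ∧ ∀ (N : ℕ) (ε : ℕ → ℝ), (∀ j, |ε j| ≤ 1) → ∀ s, |∑ j ∈ Finset.range N, ε j * dil φ j s| ≤ M := by
  classical
  choose! B hB using fun (j : ℕ) => (h.test j).exists_bound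
  obtain ⟨M0, hM0⟩ : ∃ M0, ∀ j s, |φ j s| ≤ M0 := by
    have h1 : ∀ f ∈ Set.range φ, ∃ M, ∀ s, |f s| ≤ M := by rintro _ ⟨j, rfl⟩; exact ⟨B j, hB j⟩
    choose! B' hB' using h1
    obtain ⟨M0, hM0⟩ := (h.finite.image B').bddAbove
    exact ⟨M0, fun j s => (hB' _ ⟨j, rfl⟩ s).trans (hM0 ⟨φ j, ⟨j, rfl⟩, rfl⟩)⟩
  have hM0' : 0 ≤ M0 := (abs_nonneg _).trans (hM0 0 0)
  have ha := h.pos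
  obtain ⟨n, hn⟩ := pow_unbounded_of_one_lt (b / a) (by norm_num : (1 : ℝ) < 4)
  rw [div_lt_iff₀ ha] at hn
  refine ⟨n * M0 + 1, by positivity, fun N ε hε s => ?_⟩
  set J := (Finset.range N).filter fun j => dil φ j s ≠ 0 with hJ
  have e : ∑ j ∈ Finset.range N, ε j * dil φ j s = ∑ j ∈ J, ε j * dil φ j s := by
    refine (Finset.sum_subset (Finset.filter_subset _ _) fun j hj hj' => ?_).symm
    have : dil φ j s = 0 := by
      by_contra h0
      exact hj' (Finset.mem_filter.2 ⟨hj, h0⟩)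
    rw [this, mul_zero]
  have hmem : ∀ j ∈ J, 4 ^ j * a ≤ s ∧ s ≤ 4 ^ j * b := fun j hj => by
    have h1 := h.supp j _ (Finset.mem_filter.1 hj).2
    have h4 : (0 : ℝ) < 4 ^ j := by positivity
    have h5 : (4 : ℝ) ^ j * ((4 : ℝ)⁻¹ ^ j * s) = s := by
      rw [← mul_assoc, ← mul_pow]; norm_num
    constructor
    · calc 4 ^ j * a ≤ 4 ^ j * ((4 : ℝ)⁻¹ ^ j * s) := by gcongr; exact h1.1
        _ = s := h5
    · calc s = 4 ^ j * ((4 : ℝ)⁻¹ ^ j * s) := h5.symm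
        _ ≤ _ := by gcongr; exact h1.2
  have hcard : J.card ≤ n := by
    rcases J.eq_empty_or_nonempty with h0 | h0
    · rw [h0]; simp
    · have hsub : J ⊆ Finset.Ico (J.min' h0) (J.min' h0 + n) := fun j hj => by
        refine Finset.mem_Ico.2 ⟨J.min'_le j hj, ?_⟩
        by_contra hlt
        rw [not_lt] at hlt
        have h1 := (hmem j hj).1
        have h2 := (hmem _ (J.min'_mem h0)).2
        have h3 : (4 : ℝ) ^ (J.min' h0 + n) ≤ 4 ^ j := pow_le_pow_right₀ (by norm_num) hlt
        have h4 : (0 : ℝ) < 4 ^ (J.min' h0) := by positivity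
        have h5 : (4 : ℝ) ^ (J.min' h0) * b < 4 ^ (J.min' h0) * (4 ^ n * a) := mul_lt_mul_of_pos_left hn h4
        have h6 : (4 : ℝ) ^ (J.min' h0 + n) * a ≤ 4 ^ j * a := by gcongr
        rw [pow_add] at h6
        nlinarith
      simpa using Finset.card_le_card hsub
  rw [e]
  calc |∑ j ∈ J, ε j * dil φ j s| ≤ ∑ j ∈ J, |ε j * dil φ j s| := Finset.abs_sum_le_sum_abs _ _
    _ ≤ ∑ _j ∈ J, M0 := Finset.sum_le_sum fun j _ => by
        rw [abs_mul]
        exact (mul_le_of_le_one_left (abs_nonneg _) (hε j)).trans (hM0 _ _)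
    _ = J.card * M0 := by simp
    _ ≤ n * M0 + 1 := by
        have : (J.card : ℝ) ≤ n := by exact_mod_cast hcard
        nlinarith

/-- The summand is dominated by 12 times the increment of `y/(1+y)` between `y = x 2^j` and `2y`, so
the sum telescopes, with a bound independent of `x` and `N`. -/
lemma sum_min_le {x : ℝ} (hx : 0 < x) (N : ℕ) :
    ∑ j ∈ Finset.range N, min (x * 2 ^ j) (2 / (x * 2 ^ j)) ≤ 12 := by
  have h : ∀ j ∈ Finset.range N, min (x * 2 ^ j) (2 / (x * 2 ^ j)) ≤
      12 * (x * 2 ^ (j + 1) / (1 + x * 2 ^ (j + 1))) - 12 * (x * 2 ^ j / (1 + x * 2 ^ j)) := by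
    intro j _
    set y := x * 2 ^ j with hy
    have hy0 : 0 < y := by positivity
    have e : x * 2 ^ (j + 1) = 2 * y := by rw [hy]; ring
    have e2 : 12 * (2 * y / (1 + 2 * y)) - 12 * (y / (1 + y)) = 12 * y / ((1 + 2 * y) * (1 + y)) := by
      field_simp; ring
    rw [e, e2, le_div_iff₀ (by positivity)]
    rcases le_total y 1 with h1 | h1
    · have := min_le_left y (2 / y)
      calc min y (2 / y) * ((1 + 2 * y) * (1 + y)) ≤ y * ((1 + 2 * y) * (1 + y)) := by gcongr
        _ ≤ 12 * y := by nlinarith [mul_pos hy0 hy0]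
    · calc min y (2 / y) * ((1 + 2 * y) * (1 + y)) ≤ 2 / y * ((1 + 2 * y) * (1 + y)) := by
            gcongr; exact min_le_right _ _
        _ ≤ 2 / y * (6 * y ^ 2) := mul_le_mul_of_nonneg_left (by nlinarith) (by positivity)
        _ = 12 * y := by field_simp; ring
  refine (Finset.sum_le_sum h).trans ?_
  rw [Finset.sum_range_sub (fun j => 12 * (x * 2 ^ j / (1 + x * 2 ^ j)))]
  have h1 : x * 2 ^ N / (1 + x * 2 ^ N) ≤ 1 := by
    rw [div_le_one (by positivity)]; linarith
  have h2 : 0 ≤ x * 2 ^ 0 / (1 + x * 2 ^ 0) := by positivity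
  linarith

/-- The Hörmander condition for a kernel at scale `t`. -/
lemma lintegral_hormander_le {d : ℕ} {K : Space d → Space d → ℂ} {C D : ℝ≥0} (hK : IsSchurKernel K D)
    (hs : ∀ z w, K z w = K w z) {t : ℝ}
    (h1 : ∀ z, ∫⁻ w, ‖K z w‖ₑ * ‖z - w‖ₑ ≤ ENNReal.ofReal t * C)
    (h2 : ∀ w w', ∫⁻ z, ‖K z w - K z w'‖ₑ ≤ ENNReal.ofReal (‖w - w'‖ / t) * C) (ht : 0 < t)
    {w w' : Space d} (hw : w ≠ w') :
    ∫⁻ z in {z | 2 * ‖w - w'‖ ≤ ‖z - w'‖}, ‖K z w - K z w'‖ₑ ≤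
      ENNReal.ofReal (min (‖w - w'‖ / t) (2 / (‖w - w'‖ / t))) * C := by
  set r := ‖w - w'‖ with hr
  have hr0 : 0 < r := norm_pos_iff.2 (sub_ne_zero.2 hw)
  -- Chebyshev with the first moment: at distance at least `r` the mass of the kernel is at most
  -- `(t/r) C`.
  have hfar : ∀ (w : Space d) (S : Set (Space d)), MeasurableSet S → (∀ z ∈ S, r ≤ ‖z - w‖) →
      ∫⁻ z in S, ‖K z w‖ₑ ≤ ENNReal.ofReal (t / r) * C := by
    intro w S hS hSr
    have h3 : ENNReal.ofReal r * ∫⁻ z in S, ‖K z w‖ₑ ≤ ENNReal.ofReal t * C := by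
      rw [← lintegral_const_mul' _ _ ENNReal.ofReal_ne_top]
      refine le_trans ?_ (h1 w)
      refine (setLIntegral_mono' (g := fun z => ‖K w z‖ₑ * ‖w - z‖ₑ) hS fun z hz => ?_).trans
        (setLIntegral_le_lintegral _ _)
      rw [mul_comm, hs w z, ← ofReal_norm (w - z), norm_sub_rev]
      gcongr
      exact hSr z hz
    calc ∫⁻ z in S, ‖K z w‖ₑ = ENNReal.ofReal r⁻¹ * (ENNReal.ofReal r * ∫⁻ z in S, ‖K z w‖ₑ) := by
          rw [← mul_assoc, ← ENNReal.ofReal_mul (by positivity), inv_mul_cancel₀ hr0.ne']; simp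
      _ ≤ ENNReal.ofReal r⁻¹ * (ENNReal.ofReal t * C) := by gcongr
      _ = _ := by
          rw [← mul_assoc, ← ENNReal.ofReal_mul (by positivity)]
          congr 2
          rw [div_eq_inv_mul]
  have hSm : MeasurableSet {z : Space d | 2 * r ≤ ‖z - w'‖} :=
    measurableSet_le measurable_const (by fun_prop)
  -- The modulus of continuity is the better bound for `r` small compared with the scale `t`, and
  -- the decay of each kernel separately for `r` large.
  rcases min_choice (r / t) (2 / (r / t)) with h | h <;> rw [h]
  · exact (setLIntegral_le_lintegral _ _).trans (h2 w w')
  · calc ∫⁻ z in {z | 2 * r ≤ ‖z - w'‖}, ‖K z w - K z w'‖ₑ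
        ≤ ∫⁻ z in {z | 2 * r ≤ ‖z - w'‖}, (‖K z w‖ₑ + ‖K z w'‖ₑ) := lintegral_mono fun z => enorm_sub_le
      _ = (∫⁻ z in {z | 2 * r ≤ ‖z - w'‖}, ‖K z w‖ₑ) + ∫⁻ z in {z | 2 * r ≤ ‖z - w'‖}, ‖K z w'‖ₑ :=
          lintegral_add_left (hK.meas_right w).enorm _
      _ ≤ ENNReal.ofReal (t / r) * C + ENNReal.ofReal (t / r) * C := by
          refine add_le_add (hfar w _ hSm fun z hz => ?_) (hfar w' _ hSm fun z hz => ?_)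
          · have h3 : 2 * r ≤ ‖z - w'‖ := hz
            have h4 : ‖z - w'‖ ≤ ‖z - w‖ + ‖w - w'‖ := norm_sub_le_norm_sub_add_norm_sub _ _ _
            linarith
          · have h3 : 2 * r ≤ ‖z - w'‖ := hz
            linarith
      _ = _ := by
          rw [← two_mul, ← mul_assoc, ← ENNReal.ofReal_ofNat 2, ← ENNReal.ofReal_mul (by norm_num)]
          congr 2
          field_simp

lemma IsSchurKernel.add {d : ℕ} {K K' : Space d → Space d → ℂ} {C C' : ℝ≥0} (hK : IsSchurKernel K C)
    (hK' : IsSchurKernel K' C') : IsSchurKernel (fun z w => K z w + K' z w) (C + C') where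
  meas := hK.meas.add hK'.meas
  left z := by
    refine (lintegral_mono fun w => enorm_add_le _ _).trans ?_
    rw [lintegral_add_left (hK.meas_left z).enorm]
    push_cast
    exact add_le_add (hK.left z) (hK'.left z)
  right w := by
    refine (lintegral_mono fun w => enorm_add_le _ _).trans ?_
    rw [lintegral_add_left (hK.meas_right w).enorm]
    push_cast
    exact add_le_add (hK.right w) (hK'.right w)

lemma IsSchurKernel.const_mul {d : ℕ} {K : Space d → Space d → ℂ} {C : ℝ≥0} (hK : IsSchurKernel K C) (c : ℂ) :
    IsSchurKernel (fun z w => c * K z w) (‖c‖₊ * C) where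
  meas := hK.meas.const_mul c
  left z := by
    simp only [enorm_mul]
    rw [lintegral_const_mul' _ _ enorm_ne_top]
    push_cast
    exact mul_le_mul_right (hK.left z) _
  right w := by
    simp only [enorm_mul]
    rw [lintegral_const_mul' _ _ enorm_ne_top]
    push_cast
    exact mul_le_mul_right (hK.right w) _

lemma IsOpKernel.integrable {d : ℕ} {F : ℝ → ℝ} {K : Space d → Space d → ℂ} (hK : IsOpKernel F K) {f : Space d → ℂ}
    (hf : Integrable f) (z : Space d) : Integrable fun w => K z w * f w := by
  obtain ⟨C, hC⟩ := hK.schur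
  obtain ⟨M, hM⟩ := hK.bdd
  exact hf.bdd_mul (c := M) (hC.meas_left z).aestronglyMeasurable (.of_forall (hM z))

lemma IsOpKernel.add {d : ℕ} (hd : 1 ≤ d) {F G : ℝ → ℝ} (hF : IsBddSymbol F) (hG : IsBddSymbol G)
    {K K' : Space d → Space d → ℂ} (hK : IsOpKernel F K)
    (hK' : IsOpKernel G K') : IsOpKernel (fun s => F s + G s) (fun z w => K z w + K' z w) where
  schur := by
    obtain ⟨C, hC⟩ := hK.schur
    obtain ⟨C', hC'⟩ := hK'.schur
    exact ⟨_, hC.add hC'⟩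
  bdd := by
    obtain ⟨C, hC⟩ := hK.bdd
    obtain ⟨C', hC'⟩ := hK'.bdd
    exact ⟨C + C', fun z w => (norm_add_le _ _).trans (add_le_add (hC z w) (hC' z w))⟩
  symm z w := by rw [hK.symm, hK'.symm]
  conj z w := by rw [map_add, hK.conj, hK'.conj]
  repr u hu z := by
    have hi := isTestFun_integrable hu
    have e : kerOp (fun z w => K z w + K' z w) u z = kerOp K u z + kerOp K' u z := by
      rw [kerOp, kerOp, kerOp, ← integral_add (hK.integrable hi z) (hK'.integrable hi z)]
      simp only [add_mul]
    rw [e, hK.repr u hu, hK'.repr u hu, symbolOp, symbolOp, symbolOp,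
      ← integral_add (integrable_symbol_mul_kap hd hF hu z) (integrable_symbol_mul_kap hd hG hu z)]
    simp [add_mul]

lemma IsOpKernel.const_mul {d : ℕ} {F : ℝ → ℝ} {K : Space d → Space d → ℂ} (hK : IsOpKernel F K) (c : ℝ) :
    IsOpKernel (fun s => c * F s) (fun z w => c * K z w) where
  schur := by
    obtain ⟨C, hC⟩ := hK.schur
    exact ⟨_, hC.const_mul c⟩
  bdd := by
    obtain ⟨C, hC⟩ := hK.bdd
    refine ⟨‖(c : ℂ)‖ * C, fun z w => ?_⟩
    rw [norm_mul]
    gcongr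
    exact hC z w
  symm z w := by rw [hK.symm]
  conj z w := by rw [map_mul, hK.conj, Complex.conj_ofReal]
  repr u hu z := by
    have e : kerOp (fun z w => c * K z w) u z = c * kerOp K u z := by
      rw [kerOp, kerOp, ← integral_const_mul]
      simp only [mul_assoc]
    rw [e, hK.repr u hu, symbolOp, symbolOp, ← integral_const_mul]
    simp [mul_assoc]

lemma isOpKernel_zero {d : ℕ} : IsOpKernel (fun _ => 0) (fun _ _ : Space d => 0) where
  schur := ⟨0, stronglyMeasurable_const, by simp, by simp⟩
  bdd := ⟨0, by simp⟩
  symm _ _ := rfl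
  conj _ _ := map_zero _
  repr u hu z := by simp [kerOp, symbolOp]

lemma isOpKernel_sum {d : ℕ} (hd : 1 ≤ d) {F : ℕ → ℝ → ℝ} (hF : ∀ j, IsTestSymbol (F j))
    {K : ℕ → Space d → Space d → ℂ} (hK : ∀ j, IsOpKernel (F j) (K j)) (N : ℕ) :
    IsOpKernel (fun s => ∑ j ∈ Finset.range N, F j s) (fun z w => ∑ j ∈ Finset.range N, K j z w) := by
  induction N with
  | zero => simpa using isOpKernel_zero
  | succ N ih =>
    simp only [Finset.sum_range_succ]
    exact ih.add hd (IsTestSymbol.sum _ fun j _ => hF j).isBddSymbol (hF N).isBddSymbol (hK N)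

/-- Signed sums of dyadic pieces have Calderón–Zygmund kernels, uniformly in the signs. -/
lemma IsDyadicFamily.exists_czKernel {d : ℕ} (hd : 1 ≤ d) {a b : ℝ} {φ : ℕ → ℝ → ℝ} (h : IsDyadicFamily a b φ) :
    ∃ B : ℝ≥0, ∀ (N : ℕ) (ε : ℕ → ℝ), (∀ j, |ε j| ≤ 1) → ∃ K : Space d → Space d → ℂ,
      IsOpKernel (fun s => ∑ j ∈ Finset.range N, ε j * dil φ j s) K ∧ IsCZKernel K B := by
  obtain ⟨M, hM0, hM⟩ := h.exists_bound
  obtain ⟨C, hC⟩ : ∃ C : ℝ≥0, ∀ j, ∃ K : Space d → Space d → ℂ, IsOpKernel (dil φ j) K ∧ IsSchurKernel K C ∧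
      (∀ z, ∫⁻ w, ‖K z w‖ₑ * ‖z - w‖ₑ ≤ ENNReal.ofReal ((2 : ℝ)⁻¹ ^ j) * C) ∧
      (∀ w w', ∫⁻ z, ‖K z w - K z w'‖ₑ ≤ ENNReal.ofReal (‖w - w'‖ / (2 : ℝ)⁻¹ ^ j) * C) := by
    have h1 : ∀ f ∈ Set.range φ, IsTestSymbol f := by rintro _ ⟨j, rfl⟩; exact h.test j
    choose! C hC using fun f (hf : f ∈ Set.range φ) => exists_opKernel d (h1 f hf)
    obtain ⟨C0, hC0⟩ := (h.finite.image C).bddAbove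
    refine ⟨C0, fun j => ?_⟩
    have hj : φ j ∈ Set.range φ := ⟨j, rfl⟩
    obtain ⟨K, k1, k2, k3, k4⟩ := hC _ hj ((4 : ℝ)⁻¹ ^ j) (by positivity) (pow_le_one₀ (by norm_num) (by norm_num))
    have hle : C (φ j) ≤ C0 := hC0 ⟨_, hj, rfl⟩
    have hsq : Real.sqrt ((4 : ℝ)⁻¹ ^ j) = (2 : ℝ)⁻¹ ^ j := by
      rw [Real.sqrt_eq_iff_eq_sq (by positivity) (by positivity), ← pow_mul, mul_comm, pow_mul]
      norm_num
    rw [hsq] at k3 k4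
    exact ⟨K, k1, k2.mono hle, fun z => (k3 z).trans (by gcongr), fun w w' => (k4 w w').trans (by gcongr)⟩
  choose K k1 k2 k3 k4 using hC
  -- The first summand is the `L²` bound and the second the Hörmander constant, with 12 from the
  -- telescoping sum over the scales `√(4^{-j}) = 2^{-j}`.
  refine ⟨(2 * M).toNNReal + 12 * C, fun N ε hε => ?_⟩
  have hFt : ∀ j, IsTestSymbol fun s => ε j * dil φ j s := fun j => (h.dil_test j).const_mul _
  have hop := isOpKernel_sum hd hFt (fun j => (k1 j).const_mul (ε j)) N
  refine ⟨_, hop, hop.schur, hop.bdd, fun f hf => ?_, fun w w' => ?_⟩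
  · have hFs : IsTestSymbol fun s => ∑ j ∈ Finset.range N, ε j * dil φ j s := IsTestSymbol.sum _ fun j _ => hFt j
    have h1 := norm_symOp_two_le hd hFs hM0 (hM N ε hε) (hf.toLp f)
    have h2 := hop.symOp_apply hd ENNReal.ofNat_ne_top hFs.isBddSymbol (hf.toLp f)
    rw [kerOp_congr _ hf.coeFn_toLp] at h2
    rw [← eLpNorm_congr_ae h2]
    have h3 := ENNReal.ofReal_le_ofReal h1
    rw [Lp.norm_toLp, ENNReal.ofReal_mul (by positivity), ENNReal.ofReal_toReal hf.2.ne, Lp.norm_def,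
      ENNReal.ofReal_toReal (Lp.eLpNorm_ne_top _)] at h3
    refine h3.trans ?_
    gcongr
    push_cast
    exact le_self_add
  · rcases eq_or_ne w w' with rfl | hw
    · simp
    have hx : 0 < ‖w - w'‖ := norm_pos_iff.2 (sub_ne_zero.2 hw)
    have hmj : ∀ j ∈ Finset.range N, Measurable fun z => ‖K j z w - K j z w'‖ₑ := fun j _ =>
      (((k2 j).meas_right w).sub ((k2 j).meas_right w')).enorm
    calc ∫⁻ z in {z | 2 * ‖w - w'‖ ≤ ‖z - w'‖},
          ‖∑ j ∈ Finset.range N, (ε j : ℂ) * K j z w - ∑ j ∈ Finset.range N, (ε j : ℂ) * K j z w'‖ₑ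
        ≤ ∫⁻ z in {z | 2 * ‖w - w'‖ ≤ ‖z - w'‖}, ∑ j ∈ Finset.range N, ‖K j z w - K j z w'‖ₑ := by
          refine lintegral_mono fun z => ?_
          dsimp only
          rw [← Finset.sum_sub_distrib]
          refine (enorm_sum_le _ _).trans (Finset.sum_le_sum fun j _ => ?_)
          rw [← mul_sub, enorm_mul]
          refine mul_le_of_le_one_left zero_le ?_
          rw [← ofReal_norm, Complex.norm_real, Real.norm_eq_abs]
          exact ENNReal.ofReal_le_one.2 (hε j)
      _ = ∑ j ∈ Finset.range N, ∫⁻ z in {z | 2 * ‖w - w'‖ ≤ ‖z - w'‖}, ‖K j z w - K j z w'‖ₑ :=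
          lintegral_finsetSum _ hmj
      _ ≤ ∑ j ∈ Finset.range N, ENNReal.ofReal (min (‖w - w'‖ * 2 ^ j) (2 / (‖w - w'‖ * 2 ^ j))) * C := by
          refine Finset.sum_le_sum fun j _ => ?_
          have := lintegral_hormander_le (k2 j) (k1 j).symm (k3 j) (k4 j) (by positivity) hw
          rwa [inv_pow, div_inv_eq_mul] at this
      _ = ENNReal.ofReal (∑ j ∈ Finset.range N, min (‖w - w'‖ * 2 ^ j) (2 / (‖w - w'‖ * 2 ^ j))) * C := by
          rw [ENNReal.ofReal_sum_of_nonneg fun j _ => by positivity, Finset.sum_mul]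
      _ ≤ ENNReal.ofReal 12 * C := by
          gcongr
          exact sum_min_le hx N
      _ ≤ _ := by
          push_cast
          rw [ENNReal.ofReal_ofNat]
          exact le_add_self

/-! ### Uniform `L^p` bounds for signed sums -/

/-- A bound for a bounded operator need only be checked on test functions. -/
lemma norm_le_of_test {d : ℕ} {p : ℝ≥0∞} [hp : Fact (1 ≤ p)] (hp' : p ≠ ⊤) {A : LpSpace d p →L[ℂ] LpSpace d p} {C : ℝ}
    (h : ∀ u : Space d → ℂ, IsTestFun u → ∀ hu : MemLp u p volume, ‖A (hu.toLp u)‖ ≤ C * ‖hu.toLp u‖)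
    (f : LpSpace d p) : ‖A f‖ ≤ C * ‖f‖ := by
  have hd := Lp.dense_hasCompactSupport_contDiff (E := Space d) (F := ℂ) (μ := volume) hp'
  have hcl : IsClosed {f : LpSpace d p | ‖A f‖ ≤ C * ‖f‖} :=
    isClosed_le A.continuous.norm (continuous_const.mul continuous_norm)
  refine hcl.closure_subset_iff.2 ?_ (hd f)
  rintro f ⟨u, hfu, hc, hs⟩
  have hu : MemLp u p volume := (memLp_congr_ae hfu).1 (Lp.memLp f)
  have : f = hu.toLp u := Lp.ext (hfu.trans hu.coeFn_toLp.symm)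
  rw [this]
  exact h u ⟨hs, hc⟩ hu

lemma IsDyadicFamily.test_sum {a b : ℝ} {φ : ℕ → ℝ → ℝ} (h : IsDyadicFamily a b φ) (N : ℕ) (ε : ℕ → ℝ) :
    IsTestSymbol fun s => ∑ j ∈ Finset.range N, ε j * dil φ j s :=
  IsTestSymbol.sum _ fun j _ => (h.dil_test j).const_mul _

lemma IsDyadicFamily.exists_norm_le_of_lt_two {d : ℕ} (hd : 1 ≤ d) {a b : ℝ} {φ : ℕ → ℝ → ℝ}
    (h : IsDyadicFamily a b φ) (p : ℝ≥0∞) [Fact (1 ≤ p)] (hp : 1 < p) (hp2 : p < 2) :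
    ∃ C : ℝ, 0 ≤ C ∧ ∀ (N : ℕ) (ε : ℕ → ℝ), (∀ j, |ε j| ≤ 1) → ∀ f : LpSpace d p,
      ‖symOp d p (fun s => ∑ j ∈ Finset.range N, ε j * dil φ j s) f‖ ≤ C * ‖f‖ := by
  obtain ⟨B, hB⟩ := h.exists_czKernel hd
  have hp' : p ≠ ⊤ := (hp2.trans ENNReal.ofNat_lt_top).ne
  have hp0 : p ≠ 0 := (zero_lt_one.trans hp).ne'
  have hr1 : 1 < p.toReal := by simpa using (ENNReal.toReal_lt_toReal ENNReal.one_ne_top hp').2 hp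
  have hr2 : p.toReal < 2 := by simpa using (ENNReal.toReal_lt_toReal hp' ENNReal.ofNat_ne_top).2 hp2
  set C : ℝ≥0 := (czStrongConst d B p.toReal) ^ (1 / p.toReal) with hC
  refine ⟨C, C.2, fun N ε hε f => norm_le_of_test hp' (fun u hu hu' => ?_) f⟩
  obtain ⟨K, hK, hCZ⟩ := hB N ε hε
  have h1 := hK.symOp_apply hd hp' (h.test_sum N ε).isBddSymbol (hu'.toLp u)
  rw [kerOp_congr _ hu'.coeFn_toLp] at h1
  have h2 := hCZ.lintegral_rpow_le hu.smooth.continuous hu.compact hr1 hr2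
  have h3 : eLpNorm (kerOp K u) p volume ≤ C * eLpNorm u p volume := by
    rw [eLpNorm_eq_lintegral_rpow_enorm_toReal hp0 hp', eLpNorm_eq_lintegral_rpow_enorm_toReal hp0 hp', hC,
      ENNReal.coe_rpow_of_nonneg _ (by positivity), ← ENNReal.mul_rpow_of_nonneg _ _ (by positivity)]
    exact ENNReal.rpow_le_rpow h2 (by positivity)
  rw [Lp.norm_toLp, Lp.norm_def, eLpNorm_congr_ae h1]
  have := ENNReal.toReal_mono (ENNReal.mul_ne_top ENNReal.coe_ne_top hu'.2.ne) h3
  simpa using this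

/-- Below 2 this is Calderón–Zygmund theory, at 2 the supremum bound, and above 2 duality, the
operators being symmetric for the bilinear pairing. -/
lemma IsDyadicFamily.exists_norm_le {d : ℕ} (hd : 1 ≤ d) {a b : ℝ} {φ : ℕ → ℝ → ℝ}
    (h : IsDyadicFamily a b φ) (p : ℝ≥0∞) [Fact (1 ≤ p)] (hp : 1 < p) (hp' : p ≠ ⊤) :
    ∃ C : ℝ, 0 ≤ C ∧ ∀ (N : ℕ) (ε : ℕ → ℝ), (∀ j, |ε j| ≤ 1) → ∀ f : LpSpace d p,
      ‖symOp d p (fun s => ∑ j ∈ Finset.range N, ε j * dil φ j s) f‖ ≤ C * ‖f‖ := by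
  rcases lt_trichotomy p 2 with h2 | rfl | h2
  · exact h.exists_norm_le_of_lt_two hd p hp h2
  · obtain ⟨M, hM0, hM⟩ := h.exists_bound
    refine ⟨2 * M, by positivity, fun N ε hε f => ?_⟩
    have := norm_symOp_two_le hd (h.test_sum N ε) hM0 (hM N ε hε) f
    convert this
  · set q := ENNReal.conjExponent p with hq
    have hpq : ENNReal.HolderConjugate p q := ENNReal.HolderConjugate.conjExponent hp.le
    have hq1 : 1 < q := (ENNReal.HolderConjugate.lt_top_iff_one_lt p q).1 hp'.lt_top
    have hq2 : q < 2 := by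
      by_contra hn
      rw [not_lt] at hn
      have h3 := hpq.inv_add_inv_eq_one
      have h4 : p⁻¹ < 2⁻¹ := ENNReal.inv_lt_inv.2 h2
      have h5 : q⁻¹ ≤ 2⁻¹ := ENNReal.inv_le_inv.2 hn
      have h6 := ENNReal.add_lt_add_of_lt_of_le (by exact ne_top_of_le_ne_top (by simp) h5) h4 h5
      rw [h3, ENNReal.inv_two_add_inv_two] at h6
      exact lt_irrefl _ h6
    have : Fact (1 ≤ q) := ⟨hq1.le⟩
    have hq' : q ≠ ⊤ := (hq2.trans ENNReal.ofNat_lt_top).ne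
    obtain ⟨C, hC0, hC⟩ := h.exists_norm_le_of_lt_two hd q hq1 hq2
    refine ⟨C, hC0, fun N ε hε f => ?_⟩
    refine norm_le_of_forall_integral_mul_le (p := q) hp hq' hp' hpq.symm _ (by positivity) fun v => ?_
    rw [integral_symOp_mul hd hp hp' hq' hpq (h.test_sum N ε)]
    refine (norm_integral_mul_le hp hp' hpq _ _).trans ?_
    have := hC N ε hε v
    calc ‖f‖ * _ ≤ ‖f‖ * (C * ‖v‖) := by gcongr
      _ = _ := by ring

/-! ### Khinchine's inequality -/

/-- The sign pattern of a finite set. -/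
def sgn (A : Finset ℕ) (j : ℕ) : ℝ := if j ∈ A then 1 else -1

lemma abs_sgn (A : Finset ℕ) (j : ℕ) : |sgn A j| ≤ 1 := by
  unfold sgn; split_ifs <;> simp

/-- Random signs are modelled by the subsets of `range N`, so expectations are finite averages and
the moments follow by induction on the last sign. -/
lemma sum_powerset_range_succ (N : ℕ) (a : ℕ → ℂ) (Φ : ℂ → ℝ) :
    ∑ A ∈ (Finset.range (N + 1)).powerset, Φ (∑ j ∈ Finset.range (N + 1), (sgn A j : ℂ) * a j) =
      ∑ A ∈ (Finset.range N).powerset, (Φ ((∑ j ∈ Finset.range N, (sgn A j : ℂ) * a j) + a N) +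
        Φ ((∑ j ∈ Finset.range N, (sgn A j : ℂ) * a j) - a N)) := by
  rw [Finset.range_add_one, Finset.sum_powerset_insert Finset.notMem_range_self, ← Finset.sum_add_distrib]
  refine Finset.sum_congr rfl fun A hA => ?_
  have hN : N ∉ A := fun h => Finset.notMem_range_self (Finset.mem_powerset.1 hA h)
  rw [Finset.sum_insert Finset.notMem_range_self, Finset.sum_insert Finset.notMem_range_self, add_comm]
  have e1 : ∑ j ∈ Finset.range N, (sgn (insert N A) j : ℂ) * a j = ∑ j ∈ Finset.range N, (sgn A j : ℂ) * a j := by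
    refine Finset.sum_congr rfl fun j hj => ?_
    have : j ≠ N := fun h => Finset.notMem_range_self (h ▸ hj)
    simp [sgn, this]
  rw [e1]
  congr 2
  · simp [sgn]; ring
  · simp [sgn, hN]; ring

lemma sum_powerset_sq (N : ℕ) (a : ℕ → ℂ) :
    ∑ A ∈ (Finset.range N).powerset, ‖∑ j ∈ Finset.range N, (sgn A j : ℂ) * a j‖ ^ 2 =
      2 ^ N * ∑ j ∈ Finset.range N, ‖a j‖ ^ 2 := by
  induction N with
  | zero => simp
  | succ N ih =>
    rw [sum_powerset_range_succ N a (fun x => ‖x‖ ^ 2)]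
    have h : ∀ x y : ℂ, ‖x + y‖ ^ 2 + ‖x - y‖ ^ 2 = 2 * ‖x‖ ^ 2 + 2 * ‖y‖ ^ 2 := fun x y => by
      have := parallelogram_law_with_norm ℝ x y
      nlinarith
    simp_rw [h]
    rw [Finset.sum_add_distrib, ← Finset.mul_sum, ih, Finset.sum_range_succ]
    simp [pow_succ]; ring

lemma sum_powerset_pow_four_le (N : ℕ) (a : ℕ → ℂ) :
    ∑ A ∈ (Finset.range N).powerset, ‖∑ j ∈ Finset.range N, (sgn A j : ℂ) * a j‖ ^ 4 ≤
      2 ^ N * (3 * (∑ j ∈ Finset.range N, ‖a j‖ ^ 2) ^ 2) := by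
  induction N with
  | zero => simp
  | succ N ih =>
    rw [sum_powerset_range_succ N a (fun x => ‖x‖ ^ 4)]
    have h : ∀ x y : ℂ, ‖x + y‖ ^ 4 + ‖x - y‖ ^ 4 ≤ 2 * ‖x‖ ^ 4 + 12 * ‖y‖ ^ 2 * ‖x‖ ^ 2 + 2 * ‖y‖ ^ 4 := fun x y => by
      have h1 := norm_add_sq_real x y
      have h2 := norm_sub_sq_real x y
      have h3 := abs_real_inner_le_norm x y
      have h4 : (inner ℝ x y) ^ 2 ≤ (‖x‖ * ‖y‖) ^ 2 := sq_le_sq' (by linarith [neg_abs_le (inner ℝ x y)]) ((le_abs_self _).trans h3)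
      have e1 : ‖x + y‖ ^ 4 = (‖x + y‖ ^ 2) ^ 2 := by ring
      have e2 : ‖x - y‖ ^ 4 = (‖x - y‖ ^ 2) ^ 2 := by ring
      rw [e1, e2, h1, h2]
      nlinarith
    refine (Finset.sum_le_sum fun A _ => h _ _).trans ?_
    rw [Finset.sum_add_distrib, Finset.sum_add_distrib, ← Finset.mul_sum, ← Finset.mul_sum, sum_powerset_sq,
      Finset.sum_range_succ]
    simp only [Finset.sum_const, Finset.card_powerset, Finset.card_range, nsmul_eq_mul, Nat.cast_pow, Nat.cast_ofNat]
    set S := ∑ j ∈ Finset.range N, ‖a j‖ ^ 2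
    have h2 : (0 : ℝ) < 2 ^ N := by positivity
    have h3 : 0 ≤ 2 ^ N * ‖a N‖ ^ 4 := by positivity
    rw [pow_succ (2 : ℝ) N]
    nlinarith

/-- Khinchine's inequality. -/
lemma khinchine {p : ℝ} (hp : 0 < p) : ∃ κ : ℝ, 0 < κ ∧ ∀ (N : ℕ) (a : ℕ → ℂ),
    (∑ j ∈ Finset.range N, ‖a j‖ ^ 2) ^ (p / 2) ≤
      κ * ((2 ^ N)⁻¹ * ∑ A ∈ (Finset.range N).powerset, ‖∑ j ∈ Finset.range N, (sgn A j : ℂ) * a j‖ ^ p) := by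
  refine ⟨12 * 2 ^ p, by positivity, fun N a => ?_⟩
  set S := ∑ j ∈ Finset.range N, ‖a j‖ ^ 2 with hS
  set X : Finset ℕ → ℝ := fun A => ‖∑ j ∈ Finset.range N, (sgn A j : ℂ) * a j‖ with hX
  set E := (2 ^ N : ℝ)⁻¹ * ∑ A ∈ (Finset.range N).powerset, X A ^ p with hE
  have hX0 : ∀ A, 0 ≤ X A := fun A => norm_nonneg _
  have hE0 : 0 ≤ E := by
    have : 0 ≤ ∑ A ∈ (Finset.range N).powerset, X A ^ p := Finset.sum_nonneg fun A _ => Real.rpow_nonneg (hX0 A) _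
    positivity
  have h2N : (0 : ℝ) < 2 ^ N := by positivity
  have hS0 : 0 ≤ S := Finset.sum_nonneg fun j _ => by positivity
  rcases hS0.eq_or_lt with h0 | hpos
  · rw [← h0, Real.zero_rpow (by positivity)]
    positivity
  have hm2 := sum_powerset_sq N a
  have hm4 := sum_powerset_pow_four_le N a
  have hsplit : ∀ c : ℝ, 0 < c → ∀ x : ℝ, 0 ≤ x → c ≤ x → 2 ≤ p → x ^ 2 ≤ c ^ (2 - p) * x ^ p := by
    intro c hc x hx hcx hp2
    have hx' : 0 < x := hc.trans_le hcx
    calc x ^ 2 = x ^ (2 - p) * x ^ p := by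
          rw [← Real.rpow_add hx', ← Real.rpow_natCast]; congr 1; push_cast; ring
      _ ≤ c ^ (2 - p) * x ^ p := by
          gcongr ?_ * _
          exact Real.rpow_le_rpow_of_nonpos hc hcx (by linarith)
  rcases le_total p 2 with hp2 | hp2
  -- For `p ≤ 2`, `x²` is bounded by its `p`-th power below `c` and by `x⁴/c²` above. The fourth
  -- moment is at most `3S²`, so `c² = 6S` makes the second contribution `S/2`, which is absorbed.
  · set c := Real.sqrt (6 * S) with hc
    have hc0 : 0 < c := Real.sqrt_pos.2 (by positivity)
    have hcs : c ^ 2 = 6 * S := Real.sq_sqrt (by positivity)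
    have h1 : ∀ x : ℝ, 0 ≤ x → x ^ 2 ≤ c ^ (2 - p) * x ^ p + x ^ 4 / c ^ 2 := by
      intro x hx
      rcases le_total x c with hxc | hxc
      · rcases hx.eq_or_lt with rfl | hx'
        · have : (0 : ℝ) ≤ c ^ (2 - p) * 0 ^ p := by positivity
          norm_num; linarith
        · have : x ^ 2 ≤ c ^ (2 - p) * x ^ p := by
            calc x ^ 2 = x ^ (2 - p) * x ^ p := by
                  rw [← Real.rpow_add hx', ← Real.rpow_natCast]; congr 1; push_cast; ring
              _ ≤ c ^ (2 - p) * x ^ p := by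
                  gcongr
          have : 0 ≤ x ^ 4 / c ^ 2 := by positivity
          linarith
      · have h3 : x ^ 2 ≤ x ^ 4 / c ^ 2 := by
          rw [le_div_iff₀ (by positivity)]
          have : c ^ 2 ≤ x ^ 2 := by gcongr
          nlinarith [sq_nonneg x]
        have : 0 ≤ c ^ (2 - p) * x ^ p := by positivity
        linarith
    have h2 : 2 ^ N * S ≤ c ^ (2 - p) * (2 ^ N * E) + 2 ^ N * (3 * S ^ 2) / c ^ 2 := by
      rw [← hm2]
      refine (Finset.sum_le_sum fun A _ => h1 _ (hX0 A)).trans ?_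
      rw [Finset.sum_add_distrib, ← Finset.mul_sum, ← Finset.sum_div]
      refine add_le_add (le_of_eq ?_) (by gcongr)
      rw [hE, ← mul_assoc (2 ^ N : ℝ), mul_inv_cancel₀ h2N.ne', one_mul]
    have h3 : S / 2 ≤ c ^ (2 - p) * E := by
      rw [hcs] at h2
      have e : 2 ^ N * (3 * S ^ 2) / (6 * S) = 2 ^ N * (S / 2) := by field_simp; norm_num
      rw [e] at h2
      have : 2 ^ N * (S / 2) ≤ 2 ^ N * (c ^ (2 - p) * E) := by nlinarith
      exact le_of_mul_le_mul_left this h2N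
    have h4 : c ^ (2 - p) = 6 ^ ((2 - p) / 2) * S ^ (1 - p / 2) := by
      rw [hc, Real.sqrt_eq_rpow, ← Real.rpow_mul (by positivity), Real.mul_rpow (by norm_num) hS0]
      congr 2 <;> ring
    have h5 : S ^ (1 - p / 2) * S ^ (p / 2) = S := by
      rw [← Real.rpow_add hpos]; simp
    have hSp : 0 < S ^ (1 - p / 2) := by positivity
    have h6 : S ^ (p / 2) ≤ 2 * 6 ^ ((2 - p) / 2) * E := by
      rw [h4] at h3
      have : S ^ (1 - p / 2) * S ^ (p / 2) ≤ S ^ (1 - p / 2) * (2 * 6 ^ ((2 - p) / 2) * E) := by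
        rw [h5]; linarith
      exact le_of_mul_le_mul_left this hSp
    have h7 : (6 : ℝ) ^ ((2 - p) / 2) ≤ 6 := by
      calc (6 : ℝ) ^ ((2 - p) / 2) ≤ 6 ^ (1 : ℝ) := Real.rpow_le_rpow_of_exponent_le (by norm_num) (by linarith)
        _ = 6 := Real.rpow_one 6
    have h8 : (1 : ℝ) ≤ 2 ^ p := Real.one_le_rpow (by norm_num) hp.le
    calc S ^ (p / 2) ≤ 2 * 6 ^ ((2 - p) / 2) * E := h6
      _ ≤ 12 * 2 ^ p * E := mul_le_mul_of_nonneg_right (by nlinarith) hE0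
  -- For `p ≥ 2` the second moment suffices: values below `c` contribute at most `c² = S/2`.
  · set c := Real.sqrt (S / 2) with hc
    have hc0 : 0 < c := Real.sqrt_pos.2 (by positivity)
    have hcs : c ^ 2 = S / 2 := Real.sq_sqrt (by positivity)
    have h1 : ∀ x : ℝ, 0 ≤ x → x ^ 2 ≤ c ^ (2 - p) * x ^ p + c ^ 2 := by
      intro x hx
      rcases le_total x c with hxc | hxc
      · have : 0 ≤ c ^ (2 - p) * x ^ p := by positivity
        have : x ^ 2 ≤ c ^ 2 := by gcongr
        linarith
      · have := hsplit c hc0 x hx hxc hp2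
        nlinarith [sq_nonneg c]
    have h2 : 2 ^ N * S ≤ c ^ (2 - p) * (2 ^ N * E) + 2 ^ N * c ^ 2 := by
      rw [← hm2]
      refine (Finset.sum_le_sum fun A _ => h1 _ (hX0 A)).trans ?_
      rw [Finset.sum_add_distrib, ← Finset.mul_sum]
      refine add_le_add (le_of_eq ?_) (le_of_eq (by simp))
      rw [hE, ← mul_assoc (2 ^ N : ℝ), mul_inv_cancel₀ h2N.ne', one_mul]
    have h3 : S / 2 ≤ c ^ (2 - p) * E := by
      rw [hcs] at h2
      have : 2 ^ N * (S / 2) ≤ 2 ^ N * (c ^ (2 - p) * E) := by nlinarith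
      exact le_of_mul_le_mul_left this h2N
    have h4 : c ^ (2 - p) = (S / 2) ^ (1 - p / 2) := by
      rw [hc, Real.sqrt_eq_rpow, ← Real.rpow_mul (by positivity)]
      congr 1; ring
    have hS2 : 0 < S / 2 := by positivity
    have h5 : (S / 2) ^ (1 - p / 2) * (S / 2) ^ (p / 2) = S / 2 := by
      rw [← Real.rpow_add hS2]; simp
    have hSp : 0 < (S / 2) ^ (1 - p / 2) := by positivity
    have h6 : (S / 2) ^ (p / 2) ≤ E := by
      rw [h4, ← h5] at h3
      have : (S / 2) ^ (1 - p / 2) * (S / 2) ^ (p / 2) ≤ (S / 2) ^ (1 - p / 2) * E := by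
        rw [h5]; rw [h5] at h3; exact h3
      exact le_of_mul_le_mul_left this hSp
    have h7 : S ^ (p / 2) = 2 ^ (p / 2) * (S / 2) ^ (p / 2) := by
      rw [← Real.mul_rpow (by norm_num) hS2.le]; congr 1; ring
    have h8 : (2 : ℝ) ^ (p / 2) ≤ 2 ^ p := Real.rpow_le_rpow_of_exponent_le (by norm_num) (by linarith)
    rw [h7]
    calc (2 : ℝ) ^ (p / 2) * (S / 2) ^ (p / 2) ≤ 2 ^ p * E := by gcongr
      _ ≤ 12 * 2 ^ p * E := by
          gcongr
          linarith [Real.rpow_nonneg (by norm_num : (0 : ℝ) ≤ 2) p]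

/-! ### Square functions -/

/-- The square sum of the members of a family of functions with indices in `S`. -/
def sqSum {X : Type*} (S : Finset ℕ) (h : ℕ → X → ℂ) (z : X) : ℝ≥0∞ :=
  (∑ j ∈ S, ‖h j z‖ₑ ^ 2) ^ (1 / 2 : ℝ)

/-- The square function of a sequence of functions. -/
def sqFun {X : Type*} (h : ℕ → X → ℂ) (z : X) : ℝ≥0∞ := (∑' j, ‖h j z‖ₑ ^ 2) ^ (1 / 2 : ℝ)

lemma measurable_sqSum {d : ℕ} {p : ℝ≥0∞} (S : Finset ℕ) (h : ℕ → LpSpace d p) :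
    Measurable (sqSum S fun j => (h j : Space d → ℂ)) :=
  (Finset.measurable_sum _ fun j _ => (Lp.stronglyMeasurable (h j)).enorm.pow_const 2).pow_const _

lemma measurable_sqFun {d : ℕ} {p : ℝ≥0∞} (h : ℕ → LpSpace d p) :
    Measurable (sqFun fun j => (h j : Space d → ℂ)) :=
  (Measurable.tsum fun j => (Lp.stronglyMeasurable (h j)).enorm.pow_const 2).pow_const _

lemma sqSum_mono {X : Type*} {S T : Finset ℕ} (hST : S ⊆ T) (h : ℕ → X → ℂ) (z : X) : sqSum S h z ≤ sqSum T h z :=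
  ENNReal.rpow_le_rpow (Finset.sum_le_sum_of_subset hST) (by norm_num)

lemma sqSum_le_sqFun {X : Type*} (S : Finset ℕ) (h : ℕ → X → ℂ) (z : X) : sqSum S h z ≤ sqFun h z :=
  ENNReal.rpow_le_rpow (ENNReal.sum_le_tsum S) (by norm_num)

lemma khinchine_enorm {p : ℝ} (hp : 0 < p) : ∃ κ : ℝ≥0, ∀ (N : ℕ) (a : ℕ → ℂ),
    ((∑ j ∈ Finset.range N, ‖a j‖ₑ ^ 2) ^ (1 / 2 : ℝ)) ^ p ≤
      κ * ((2 ^ N)⁻¹ * ∑ A ∈ (Finset.range N).powerset, ‖∑ j ∈ Finset.range N, (sgn A j : ℂ) * a j‖ₑ ^ p) := by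
  obtain ⟨κ, hκ, h⟩ := khinchine hp
  refine ⟨κ.toNNReal, fun N a => ?_⟩
  have h1 := ENNReal.ofReal_le_ofReal (h N a)
  rw [ENNReal.ofReal_mul hκ.le, ENNReal.ofReal_mul (by positivity), ENNReal.ofReal_inv_of_pos (by positivity),
    ENNReal.ofReal_pow (by norm_num), ENNReal.ofReal_sum_of_nonneg (fun _ _ => by positivity),
    ← ENNReal.ofReal_rpow_of_nonneg (Finset.sum_nonneg fun _ _ => by positivity) (by positivity),
    ENNReal.ofReal_sum_of_nonneg (fun _ _ => by positivity)] at h1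
  simp_rw [← ENNReal.ofReal_rpow_of_nonneg (norm_nonneg _) hp.le, ENNReal.ofReal_pow (norm_nonneg _), ofReal_norm] at h1
  rw [← ENNReal.rpow_mul, one_div_mul_eq_div]
  change _ ≤ ENNReal.ofReal κ * _
  simpa using h1

lemma coeFn_finsetSum {d : ℕ} {p : ℝ≥0∞} {ι : Type*} (S : Finset ι) (f : ι → LpSpace d p) :
    ((∑ i ∈ S, f i : LpSpace d p) : Space d → ℂ) =ᵐ[volume] fun z => ∑ i ∈ S, f i z := by
  classical
  induction S using Finset.induction_on with
  | empty => exact Lp.coeFn_zero ℂ p (volume : Measure (Space d))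
  | insert i S hi ih =>
    rw [Finset.sum_insert hi]
    filter_upwards [Lp.coeFn_add (f i) (∑ i ∈ S, f i), ih] with z h1 h2
    rw [h1, Pi.add_apply, h2, Finset.sum_insert hi]

lemma symOp_sum_mul_apply {d : ℕ} (hd : 1 ≤ d) {a b : ℝ} {φ : ℕ → ℝ → ℝ} (h : IsDyadicFamily a b φ) {p : ℝ≥0∞}
    [Fact (1 ≤ p)] (hp' : p ≠ ⊤) (N : ℕ) (ε : ℕ → ℝ) (f : LpSpace d p) :
    symOp d p (fun s => ∑ j ∈ Finset.range N, ε j * dil φ j s) f =ᵐ[volume]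
      fun z => ∑ j ∈ Finset.range N, (ε j : ℂ) * symOp d p (dil φ j) f z := by
  rw [symOp_sum hd hp' _ fun j _ => (h.dil_test j).const_mul _]
  simp only [symOp_const_mul hd hp' (h.dil_test _), sum_apply, smul_apply]
  have : ∀ᵐ z ∂(volume : Measure (Space d)), ∀ j, ((ε j : ℂ) • symOp d p (dil φ j) f : LpSpace d p) z =
      (ε j : ℂ) * symOp d p (dil φ j) f z :=
    ae_all_iff.2 fun j => by
      filter_upwards [Lp.coeFn_smul (ε j : ℂ) (symOp d p (dil φ j) f)] with z hz
      rw [hz]; rfl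
  filter_upwards [this, coeFn_finsetSum (Finset.range N) fun j => (ε j : ℂ) • symOp d p (dil φ j) f] with z h1 h2
  rw [h2]
  exact Finset.sum_congr rfl fun j _ => h1 j

/-- The Littlewood–Paley upper bound for finitely many pieces. -/
lemma IsDyadicFamily.exists_sqSum_le {d : ℕ} (hd : 1 ≤ d) {a b : ℝ} {φ : ℕ → ℝ → ℝ}
    (h : IsDyadicFamily a b φ) (p : ℝ≥0∞) [Fact (1 ≤ p)] (hp : 1 < p) (hp' : p ≠ ⊤) :
    ∃ C : ℝ≥0, ∀ (S : Finset ℕ) (f : LpSpace d p),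
      eLpNorm (sqSum S fun j => (symOp d p (dil φ j) f : Space d → ℂ)) p volume ≤ C * eLpNorm f p volume := by
  have hp0 : p ≠ 0 := (zero_lt_one.trans hp).ne'
  have hr : 0 < p.toReal := ENNReal.toReal_pos hp0 hp'
  obtain ⟨κ, hκ⟩ := khinchine_enorm hr
  obtain ⟨C, hC0, hC⟩ := h.exists_norm_le hd p hp hp'
  refine ⟨κ ^ (1 / p.toReal) * C.toNNReal, fun S f => ?_⟩
  obtain ⟨N, hN⟩ := S.exists_nat_subset_range
  refine (eLpNorm_mono_enorm (g := sqSum (Finset.range N) fun j => (symOp d p (dil φ j) f : Space d → ℂ))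
    fun z => by simpa using sqSum_mono hN _ z).trans ?_
  -- One signed sum for each sign pattern, all with the same norm bound. Integrating Khinchine's
  -- inequality pointwise bounds the square function by their average.
  set F : Finset ℕ → LpSpace d p := fun A =>
    symOp d p (fun s => ∑ j ∈ Finset.range N, sgn A j * dil φ j s) f with hF
  have hFn : ∀ A, ∫⁻ z, ‖F A z‖ₑ ^ p.toReal ≤ (C.toNNReal * eLpNorm f p volume) ^ p.toReal := fun A => by
    have h1 : eLpNorm (F A) p volume ≤ C.toNNReal * eLpNorm f p volume := by
      have h2 := ENNReal.ofReal_le_ofReal (hC N (sgn A) (abs_sgn A) f)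
      rw [ENNReal.ofReal_mul hC0, ofReal_norm, ofReal_norm, Lp.enorm_def, Lp.enorm_def] at h2
      exact h2
    refine le_trans (le_of_eq ?_) (ENNReal.rpow_le_rpow h1 hr.le)
    rw [eLpNorm_eq_lintegral_rpow_enorm_toReal hp0 hp', ← ENNReal.rpow_mul, one_div_mul_cancel hr.ne', ENNReal.rpow_one]
  have h3 : ∫⁻ z, (sqSum (Finset.range N) (fun j => (symOp d p (dil φ j) f : Space d → ℂ)) z) ^ p.toReal ≤
      κ * (C.toNNReal * eLpNorm f p volume) ^ p.toReal := by
    have hae : ∀ᵐ z ∂(volume : Measure (Space d)), ∀ A : Finset ℕ,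
        F A z = ∑ j ∈ Finset.range N, (sgn A j : ℂ) * symOp d p (dil φ j) f z :=
      ae_all_iff.2 fun A => symOp_sum_mul_apply hd h hp' N (sgn A) f
    calc _ ≤ ∫⁻ z, κ * ((2 ^ N)⁻¹ * ∑ A ∈ (Finset.range N).powerset, ‖F A z‖ₑ ^ p.toReal) := by
          refine lintegral_mono_ae ?_
          filter_upwards [hae] with z hz
          simp only [hz]
          exact hκ N _
      _ = κ * ((2 ^ N)⁻¹ * ∑ A ∈ (Finset.range N).powerset, ∫⁻ z, ‖F A z‖ₑ ^ p.toReal) := by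
          have hm : ∀ A, Measurable fun z => ‖F A z‖ₑ ^ p.toReal := fun A =>
            (Lp.stronglyMeasurable (F A)).enorm.pow_const _
          rw [lintegral_const_mul _ ((Finset.measurable_sum _ fun A _ => hm A).const_mul _),
            lintegral_const_mul _ (Finset.measurable_sum _ fun A _ => hm A), lintegral_finsetSum _ fun A _ => hm A]
      _ ≤ κ * ((2 ^ N)⁻¹ * ∑ A ∈ (Finset.range N).powerset, (C.toNNReal * eLpNorm f p volume) ^ p.toReal) := by
          gcongr with A _
          exact hFn A
      _ = _ := by
          rw [Finset.sum_const, Finset.card_powerset, Finset.card_range, nsmul_eq_mul, ← mul_assoc (_⁻¹)]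
          push_cast
          rw [ENNReal.inv_mul_cancel (by positivity) (by finiteness), one_mul]
  rw [eLpNorm_eq_lintegral_rpow_enorm_toReal hp0 hp']
  simp only [enorm_eq_self]
  refine (ENNReal.rpow_le_rpow h3 (by positivity)).trans (le_of_eq ?_)
  rw [ENNReal.mul_rpow_of_nonneg _ _ (by positivity), ← ENNReal.rpow_mul, mul_one_div_cancel hr.ne', ENNReal.rpow_one,
    ENNReal.coe_mul, ENNReal.coe_rpow_of_nonneg _ (by positivity), mul_assoc]

/-- The Littlewood–Paley upper bound. -/
lemma IsDyadicFamily.exists_sqFun_le {d : ℕ} (hd : 1 ≤ d) {a b : ℝ} {φ : ℕ → ℝ → ℝ}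
    (h : IsDyadicFamily a b φ) (p : ℝ≥0∞) [Fact (1 ≤ p)] (hp : 1 < p) (hp' : p ≠ ⊤) :
    ∃ C : ℝ≥0, ∀ f : LpSpace d p,
      eLpNorm (sqFun fun j => (symOp d p (dil φ j) f : Space d → ℂ)) p volume ≤ C * eLpNorm f p volume := by
  have hp0 : p ≠ 0 := (zero_lt_one.trans hp).ne'
  have hr : 0 < p.toReal := ENNReal.toReal_pos hp0 hp'
  obtain ⟨C, hC⟩ := h.exists_sqSum_le hd p hp hp'
  refine ⟨C, fun f => ?_⟩
  set g : ℕ → Space d → ℂ := fun j => (symOp d p (dil φ j) f : Space d → ℂ)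
  have h1 : Filter.Tendsto (fun N => ∫⁻ z, (sqSum (Finset.range N) g z) ^ p.toReal) Filter.atTop
      (nhds (∫⁻ z, (sqFun g z) ^ p.toReal)) := by
    refine lintegral_tendsto_of_tendsto_of_monotone
      (fun N => ((measurable_sqSum _ fun j => symOp d p (dil φ j) f).pow_const _).aemeasurable) ?_ ?_
    · refine Filter.Eventually.of_forall fun z M N hMN => ENNReal.rpow_le_rpow (sqSum_mono ?_ _ z) hr.le
      exact Finset.range_mono hMN
    · refine Filter.Eventually.of_forall fun z => ?_
      have := (ENNReal.tendsto_nat_tsum fun j => ‖g j z‖ₑ ^ 2).ennrpow_const (1 / 2)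
      exact this.ennrpow_const _
  have h2 := h1.ennrpow_const (1 / p.toReal)
  rw [eLpNorm_eq_lintegral_rpow_enorm_toReal hp0 hp']
  simp only [enorm_eq_self]
  refine le_of_tendsto' h2 fun N => ?_
  have := hC (Finset.range N) f
  rw [eLpNorm_eq_lintegral_rpow_enorm_toReal hp0 hp'] at this
  simpa only [enorm_eq_self] using this

lemma enorm_sum_mul_le_sqSum {X : Type*} (S : Finset ℕ) (h g : ℕ → X → ℂ) (z : X) :
    ‖∑ j ∈ S, h j z * g j z‖ₑ ≤ sqSum S h z * sqSum S g z := by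
  refine (enorm_sum_le _ _).trans ?_
  simp only [enorm_mul]
  have := ENNReal.inner_le_Lp_mul_Lq S (fun j => ‖h j z‖ₑ) (fun j => ‖g j z‖ₑ) Real.HolderConjugate.two_two
  simpa [sqSum] using this

/-- The bound dual to the Littlewood–Paley upper bound. -/
lemma IsDyadicFamily.exists_norm_sum_le {d : ℕ} (hd : 1 ≤ d) {a b : ℝ} {φ : ℕ → ℝ → ℝ}
    (h : IsDyadicFamily a b φ) (p : ℝ≥0∞) [Fact (1 ≤ p)] (hp : 1 < p) (hp' : p ≠ ⊤) :
    ∃ C : ℝ≥0, ∀ (S : Finset ℕ) (g : ℕ → LpSpace d p) (D : ℝ≥0),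
      eLpNorm (sqSum S fun j => (g j : Space d → ℂ)) p volume ≤ D →
        ‖∑ j ∈ S, symOp d p (dil φ j) (g j)‖ ≤ C * D := by
  set q := ENNReal.conjExponent p with hq
  have hpq : ENNReal.HolderConjugate p q := ENNReal.HolderConjugate.conjExponent hp.le
  have hq1 : 1 < q := (ENNReal.HolderConjugate.lt_top_iff_one_lt p q).1 hp'.lt_top
  have hq' : q ≠ ⊤ := ((ENNReal.HolderConjugate.lt_top_iff_one_lt q p).2 hp).ne
  have : Fact (1 ≤ q) := ⟨hq1.le⟩
  have hqp := hpq.symm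
  obtain ⟨C, hC⟩ := h.exists_sqSum_le hd q hq1 hq'
  refine ⟨C, fun S g D hD => ?_⟩
  refine norm_le_of_forall_integral_mul_le (p := q) hp hq' hp' hqp _ (by positivity) fun v => ?_
  have hint : ∀ (f : LpSpace d p) (w : LpSpace d q), Integrable (fun z => f z * w z) volume := fun f w => by
    have : ENNReal.HolderTriple p q 1 := hpq
    exact (Lp.memLp f).integrable_mul (Lp.memLp w)
  -- By symmetry each operator moves onto `v`. Cauchy–Schwarz in `j` and Hölder then leave the upper
  -- square function bound in the dual space.
  have e1 : ∫ z, (∑ j ∈ S, symOp d p (dil φ j) (g j) : LpSpace d p) z * v z =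
      ∫ z, ∑ j ∈ S, g j z * symOp d q (dil φ j) v z := by
    rw [integral_finsetSum _ fun j _ => hint _ _]
    simp_rw [← integral_symOp_mul hd hp hp' hq' hpq (h.dil_test _)]
    rw [← integral_finsetSum _ fun j _ => hint _ _]
    refine integral_congr_ae ?_
    filter_upwards [coeFn_finsetSum S fun j => symOp d p (dil φ j) (g j)] with z hz
    rw [hz, Finset.sum_mul]
  have e2 : ‖∫ z, ∑ j ∈ S, g j z * symOp d q (dil φ j) v z‖ₑ ≤ C * D * eLpNorm v q volume := by
    calc _ ≤ ∫⁻ z, ‖∑ j ∈ S, g j z * symOp d q (dil φ j) v z‖ₑ := enorm_integral_le_lintegral_enorm _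
      _ ≤ ∫⁻ z, sqSum S (fun j => (g j : Space d → ℂ)) z *
          sqSum S (fun j => (symOp d q (dil φ j) v : Space d → ℂ)) z :=
          lintegral_mono fun z => enorm_sum_mul_le_sqSum S _ _ z
      _ ≤ eLpNorm (sqSum S fun j => (g j : Space d → ℂ)) p volume *
          eLpNorm (sqSum S fun j => (symOp d q (dil φ j) v : Space d → ℂ)) q volume :=
          lintegral_mul_le_eLpNorm_mul_eLpNorm hp hp' hpq (measurable_sqSum _ _).aemeasurable
            (measurable_sqSum _ _).aemeasurable
      _ ≤ D * (C * eLpNorm v q volume) := by gcongr; exact hC S v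
      _ = _ := by ring
  rw [e1]
  have := ENNReal.toReal_mono (ENNReal.mul_ne_top (by finiteness) (Lp.eLpNorm_ne_top v)) e2
  simpa [Lp.norm_def] using this

/-- If the square function of `g` is in `L^p`, then `∑ φ_j(H) g_j` converges in `L^p`. -/
lemma IsDyadicFamily.exists_summable {d : ℕ} (hd : 1 ≤ d) {a b : ℝ} {φ : ℕ → ℝ → ℝ}
    (h : IsDyadicFamily a b φ) (p : ℝ≥0∞) [Fact (1 ≤ p)] (hp : 1 < p) (hp' : p ≠ ⊤) :
    ∃ C : ℝ≥0, ∀ (g : ℕ → LpSpace d p) (D : ℝ≥0),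
      eLpNorm (sqFun fun j => (g j : Space d → ℂ)) p volume ≤ D →
        Summable (fun j => symOp d p (dil φ j) (g j)) ∧ ‖∑' j, symOp d p (dil φ j) (g j)‖ ≤ C * D := by
  have hp0 : p ≠ 0 := (zero_lt_one.trans hp).ne'
  have hr : 0 < p.toReal := ENNReal.toReal_pos hp0 hp'
  obtain ⟨C, hC⟩ := h.exists_norm_sum_le hd p hp hp'
  refine ⟨C, fun g D hD => ?_⟩
  set G : ℕ → Space d → ℂ := fun j => (g j : Space d → ℂ)
  have hm : Measurable fun z => (sqFun G z) ^ p.toReal := (measurable_sqFun g).pow_const _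
  have hfin : ∫⁻ z, (sqFun G z) ^ p.toReal ≠ ⊤ := by
    have h1 := hD.trans_lt ENNReal.coe_lt_top
    have h2 := lintegral_rpow_enorm_lt_top_of_eLpNorm_lt_top hp0 hp' h1
    simpa only [enorm_eq_self] using h2.ne
  -- The square function of the tail tends to 0 in `L^p` by dominated convergence, so the bound for
  -- finite sums gives the Cauchy criterion.
  set τ : Finset ℕ → Space d → ℝ≥0∞ := fun s z => (∑' j : {j // j ∉ s}, ‖G j z‖ₑ ^ 2) ^ (1 / 2 : ℝ) with hτ
  have hτm : ∀ s, Measurable fun z => (τ s z) ^ p.toReal := fun s =>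
    ((Measurable.tsum fun j : {j // j ∉ s} =>
      (Lp.stronglyMeasurable (g j)).enorm.pow_const 2).pow_const _).pow_const _
  have ht : Filter.Tendsto (fun s => ∫⁻ z, (τ s z) ^ p.toReal) Filter.atTop (nhds 0) := by
    have : Filter.Tendsto (fun s => ∫⁻ z, (τ s z) ^ p.toReal) Filter.atTop
        (nhds (∫⁻ _ : Space d, (0 : ℝ≥0∞))) := by
      refine tendsto_lintegral_filter_of_dominated_convergence (fun z => (sqFun G z) ^ p.toReal)
        (Filter.Eventually.of_forall hτm) (Filter.Eventually.of_forall fun s => Filter.Eventually.of_forall fun z => ?_)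
        hfin ?_
      · exact ENNReal.rpow_le_rpow (ENNReal.rpow_le_rpow (ENNReal.tsum_comp_le_tsum_of_injective
          Subtype.val_injective _) (by norm_num)) hr.le
      · filter_upwards [ae_lt_top hm hfin] with z hz
        have h1 : (∑' j, ‖G j z‖ₑ ^ 2) ≠ ⊤ := fun hT => by
          simp [sqFun, hT, hr] at hz
        have h2 := ((ENNReal.tendsto_tsum_compl_atTop_zero h1).ennrpow_const (1 / 2)).ennrpow_const p.toReal
        simpa [hτ, hr, hr.ne'] using h2
    simpa using this
  have hs : Summable (fun j => symOp d p (dil φ j) (g j)) := by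
    rw [summable_iff_vanishing_norm]
    intro ε hε
    obtain ⟨δ, hδ, hδε⟩ : ∃ δ : ℝ≥0, 0 < δ ∧ C * δ < ε := by
      have h0 : (0 : ℝ) < ε / (C + 1) := by positivity
      refine ⟨⟨ε / (C + 1), h0.le⟩, h0, ?_⟩
      change (C : ℝ) * (ε / (C + 1)) < ε
      rw [mul_div_assoc', div_lt_iff₀ (by positivity)]
      nlinarith [C.2]
    have hδ' : (0 : ℝ≥0∞) < (δ : ℝ≥0∞) ^ p.toReal := ENNReal.rpow_pos (by exact_mod_cast hδ) ENNReal.coe_ne_top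
    obtain ⟨s, hs⟩ := (ht.eventually_lt_const hδ').exists
    refine ⟨s, fun t hts => (hC t g δ ?_).trans_lt hδε⟩
    rw [eLpNorm_eq_lintegral_rpow_enorm_toReal hp0 hp']
    simp only [enorm_eq_self]
    have h3 : ∫⁻ z, (sqSum t G z) ^ p.toReal ≤ (δ : ℝ≥0∞) ^ p.toReal := by
      refine (lintegral_mono fun z => ?_).trans hs.le
      refine ENNReal.rpow_le_rpow (ENNReal.rpow_le_rpow ?_ (by norm_num)) hr.le
      have hsub : ∀ j ∈ t, j ∉ s := fun j hj hjs => Finset.disjoint_left.1 hts hj hjs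
      rw [← Finset.sum_attach t, ← Finset.sum_image (s := t.attach) (f := fun j : {j // j ∉ s} => ‖G j z‖ₑ ^ 2)
        (g := fun j => ⟨j.1, hsub j.1 j.2⟩) (fun x _ y _ hxy => Subtype.ext (Subtype.mk.inj hxy))]
      exact ENNReal.sum_le_tsum _
    refine (ENNReal.rpow_le_rpow h3 (by positivity)).trans (le_of_eq ?_)
    rw [← ENNReal.rpow_mul, mul_one_div_cancel hr.ne', ENNReal.rpow_one]
  refine ⟨hs, le_of_tendsto hs.hasSum.norm (Filter.Eventually.of_forall fun t => hC t g D ?_)⟩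
  exact (eLpNorm_mono_enorm fun z => by simpa using sqSum_le_sqFun t G z).trans hD

/-! ### Limits of operators given by symbols -/

lemma le_sv {d : ℕ} (θ : ℕ × ℝ) : (d : ℝ) ≤ sv d θ := by
  rw [sv_eq]
  have : (0 : ℝ) ≤ θ.1 := by positivity
  nlinarith [sq_nonneg θ.2]

lemma tendsto_symbolOp {d : ℕ} (hd : 1 ≤ d) {F : ℕ → ℝ → ℝ} {G : ℝ → ℝ} (hF : ∀ N, IsBddSymbol (F N)) {M : ℝ}
    (hM : ∀ N s, 1 ≤ s → |F N s| ≤ M)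
    (hlim : ∀ s, (d : ℝ) ≤ s → Filter.Tendsto (fun N => F N s) Filter.atTop (nhds (G s)))
    {u : Space d → ℂ} (hu : IsTestFun u) (z : Space d) :
    Filter.Tendsto (fun N => symbolOp (F N) u z) Filter.atTop (nhds (symbolOp G u z)) := by
  refine tendsto_integral_of_dominated_convergence (fun θ => M * ‖kap u z θ‖)
    (fun N => (integrable_symbol_mul_kap hd (hF N) hu z).1)
    ((integrable_kap hd hu.smooth hu.compact z).norm.const_mul M) (fun N => .of_forall fun θ => ?_)
    (.of_forall fun θ => ?_)
  · rw [norm_mul, Complex.norm_real]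
    gcongr
    exact hM N _ (one_le_sv hd θ)
  · exact ((Complex.continuous_ofReal.tendsto _).comp (hlim _ (le_sv θ))).mul_const _

/-- On a test function the operators converge in `L^p`, hence almost everywhere along a subsequence,
while the symbol integrals converge at every point. The two limits agree. -/
lemma Represents.of_tendsto {d : ℕ} (hd : 1 ≤ d) {p : ℝ≥0∞} [Fact (1 ≤ p)] {F : ℕ → ℝ → ℝ} {G : ℝ → ℝ}
    (hF : ∀ N, IsBddSymbol (F N)) {M : ℝ} (hM : ∀ N s, 1 ≤ s → |F N s| ≤ M)
    (hlim : ∀ s, (d : ℝ) ≤ s → Filter.Tendsto (fun N => F N s) Filter.atTop (nhds (G s)))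
    {A : ℕ → LpSpace d p →L[ℂ] LpSpace d p} {B : LpSpace d p →L[ℂ] LpSpace d p}
    (hA : ∀ N, Represents (F N) (A N)) (hAB : ∀ f, Filter.Tendsto (fun N => A N f) Filter.atTop (nhds (B f))) :
    Represents G B := by
  intro u hu hu'
  obtain ⟨ns, hns, hae⟩ := (tendstoInMeasure_of_tendsto_Lp (hAB (hu'.toLp u))).exists_seq_tendsto_ae
  filter_upwards [hae, ae_all_iff.2 fun N => hA N u hu hu'] with z h1 h2
  simp only [h2] at h1
  exact tendsto_nhds_unique h1 ((tendsto_symbolOp hd hF hM hlim hu z).comp hns.tendsto_atTop)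

/-! ### A smooth dyadic resolution of the identity -/

/-- A smooth function, `1` on `(-∞, 1]` and `0` on `[2, ∞)`. -/
def lowCut (s : ℝ) : ℝ := Real.smoothTransition (2 - s)

/-- The difference of two dilates of `lowCut`. -/
def band (s : ℝ) : ℝ := lowCut s - lowCut (4 * s)

lemma lowCut_of_le {s : ℝ} (h : s ≤ 1) : lowCut s = 1 := Real.smoothTransition.one_of_one_le (by linarith)

lemma lowCut_of_ge {s : ℝ} (h : 2 ≤ s) : lowCut s = 0 := Real.smoothTransition.zero_of_nonpos (by linarith)

lemma contDiff_lowCut : ContDiff ℝ ∞ lowCut :=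
  Real.smoothTransition.contDiff.comp (contDiff_const.sub contDiff_id)

lemma band_supp {s : ℝ} (h : band s ≠ 0) : s ∈ Set.Icc (1 / 4 : ℝ) 2 := by
  by_contra hs
  rw [Set.mem_Icc, not_and_or, not_le, not_le] at hs
  refine h ?_
  rcases hs with hs | hs
  · rw [band, lowCut_of_le (by linarith), lowCut_of_le (by linarith), sub_self]
  · rw [band, lowCut_of_ge (by linarith), lowCut_of_ge (by linarith), sub_self]

lemma isTestSymbol_of_supp {F : ℝ → ℝ} {a b : ℝ} (hF : ContDiff ℝ ∞ F) (h : ∀ s, F s ≠ 0 → s ∈ Set.Icc a b) :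
    IsTestSymbol F :=
  ⟨hF, HasCompactSupport.of_support_subset_isCompact isCompact_Icc fun s hs => h s hs⟩

lemma isTestSymbol_band : IsTestSymbol band :=
  isTestSymbol_of_supp (contDiff_lowCut.sub (contDiff_lowCut.comp (contDiff_const.mul contDiff_id))) fun _ => band_supp

lemma sum_band (N : ℕ) (s : ℝ) :
    ∑ j ∈ Finset.range (N + 1), band ((4 : ℝ)⁻¹ ^ j * s) = lowCut ((4 : ℝ)⁻¹ ^ N * s) - lowCut (4 * s) := by
  induction N with
  | zero => simp [band]
  | succ N ih =>
    rw [Finset.sum_range_succ, ih, band, pow_succ]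
    have : 4 * ((4 : ℝ)⁻¹ ^ N * 4⁻¹ * s) = (4 : ℝ)⁻¹ ^ N * s := by ring
    rw [this]; ring

lemma sum_band_eq_one {N : ℕ} {s : ℝ} (h1 : 1 ≤ s) (h2 : s ≤ 4 ^ N) :
    ∑ j ∈ Finset.range (N + 1), band ((4 : ℝ)⁻¹ ^ j * s) = 1 := by
  rw [sum_band, lowCut_of_ge (by linarith : 2 ≤ 4 * s), lowCut_of_le, sub_zero]
  rw [inv_pow, inv_mul_le_iff₀ (by positivity)]
  linarith

/-- The power is singular only at 0, and `F` vanishes below `a > 0`. -/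
lemma IsTestSymbol.rpow_mul {F : ℝ → ℝ} {a b : ℝ} (hF : IsTestSymbol F) (ha : 0 < a)
    (hs : ∀ s, F s ≠ 0 → s ∈ Set.Icc a b) (c : ℝ) : IsTestSymbol fun s => s ^ c * F s := by
  refine isTestSymbol_of_supp (a := a) (b := b) (contDiff_iff_contDiffAt.2 fun s => ?_)
    fun s h => hs s (right_ne_zero_of_mul h)
  rcases lt_or_ge s a with h | h
  · have : (fun s => s ^ c * F s) =ᶠ[nhds s] fun _ => 0 := by
      filter_upwards [Iio_mem_nhds h] with x hx
      have : F x = 0 := by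
        by_contra hne
        exact absurd (hs x hne).1 (not_le.2 hx)
      rw [this, mul_zero]
    exact contDiffAt_const.congr_of_eventuallyEq this
  · exact (Real.contDiffAt_rpow_const_of_ne (ha.trans_le h).ne').mul hF.smooth.contDiffAt

lemma isDyadicFamily_const {F : ℝ → ℝ} {a b : ℝ} (hF : IsTestSymbol F) (ha : 0 < a)
    (hs : ∀ s, F s ≠ 0 → s ∈ Set.Icc a b) : IsDyadicFamily a b fun _ => F :=
  ⟨ha, (Set.finite_singleton F).subset (by rintro _ ⟨_, rfl⟩; rfl), fun _ => hF, fun _ => hs⟩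

lemma inv_four_pow_rpow (j : ℕ) (c : ℝ) : ((4 : ℝ)⁻¹ ^ j) ^ c = 2 ^ (-(2 * j * c)) := by
  rw [show (4 : ℝ)⁻¹ = 2 ^ (-2 : ℝ) by rw [Real.rpow_neg (by norm_num)]; norm_num, ← Real.rpow_natCast,
    ← Real.rpow_mul (by norm_num), ← Real.rpow_mul (by norm_num)]
  congr 1; ring

/-! ### The potential operator -/

lemma isBddSymbol_rpow {α : ℝ} (hα : 0 ≤ α) : IsBddSymbol fun s => s ^ (-α / 2) := by
  refine ⟨measurable_id.pow_const _, 1, fun s hs => ?_⟩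
  rw [abs_of_nonneg (Real.rpow_nonneg (by linarith) _)]
  exact Real.rpow_le_one_of_one_le_of_nonpos hs (by linarith)

/-- The negative powers of `H_par` are limits of operators with test symbols. -/
lemma exists_tendsto_potential {d : ℕ} (hd : 1 ≤ d) {p : ℝ≥0∞} [Fact (1 ≤ p)] (hp : 1 < p) (hp' : p ≠ ⊤) {α : ℝ}
    (hα : 0 < α) : ∃ (F : ℕ → ℝ → ℝ) (B : LpSpace d p →L[ℂ] LpSpace d p), (∀ N, IsTestSymbol (F N)) ∧
      (∃ M, ∀ N s, |F N s| ≤ M) ∧ (∀ N s, 1 ≤ s → s ≤ 4 ^ N → F (N + 1) s = s ^ (-α / 2)) ∧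
      ∀ f, Filter.Tendsto (fun N => symOp d p (F N) f) Filter.atTop (nhds (B f)) := by
  have hφ : IsDyadicFamily (1 / 4) 2 fun _ s => s ^ (-α / 2) * band s :=
    isDyadicFamily_const (isTestSymbol_band.rpow_mul (by norm_num) (fun _ => band_supp) _) (by norm_num)
      fun s h => band_supp (right_ne_zero_of_mul h)
  set φ : ℕ → ℝ → ℝ := fun _ s => s ^ (-α / 2) * band s with hφdef
  obtain ⟨C, hC0, hC⟩ := hφ.exists_norm_le hd p hp hp'
  obtain ⟨M, -, hM⟩ := hφ.exists_bound
  -- Factoring `2^{-jα}` out of the pieces `s^{-α/2} band(4^{-j}s)` leaves dilates of one symbol,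
  -- with uniformly bounded operators. As `α > 0` the series converges geometrically in operator
  -- norm; `α = 0` is the identity and is treated apart.
  set ε : ℕ → ℝ := fun j => ((2 : ℝ) ^ (-α)) ^ j with hε
  have hr0 : (0 : ℝ) < 2 ^ (-α) := by positivity
  have hr1 : (2 : ℝ) ^ (-α) < 1 := Real.rpow_lt_one_of_one_lt_of_neg (by norm_num) (by linarith)
  have hε1 : ∀ j, |ε j| ≤ 1 := fun j => by
    rw [abs_of_nonneg (by positivity)]
    exact pow_le_one₀ hr0.le hr1.le
  -- A single piece is the sum with coefficients equal to the indicator of `j`, which are also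
  -- bounded by 1.
  have hCj : ∀ j, ‖symOp d p (dil φ j)‖ ≤ C := fun j => by
    refine ContinuousLinearMap.opNorm_le_bound _ hC0 fun f => ?_
    have := hC (j + 1) (fun i => if i = j then 1 else 0) (fun i => by split_ifs <;> simp) f
    simpa [Finset.sum_ite_eq'] using this
  have hsum : Summable fun j => (ε j : ℂ) • symOp d p (dil φ j) := by
    refine Summable.of_norm_bounded (g := fun j => ε j * C)
      ((summable_geometric_of_lt_one hr0.le hr1).mul_right C) fun j => ?_
    rw [norm_smul, Complex.norm_real, Real.norm_eq_abs, abs_of_nonneg (by positivity)]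
    gcongr
    exact hCj j
  refine ⟨fun N s => ∑ j ∈ Finset.range N, ε j * dil φ j s, ∑' j, (ε j : ℂ) • symOp d p (dil φ j),
    fun N => hφ.test_sum N ε, ⟨M, fun N => hM N ε hε1⟩, fun N s h1 h2 => ?_, fun f => ?_⟩
  · have h3 : ∀ j, ε j * dil φ j s = s ^ (-α / 2) * band ((4 : ℝ)⁻¹ ^ j * s) := fun j => by
      have : ε j * ((4 : ℝ)⁻¹ ^ j) ^ (-α / 2) = 1 := by
        rw [inv_four_pow_rpow, hε]
        simp only
        rw [← Real.rpow_natCast, ← Real.rpow_mul (by norm_num), ← Real.rpow_add (by norm_num)]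
        ring_nf
        exact Real.rpow_zero _
      rw [dil, hφdef]
      simp only
      rw [Real.mul_rpow (by positivity) (by linarith)]
      linear_combination s ^ (-α / 2) * band ((4 : ℝ)⁻¹ ^ j * s) * this
    simp only [h3]
    rw [← Finset.mul_sum, sum_band_eq_one h1 h2, mul_one]
  · have h4 := hsum.hasSum.tendsto_sum_nat
    have h5 := ((ContinuousLinearMap.apply ℂ (LpSpace d p) f).continuous.tendsto _).comp h4
    refine h5.congr fun N => ?_
    rw [symOp_sum hd hp' _ fun j _ => (hφ.dil_test j).const_mul _]
    simp only [symOp_const_mul hd hp' (hφ.dil_test _)]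
    rfl

lemma potential_zero {d : ℕ} (hd : 1 ≤ d) {p : ℝ≥0∞} [Fact (1 ≤ p)] (hp' : p ≠ ⊤) :
    potential d p 0 = ContinuousLinearMap.id ℂ (LpSpace d p) := by
  refine Represents.symOp_eq hd hp' (F := fun s => s ^ (-(0 : ℝ) / 2)) (isBddSymbol_rpow le_rfl) ?_
  simpa using represents_one hd

lemma eventually_eq_of_le_four_pow {F : ℕ → ℝ → ℝ} {α : ℝ}
    (h : ∀ N s, 1 ≤ s → s ≤ 4 ^ N → F (N + 1) s = s ^ (-α / 2)) (R : ℝ) :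
    ∀ᶠ N in Filter.atTop, ∀ s, 1 ≤ s → s ≤ R → F N s = s ^ (-α / 2) := by
  obtain ⟨n, hn⟩ := pow_unbounded_of_one_lt R (by norm_num : (1 : ℝ) < 4)
  filter_upwards [Filter.eventually_ge_atTop (n + 1)] with N hN s h1 h2
  obtain ⟨k, rfl⟩ := Nat.exists_eq_add_of_le hN
  rw [show n + 1 + k = n + k + 1 by ring]
  refine h _ _ h1 (h2.trans (hn.le.trans ?_))
  exact pow_le_pow_right₀ (by norm_num) (by omega)

lemma represents_potential {d : ℕ} (hd : 1 ≤ d) {p : ℝ≥0∞} [Fact (1 ≤ p)] (hp : 1 < p) (hp' : p ≠ ⊤) {α : ℝ}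
    (hα : 0 ≤ α) : Represents (fun s => s ^ (-α / 2)) (potential d p α) := by
  rcases hα.eq_or_lt with rfl | hα'
  · rw [potential_zero hd hp']
    simpa using represents_one hd
  · obtain ⟨F, B, hF, ⟨M, hM⟩, hlim, hB⟩ := exists_tendsto_potential (d := d) hd hp hp' hα'
    have hd' : (1 : ℝ) ≤ d := by exact_mod_cast hd
    have hR : Represents (fun s => s ^ (-α / 2)) B :=
      Represents.of_tendsto hd (fun N => (hF N).isBddSymbol) (fun N s _ => hM N s)
        (fun s hs => tendsto_const_nhds.congr' (by
          filter_upwards [eventually_eq_of_le_four_pow hlim s] with N hN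
          exact (hN s (hd'.trans hs) le_rfl).symm))
        (fun N => (hF N).represents hd hp') hB
    have : potential d p α = B := Represents.symOp_eq hd hp' (isBddSymbol_rpow hα) hR
    rwa [this]

/-- The symbols approximating `s^{-α/2}` agree with it on `[1, 4^N]`. Multiplied by the compactly
supported `G` they become eventually constant on the spectrum, so multiplicativity for test symbols
passes to the limit trivially. -/
lemma potential_symOp {d : ℕ} (hd : 1 ≤ d) {p : ℝ≥0∞} [Fact (1 ≤ p)] (hp : 1 < p) (hp' : p ≠ ⊤) {α : ℝ}
    (hα : 0 ≤ α) {G : ℝ → ℝ} (hG : IsTestSymbol G) (hG' : IsTestSymbol fun s => s ^ (-α / 2) * G s) (f : LpSpace d p) :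
    potential d p α (symOp d p G f) = symOp d p (fun s => s ^ (-α / 2) * G s) f ∧
      symOp d p G (potential d p α f) = symOp d p (fun s => s ^ (-α / 2) * G s) f := by
  rcases hα.eq_or_lt with rfl | hα'
  · rw [potential_zero hd hp']
    simp
  · obtain ⟨F, B, hF, ⟨M, hM⟩, hlim, hB⟩ := exists_tendsto_potential (d := d) hd hp hp' hα'
    have hd' : (1 : ℝ) ≤ d := by exact_mod_cast hd
    have hR : Represents (fun s => s ^ (-α / 2)) B :=
      Represents.of_tendsto hd (fun N => (hF N).isBddSymbol) (fun N s _ => hM N s)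
        (fun s hs => tendsto_const_nhds.congr' (by
          filter_upwards [eventually_eq_of_le_four_pow hlim s] with N hN
          exact (hN s (hd'.trans hs) le_rfl).symm))
        (fun N => (hF N).represents hd hp') hB
    have hpot : potential d p α = B := Represents.symOp_eq hd hp' (isBddSymbol_rpow hα) hR
    obtain ⟨R, hGR⟩ : ∃ R, ∀ s, R < s → G s = 0 := by
      obtain ⟨R, hR⟩ := hG.compact.isCompact.bddAbove
      exact ⟨R, fun s hs => image_eq_zero_of_notMem_tsupport fun h => absurd (hR h) (not_le.2 hs)⟩
    have hev : ∀ᶠ N in Filter.atTop, symOp d p (fun s => F N s * G s) f = symOp d p (fun s => s ^ (-α / 2) * G s) f := by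
      filter_upwards [eventually_eq_of_le_four_pow hlim R] with N hN
      rw [symOp_congr hd hp' ((hF N).mul hG) hG' fun s hs => ?_]
      rcases le_or_gt s R with h | h
      · rw [hN s hs h]
      · rw [hGR s h, mul_zero, mul_zero]
    rw [hpot]
    constructor
    · refine tendsto_nhds_unique (hB _) (tendsto_const_nhds.congr' ?_)
      filter_upwards [hev] with N hN
      rw [← hN, symOp_mul hd hp' (hF N) hG]; rfl
    · refine tendsto_nhds_unique (((symOp d p G).continuous.tendsto _).comp (hB f)) (tendsto_const_nhds.congr' ?_)
      filter_upwards [hev] with N hN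
      rw [← hN]
      simp only [mul_comm (F N _)]
      rw [symOp_mul hd hp' hG (hF N)]; rfl

/-! ### The dyadic pieces -/

/-- The function `s ↦ m(√s)`. -/
def sqrtSymbol (m : ℝ → ℝ) (s : ℝ) : ℝ := m (Real.sqrt s)

lemma sqrtSymbol_supp {m : ℝ → ℝ} {a b : ℝ} (ha : 0 < a) (hsupp : tsupport m ⊆ Set.Icc a b) {s : ℝ}
    (h : sqrtSymbol m s ≠ 0) : s ∈ Set.Icc (a ^ 2) (b ^ 2) := by
  obtain ⟨h1, h2⟩ := hsupp (subset_tsupport m h)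
  have h0 : 0 < s := Real.sqrt_pos.1 (ha.trans_le h1)
  rw [← Real.sq_sqrt h0.le]
  exact ⟨pow_le_pow_left₀ ha.le h1 2, pow_le_pow_left₀ (Real.sqrt_nonneg _) h2 2⟩

/-- The square root is not smooth at 0, but `m` vanishes below `a`. Passing from `√s` to `s` turns
the dilations by `2^{-j}` into dilations by `4^{-j}`. -/
lemma isTestSymbol_sqrtSymbol {m : ℝ → ℝ} (hm : ContDiff ℝ ∞ m) {a b : ℝ} (ha : 0 < a)
    (hsupp : tsupport m ⊆ Set.Icc a b) : IsTestSymbol (sqrtSymbol m) := by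
  refine isTestSymbol_of_supp (contDiff_iff_contDiffAt.2 fun s => ?_) fun s => sqrtSymbol_supp ha hsupp
  rcases lt_or_ge s (a ^ 2) with h | h
  · have : sqrtSymbol m =ᶠ[nhds s] fun _ => 0 := by
      filter_upwards [Iio_mem_nhds h] with x hx
      by_contra hne
      exact absurd (sqrtSymbol_supp ha hsupp hne).1 (not_le.2 hx)
    exact contDiffAt_const.congr_of_eventuallyEq this
  · exact hm.contDiffAt.comp s (Real.contDiffAt_sqrt ((by positivity : 0 < a ^ 2).trans_le h).ne')

lemma sqrtSymbol_mul (m : ℝ → ℝ) (j : ℕ) (s : ℝ) :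
    sqrtSymbol m ((4 : ℝ)⁻¹ ^ j * s) = m ((2 : ℝ)⁻¹ ^ j * Real.sqrt s) := by
  have : Real.sqrt ((4 : ℝ)⁻¹ ^ j) = (2 : ℝ)⁻¹ ^ j := by
    rw [Real.sqrt_eq_iff_mul_self_eq_of_pos (by positivity), ← mul_pow]
    norm_num
  rw [sqrtSymbol, Real.sqrt_mul (by positivity), this]

lemma dyadicSymbol_eq (d : ℕ) (m : ℝ → ℝ) (j : ℕ) :
    dyadicSymbol d m j = toSymbol d (dil (fun _ => sqrtSymbol m) j) := by
  funext τ k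
  rw [dyadicSymbol, toSymbol, dil, sqrtSymbol_mul]

lemma dyadicPiece_eq (d : ℕ) (p : ℝ≥0∞) [Fact (1 ≤ p)] (m : ℝ → ℝ) (j : ℕ) :
    dyadicPiece d p m j = symOp d p (dil (fun _ => sqrtSymbol m) j) := by
  rw [dyadicPiece, dyadicSymbol_eq, symOp]

lemma isMultiplierExtension_dyadicPiece {d : ℕ} (hd : 1 ≤ d) {p : ℝ≥0∞} [Fact (1 ≤ p)] (hp' : p ≠ ⊤) {m : ℝ → ℝ}
    (hm : IsTestSymbol (sqrtSymbol m)) (j : ℕ) : IsMultiplierExtension (dyadicSymbol d m j) (dyadicPiece d p m j) := by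
  have h : IsTestSymbol (dil (fun _ => sqrtSymbol m) j) := hm.comp_mul_left (by positivity)
  rw [dyadicSymbol_eq, dyadicPiece_eq]
  exact (Represents.isMultiplierExtension hd h.isBddSymbol).1 (h.represents hd hp')

lemma two_rpow_mul_enorm (c : ℝ) (w : ℂ) : (2 : ℝ≥0∞) ^ c * ‖w‖ₑ = ‖(((2 : ℝ) ^ c : ℝ) : ℂ) * w‖ₑ := by
  rw [enorm_mul]
  congr 1
  rw [← ofReal_norm, Complex.norm_real, Real.norm_eq_abs, abs_of_pos (by positivity),
    ← ENNReal.ofReal_rpow_of_pos (by norm_num)]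
  simp

lemma squareFun_ae_eq {d : ℕ} {p : ℝ≥0∞} [Fact (1 ≤ p)] (m : ℝ → ℝ) (α : ℝ) (f : LpSpace d p) :
    squareFun d p m α f =ᵐ[volume] sqFun fun j =>
      (((((2 : ℝ) ^ ((j : ℝ) * α) : ℝ) : ℂ) • dyadicPiece d p m j f : LpSpace d p) : Space d → ℂ) := by
  filter_upwards [ae_all_iff.2 fun j : ℕ => Lp.coeFn_smul ((((2 : ℝ) ^ ((j : ℝ) * α) : ℝ) : ℂ))
    (dyadicPiece d p m j f)] with z hz
  simp only [squareFun, sqFun, hz, two_rpow_mul_enorm, Pi.smul_apply, smul_eq_mul]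

lemma dil_rpow_mul (c : ℝ) (F : ℝ → ℝ) (j : ℕ) {s : ℝ} (hs : 0 ≤ s) :
    dil (fun _ x => x ^ c * F x) j s = 2 ^ (-(2 * j * c)) * (s ^ c * F ((4 : ℝ)⁻¹ ^ j * s)) := by
  rw [dil, Real.mul_rpow (by positivity) hs, inv_four_pow_rpow, mul_assoc]

lemma mem_Icc_of_inv_four_pow_mul_mem {a b s : ℝ} {j : ℕ} (h : (4 : ℝ)⁻¹ ^ j * s ∈ Set.Icc a b) :
    s ∈ Set.Icc (4 ^ j * a) (4 ^ j * b) := by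
  obtain ⟨h4, h5⟩ := h
  rw [inv_pow, inv_mul_eq_div] at h4 h5
  rw [le_div_iff₀ (by positivity)] at h4
  rw [div_le_iff₀ (by positivity)] at h5
  constructor <;> linarith

/-- The upper Littlewood–Paley estimate in Sobolev spaces. -/
lemma exists_squareFun_potential_le {d : ℕ} (hd : 1 ≤ d) {p : ℝ≥0∞} [Fact (1 ≤ p)] (hp : 1 < p) (hp' : p ≠ ⊤)
    {m : ℝ → ℝ} (hm : ContDiff ℝ ∞ m) {a b : ℝ} (ha : 0 < a) (hsupp : tsupport m ⊆ Set.Icc a b) {α : ℝ}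
    (hα : 0 ≤ α) : ∃ C : ℝ≥0, ∀ g : LpSpace d p,
      eLpNorm (squareFun d p m α (potential d p α g)) p volume ≤ C * eLpNorm g p volume := by
  have hψ := isTestSymbol_sqrtSymbol hm ha hsupp
  have ha2 : 0 < a ^ 2 := by positivity
  have hsp : ∀ s, sqrtSymbol m s ≠ 0 → s ∈ Set.Icc (a ^ 2) (b ^ 2) := fun s => sqrtSymbol_supp ha hsupp
  set φ : ℕ → ℝ → ℝ := fun _ x => x ^ (-α / 2) * sqrtSymbol m x with hφdef
  have hφ : IsDyadicFamily (a ^ 2) (b ^ 2) φ :=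
    isDyadicFamily_const (hψ.rpow_mul ha2 hsp _) ha2 fun s h => hsp s (right_ne_zero_of_mul h)
  obtain ⟨C, hC⟩ := hφ.exists_sqFun_le hd p hp hp'
  refine ⟨C, fun g => (le_of_eq (eLpNorm_congr_ae ((squareFun_ae_eq m α _).trans (.of_forall fun z => ?_)))).trans
    (hC g)⟩
  -- The factors balance: `2^{jα} s^{-α/2} ψ(4^{-j}s) = φ(4^{-j}s)` with `φ(x) = x^{-α/2} ψ(x)`, so
  -- the weighted pieces of `H^{-α/2} g` are the unweighted pieces of `g` for another dyadic family.
  have h1 : ∀ j : ℕ, ((((2 : ℝ) ^ ((j : ℝ) * α) : ℝ) : ℂ) • dyadicPiece d p m j (potential d p α g) : LpSpace d p) =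
      symOp d p (dil φ j) g := fun j => by
    have h2 : IsTestSymbol (dil (fun _ => sqrtSymbol m) j) := hψ.comp_mul_left (by positivity)
    have h3 : IsTestSymbol fun s => s ^ (-α / 2) * dil (fun _ => sqrtSymbol m) j s := by
      refine h2.rpow_mul (a := 4 ^ j * a ^ 2) (b := 4 ^ j * b ^ 2) (by positivity) (fun s hs => ?_) _
      exact mem_Icc_of_inv_four_pow_mul_mem (hsp _ hs)
    rw [dyadicPiece_eq, (potential_symOp hd hp hp' hα h2 h3 g).2]
    have h4 := symOp_const_mul hd hp' h3 ((2 : ℝ) ^ ((j : ℝ) * α))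
    have h5 := symOp_congr (d := d) hd hp' (h3.const_mul ((2 : ℝ) ^ ((j : ℝ) * α))) (hφ.dil_test j) fun s hs => by
      rw [hφdef, dil_rpow_mul _ _ _ (by linarith), dil]
      congr 2
      ring
    rw [← h5, h4]; rfl
  simp only [h1]

/-! ### The reproducing weight -/

/-- The sum `∑ i, F(4^{-i} s)²`. -/
def dyadicSq (F : ℝ → ℝ) (s : ℝ) : ℝ := ∑' i : ℕ, F ((4 : ℝ)⁻¹ ^ i * s) ^ 2

/-- A smooth function equal to `1 / ∑ i, F(4^{-i} s)²` for `s ≥ c`. -/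
def weight (F : ℝ → ℝ) (c s : ℝ) : ℝ := (dyadicSq F s + expNegInvGlue (c - s))⁻¹

lemma eq_zero_of_lt {F : ℝ → ℝ} {a b : ℝ} (hs : ∀ s, F s ≠ 0 → s ∈ Set.Icc a b) (ha : 0 < a) {n i : ℕ} {s : ℝ}
    (hn : s < 4 ^ n * a) (hi : n ≤ i) : F ((4 : ℝ)⁻¹ ^ i * s) = 0 := by
  by_contra h
  have h1 := (hs _ h).1
  rw [inv_pow, inv_mul_eq_div, le_div_iff₀ (by positivity)] at h1
  have : (4 : ℝ) ^ n ≤ 4 ^ i := pow_le_pow_right₀ (by norm_num) hi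
  nlinarith

lemma dyadicSq_eq_sum {F : ℝ → ℝ} {a b : ℝ} (hs : ∀ s, F s ≠ 0 → s ∈ Set.Icc a b) (ha : 0 < a) {n : ℕ} {s : ℝ}
    (hn : s < 4 ^ n * a) : dyadicSq F s = ∑ i ∈ Finset.range n, F ((4 : ℝ)⁻¹ ^ i * s) ^ 2 :=
  tsum_eq_sum fun i hi => by
    rw [eq_zero_of_lt hs ha hn (not_lt.1 fun h => hi (Finset.mem_range.2 h))]; norm_num

lemma exists_lt_four_pow_mul {a : ℝ} (ha : 0 < a) (s : ℝ) : ∃ n : ℕ, s < 4 ^ n * a := by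
  obtain ⟨n, hn⟩ := pow_unbounded_of_one_lt (s / a) (by norm_num : (1 : ℝ) < 4)
  exact ⟨n, (div_lt_iff₀ ha).1 hn⟩

lemma contDiff_dyadicSq {F : ℝ → ℝ} {a b : ℝ} (hF : IsTestSymbol F) (hs : ∀ s, F s ≠ 0 → s ∈ Set.Icc a b)
    (ha : 0 < a) : ContDiff ℝ ∞ (dyadicSq F) := by
  refine contDiff_iff_contDiffAt.2 fun s => ?_
  obtain ⟨n, hn⟩ := exists_lt_four_pow_mul ha s
  have h1 : dyadicSq F =ᶠ[nhds s] fun s => ∑ i ∈ Finset.range n, F ((4 : ℝ)⁻¹ ^ i * s) ^ 2 := by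
    filter_upwards [Iio_mem_nhds hn] with x hx
    exact dyadicSq_eq_sum hs ha hx
  refine ContDiffAt.congr_of_eventuallyEq ?_ h1
  refine ContDiff.contDiffAt (ContDiff.sum fun i _ => ?_)
  exact (hF.smooth.comp (contDiff_const.mul contDiff_id)).pow 2

lemma dyadicSq_nonneg (F : ℝ → ℝ) (s : ℝ) : 0 ≤ dyadicSq F s := tsum_nonneg fun _ => sq_nonneg _

lemma dyadicSq_pos {F : ℝ → ℝ} {a b : ℝ} (hs : ∀ s, F s ≠ 0 → s ∈ Set.Icc a b) (ha : 0 < a) {s : ℝ} {j : ℕ}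
    (h : F ((4 : ℝ)⁻¹ ^ j * s) ≠ 0) : 0 < dyadicSq F s := by
  obtain ⟨n, hn⟩ := exists_lt_four_pow_mul ha s
  rw [dyadicSq_eq_sum hs ha hn]
  refine Finset.sum_pos' (fun _ _ => sq_nonneg _) ⟨j, Finset.mem_range.2 ?_, by positivity⟩
  by_contra hj
  exact h (eq_zero_of_lt hs ha hn (not_lt.1 hj))

/-- Replacing `s` by `4s` shifts the index and adds one term `F(4s)²`, which vanishes beyond the
support. The one-sided sum is therefore scale invariant for `s` above `b/4`. -/
lemma dyadicSq_four_mul {F : ℝ → ℝ} {a b : ℝ} (hs : ∀ s, F s ≠ 0 → s ∈ Set.Icc a b) (ha : 0 < a) {s : ℝ}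
    (hsb : b < 4 * s) : dyadicSq F (4 * s) = dyadicSq F s := by
  obtain ⟨n, hn⟩ := exists_lt_four_pow_mul ha s
  rw [dyadicSq_eq_sum hs ha hn, dyadicSq_eq_sum (n := n + 1) hs ha (by rw [pow_succ]; linarith),
    Finset.sum_range_succ']
  have h0 : F ((4 : ℝ)⁻¹ ^ 0 * (4 * s)) = 0 := by
    by_contra h
    have := (hs _ h).2
    rw [pow_zero, one_mul] at this
    linarith
  rw [h0, zero_pow two_ne_zero, add_zero]
  refine Finset.sum_congr rfl fun i _ => ?_
  congr 2
  rw [pow_succ]; ring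

/-- The sum may vanish below `c`; there the added `expNegInvGlue` term is positive, and from `c` on
it disappears without affecting smoothness. -/
lemma contDiff_weight {F : ℝ → ℝ} {a b c : ℝ} (hF : IsTestSymbol F) (hs : ∀ s, F s ≠ 0 → s ∈ Set.Icc a b)
    (ha : 0 < a) (hpos : ∀ s, c ≤ s → 0 < dyadicSq F s) : ContDiff ℝ ∞ (weight F c) := by
  refine ((contDiff_dyadicSq hF hs ha).add (expNegInvGlue.contDiff.comp (contDiff_const.sub contDiff_id))).inv
    fun s => ne_of_gt ?_
  rcases le_or_gt c s with h | h
  · exact add_pos_of_pos_of_nonneg (hpos s h) (expNegInvGlue.nonneg _)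
  · exact add_pos_of_nonneg_of_pos (dyadicSq_nonneg F s) (expNegInvGlue.pos_of_pos (by simpa using h))

lemma weight_of_ge (F : ℝ → ℝ) {c s : ℝ} (h : c ≤ s) : weight F c s = (dyadicSq F s)⁻¹ := by
  rw [weight, expNegInvGlue.zero_of_nonpos (by linarith), add_zero]

lemma weight_four_mul {F : ℝ → ℝ} {a b c : ℝ} (hs : ∀ s, F s ≠ 0 → s ∈ Set.Icc a b) (ha : 0 < a) {s : ℝ}
    (h0 : 0 ≤ s) (hc : c ≤ s) (hsb : b < 4 * s) : weight F c (4 * s) = weight F c s := by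
  rw [weight_of_ge F hc, weight_of_ge F (by linarith), dyadicSq_four_mul hs ha hsb]

/-- Multiplying a fixed symbol by the dilates of the weight gives a dyadic family. -/
lemma isDyadicFamily_mul_weight {F G : ℝ → ℝ} {a b c : ℝ} (hF : IsTestSymbol F)
    (hs : ∀ s, F s ≠ 0 → s ∈ Set.Icc a b) (ha : 0 < a) (hpos : ∀ s, c ≤ s → 0 < dyadicSq F s)
    (hG : IsTestSymbol G) (hGs : ∀ s, G s ≠ 0 → s ∈ Set.Icc a b) :
    IsDyadicFamily a b fun j x => G x * weight F c (4 ^ j * x) := by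
  have hW := contDiff_weight hF hs ha hpos
  refine ⟨ha, ?_, fun j => ⟨hG.smooth.mul (hW.comp (contDiff_const.mul contDiff_id)), hG.compact.mul_right⟩,
    fun j s h => hGs s (left_ne_zero_of_mul h)⟩
  -- On the support `x ≥ a`, so from index `n` on the argument `4^j x` lies where the weight is
  -- invariant under multiplication by 4. The family is constant for `j ≥ n` and so takes finitely
  -- many values.
  obtain ⟨n, hn⟩ := exists_lt_four_pow_mul ha (max b c)
  have hper : ∀ k : ℕ, (fun x => G x * weight F c (4 ^ (n + k) * x)) = fun x => G x * weight F c (4 ^ n * x) := by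
    intro k
    induction k with
    | zero => rfl
    | succ k ih =>
      rw [← ih]
      funext x
      by_cases hx : G x = 0
      · rw [hx, zero_mul, zero_mul]
      · have hxa := (hGs x hx).1
        have h1 : max b c < 4 ^ (n + k) * x := by
          refine hn.trans_le (mul_le_mul (pow_le_pow_right₀ (by norm_num) (by omega)) hxa ha.le (by positivity))
        have h2 : 0 ≤ (4 : ℝ) ^ (n + k) * x := mul_nonneg (by positivity) (ha.le.trans hxa)
        rw [← add_assoc, pow_succ, mul_comm ((4 : ℝ) ^ (n + k)) 4, mul_assoc,
          weight_four_mul hs ha h2 ((le_max_right _ _).trans h1.le) (by linarith [le_max_left b c])]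
  refine ((Finset.range (n + 1)).finite_toSet.image fun j x => G x * weight F c (4 ^ j * x)).subset ?_
  rintro _ ⟨j, rfl⟩
  rcases le_or_gt j n with h | h
  · exact ⟨j, by simpa using Nat.lt_succ_of_le h, rfl⟩
  · obtain ⟨k, rfl⟩ := Nat.exists_eq_add_of_lt h
    exact ⟨n, by simp, (hper (k + 1)).symm⟩

lemma four_pow_mul_inv (j : ℕ) (s : ℝ) : (4 : ℝ) ^ j * ((4 : ℝ)⁻¹ ^ j * s) = s := by
  rw [← mul_assoc, ← mul_pow]; norm_num

/-- The Calderón reproducing formula. -/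
lemma hasSum_reproducing {d : ℕ} (hd : 1 ≤ d) {p : ℝ≥0∞} [Fact (1 ≤ p)] (hp : 1 < p) (hp' : p ≠ ⊤)
    {F : ℝ → ℝ} {a b : ℝ} (hF : IsTestSymbol F) (hs : ∀ s, F s ≠ 0 → s ∈ Set.Icc a b) (ha : 0 < a)
    (hpos : ∀ s, (d : ℝ) ≤ s → 0 < dyadicSq F s) (f : LpSpace d p) :
    Filter.Tendsto (fun N => ∑ j ∈ Finset.range N,
      symOp d p (dil (fun j x => F x ^ 2 * weight F d (4 ^ j * x)) j) f) Filter.atTop (nhds f) := by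
  set φ : ℕ → ℝ → ℝ := fun j x => F x * weight F d (4 ^ j * x) with hφdef
  set χ : ℕ → ℝ → ℝ := fun j x => F x ^ 2 * weight F d (4 ^ j * x) with hχdef
  have hφ : IsDyadicFamily a b φ := isDyadicFamily_mul_weight hF hs ha hpos hF hs
  have hχ : IsDyadicFamily a b χ := isDyadicFamily_mul_weight hF hs ha hpos (G := fun x => F x ^ 2)
    (by simpa only [pow_two] using hF.mul hF) fun s h => hs s (by simpa using h)
  have hc : IsDyadicFamily a b fun _ => F := isDyadicFamily_const hF ha hs
  obtain ⟨C, hC⟩ := hφ.exists_summable hd p hp hp'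
  obtain ⟨C', hC'⟩ := hc.exists_sqFun_le hd p hp hp'
  obtain ⟨M, -, hM⟩ := hχ.exists_bound
  -- Each piece factors through the plain dyadic piece of `F`. The upper bound for those pieces and
  -- the dual bound for `φ` together make the series converge in `L^p`.
  have hmul : ∀ (j : ℕ) (f : LpSpace d p), symOp d p (dil φ j) (symOp d p (dil (fun _ => F) j) f) =
      symOp d p (dil χ j) f := fun j f => by
    have h1 := symOp_mul (d := d) hd hp' (hφ.dil_test j) (hc.dil_test j)
    have h2 : (fun s => dil φ j s * dil (fun _ => F) j s) = dil χ j := by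
      funext s; simp only [dil, hφdef, hχdef]; ring
    rw [← h2, h1]; rfl
  have hsum : ∀ f : LpSpace d p, Summable fun j => symOp d p (dil χ j) f := fun f => by
    have h1 := (hC (fun j => symOp d p (dil (fun _ => F) j) f) (C' * ‖f‖₊) (by
      refine (hC' f).trans (le_of_eq ?_)
      rw [ENNReal.coe_mul, ← Lp.enorm_def, enorm_eq_nnnorm])).1
    simpa only [hmul] using h1
  set A : ℕ → LpSpace d p →L[ℂ] LpSpace d p := fun N => symOp d p fun s => ∑ j ∈ Finset.range N, 1 * dil χ j s
  have hA : ∀ N f, A N f = ∑ j ∈ Finset.range N, symOp d p (dil χ j) f := fun N f => by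
    have := symOp_sum (d := d) hd hp' (Finset.range N) fun j _ => hχ.dil_test j
    simp only [A, one_mul, this, sum_apply]
  have hlim : ∀ f, Filter.Tendsto (fun N => A N f) Filter.atTop (nhds (∑' j, symOp d p (dil χ j) f)) := fun f => by
    simp only [hA]
    exact (hsum f).hasSum.tendsto_sum_nat
  set B := continuousLinearMapOfTendsto (fun N => A N) (tendsto_pi_nhds.2 hlim) with hB
  -- At every spectral value the partial sums of the symbol are eventually exactly 1, by the choice
  -- of the weight, so the limit operator is the identity.
  have hR : Represents (fun _ => 1) B := by
    refine Represents.of_tendsto hd (fun N => (hχ.test_sum N fun _ => 1).isBddSymbol)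
      (fun N s _ => hM N (fun _ => 1) (by simp) s) (fun s hsd => tendsto_const_nhds.congr' ?_)
      (fun N => (hχ.test_sum N fun _ => 1).represents hd hp') hlim
    obtain ⟨n, hn⟩ := exists_lt_four_pow_mul ha s
    filter_upwards [Filter.eventually_ge_atTop n] with N hN
    have hN' : s < 4 ^ N * a := hn.trans_le (by gcongr; norm_num)
    simp only [hχdef, dil, four_pow_mul_inv, one_mul]
    rw [← Finset.sum_mul, ← dyadicSq_eq_sum hs ha hN', weight_of_ge F hsd, mul_inv_cancel₀ (hpos s hsd).ne']
  have hid : B = ContinuousLinearMap.id ℂ (LpSpace d p) := hR.unique hp' hd (fun _ _ => rfl) (represents_one hd)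
  have h1 := hlim f
  have h2 : ∑' j, symOp d p (dil χ j) f = f := by
    have : B f = ∑' j, symOp d p (dil χ j) f := rfl
    rw [← this, hid]; rfl
  rw [h2] at h1
  simpa only [hA] using h1

/-- The lower Littlewood–Paley estimate in Sobolev spaces. -/
lemma exists_sobolevNorm_le {d : ℕ} (hd : 1 ≤ d) {p : ℝ≥0∞} [Fact (1 ≤ p)] (hp : 1 < p) (hp' : p ≠ ⊤)
    {m : ℝ → ℝ} (hm : ContDiff ℝ ∞ m) {a b : ℝ} (ha : 0 < a) (hsupp : tsupport m ⊆ Set.Icc a b)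
    (hcov : CoversSpectrum d m) {α : ℝ} (hα : 0 ≤ α) : ∃ C : ℝ≥0, 0 < C ∧ ∀ f : LpSpace d p,
      sobolevNorm d p α f ≤ C * eLpNorm (squareFun d p m α f) p volume := by
  have hψ := isTestSymbol_sqrtSymbol hm ha hsupp
  have ha2 : 0 < a ^ 2 := by positivity
  have hsp : ∀ s, sqrtSymbol m s ≠ 0 → s ∈ Set.Icc (a ^ 2) (b ^ 2) := fun s => sqrtSymbol_supp ha hsupp
  set ψ := sqrtSymbol m
  have hpos : ∀ s, (d : ℝ) ≤ s → 0 < dyadicSq ψ s := fun s h => by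
    obtain ⟨j, hj⟩ := hcov (Real.sqrt s) (Real.sqrt_le_sqrt h)
    exact dyadicSq_pos hsp ha2 (j := j) (by rw [show ψ = sqrtSymbol m from rfl, sqrtSymbol_mul]; exact hj)
  -- The power `x^{α/2}` is inserted to be cancelled by the potential: applying `H^{-α/2}` to the
  -- resulting series must give back the reproducing formula for `f`.
  set φ : ℕ → ℝ → ℝ := fun j x => (x ^ (α / 2) * ψ x) * weight ψ d (4 ^ j * x) with hφdef
  set χ : ℕ → ℝ → ℝ := fun j x => ψ x ^ 2 * weight ψ d (4 ^ j * x) with hχdef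
  have hφ : IsDyadicFamily (a ^ 2) (b ^ 2) φ := isDyadicFamily_mul_weight hψ hsp ha2 hpos
    (G := fun x => x ^ (α / 2) * ψ x) (hψ.rpow_mul ha2 hsp _) fun s h => hsp s (right_ne_zero_of_mul h)
  have hχ : IsDyadicFamily (a ^ 2) (b ^ 2) χ := isDyadicFamily_mul_weight hψ hsp ha2 hpos (G := fun x => ψ x ^ 2)
    (by simpa only [pow_two] using hψ.mul hψ) fun s h => hsp s (by simpa using h)
  have hc : IsDyadicFamily (a ^ 2) (b ^ 2) fun _ => ψ := isDyadicFamily_const hψ ha2 hsp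
  obtain ⟨C, hC⟩ := hφ.exists_summable hd p hp hp'
  -- A positive constant is needed when the square function is not in `L^p`, since `0 * ∞ = 0` in
  -- `ℝ≥0∞`.
  refine ⟨C + 1, by positivity, fun f => ?_⟩
  by_cases htop : eLpNorm (squareFun d p m α f) p volume = ⊤
  · rw [htop, ENNReal.mul_top (by exact_mod_cast (by positivity : (C + 1 : ℝ≥0) ≠ 0))]
    exact le_top
  set D := (eLpNorm (squareFun d p m α f) p volume).toNNReal with hD
  have hDe : (D : ℝ≥0∞) = eLpNorm (squareFun d p m α f) p volume := ENNReal.coe_toNNReal htop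
  set h : ℕ → LpSpace d p := fun j => (((2 : ℝ) ^ ((j : ℝ) * α) : ℝ) : ℂ) • dyadicPiece d p m j f with hh
  obtain ⟨hsum, hnorm⟩ := hC h D (by rw [hDe]; exact (eLpNorm_congr_ae (squareFun_ae_eq m α f)).ge)
  -- The candidate preimage of `f` under the potential. It exists precisely because the weighted
  -- square function of `f` is in `L^p`, and its norm is controlled by that square function.
  set g := ∑' j, symOp d p (dil φ j) (h j) with hg
  have hterm : ∀ j, potential d p α (symOp d p (dil φ j) (h j)) = symOp d p (dil χ j) f := fun j => by
    set c : ℝ := (2 : ℝ) ^ ((j : ℝ) * α) with hcdef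
    have t1 : IsTestSymbol fun s => dil φ j s * dil (fun _ => ψ) j s := (hφ.dil_test j).mul (hc.dil_test j)
    have t2 : IsTestSymbol fun s => c * (dil φ j s * dil (fun _ => ψ) j s) := t1.const_mul c
    have t3 : IsTestSymbol fun s => s ^ (-α / 2) * (c * (dil φ j s * dil (fun _ => ψ) j s)) :=
      t2.rpow_mul (a := 4 ^ j * a ^ 2) (b := 4 ^ j * b ^ 2) (by positivity) (fun s hs =>
        mem_Icc_of_inv_four_pow_mul_mem (hsp _ (right_ne_zero_of_mul (right_ne_zero_of_mul hs)))) _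
    have e1 : symOp d p (dil φ j) (h j) = symOp d p (fun s => c * (dil φ j s * dil (fun _ => ψ) j s)) f := by
      rw [symOp_const_mul hd hp' t1, symOp_mul hd hp' (hφ.dil_test j) (hc.dil_test j), hh]
      simp only
      rw [map_smul, dyadicPiece_eq]; rfl
    rw [e1, (potential_symOp hd hp hp' hα t2 t3 f).1]
    refine congrArg (fun T : LpSpace d p →L[ℂ] LpSpace d p => T f) (symOp_congr hd hp' t3 (hχ.dil_test j) fun s hs => ?_)
    have hs0 : 0 < s := by linarith
    have e2 : s ^ (-α / 2) * s ^ (α / 2) = 1 := by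
      rw [← Real.rpow_add hs0, show -α / 2 + α / 2 = 0 by ring, Real.rpow_zero]
    -- The weight `2^{jα}` of the square function undoes the rescaling of `x^{α/2}` at scale
    -- `4^{-j}`.
    have e3 : c * ((4 : ℝ)⁻¹ ^ j) ^ (α / 2) = 1 := by
      rw [inv_four_pow_rpow, hcdef, ← Real.rpow_add (by norm_num), show (j : ℝ) * α + -(2 * j * (α / 2)) = 0 by ring,
        Real.rpow_zero]
    simp only [dil, hφdef, hχdef]
    rw [Real.mul_rpow (by positivity) hs0.le]
    set w := weight ψ d (4 ^ j * ((4 : ℝ)⁻¹ ^ j * s))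
    set y := ψ ((4 : ℝ)⁻¹ ^ j * s)
    calc _ = (s ^ (-α / 2) * s ^ (α / 2)) * (c * ((4 : ℝ)⁻¹ ^ j) ^ (α / 2)) * (y ^ 2 * w) := by ring
      _ = y ^ 2 * w := by rw [e2, e3]; ring
  have hpot : potential d p α g = f := by
    have h1 := ((potential d p α).hasSum hsum.hasSum).tendsto_sum_nat
    simp only [hterm] at h1
    exact tendsto_nhds_unique h1 (hasSum_reproducing hd hp hp' hψ hsp ha2 hpos f)
  calc sobolevNorm d p α f ≤ eLpNorm g p volume := iInf₂_le g hpot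
    _ = ‖g‖ₑ := (Lp.enorm_def g).symm
    _ ≤ C * D := by
        rw [← ofReal_norm]
        refine (ENNReal.ofReal_le_ofReal hnorm).trans (le_of_eq ?_)
        rw [ENNReal.ofReal_mul C.coe_nonneg, ENNReal.ofReal_coe_nnreal, ENNReal.ofReal_coe_nnreal]
    _ ≤ (C + 1 : ℝ≥0) * D := by gcongr; simp
    _ = _ := by rw [hDe]

lemma sobolevNorm_zero {d : ℕ} (hd : 1 ≤ d) {p : ℝ≥0∞} [Fact (1 ≤ p)] (hp' : p ≠ ⊤) (f : LpSpace d p) :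
    sobolevNorm d p 0 f = eLpNorm f p volume := by
  simp [sobolevNorm, potential_zero hd hp']

end PartialHarmonic

end

/-! ### The main theorem -/

theorem mainTheorem2 (d : ℕ) (hd : 1 ≤ d) (p : ℝ≥0∞) [Fact (1 ≤ p)] (hp : 1 < p) (hp' : p < ⊤)
    (m : ℝ → ℝ) (hm : ContDiff ℝ ∞ m) (hm01 : ∀ r, m r ∈ Set.Icc (0 : ℝ) 1)
    (a b : ℝ) (ha : 0 < a) (hsupp : tsupport m ⊆ Set.Icc a b) :
    -- the operators `Δ_j` and `H_par^{-α/2}` extend from `C_c^∞` to bounded operators on `L^p`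
    (∀ j : ℕ, PartialHarmonic.IsMultiplierExtension (PartialHarmonic.dyadicSymbol d m j)
      (PartialHarmonic.dyadicPiece d p m j)) ∧
    (∀ α : ℝ, 0 ≤ α → PartialHarmonic.IsMultiplierExtension (PartialHarmonic.potentialSymbol d α)
      (PartialHarmonic.potential d p α)) ∧
    -- the upper bounds
    (∃ C : ℝ≥0, ∀ f : PartialHarmonic.LpSpace d p,
      eLpNorm (PartialHarmonic.squareFun d p m 0 f) p volume ≤ C * eLpNorm f p volume) ∧
    (∀ α : ℝ, 0 ≤ α → ∃ C : ℝ≥0, 0 < C ∧ ∀ f : PartialHarmonic.LpSpace d p,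
      eLpNorm (PartialHarmonic.squareFun d p m α f) p volume ≤
        C * PartialHarmonic.sobolevNorm d p α f) ∧
    -- the lower bounds
    (PartialHarmonic.CoversSpectrum d m →
      (∃ C : ℝ≥0, 0 < C ∧ ∀ f : PartialHarmonic.LpSpace d p,
        eLpNorm f p volume ≤ C * eLpNorm (PartialHarmonic.squareFun d p m 0 f) p volume) ∧
      (∀ α : ℝ, 0 ≤ α → ∃ C : ℝ≥0, 0 < C ∧ ∀ f : PartialHarmonic.LpSpace d p,
        PartialHarmonic.sobolevNorm d p α f ≤
          C * eLpNorm (PartialHarmonic.squareFun d p m α f) p volume)) := by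
  have hp2 := hp'.ne
  have hψ := PartialHarmonic.isTestSymbol_sqrtSymbol hm ha hsupp
  refine ⟨fun j => PartialHarmonic.isMultiplierExtension_dyadicPiece hd hp2 hψ j, fun α hα => ?_, ?_, fun α hα => ?_,
    fun hcov => ⟨?_, fun α hα => PartialHarmonic.exists_sobolevNorm_le hd hp hp2 hm ha hsupp hcov hα⟩⟩
  · exact (PartialHarmonic.Represents.isMultiplierExtension hd (PartialHarmonic.isBddSymbol_rpow hα)).1
      (PartialHarmonic.represents_potential hd hp hp2 hα)
  · obtain ⟨C, hC⟩ := PartialHarmonic.exists_squareFun_potential_le hd hp hp2 hm ha hsupp le_rfl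
    refine ⟨C, fun f => ?_⟩
    have := hC f
    rwa [PartialHarmonic.potential_zero hd hp2] at this
  · obtain ⟨C, hC⟩ := PartialHarmonic.exists_squareFun_potential_le hd hp hp2 hm ha hsupp hα
    -- The constant must be nonzero to be moved inside the infimum defining the Sobolev norm, which
    -- is `∞` when `f` has no preimage.
    refine ⟨C + 1, by positivity, fun f => ?_⟩
    rw [PartialHarmonic.sobolevNorm, ENNReal.mul_iInf_of_ne (by simp) ENNReal.coe_ne_top]
    refine le_iInf fun g => ?_
    rw [ENNReal.mul_iInf_of_ne (by simp) ENNReal.coe_ne_top]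
    refine le_iInf fun hg => ?_
    rw [← hg]
    refine (hC g).trans ?_
    gcongr
    simp
  · obtain ⟨C, hC0, hC⟩ := PartialHarmonic.exists_sobolevNorm_le hd hp hp2 hm ha hsupp hcov le_rfl
    refine ⟨C, hC0, fun f => ?_⟩
    rw [← PartialHarmonic.sobolevNorm_zero hd hp2 f]
    exact hC f
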